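/- Let $S^2\subset\mathbb R^3$ be the unit sphere. For a function $h$ on $S^2$ and $(t,y)\in\mathbb R\times S^2$ let $Rh(t,y)$ be the mean $\frac1{2\pi}\int_0^{2\pi}h(\gamma_{(t,y)}(\varphi))\,d\varphi$ over the small circle $\gamma_{(t,y)}(\varphi)=\frac{\cos\varphi}{\cosh t}y_1^\perp+\frac{\sin\varphi}{\cosh t}y_2^\perp+\tanh t\;y$, where $(y_1^\perp,y_2^\perp,y)$ is an orthonormal frame. Call $h$ *admissible* if it is smooth, $\int_{S^2}h=0$ and $|\partial_tRh(t,y)|<1$ for all $(t,y)\in\mathbb R\times S^2$. Identify $S^2$ with $\mathbb{CP}^1=\mathbb C\cup\{\infty\}$ by $u\mapsto (u_2+iu_3)/(1+u_1)$. Put $L_+=\{z_2=z_3=0\}$, $L_-=\{z_0=z_1=0\}$, $Z=\mathbb{CP}^3\setminus(L_+\sqcup L_-)$ and $$P_h=\{[z_0:z_1:z_2:z_3]\in Z\mid z_3=\bar z_0e^{-h(z_1/z_0)},\ z_2=\bar z_1e^{-h(z_1/z_0)}\}.$$ Let $\varepsilon=(0,0,1)$, $S_\pm=\{\pm\varepsilon\}\times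 S^2$ and $\mathcal M=(S^2\times S^2)\setminus(S_+\sqcup S_-)$. A point $\xi=(x,y)\in\mathcal M$ has coordinates $(s,t,\lambda)\in S^1\times\mathbb R\times\mathbb{CP}^1$, where $x=(\frac{\cos s}{\cosh t},\frac{\sin s}{\cosh t},\tanh t)$ and $\lambda$ corresponds to $y$. Let $\eta(w)=\frac{-w+\lambda e^t}{\bar\lambda w+e^t}$, let $\sum_{k\in\mathbb Z}H_kw^k$ be the Fourier series of $w\mapsto h(\eta(w))$ on $|w|=1$, let $H_+(w)=\sum_{k>0}H_kw^k$, and let $D_\xi$ be the image of the closed unit disk under $$w\mapsto\big[-ie^{2H_+(w)+H_0+is}(\bar\lambda w+e^t):-ie^{2H_+(w)+H_0+is}(-w+\lambda e^t):-1+\bar\lambda e^tw:\lambda+e^tw\big]$$ (for $\lambda=\infty$ these expressions are homogenized in $\lambda$ in the obvious way: write $\lambda=b/a$, with $a=1$ for $\lambda\neq\infty$ and $(a,b)=(0,1)$ for $\lambda=\infty$; replace $\bar\lambda w+e^t$, $-w+\lambda e^t$, $-1+\bar\lambda e^tw$, $\lambda+e^tw$ by $\bar bw+ae^t$, $-\bar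 aw+be^t$, $-a+\bar be^tw$, $b+\bar ae^tw$, and let $\eta$ be the ratio of the second to the first). On $S_\pm$ the family is extended continuously: $D_{(\varepsilon,y)}$ is the image of $w\mapsto[e^{h(\lambda)}:e^{h(\lambda)}\lambda:w\bar\lambda:w]$ and, with $\mu=-\bar\lambda^{-1}$, $D_{(-\varepsilon,y)}$ is the image of $w\mapsto[e^{h(\mu)}w:e^{h(\mu)}w\mu:\bar\mu:1]$, $|w|\le1$ (again homogenized where $\lambda$ or $\mu$ is $\infty$). Let $D_\xi^\circ$ be the image of the open unit disk. **Proposition.** Let $h$ be admissible. Then each $D_\xi$, $\xi\in S^2\times S^2$, with this parametrization, is an injective holomorphic disk in $\mathbb{CP}^3$ with boundary on $P_h$ (continuous and injective on the closed disk, holomorphic in the interior, mapping the unit circle into $P_h$), and: 1. $\xi\in\mathcal M$ if and only if $D_\xi\subset Z$; 2. for every $\xi\in S^2\times S^2$, the class $[D_\xi]\in H_2(\mathbb{CP}^3,P_h;\mathbb Z)$ (the image of a fundamental class of the disk relative to its boundary circle) generates $H_2(\mathbb{CP}^3,P_h;\mathbb Z)$; 3. $\{D_\xi^\circ\}_{\xi\in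 S^2\times S^2}$ foliates $\mathbb{CP}^3\setminus P_h$: the sets $D_\xi^\circ$ are connected, pairwise disjoint, have union $\mathbb{CP}^3\setminus P_h$, and are the leaves of a smooth foliation by real surfaces, i.e. each point of $\mathbb{CP}^3\setminus P_h$ has a smooth chart of $\mathbb{CP}^3$ defined on a neighbourhood contained in $\mathbb{CP}^3\setminus P_h$, with image a polydisk in $\mathbb C\times\mathbb C^2$, in which the connected components of the traces of the sets $D_\xi^\circ$ are the slices $\mathbb C\times\{\mathrm{const}\}$ of the polydisk. -/

import Mathlib

open scoped Manifold ContDiff LinearAlgebra.Projectivization ComplexConjugate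

noncomputable section

/-! ### The unit two-sphere and generating functions -/

/-- Euclidean three-space. -/
abbrev E3 : Type := EuclideanSpace ℝ (Fin 3)

instance instFactFinrankE3 : Fact (Module.finrank ℝ E3 = 2 + 1) := ⟨by simp⟩

/-- The unit sphere `S² ⊂ ℝ³`. -/
abbrev S2 : Type := Metric.sphere (0 : E3) 1

/-- A parametrization of the (oriented) small circle `{u ∈ S² | u · y = tanh t}`, where the axis
is `y = e 2` and `e 0, e 1, e 2` is an orthonormal frame:
`φ ↦ (cos φ / cosh t) e₀ + (sin φ / cosh t) e₁ + tanh t • y`. -/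
def smallCircle (e : OrthonormalBasis (Fin 3) ℝ E3) (t φ : ℝ) : S2 :=
  ⟨(Real.cos φ / Real.cosh t) • e 0 + (Real.sin φ / Real.cosh t) • e 1 + Real.tanh t • e 2, by
    have hc : Real.cosh t ≠ 0 := (Real.cosh_pos t).ne'
    have h1 : ‖(Real.cos φ / Real.cosh t) • e 0 + (Real.sin φ / Real.cosh t) • e 1
        + Real.tanh t • e 2‖ ^ 2 = 1 := by
      have := e.sum_sq_norm_inner_right ((Real.cos φ / Real.cosh t) • e 0
        + (Real.sin φ / Real.cosh t) • e 1 + Real.tanh t • e 2)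
      rw [← this]
      simp [Fin.sum_univ_three, inner_add_right, inner_smul_right, Real.tanh_eq_sinh_div_cosh]
      field_simp
      nlinarith [Real.sin_sq_add_cos_sq φ, Real.cosh_sq t]
    simpa using (pow_eq_one_iff_of_nonneg (norm_nonneg _) two_ne_zero).1 h1⟩

/-- The circle transform `R h (t, y) = (1 / 2π) ∫₀^{2π} h(γ_{(t,y)}(φ)) dφ`, with `y = e 2`.
The value does not depend on the choice of `e 0, e 1`. -/
def circleMean (h : S2 → ℝ) (e : OrthonormalBasis (Fin 3) ℝ E3) (t : ℝ) : ℝ :=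
  (2 * Real.pi)⁻¹ * ∫ φ in (0 : ℝ)..(2 * Real.pi), h (smallCircle e t φ)

/-- Admissible generating functions: smooth functions on `S²` of mean zero such that
`|∂ₜ R h (t, y)| < 1` for all `(t, y) ∈ ℝ × S²`. -/
structure IsAdmissible (h : S2 → ℝ) : Prop where
  smooth : ContMDiff (𝓡 2) 𝓘(ℝ, ℝ) ∞ h
  mean_zero : ∫ u, h u ∂(MeasureTheory.volume : MeasureTheory.Measure E3).toSphere = 0
  deriv_lt : ∀ (e : OrthonormalBasis (Fin 3) ℝ E3) (t : ℝ), |deriv (circleMean h e) t| < 1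

/-- The point of `S²` whose stereographic coordinate `(u₁ + i u₂) / (1 + u₀)` is `b / a`
(for `(a, b) ≠ (0, 0)`; `a = 0` is the coordinate `∞`). -/
def spherePoint (a b : ℂ) : S2 :=
  if hab : ‖a‖ ^ 2 + ‖b‖ ^ 2 = 0 then ⟨EuclideanSpace.single 0 1, by simp⟩
  else ⟨!₂[(‖a‖ ^ 2 - ‖b‖ ^ 2) / (‖a‖ ^ 2 + ‖b‖ ^ 2),
      2 * (conj a * b).re / (‖a‖ ^ 2 + ‖b‖ ^ 2),
      2 * (conj a * b).im / (‖a‖ ^ 2 + ‖b‖ ^ 2)], by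
    have hN : 0 < ‖a‖ ^ 2 + ‖b‖ ^ 2 := lt_of_le_of_ne (by positivity) (Ne.symm hab)
    rw [mem_sphere_zero_iff_norm, EuclideanSpace.norm_eq, Real.sqrt_eq_one]
    simp only [Fin.sum_univ_three, Real.norm_eq_abs, sq_abs, Matrix.cons_val_zero,
      Matrix.cons_val_one, Matrix.cons_val]
    rw [div_pow, div_pow, div_pow, ← add_div, ← add_div, div_eq_one_iff_eq (by positivity)]
    simp only [Complex.sq_norm, Complex.normSq_apply, Complex.mul_re, Complex.mul_im,
      Complex.conj_re, Complex.conj_im]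
    ring⟩

/-! ### Complex projective three-space -/

/-- Complex projective three-space. -/
abbrev CP3 : Type := ℙ ℂ (Fin 4 → ℂ)

/-- The quotient topology. -/
instance instTopologicalSpaceCP3 : TopologicalSpace CP3 :=
  inferInstanceAs (TopologicalSpace (Quotient (projectivizationSetoid ℂ (Fin 4 → ℂ))))

theorem isQuotientMap_mk' :
    Topology.IsQuotientMap (Projectivization.mk' ℂ : {v : Fin 4 → ℂ // v ≠ 0} → CP3) :=
  isQuotientMap_quot_mk

/-- The affine coordinates `(z_j / z_i)_{j ≠ i}` (meaningful where `z_i ≠ 0`). -/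
def affineCoord (i : Fin 4) (p : CP3) : Fin 3 → ℂ :=
  fun j => p.rep (i.succAbove j) / p.rep i

theorem rep_mk (v : Fin 4 → ℂ) (hv : v ≠ 0) :
    ∃ c : ℂ, c ≠ 0 ∧ (Projectivization.mk ℂ v hv : CP3).rep = c • v := by
  obtain ⟨c, hc⟩ := Projectivization.exists_smul_eq_mk_rep ℂ v hv
  exact ⟨c, c.ne_zero, hc.symm⟩

theorem affineCoord_mk (i : Fin 4) (v : Fin 4 → ℂ) (hv : v ≠ 0) :
    affineCoord i (Projectivization.mk ℂ v hv) = fun j => v (i.succAbove j) / v i := by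
  obtain ⟨c, hc, h⟩ := rep_mk v hv
  funext j
  simp only [affineCoord, h, Pi.smul_apply, smul_eq_mul]
  rw [mul_div_mul_left _ _ hc]

theorem insertNth_ne_zero (i : Fin 4) (w : Fin 3 → ℂ) :
    (i.insertNth (1 : ℂ) w : Fin 4 → ℂ) ≠ 0 := fun h => by
  simpa using congrFun h i

theorem preimage_rep_ne_zero (i : Fin 4) :
    (Projectivization.mk' ℂ : {v : Fin 4 → ℂ // v ≠ 0} → CP3) ⁻¹' {p | p.rep i ≠ 0}
      = {v | v.1 i ≠ 0} := by
  ext v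
  obtain ⟨c, hc, h⟩ := rep_mk v.1 v.2
  simp [h, hc]

theorem isOpen_rep_ne_zero (i : Fin 4) : IsOpen {p : CP3 | p.rep i ≠ 0} := by
  rw [← isQuotientMap_mk'.isOpen_preimage, preimage_rep_ne_zero]
  exact isOpen_ne_fun ((continuous_apply i).comp continuous_subtype_val) continuous_const

/-- The affine chart `[z] ↦ (z_j / z_i)_{j ≠ i}` on `{z_i ≠ 0}`. -/
def affineChart (i : Fin 4) : OpenPartialHomeomorph CP3 (Fin 3 → ℂ) where
  toFun := affineCoord i
  invFun w := Projectivization.mk ℂ (i.insertNth (1 : ℂ) w) (insertNth_ne_zero i w)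
  source := {p | p.rep i ≠ 0}
  target := Set.univ
  map_source' _ _ := Set.mem_univ _
  map_target' w _ := by
    obtain ⟨c, hc, h⟩ := rep_mk _ (insertNth_ne_zero i w)
    simp [h, hc]
  left_inv' p hp := by
    conv_rhs => rw [← p.mk_rep]
    rw [Projectivization.mk_eq_mk_iff']
    refine ⟨(p.rep i)⁻¹, ?_⟩
    funext k
    refine Fin.succAboveCases i ?_ (fun j => ?_) k
    · simpa using inv_mul_cancel₀ hp
    · simp [affineCoord, div_eq_inv_mul]
  right_inv' w _ := by
    simp [affineCoord_mk]
  open_source := isOpen_rep_ne_zero i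
  open_target := isOpen_univ
  continuousOn_toFun := by
    rw [isQuotientMap_mk'.continuousOn_isOpen_iff (isOpen_rep_ne_zero i), preimage_rep_ne_zero]
    have : affineCoord i ∘ (Projectivization.mk' ℂ : {v : Fin 4 → ℂ // v ≠ 0} → CP3)
        = fun v j => v.1 (i.succAbove j) / v.1 i := by
      funext v
      exact affineCoord_mk i v.1 v.2
    rw [this]
    exact continuousOn_pi.2 fun j => ContinuousOn.div
      ((continuous_apply _).comp continuous_subtype_val).continuousOn
      ((continuous_apply _).comp continuous_subtype_val).continuousOn fun v hv => hv
  continuousOn_invFun := by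
    apply Continuous.continuousOn
    refine isQuotientMap_mk'.continuous.comp (f := fun w : Fin 3 → ℂ =>
      (⟨i.insertNth (1 : ℂ) w, insertNth_ne_zero i w⟩ : {v : Fin 4 → ℂ // v ≠ 0})) ?_
    exact Continuous.subtype_mk
      (Continuous.finInsertNth i (continuous_const (y := (1 : ℂ))) (continuous_id' (X := Fin 3 → ℂ))) _

theorem exists_rep_ne_zero (p : CP3) : ∃ i, p.rep i ≠ 0 := by
  by_contra! h
  exact p.rep_nonzero (funext h)

/-- The standard atlas of `ℂP³`, consisting of the four affine charts. -/
instance instChartedSpaceCP3 : ChartedSpace (Fin 3 → ℂ) CP3 where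
  atlas := Set.range affineChart
  chartAt p := affineChart (exists_rep_ne_zero p).choose
  mem_chart_source p := (exists_rep_ne_zero p).choose_spec
  chart_mem_atlas _ := Set.mem_range_self _

/-- The affine charts are smoothly compatible over `𝕜 = ℂ` (complex manifold structure) as well as
over `𝕜 = ℝ` (underlying real manifold structure). -/
instance instIsManifoldCP3 {𝕜 : Type*} [NontriviallyNormedField 𝕜] [NormedAlgebra 𝕜 ℂ] :
    IsManifold 𝓘(𝕜, Fin 3 → ℂ) ∞ CP3 := by
  apply isManifold_of_contDiffOn
  rintro _ _ ⟨i, rfl⟩ ⟨j, rfl⟩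
  have key : ContDiffOn 𝕜 ∞ (fun (w : Fin 3 → ℂ) (k : Fin 3) =>
      (i.insertNth (1 : ℂ) w : Fin 4 → ℂ) (j.succAbove k) / (i.insertNth (1 : ℂ) w : Fin 4 → ℂ) j)
      {w | (i.insertNth (1 : ℂ) w : Fin 4 → ℂ) j ≠ 0} := by
    have hc : ∀ l : Fin 4, ContDiff 𝕜 ∞
        (fun w : Fin 3 → ℂ => (i.insertNth (1 : ℂ) w : Fin 4 → ℂ) l) := by
      intro l
      refine Fin.succAboveCases i ?_ (fun m => ?_) l
      · simpa using contDiff_const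
      · simpa using contDiff_apply 𝕜 ℂ m
    rw [contDiffOn_pi]
    intro k
    simp only [div_eq_mul_inv]
    exact (hc _).contDiffOn.mul ((hc _).contDiffOn.inv fun w hw => hw)
  refine (key.congr fun w _ => ?_).mono fun w hw => ?_
  · exact affineCoord_mk j _ (insertNth_ne_zero i w)
  · have h1 : (Projectivization.mk ℂ (i.insertNth (1 : ℂ) w) (insertNth_ne_zero i w) : CP3).rep j
        ≠ 0 := by
      simpa [affineChart] using hw
    obtain ⟨c, hc, h⟩ := rep_mk _ (insertNth_ne_zero i w)
    rw [h] at h1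
    exact right_ne_zero_of_mul h1

/-! ### The twistor space -/

/-- The line `L₊ = {z₂ = z₃ = 0}`. -/
def lineLplus : Set CP3 := {p | p.rep 2 = 0 ∧ p.rep 3 = 0}

/-- The line `L₋ = {z₀ = z₁ = 0}`. -/
def lineLminus : Set CP3 := {p | p.rep 0 = 0 ∧ p.rep 1 = 0}

/-- The open set `Z = ℂP³ ∖ (L₊ ⊔ L₋)`. -/
def twistorZ : Set CP3 := (lineLplus ∪ lineLminus)ᶜ

/-- The deformed real submanifold
`P_h = {[z] ∈ Z | z₃ = conj z₀ · exp (-h (z₁ / z₀)), z₂ = conj z₁ · exp (-h (z₁ / z₀))}`.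
The conditions are imposed on some vector of homogeneous coordinates of the point. -/
def realP (h : S2 → ℝ) : Set CP3 :=
  {p | p ∈ twistorZ ∧ ∃ (z : Fin 4 → ℂ) (hz : z ≠ 0), Projectivization.mk ℂ z hz = p ∧
    z 3 = conj (z 0) * Real.exp (-h (spherePoint (z 0) (z 1))) ∧
    z 2 = conj (z 1) * Real.exp (-h (spherePoint (z 0) (z 1)))}

/-! ### The holomorphic disks

A point `ξ = (x, y)` of `S² × S²` off the fixed spheres has coordinates `(s, t, lam)` with
`x = (cos s / cosh t, sin s / cosh t, tanh t)` and `lam = (y₁ + i y₂) / (1 + y₀) ∈ ℂ ∪ {∞}`.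
Write `lam = b / a`, `q = √((1 + x₂) / 2)`, `m = √((1 - x₂) / 2)` and `σ = exp (i s)`,
so that `q / m = exp t`. The disk of `ξ` is the image of
`w ↦ [-iσ E (m b̄ w + q a) : -iσ E (-m ā w + q b) : -m a + q b̄ w : m b + q ā w]`, `|w| ≤ 1`,
where `E (w) = exp (H₀ + 2 H₊(w))` and `∑ₖ Hₖ wᵏ = H₊ + H₀ + H₋` is the Fourier series of `h` along
the boundary circle. For `a = 1` this is `1 / m` times
`[-i e^{is} E (lam̄ w + e^t) : -i e^{is} E (-w + lam e^t) : -1 + lam̄ e^t w : lam + e^t w]`.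
The formula continues to make sense on the fixed spheres, where (up to a rotation of `w`) it is
`[e^{h(lam)} : e^{h(lam)} lam : w lam̄ : w]` for `x = (0,0,1)` and, with `μ = -1 / lam̄`,
`[e^{h(μ)} w : e^{h(μ)} w μ : μ̄ : 1]` for `x = (0,0,-1)`. -/

/-- The first homogeneous coordinate `a` of `lam = b / a`: it is `1`, and `0` for `lam = ∞`. -/
def spinA (y : S2) : ℂ := if 1 + y.1 0 = 0 then 0 else 1

/-- The second homogeneous coordinate `b` of `lam = b / a`: it is `lam`, and `1` for `lam = ∞`. -/
def spinB (y : S2) : ℂ :=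
  if 1 + y.1 0 = 0 then 1 else ((y.1 1 : ℂ) + Complex.I * (y.1 2 : ℂ)) / (1 + (y.1 0 : ℂ))

/-- `q = √((1 + x₂) / 2)`. -/
def radQ (x : S2) : ℝ := √((1 + x.1 2) / 2)

/-- `m = √((1 - x₂) / 2)`. -/
def radM (x : S2) : ℝ := √((1 - x.1 2) / 2)

/-- The phase `e^{is}` of `x₀ + i x₁`; it is set to be `1` at the poles. -/
def phase (x : S2) : ℂ :=
  if (x.1 0 : ℂ) + Complex.I * (x.1 1 : ℂ) = 0 then 1
  else ((x.1 0 : ℂ) + Complex.I * (x.1 1 : ℂ)) / ‖(x.1 0 : ℂ) + Complex.I * (x.1 1 : ℂ)‖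

/-- `m b̄ w + q a` -/
def top0 (ξ : S2 × S2) (w : ℂ) : ℂ := radM ξ.1 * conj (spinB ξ.2) * w + radQ ξ.1 * spinA ξ.2

/-- `-m ā w + q b` -/
def top1 (ξ : S2 × S2) (w : ℂ) : ℂ := -radM ξ.1 * conj (spinA ξ.2) * w + radQ ξ.1 * spinB ξ.2

/-- `-m a + q b̄ w` -/
def bot0 (ξ : S2 × S2) (w : ℂ) : ℂ := -radM ξ.1 * spinA ξ.2 + radQ ξ.1 * conj (spinB ξ.2) * w

/-- `m b + q ā w` -/
def bot1 (ξ : S2 × S2) (w : ℂ) : ℂ := radM ξ.1 * spinB ξ.2 + radQ ξ.1 * conj (spinA ξ.2) * w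

/-- The boundary function `H(e^{iθ}) = h(η(e^{iθ}))` with `η = top1 / top0`. -/
def boundaryH (h : S2 → ℝ) (ξ : S2 × S2) (θ : ℝ) : ℝ :=
  h (spherePoint (top0 ξ (Complex.exp (Complex.I * θ))) (top1 ξ (Complex.exp (Complex.I * θ))))

/-- The Fourier coefficients `Hₖ` of the boundary function. -/
def coeffH (h : S2 → ℝ) (ξ : S2 × S2) (k : ℕ) : ℂ :=
  (2 * Real.pi : ℂ)⁻¹ * ∫ θ in (0 : ℝ)..(2 * Real.pi),
    (boundaryH h ξ θ : ℂ) * Complex.exp (-(Complex.I * k * θ))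

/-- `E(w) = exp (H₀ + 2 ∑_{k > 0} Hₖ wᵏ)`. -/
def factorE (h : S2 → ℝ) (ξ : S2 × S2) (w : ℂ) : ℂ :=
  Complex.exp (coeffH h ξ 0 + 2 * ∑' k : ℕ, coeffH h ξ (k + 1) * w ^ (k + 1))

/-- Homogeneous coordinates of the disk of `ξ`. -/
def diskVec (h : S2 → ℝ) (ξ : S2 × S2) (w : ℂ) : Fin 4 → ℂ :=
  ![-Complex.I * phase ξ.1 * factorE h ξ w * top0 ξ w,
    -Complex.I * phase ξ.1 * factorE h ξ w * top1 ξ w, bot0 ξ w, bot1 ξ w]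

theorem phase_ne_zero (x : S2) : phase x ≠ 0 := by
  unfold phase
  split_ifs with h0
  · exact one_ne_zero
  · exact div_ne_zero h0 (by simpa using h0)

theorem diskVec_ne_zero (h : S2 → ℝ) (ξ : S2 × S2) (w : ℂ) : diskVec h ξ w ≠ 0 := by
  intro hv
  have hE : -Complex.I * phase ξ.1 * factorE h ξ w ≠ 0 :=
    mul_ne_zero (mul_ne_zero (by simp) (phase_ne_zero _)) (Complex.exp_ne_zero _)
  have e0 : top0 ξ w = 0 := by
    have := congrFun hv 0
    simpa [diskVec, Complex.exp_ne_zero, phase_ne_zero, factorE] using this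
  have e1 : top1 ξ w = 0 := by
    have := congrFun hv 1
    simpa [diskVec, Complex.exp_ne_zero, phase_ne_zero, factorE] using this
  have e2 : bot0 ξ w = 0 := by simpa [diskVec] using congrFun hv 2
  have e3 : bot1 ξ w = 0 := by simpa [diskVec] using congrFun hv 3
  have hab : spinA ξ.2 ≠ 0 ∨ spinB ξ.2 ≠ 0 := by
    unfold spinA spinB
    split_ifs <;> simp
  have hN : spinA ξ.2 * conj (spinA ξ.2) + spinB ξ.2 * conj (spinB ξ.2) ≠ 0 := by
    rw [Complex.mul_conj, Complex.mul_conj]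
    have h1 := Complex.normSq_nonneg (spinA ξ.2)
    have h2 := Complex.normSq_nonneg (spinB ξ.2)
    have : 0 < Complex.normSq (spinA ξ.2) + Complex.normSq (spinB ξ.2) := by
      rcases hab with h | h
      · exact add_pos_of_pos_of_nonneg (Complex.normSq_pos.2 h) h2
      · exact add_pos_of_nonneg_of_pos h1 (Complex.normSq_pos.2 h)
    exact_mod_cast this.ne'
  unfold top0 at e0
  unfold top1 at e1
  unfold bot0 at e2
  unfold bot1 at e3
  have hq : (radQ ξ.1 : ℂ) = 0 := by
    have : (radQ ξ.1 : ℂ) * (spinA ξ.2 * conj (spinA ξ.2) + spinB ξ.2 * conj (spinB ξ.2)) = 0 := by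
      linear_combination conj (spinA ξ.2) * e0 + conj (spinB ξ.2) * e1
    exact (mul_eq_zero.1 this).resolve_right hN
  have hm : (radM ξ.1 : ℂ) = 0 := by
    have : (radM ξ.1 : ℂ) * (spinA ξ.2 * conj (spinA ξ.2) + spinB ξ.2 * conj (spinB ξ.2)) = 0 := by
      linear_combination conj (spinB ξ.2) * e3 - conj (spinA ξ.2) * e2
    exact (mul_eq_zero.1 this).resolve_right hN
  have hq' : radQ ξ.1 = 0 := by exact_mod_cast hq
  have hm' : radM ξ.1 = 0 := by exact_mod_cast hm
  unfold radQ at hq'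
  unfold radM at hm'
  have h1 := Real.sqrt_eq_zero'.1 hq'
  have h2 := Real.sqrt_eq_zero'.1 hm'
  linarith

/-- The parametrized disk of `ξ` (to be restricted to the closed unit disk). -/
def diskMap (h : S2 → ℝ) (ξ : S2 × S2) (w : ℂ) : CP3 :=
  Projectivization.mk ℂ (diskVec h ξ w) (diskVec_ne_zero h ξ w)

/-- The closed disk `D_ξ`. -/
def disk (h : S2 → ℝ) (ξ : S2 × S2) : Set CP3 := diskMap h ξ '' Metric.closedBall 0 1

/-- The interior of the disk `D_ξ`. -/
def diskInterior (h : S2 → ℝ) (ξ : S2 × S2) : Set CP3 := diskMap h ξ '' Metric.ball 0 1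

/-- The fixed sphere `S₊ = {(0, 0, 1)} × S²`. -/
def Splus : Set (S2 × S2) := {ξ | (ξ.1 : E3) = !₂[0, 0, 1]}

/-- The fixed sphere `S₋ = {(0, 0, -1)} × S²`. -/
def Sminus : Set (S2 × S2) := {ξ | (ξ.1 : E3) = !₂[0, 0, -1]}

/-- `f`, restricted to the closed unit disk, is an injective holomorphic disk in `ℂP³` with
boundary on `P`. -/
structure IsHolomorphicDisk (P : Set CP3) (f : ℂ → CP3) : Prop where
  continuousOn : ContinuousOn f (Metric.closedBall 0 1)
  injOn : Set.InjOn f (Metric.closedBall 0 1)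
  holomorphic : MDifferentiableOn 𝓘(ℂ, ℂ) 𝓘(ℂ, Fin 3 → ℂ) f (Metric.ball 0 1)
  boundary : Set.MapsTo f (Metric.sphere 0 1) P

/-! ### Relative singular homology -/

section Homology

open CategoryTheory Limits

/-- The singular chain complex with integer coefficients. -/
abbrev singularChains : TopCat.{0} ⥤ ChainComplex (ModuleCat.{0} ℤ) ℕ :=
  (AlgebraicTopology.singularChainComplexFunctor (ModuleCat.{0} ℤ)).obj (ModuleCat.of ℤ ℤ)

/-- The relative singular chain complex `C(X) / C(A)` of a pair `(X, A)`. -/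
def relChains (X : TopPair.{0}) : ChainComplex (ModuleCat.{0} ℤ) ℕ :=
  cokernel (singularChains.map X.map)

/-- The chain map induced by a map of pairs. -/
def relChainsMap {X Y : TopPair.{0}} (f : X ⟶ Y) : relChains X ⟶ relChains Y :=
  cokernel.map _ _ (singularChains.map (TopPair.Hom.snd f))
    (singularChains.map (TopPair.Hom.fst f)) (by
      rw [← Functor.map_comp, ← Functor.map_comp, TopPair.Hom.w])

/-- The relative singular homology `H_n(X, A; ℤ)`. -/
def relHomology (n : ℕ) (X : TopPair.{0}) : ModuleCat.{0} ℤ := (relChains X).homology n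

/-- The map induced on relative singular homology by a map of pairs. -/
def relHomologyMap (n : ℕ) {X Y : TopPair.{0}} (f : X ⟶ Y) :
    relHomology n X ⟶ relHomology n Y :=
  HomologicalComplex.homologyMap (relChainsMap f) n

/-- The pair (closed unit disk, unit circle). -/
abbrev diskPair : TopPair.{0} :=
  TopPair.ofSubset (X := TopCat.of (Metric.closedBall (0 : ℂ) 1)) {w | ‖(w : ℂ)‖ = 1}

/-- The pair `(ℂP³, P)`. -/
abbrev cp3Pair (P : Set CP3) : TopPair.{0} := TopPair.ofSubset (X := TopCat.of CP3) P

/-- A holomorphic disk as a map of pairs. -/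
def IsHolomorphicDisk.pairMap {P : Set CP3} {f : ℂ → CP3} (hf : IsHolomorphicDisk P f) :
    diskPair ⟶ cp3Pair P :=
  TopPair.ofHom (X := diskPair) (Y := cp3Pair P)
    (TopCat.ofHom ⟨fun w : Metric.closedBall (0 : ℂ) 1 => f w, hf.continuousOn.domRestrict⟩)
    (TopCat.ofHom ⟨fun w : {w : Metric.closedBall (0 : ℂ) 1 | ‖(w : ℂ)‖ = 1} =>
        (⟨f w.1, hf.boundary (mem_sphere_zero_iff_norm.2 w.2)⟩ : P),
      Continuous.subtype_mk (hf.continuousOn.domRestrict.comp continuous_subtype_val) _⟩)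
    rfl

/-- A class that generates the homology module it lives in. -/
def IsGenerator {M : ModuleCat.{0} ℤ} (c : M) : Prop := Submodule.span ℤ {c} = ⊤

/-- The class `[D] ∈ H₂(ℂP³, P; ℤ)` of a holomorphic disk, i.e. the image of a fundamental class
of the disk (a generator of `H₂(𝔻, ∂𝔻; ℤ) ≅ ℤ`, unique up to sign), is a generator. -/
def IsHolomorphicDisk.RepresentsGenerator {P : Set CP3} {f : ℂ → CP3}
    (hf : IsHolomorphicDisk P f) : Prop :=
  ∀ c : relHomology 2 diskPair, IsGenerator c →
    IsGenerator ((relHomologyMap 2 hf.pairMap).hom c)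

end Homology

/-! ### Foliations -/

/-- The sets `leaf i` are the leaves of a smooth foliation of the subset `U` of `ℂP³` by real
surfaces: they are connected, they partition `U`, and every point of `U` has a foliated chart,
that is, a smooth chart onto a polydisk in which the connected components of the traces of the
leaves are the slices along the first (complex) coordinate. -/
structure IsFoliation {ι : Type*} (U : Set CP3) (leaf : ι → Set CP3) : Prop where
  connected : ∀ i, IsConnected (leaf i)
  disjoint : Pairwise fun i j => Disjoint (leaf i) (leaf j)
  cover : ⋃ i, leaf i = U
  foliated_chart : ∀ p ∈ U, ∃ φ ∈ IsManifold.maximalAtlas 𝓘(ℝ, Fin 3 → ℂ) ∞ CP3,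
    p ∈ φ.source ∧ φ.source ⊆ U ∧ (∃ c r, φ.target = Metric.ball c r) ∧
    ∀ i, ∀ x ∈ leaf i ∩ φ.source, connectedComponentIn (leaf i ∩ φ.source) x =
      {x' ∈ φ.source | φ x' 1 = φ x 1 ∧ φ x' 2 = φ x 2}

end

/-! Write a vector of `ℂ⁴` as a pair `(T, V)` with `T = (z₀, z₁)` and `V = (conj z₃, conj z₂)`. A
scalar `c` acts by `(c T, conj c V)`, and `P_h` is given by `V = c T` with `|c| = exp (-h(T))`. For
`h = 0` its complement consists of the pairs for which the circle `T + ζ V`, `|ζ| = 1`, misses the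
origin (`GoodPair`), and linear algebra shows that each such pair lies on exactly one disk
(`exists_disk_of_goodPair`, `eq_of_smul_disk_eq`). For general `h` the factor `E(w)` is the
exponential of a Schwarz integral `S`, and a Möbius change of variables shows that it depends on the
pair `(T, V)` alone (`factorE_eq_exp_schwarz`). Hence the open disks for `h` are the images of those
for `h = 0` under one homogeneous map, `twist : (T, V) ↦ (exp S(T, V) T, V)`.

The foliation statement therefore reduces to `twist` being a diffeomorphism from the good pairs onto
the complement of the cone over `P_h`. Since `S` is unchanged under `(T, V) ↦ (u T, v V)` with `|u|
= |v|`, inverting `twist` amounts to solving `τ = M(T, e^τ V)`, where `M = Re S` is the mean of `h`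
over the circle. The derivative of the right side is a flux through that circle. It is conformally
invariant, so the circle may be centred, and there it equals `-∂ₜ R h`; admissibility makes it
smaller than `1` in absolute value (`abs_fluxS_lt_one`). Monotonicity and boundedness of `M` give a
unique solution, the implicit function theorem a smooth one. In linear coordinates that turn `P_0`
into `ℝP³`, the disks for `h = 0` are the halves of complexified real lines. Ratios of real Plücker
coordinates are constant on them, which gives the foliated charts after composition with the inverse
of `twist`.

For the homology class it is enough that the disk induces a surjection `H₂(𝔻, ∂𝔻) → H₂(ℂP³, P_h)`
(`representsGenerator_of_chains`). A relative cycle lifts to a chain in `ℂ⁴ ∖ 0`. There `H₂`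
vanishes, as does `H₁` of the normalized cone over `P_h`, a copy of `ℂ² ∖ 0`. The only obstruction
left is vertical motion in the fibres, generated by the half turn `z ↦ -z` of the cone. The boundary
of the lifted disk differs from a path in the cone by exactly one half turn, so modulo the disk the
obstruction disappears (`exists_boundary_loop`, `mem_fibreBd_of_cycle`). -/

open scoped Manifold ContDiff LinearAlgebra.Projectivization ComplexConjugate

noncomputable section


/-! ### Smoothness of parametric integrals -/

section ParametricIntegral

open Set Filter MeasureTheory

variable {X Y : Type} [NormedAddCommGroup X] [NormedSpace ℝ X] [FiniteDimensional ℝ X]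
  [NormedAddCommGroup Y] [NormedSpace ℝ Y] {U : Set X} {a b : ℝ}

theorem continuousOn_intervalIntegral_param {f : X × ℝ → Y} (hU : IsOpen U)
    (hf : ContinuousOn f (U ×ˢ univ)) :
    ContinuousOn (fun x => ∫ t in a..b, f (x, t)) U := by
  intro x hx
  obtain ⟨r, hr, hrU⟩ := Metric.nhds_basis_closedBall.mem_iff.1 (hU.mem_nhds hx)
  have hK : IsCompact (Metric.closedBall x r ×ˢ uIcc a b) :=
    (isCompact_closedBall x r).prod isCompact_uIcc
  obtain ⟨C, hC⟩ := hK.exists_bound_of_continuousOn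
    (hf.mono (prod_mono hrU (subset_univ _)))
  have hcont : ∀ x' ∈ U, Continuous fun t => f (x', t) := fun x' hx' =>
    hf.comp_continuous (by fun_prop) fun t => ⟨hx', mem_univ _⟩
  apply ContinuousAt.continuousWithinAt
  refine intervalIntegral.continuousAt_of_dominated_interval (bound := fun _ => C) ?_ ?_ ?_ ?_
  · filter_upwards [hU.mem_nhds hx] with x' hx'
    exact (hcont x' hx').aestronglyMeasurable
  · filter_upwards [Metric.closedBall_mem_nhds x hr] with x' hx'
    exact ae_of_all _ fun t ht => hC (x', t) ⟨hx', uIoc_subset_uIcc ht⟩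
  · exact intervalIntegrable_const
  · refine ae_of_all _ fun t _ => ?_
    have := hf.continuousAt ((hU.prod isOpen_univ).mem_nhds (⟨hx, mem_univ t⟩ : (x, t) ∈ U ×ˢ univ))
    exact ContinuousAt.comp (f := fun x => (x, t)) this (by fun_prop)

theorem hasFDerivAt_intervalIntegral_param {f : X × ℝ → Y} (hU : IsOpen U)
    (hf : ContDiffOn ℝ 1 f (U ×ˢ univ)) {x : X} (hx : x ∈ U) :
    HasFDerivAt (fun x => ∫ t in a..b, f (x, t))
      (∫ t in a..b, (fderiv ℝ f (x, t)).comp (ContinuousLinearMap.inl ℝ X ℝ)) x := by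
  have hO : IsOpen (U ×ˢ (univ : Set ℝ)) := hU.prod isOpen_univ
  have hf' : ContinuousOn (fun p => (fderiv ℝ f p).comp (ContinuousLinearMap.inl ℝ X ℝ))
      (U ×ˢ univ) :=
    (hf.continuousOn_fderiv_of_isOpen hO le_rfl).clm_comp continuousOn_const
  obtain ⟨r, hr, hrU⟩ := Metric.nhds_basis_closedBall.mem_iff.1 (hU.mem_nhds hx)
  have hK : IsCompact (Metric.closedBall x r ×ˢ uIcc a b) :=
    (isCompact_closedBall x r).prod isCompact_uIcc
  obtain ⟨C, hC⟩ := hK.exists_bound_of_continuousOn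
    (hf'.mono (prod_mono hrU (subset_univ _)))
  have hcont : ∀ x' ∈ U, Continuous fun t => f (x', t) := fun x' hx' =>
    hf.continuousOn.comp_continuous (by fun_prop) fun t => ⟨hx', mem_univ _⟩
  have hcont' : Continuous fun t =>
      (fderiv ℝ f (x, t)).comp (ContinuousLinearMap.inl ℝ X ℝ) :=
    hf'.comp_continuous (by fun_prop : Continuous fun t : ℝ => (x, t)) fun t => ⟨hx, mem_univ _⟩
  refine intervalIntegral.hasFDerivAt_integral_of_dominated_of_fderiv_le (bound := fun _ => C)
    (F' := fun x t => (fderiv ℝ f (x, t)).comp (ContinuousLinearMap.inl ℝ X ℝ))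
    (Metric.closedBall_mem_nhds x hr) ?_ ?_ ?_ ?_ ?_ ?_
  · filter_upwards [hU.mem_nhds hx] with x' hx'
    exact (hcont x' hx').aestronglyMeasurable
  · exact (hcont x hx).intervalIntegrable _ _
  · exact hcont'.aestronglyMeasurable
  · exact ae_of_all _ fun t ht x' hx' => hC (x', t) ⟨hx', uIoc_subset_uIcc ht⟩
  · exact intervalIntegrable_const
  · refine ae_of_all _ fun t _ x' hx' => ?_
    have h1 : HasFDerivAt f (fderiv ℝ f (x', t)) (x', t) :=
      ((hf.differentiableOn one_ne_zero).differentiableAt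
        (hO.mem_nhds ⟨hrU hx', mem_univ _⟩)).hasFDerivAt
    exact h1.comp x' (hasFDerivAt_prodMk_left x' t)

/-- Induction on the order. The derivative is again a parametric integral, with values in `X →L[ℝ]
Y`, so `Y` has to vary in the induction. -/
theorem contDiffOn_nat_intervalIntegral_param (n : ℕ) : ∀ {Y : Type} [NormedAddCommGroup Y]
    [NormedSpace ℝ Y] {f : X × ℝ → Y} (_ : IsOpen U) (_ : ContDiffOn ℝ ∞ f (U ×ˢ univ)),
    ContDiffOn ℝ n (fun x => ∫ t in a..b, f (x, t)) U := by
  induction n with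
  | zero =>
    intro Y _ _ f hU hf
    simpa [contDiffOn_zero] using continuousOn_intervalIntegral_param hU hf.continuousOn
  | succ n ih =>
    intro Y _ _ f hU hf
    have hd := fun x (hx : x ∈ U) => hasFDerivAt_intervalIntegral_param (a := a) (b := b) hU
      (hf.of_le (by simp)) hx
    rw [show ((n + 1 : ℕ) : ℕ∞ω) = (n : ℕ∞ω) + 1 by simp, contDiffOn_succ_iff_fderiv_of_isOpen hU]
    refine ⟨fun x hx => (hd x hx).differentiableAt.differentiableWithinAt, by simp, ?_⟩
    refine ContDiffOn.congr (ih (Y := X →L[ℝ] Y)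
      (f := fun p => (fderiv ℝ f p).comp (ContinuousLinearMap.inl ℝ X ℝ)) hU ?_)
      fun x hx => (hd x hx).fderiv
    exact (hf.fderiv_of_isOpen (hU.prod isOpen_univ) (by simp)).clm_comp contDiffOn_const

theorem contDiffOn_intervalIntegral_param {f : X × ℝ → Y} (hU : IsOpen U)
    (hf : ContDiffOn ℝ ∞ f (U ×ˢ univ)) :
    ContDiffOn ℝ ∞ (fun x => ∫ t in a..b, f (x, t)) U :=
  contDiffOn_infty.2 fun n => contDiffOn_nat_intervalIntegral_param n hU hf

end ParametricIntegral

/-! ### Functions on the sphere as homogeneous functions on `ℂ²` -/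

theorem spherePoint_smul {c : ℂ} (hc : c ≠ 0) (a b : ℂ) :
    spherePoint (c * a) (c * b) = spherePoint a b := by
  have hc' : ‖c‖ ≠ 0 := norm_ne_zero_iff.2 hc
  have key : ‖c * a‖ ^ 2 + ‖c * b‖ ^ 2 = ‖c‖ ^ 2 * (‖a‖ ^ 2 + ‖b‖ ^ 2) := by
    simp only [norm_mul]; ring
  have k2 : conj (c * a) * (c * b) = ((‖c‖ ^ 2 : ℝ) : ℂ) * (conj a * b) := by
    rw [Complex.sq_norm, Complex.normSq_eq_conj_mul_self, map_mul]; ring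
  unfold spherePoint
  by_cases h : ‖a‖ ^ 2 + ‖b‖ ^ 2 = 0
  · rw [dif_pos h, dif_pos (by rw [key, h, mul_zero])]
  · rw [dif_neg h, dif_neg (by rw [key]; exact mul_ne_zero (by positivity) h)]
    apply Subtype.ext
    simp only [k2, Complex.re_ofReal_mul, Complex.im_ofReal_mul, norm_mul, mul_pow]
    have hc2 : ‖c‖ ^ 2 ≠ 0 := by positivity
    refine PiLp.ext fun i => ?_
    fin_cases i <;> simp <;> field_simp

/-- The degree-zero homogeneous extension of a function on the sphere to `ℂ²`. -/
def liftS (h : S2 → ℝ) (v : ℂ × ℂ) : ℝ := h (spherePoint v.1 v.2)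

theorem liftS_smul (h : S2 → ℝ) {c : ℂ} (hc : c ≠ 0) (v : ℂ × ℂ) :
    liftS h (c • v) = liftS h v := by
  simp [liftS, spherePoint_smul hc]

theorem normSq_add_ne_zero {v : ℂ × ℂ} (hv : v ≠ 0) : ‖v.1‖ ^ 2 + ‖v.2‖ ^ 2 ≠ 0 := by
  intro h
  apply hv
  have h1 := sq_nonneg ‖v.1‖
  have h2 := sq_nonneg ‖v.2‖
  apply Prod.ext
  · simpa using (by linarith : ‖v.1‖ ^ 2 = 0)
  · simpa using (by linarith : ‖v.2‖ ^ 2 = 0)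

/-- Off the origin the Hopf map to the sphere is given by quotients of quadratic polynomials.
Restricting the codomain to the sphere allows it to be composed with `h`, which is smooth only as a
function on a manifold. -/
theorem contDiffAt_liftS {h : S2 → ℝ} (hh : ContMDiff (𝓡 2) 𝓘(ℝ, ℝ) ∞ h) {v : ℂ × ℂ}
    (hv : v ≠ 0) : ContDiffAt ℝ ∞ (liftS h) v := by
  let U : TopologicalSpace.Opens (ℂ × ℂ) := ⟨{0}ᶜ, isOpen_compl_singleton⟩
  let F : ℂ × ℂ → E3 := fun v => !₂[(‖v.1‖ ^ 2 - ‖v.2‖ ^ 2) / (‖v.1‖ ^ 2 + ‖v.2‖ ^ 2),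
      2 * (conj v.1 * v.2).re / (‖v.1‖ ^ 2 + ‖v.2‖ ^ 2),
      2 * (conj v.1 * v.2).im / (‖v.1‖ ^ 2 + ‖v.2‖ ^ 2)]
  have hF : ∀ v ∈ U, ContDiffAt ℝ ∞ F v := by
    intro v hv
    have hN := normSq_add_ne_zero (v := v) hv
    have hconj : ContDiff ℝ ∞ (fun z : ℂ × ℂ => conj z.1) :=
      Complex.conjCLE.contDiff.comp contDiff_fst
    have h1 : ContDiff ℝ ∞ (fun z : ℂ × ℂ => ‖z.1‖ ^ 2) := contDiff_fst.norm_sq ℝ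
    have h2 : ContDiff ℝ ∞ (fun z : ℂ × ℂ => ‖z.2‖ ^ 2) := contDiff_snd.norm_sq ℝ
    have h3 : ContDiff ℝ ∞ (fun z : ℂ × ℂ => conj z.1 * z.2) := hconj.mul contDiff_snd
    have h4 : ContDiff ℝ ∞ (fun z : ℂ × ℂ => (conj z.1 * z.2).re) := Complex.reCLM.contDiff.comp h3
    have h5 : ContDiff ℝ ∞ (fun z : ℂ × ℂ => (conj z.1 * z.2).im) := Complex.imCLM.contDiff.comp h3
    rw [contDiffAt_piLp]
    intro i
    fin_cases i
    · exact (h1.sub h2).contDiffAt.div (h1.add h2).contDiffAt hN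
    · exact (contDiff_const.mul h4).contDiffAt.div (h1.add h2).contDiffAt hN
    · exact (contDiff_const.mul h5).contDiffAt.div (h1.add h2).contDiffAt hN
  have hFs : ∀ v : U, F v = (spherePoint v.1.1 v.1.2 : E3) := by
    intro v
    rw [spherePoint, dif_neg (normSq_add_ne_zero v.2)]
  have hFU : ContMDiff 𝓘(ℝ, ℂ × ℂ) 𝓘(ℝ, E3) ∞ (fun v : U => F v) := by
    intro v
    exact contMDiffAt_subtype_iff.2 (hF v v.2).contMDiffAt
  have hmem : ∀ v : U, F v ∈ Metric.sphere (0 : E3) 1 := fun v => by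
    rw [hFs]; exact (spherePoint v.1.1 v.1.2).2
  have hcomp : ContMDiff 𝓘(ℝ, ℂ × ℂ) 𝓘(ℝ, ℝ) ∞ (fun v : U => liftS h v) := by
    have := hh.comp (hFU.codRestrict_sphere (n := 2) hmem)
    convert this using 1
    funext v
    simp only [liftS, Function.comp]
    congr 1
    exact Subtype.ext (hFs v).symm
  exact (contMDiffAt_subtype_iff (x := (⟨v, hv⟩ : U)).1 (hcomp ⟨v, hv⟩)).contDiffAt

theorem exists_bound_liftS {h : S2 → ℝ} (hh : Continuous h) :
    ∃ C, ∀ v, |liftS h v| ≤ C := by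
  obtain ⟨C, hC⟩ := (isCompact_univ (X := S2)).exists_bound_of_continuousOn hh.continuousOn
  exact ⟨C, fun v => hC _ (Set.mem_univ _)⟩


/-! ### Integrals over the unit circle -/

/-- The point `exp (i θ)` of the unit circle. -/
def ei (θ : ℝ) : ℂ := Complex.exp (Complex.I * θ)

theorem norm_ei (θ : ℝ) : ‖ei θ‖ = 1 := by
  rw [ei, mul_comm]; exact Complex.norm_exp_ofReal_mul_I θ

theorem ei_ne_zero (θ : ℝ) : ei θ ≠ 0 := Complex.exp_ne_zero _

theorem ei_mul_conj (θ : ℝ) : ei θ * conj (ei θ) = 1 := by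
  rw [Complex.mul_conj, Complex.normSq_eq_norm_sq, norm_ei]; simp

theorem conj_ei (θ : ℝ) : conj (ei θ) = ei (-θ) := by
  simp [ei, ← Complex.exp_conj]

theorem contDiff_ei : ContDiff ℝ ∞ ei :=
  (contDiff_const.mul Complex.ofRealCLM.contDiff).cexp

theorem continuous_ei : Continuous ei := contDiff_ei.continuous

theorem ei_add_two_pi (θ : ℝ) : ei (θ + 2 * Real.pi) = ei θ := by
  simp only [ei]; push_cast
  rw [mul_add, Complex.exp_add, show Complex.I * (2 * Real.pi : ℂ) = 2 * Real.pi * Complex.I by ring,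
    Complex.exp_two_pi_mul_I, mul_one]

theorem exists_ei_eq {w : ℂ} (hw : ‖w‖ = 1) : ∃ θ : ℝ, ei θ = w := by
  refine ⟨w.arg, ?_⟩
  have := Complex.norm_mul_exp_arg_mul_I w
  rw [hw] at this
  simpa [ei, mul_comm] using this

theorem hasDerivAt_ei (θ : ℝ) : HasDerivAt ei (Complex.I * ei θ) θ := by
  have h : HasDerivAt (fun t : ℝ => Complex.I * (t : ℂ)) Complex.I θ := by
    simpa using (Complex.ofRealCLM.hasDerivAt (x := θ)).const_mul Complex.I
  exact h.cexp.congr_deriv (by rw [ei, mul_comm])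

theorem one_add_re_pos {w ζ : ℂ} (hw : ‖w‖ < 1) (hζ : ‖ζ‖ = 1) : 0 < (1 + w * ζ).re := by
  have h1 : |(w * ζ).re| ≤ ‖w * ζ‖ := Complex.abs_re_le_norm _
  rw [norm_mul, hζ, mul_one] at h1
  have := neg_abs_le (w * ζ).re
  simp only [Complex.add_re, Complex.one_re]
  linarith

theorem one_add_conj_mul_ne_zero {w ζ : ℂ} (hw : ‖w‖ < 1) (hζ : ‖ζ‖ = 1) :
    1 + conj w * ζ ≠ 0 := by
  intro h
  have := one_add_re_pos (w := conj w) (ζ := ζ) (by simpa using hw) hζ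
  rw [h] at this
  simp at this

/-- Change of variables on the unit circle along the disk automorphism
`ζ ↦ (ζ + w) / (1 + conj w ζ)`. -/
theorem integral_circle_mobius {F : Type*} [NormedAddCommGroup F] [NormedSpace ℝ F] (g : ℂ → F)
    (hg : Continuous fun φ => g (ei φ)) {w : ℂ} (hw : ‖w‖ < 1) :
    ∫ θ in (0 : ℝ)..(2 * Real.pi), ((1 - ‖w‖ ^ 2) / ‖1 + conj w * ei θ‖ ^ 2) •
      g ((ei θ + w) / (1 + conj w * ei θ)) = ∫ φ in (0 : ℝ)..(2 * Real.pi), g (ei φ) := by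
  have hre : ∀ θ, 0 < (1 + w * conj (ei θ)).re := fun θ =>
    one_add_re_pos hw (by simp [norm_ei])
  have hslit : ∀ θ, 1 + w * conj (ei θ) ∈ Complex.slitPlane := fun θ => Or.inl (hre θ)
  have hne : ∀ θ, 1 + w * conj (ei θ) ≠ 0 := fun θ => Complex.slitPlane_ne_zero (hslit θ)
  have hne' : ∀ θ, 1 + conj w * ei θ ≠ 0 := fun θ => one_add_conj_mul_ne_zero hw (norm_ei θ)
  -- With `L = 1 + w conj ζ`, `ζ = ei θ`, the image point is `ζ L / conj L`, so its angle is `θ + 2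
  -- arg L`. As `L` stays in the right half plane, the principal logarithm is smooth along the
  -- circle.
  let φ : ℝ → ℝ := fun θ => θ + 2 * (Complex.log (1 + w * conj (ei θ))).im
  let φ' : ℝ → ℝ := fun θ => (1 - ‖w‖ ^ 2) / ‖1 + conj w * ei θ‖ ^ 2
  have hφ : ∀ θ, HasDerivAt φ (φ' θ) θ := by
    intro θ
    have h1 : HasDerivAt (fun t => conj (ei t)) (conj (Complex.I * ei θ)) θ :=
      (Complex.conjCLE.toContinuousLinearMap.hasFDerivAt.comp_hasDerivAt θ (hasDerivAt_ei θ))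
    have h2 : HasDerivAt (fun t => 1 + w * conj (ei t)) (w * conj (Complex.I * ei θ)) θ := by
      simpa using (h1.const_mul w).const_add 1
    have h3 := (h2.clog_real (hslit θ))
    have h4 := (Complex.imCLM.hasFDerivAt.comp_hasDerivAt θ h3)
    have h5 := (hasDerivAt_id θ).add (h4.const_mul 2)
    refine h5.congr_deriv ?_
    simp only [φ', Complex.imCLM_apply]
    have e1 : ‖1 + conj w * ei θ‖ ^ 2 = ‖1 + w * conj (ei θ)‖ ^ 2 := by
      rw [← Complex.norm_conj (1 + w * conj (ei θ))]; simp
    have e2 : w * conj (Complex.I * ei θ) / (1 + w * conj (ei θ))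
        = -Complex.I * (1 - 1 / (1 + w * conj (ei θ))) := by
      field_simp [hne θ]
      simp
      ring
    rw [e2, e1]
    have e3 : (1 / (1 + w * conj (ei θ))).re
        = (1 + w * conj (ei θ)).re / ‖1 + w * conj (ei θ)‖ ^ 2 := by
      rw [one_div, Complex.inv_re, Complex.normSq_eq_norm_sq]
    have e4 : ‖1 + w * conj (ei θ)‖ ^ 2 = 1 + 2 * (w * conj (ei θ)).re + ‖w‖ ^ 2 := by
      have : ‖w‖ ^ 2 = ‖w * conj (ei θ)‖ ^ 2 := by simp [norm_ei]
      rw [this, Complex.sq_norm, Complex.sq_norm, Complex.normSq_apply, Complex.normSq_apply]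
      simp; ring
    have e5 : ‖1 + w * conj (ei θ)‖ ^ 2 ≠ 0 := pow_ne_zero 2 (norm_ne_zero_iff.2 (hne θ))
    have e6 : (-Complex.I * (1 - 1 / (1 + w * conj (ei θ)))).im
      = -(1 - (1 / (1 + w * conj (ei θ))).re) := by
      simp [Complex.mul_im]
    rw [e6, e3, eq_div_iff e5]
    have e7 : (1 + w * conj (ei θ)).re = 1 + (w * conj (ei θ)).re := by simp
    rw [e7]
    have e8 := div_mul_cancel₀ (1 + (w * conj (ei θ)).re) e5
    linear_combination 2 * e8 - e4
  have hexp : ∀ θ, ei (φ θ) = (ei θ + w) / (1 + conj w * ei θ) := by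
    intro θ
    have hL := Complex.exp_log (hne θ)
    have hLc : Complex.exp (conj (Complex.log (1 + w * conj (ei θ)))) = 1 + conj w * ei θ := by
      rw [Complex.exp_conj, hL]; simp
    have h1 : Complex.I * (φ θ : ℂ) = Complex.I * θ + (Complex.log (1 + w * conj (ei θ)) -
        conj (Complex.log (1 + w * conj (ei θ)))) := by
      rw [Complex.sub_conj]; simp only [φ]; push_cast; ring
    rw [ei, h1, Complex.exp_add, Complex.exp_sub, hL, hLc, ← ei, ← mul_div_assoc]
    congr 1
    linear_combination w * ei_mul_conj θ
  have hφ'c : Continuous φ' := by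
    refine Continuous.div continuous_const ?_ fun θ => pow_ne_zero 2 (norm_ne_zero_iff.2 (hne' θ))
    have := continuous_ei
    fun_prop
  have key := intervalIntegral.integral_deriv_smul_comp (a := 0) (b := 2 * Real.pi)
    (g := fun φ => g (ei φ)) (fun θ _ => hφ θ) hφ'c.continuousOn hg
  simp only [Function.comp, hexp] at key
  rw [key]
  have hper : Function.Periodic (fun φ => g (ei φ)) (2 * Real.pi) := fun φ => by
    simp only [ei_add_two_pi]
  have h2 : φ (2 * Real.pi) = φ 0 + 2 * Real.pi := by
    have : ei (2 * Real.pi) = ei 0 := by simpa using ei_add_two_pi 0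
    simp only [φ, this]; ring
  rw [h2, hper.intervalIntegral_add_eq (φ 0) 0, zero_add]

/-- The Schwarz integral formula for the holomorphic extension of a Fourier series. -/
theorem schwarz_integral {H : ℝ → ℝ} (hH : Continuous H) {w : ℂ} (hw : ‖w‖ < 1)
    (c : ℕ → ℂ) (hc : ∀ k, c k = (2 * Real.pi : ℂ)⁻¹ * ∫ θ in (0 : ℝ)..(2 * Real.pi),
      (H θ : ℂ) * Complex.exp (-(Complex.I * k * θ))) :
    c 0 + 2 * ∑' k : ℕ, c (k + 1) * w ^ (k + 1) = (2 * Real.pi : ℂ)⁻¹ *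
      ∫ θ in (0 : ℝ)..(2 * Real.pi), (H θ : ℂ) * ((ei θ + w) / (ei θ - w)) := by
  obtain ⟨C, hC⟩ := isCompact_uIcc (a := (0 : ℝ)) (b := 2 * Real.pi) |>.exists_bound_of_continuousOn
    hH.continuousOn
  have hHc : Continuous fun θ => (H θ : ℂ) := Complex.continuous_ofReal.comp hH
  have hterm : ∀ k : ℕ, ∀ θ : ℝ, Complex.exp (-(Complex.I * (k + 1 : ℕ) * θ))
      = (conj (ei θ)) ^ (k + 1) := by
    intro k θ
    rw [conj_ei, ei, ← Complex.exp_nat_mul]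
    congr 1; push_cast; ring
  have hlt : ∀ θ, ‖conj (ei θ) * w‖ < 1 := fun θ => by simpa [norm_ei] using hw
  -- Summing the geometric series turns `1 + 2 ∑ (conj ζ w)^(k+1)` into the Schwarz kernel `(ζ + w)
  -- / (ζ - w)`.
  have hs : ∀ θ, HasSum (fun k : ℕ => (conj (ei θ) * w) ^ (k + 1)) (w / (ei θ - w)) := by
    intro θ
    have h1 := (hasSum_geometric_of_norm_lt_one (hlt θ)).mul_left (conj (ei θ) * w)
    have h2 : conj (ei θ) * w * (1 - conj (ei θ) * w)⁻¹ = w / (ei θ - w) := by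
      have h3 : ei θ - w ≠ 0 := by
        intro h
        have : ei θ = w := sub_eq_zero.1 h
        rw [← this, norm_ei] at hw
        exact lt_irrefl _ hw
      have h4 : 1 - conj (ei θ) * w ≠ 0 := by
        intro h
        apply h3
        have := congrArg (fun z => ei θ * z) h
        simp only [mul_zero] at this
        linear_combination this + w * ei_mul_conj θ
      rw [mul_inv_eq_iff_eq_mul₀ h4, div_mul_eq_mul_div, eq_div_iff h3]
      linear_combination w * ei_mul_conj θ
    rw [h2] at h1
    simpa [pow_succ'] using h1
  have hsum := intervalIntegral.hasSum_integral_of_dominated_convergence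
    (μ := MeasureTheory.volume) (a := 0) (b := 2 * Real.pi)
    (F := fun (k : ℕ) (θ : ℝ) => (H θ : ℂ) * (conj (ei θ) * w) ^ (k + 1))
    (f := fun θ => (H θ : ℂ) * (w / (ei θ - w)))
    (fun k _ => C * ‖w‖ ^ (k + 1)) (fun k => by
      have := continuous_ei
      apply Continuous.aestronglyMeasurable; fun_prop)
    (fun k => Filter.Eventually.of_forall fun θ hθ => by
      rw [norm_mul, norm_pow, norm_mul, Complex.norm_conj, norm_ei, one_mul, Complex.norm_real]
      exact mul_le_mul_of_nonneg_right (hC θ (Set.uIoc_subset_uIcc hθ)) (by positivity))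
    (Filter.Eventually.of_forall fun θ _ =>
      ((summable_nat_add_iff 1).2 (summable_geometric_of_lt_one (norm_nonneg w) hw)).mul_left C)
    (by simp) (Filter.Eventually.of_forall fun θ _ => (hs θ).mul_left _)
  have hcoef : ∀ k : ℕ, c (k + 1) * w ^ (k + 1) = (2 * Real.pi : ℂ)⁻¹ *
      ∫ θ in (0 : ℝ)..(2 * Real.pi), (H θ : ℂ) * (conj (ei θ) * w) ^ (k + 1) := by
    intro k
    rw [hc, mul_assoc, ← intervalIntegral.integral_mul_const]
    congr 1
    refine intervalIntegral.integral_congr fun θ _ => ?_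
    simp only [hterm, mul_pow]; ring
  have hne : ∀ θ, ei θ - w ≠ 0 := fun θ h => by
    rw [← sub_eq_zero.1 h, norm_ei] at hw
    exact lt_irrefl _ hw
  have hcont : Continuous fun θ => (H θ : ℂ) * (w / (ei θ - w)) := by
    have := continuous_ei
    exact hHc.mul (continuous_const.div (by fun_prop) hne)
  simp only [hcoef]
  rw [tsum_mul_left, hsum.tsum_eq, hc 0, mul_left_comm, ← mul_add,
    ← intervalIntegral.integral_const_mul, ← intervalIntegral.integral_add]
  · congr 1
    refine intervalIntegral.integral_congr fun θ _ => ?_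
    have := hne θ
    simp only [Nat.cast_zero, mul_zero, zero_mul, neg_zero, Complex.exp_zero, mul_one]
    field_simp
    ring
  · simp only [Nat.cast_zero, mul_zero, zero_mul, neg_zero, Complex.exp_zero, mul_one]
    exact hHc.intervalIntegrable _ _
  · exact (continuous_const.mul hcont).intervalIntegrable _ _


/-! ### Fourier series of smooth periodic functions -/

section Fourier

open Real

theorem integral_mul_exp_eq_of_hasDerivAt {f f' : ℝ → ℂ} (hf : ∀ t, HasDerivAt f (f' t) t)
    (hf' : Continuous f') (hper : f (2 * π) = f 0) {k : ℤ} (hk : k ≠ 0) :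
    ∫ t in (0 : ℝ)..(2 * π), f t * Complex.exp (-(Complex.I * k * t)) =
      (Complex.I * k)⁻¹ * ∫ t in (0 : ℝ)..(2 * π), f' t * Complex.exp (-(Complex.I * k * t)) := by
  have hIk : (Complex.I * k : ℂ) ≠ 0 := mul_ne_zero Complex.I_ne_zero (by exact_mod_cast hk)
  have hv : ∀ t : ℝ, HasDerivAt (fun t : ℝ => -(Complex.I * k : ℂ)⁻¹ *
      Complex.exp (-(Complex.I * k * t))) (Complex.exp (-(Complex.I * k * t))) t := by
    intro t
    have h1 : HasDerivAt (fun t : ℝ => -(Complex.I * k * (t : ℂ))) (-(Complex.I * k)) t := by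
      have := ((Complex.ofRealCLM.hasDerivAt (x := t)).const_mul (Complex.I * k : ℂ)).neg
      exact this.congr_deriv (by simp)
    refine (h1.cexp.const_mul (-(Complex.I * k : ℂ)⁻¹)).congr_deriv ?_
    field_simp
  have hE : Continuous fun t : ℝ => Complex.exp (-(Complex.I * k * t)) := by fun_prop
  have := intervalIntegral.integral_mul_deriv_eq_deriv_mul (a := 0) (b := 2 * π)
    (fun t _ => hf t) (fun t _ => hv t) (hf'.intervalIntegrable _ _) (hE.intervalIntegrable _ _)
  rw [this, hper]
  have h2 : Complex.exp (-(Complex.I * k * ((2 * π : ℝ) : ℂ))) = 1 := by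
    rw [Complex.exp_eq_one_iff]
    exact ⟨-k, by push_cast; ring⟩
  rw [h2, ← intervalIntegral.integral_const_mul]
  simp only [Complex.ofReal_zero, mul_zero, neg_zero, Complex.exp_zero, sub_self, zero_sub,
    ← intervalIntegral.integral_neg]
  refine intervalIntegral.integral_congr fun t _ => ?_
  ring

/-- Two integrations by parts bound the `k`-th coefficient by a multiple of `1 / k²` for `k ≠ 0`.
Summability up to the boundary is what makes `E` continuous on the closed disk. -/
theorem summable_integral_mul_exp {f : ℝ → ℂ} (hf : ContDiff ℝ ∞ f)
    (hper : Function.Periodic f (2 * π)) :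
    Summable fun k : ℤ => ‖∫ t in (0 : ℝ)..(2 * π), f t * Complex.exp (-(Complex.I * k * t))‖ := by
  have hd : ∀ t, HasDerivAt f (deriv f t) t := fun t =>
    (hf.differentiable (by simp) t).hasDerivAt
  have hf1 : ContDiff ℝ ∞ (deriv f) := (contDiff_infty_iff_deriv.1 hf).2
  have hf2 : ContDiff ℝ ∞ (deriv (deriv f)) := (contDiff_infty_iff_deriv.1 hf1).2
  have hd1 : ∀ t, HasDerivAt (deriv f) (deriv (deriv f) t) t := fun t =>
    (hf1.differentiable (by simp) t).hasDerivAt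
  have hper1 : Function.Periodic (deriv f) (2 * π) := fun t => by
    rw [← deriv_comp_add_const, show (fun x => f (x + 2 * π)) = f from funext hper]
  obtain ⟨C, hC⟩ := isCompact_uIcc (a := (0 : ℝ)) (b := 2 * π) |>.exists_bound_of_continuousOn
    hf2.continuous.continuousOn
  refine Summable.of_norm_bounded_eventually (g := fun k : ℤ => C * |2 * π - 0| * (1 / (k : ℝ) ^ 2))
    ((Real.summable_one_div_int_pow.2 one_lt_two).mul_left _) ?_
  filter_upwards [(Set.finite_singleton (0 : ℤ)).compl_mem_cofinite] with k hk
  have hk' : k ≠ 0 := hk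
  rw [norm_norm, integral_mul_exp_eq_of_hasDerivAt hd hf1.continuous (by simpa using hper 0) hk',
    integral_mul_exp_eq_of_hasDerivAt hd1 hf2.continuous (by simpa using hper1 0) hk',
    norm_mul, norm_mul, norm_inv, norm_mul, Complex.norm_I, one_mul, Complex.norm_intCast,
    ← mul_assoc, ← mul_inv, abs_mul_abs_self]
  have := intervalIntegral.norm_integral_le_of_norm_le_const (a := 0) (b := 2 * π)
    (f := fun t => deriv (deriv f) t * Complex.exp (-(Complex.I * k * t))) (C := C) fun t ht => by
      rw [norm_mul, show -(Complex.I * (k : ℂ) * (t : ℂ)) = ((-(k * t) : ℝ) : ℂ) * Complex.I by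
        push_cast; ring, Complex.norm_exp_ofReal_mul_I, mul_one]
      exact hC t (Set.uIoc_subset_uIcc ht)
  calc ((k : ℝ) * k)⁻¹ * _ ≤ ((k : ℝ) * k)⁻¹ * (C * |2 * π - 0|) :=
        mul_le_mul_of_nonneg_left this (inv_nonneg.2 (mul_self_nonneg _))
    _ = _ := by rw [one_div, sq]; ring

theorem hasSum_fourier_series {f : ℝ → ℂ} (hf : ContDiff ℝ ∞ f)
    (hper : Function.Periodic f (2 * π)) (θ : ℝ) :
    HasSum (fun k : ℤ => ((2 * π : ℂ)⁻¹ * ∫ t in (0 : ℝ)..(2 * π), f t *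
      Complex.exp (-(Complex.I * k * t))) * Complex.exp (Complex.I * k * θ)) (f θ) := by
  have : Fact (0 < 2 * π) := ⟨two_pi_pos⟩
  let F : C(AddCircle (2 * π), ℂ) :=
    ⟨hper.lift, continuous_coinduced_dom.2 hf.continuous⟩
  have hF : ∀ t : ℝ, F (t : AddCircle (2 * π)) = f t := fun t => hper.lift_coe t
  have hco : ∀ k : ℤ, fourierCoeff F k = (2 * π : ℂ)⁻¹ * ∫ t in (0 : ℝ)..(2 * π), f t *
      Complex.exp (-(Complex.I * k * t)) := by
    intro k
    rw [fourierCoeff_eq_intervalIntegral _ _ 0, zero_add, Complex.real_smul]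
    congr 1
    · push_cast; ring
    · refine intervalIntegral.integral_congr fun t _ => ?_
      simp only [hF, smul_eq_mul, fourier_coe_apply]
      rw [mul_comm]
      congr 2
      have : (π : ℂ) ≠ 0 := by exact_mod_cast pi_ne_zero
      push_cast; field_simp
  have hsum : Summable (fourierCoeff F) := by
    have := ((summable_integral_mul_exp hf hper).mul_left ‖(2 * π : ℂ)⁻¹‖)
    refine Summable.of_norm (this.congr fun k => ?_)
    rw [hco, norm_mul]
  have := has_pointwise_sum_fourier_series_of_summable hsum (θ : AddCircle (2 * π))
  rw [hF] at this
  convert this using 2 with k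
  rw [hco, smul_eq_mul, fourier_coe_apply]
  congr 2
  have : (π : ℂ) ≠ 0 := by exact_mod_cast pi_ne_zero
  push_cast; field_simp

theorem summable_coeff {H : ℝ → ℝ} (hH : ContDiff ℝ ∞ H) (hper : Function.Periodic H (2 * π))
    (c : ℕ → ℂ) (hc : ∀ k, c k = (2 * π : ℂ)⁻¹ * ∫ θ in (0 : ℝ)..(2 * π),
      (H θ : ℂ) * Complex.exp (-(Complex.I * k * θ))) : Summable fun k => ‖c k‖ := by
  have h1 : ContDiff ℝ ∞ (fun t => (H t : ℂ)) := Complex.ofRealCLM.contDiff.comp hH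
  have h2 : Function.Periodic (fun t => (H t : ℂ)) (2 * π) := fun t => by simp only [hper t]
  have := ((summable_integral_mul_exp h1 h2).mul_left ‖(2 * π : ℂ)⁻¹‖).comp_injective
    Nat.cast_injective
  refine this.congr fun k => ?_
  rw [hc, norm_mul, Function.comp]
  simp only [Int.cast_natCast]

/-- The real part of the boundary value of the holomorphic extension. -/
theorem re_coeff_sum {H : ℝ → ℝ} (hH : ContDiff ℝ ∞ H) (hper : Function.Periodic H (2 * π))
    (c : ℕ → ℂ) (hc : ∀ k, c k = (2 * π : ℂ)⁻¹ * ∫ θ in (0 : ℝ)..(2 * π),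
      (H θ : ℂ) * Complex.exp (-(Complex.I * k * θ))) (θ : ℝ) :
    (c 0 + 2 * ∑' k : ℕ, c (k + 1) * ei θ ^ (k + 1)).re = H θ := by
  have h1 : ContDiff ℝ ∞ (fun t => (H t : ℂ)) := Complex.ofRealCLM.contDiff.comp hH
  have h2 : Function.Periodic (fun t => (H t : ℂ)) (2 * π) := fun t => by simp only [hper t]
  have hs := hasSum_fourier_series h1 h2 θ
  set d : ℤ → ℂ := fun k => ((2 * π : ℂ)⁻¹ * ∫ t in (0 : ℝ)..(2 * π), (H t : ℂ) *
      Complex.exp (-(Complex.I * k * t))) * Complex.exp (Complex.I * k * θ) with hd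
  have hpos : ∀ k : ℕ, d k = c k * ei θ ^ k := by
    intro k
    simp only [hd, hc, ei, ← Complex.exp_nat_mul, Int.cast_natCast]
    congr 2; ring
  -- Since `H` is real, the terms of index `k` and `-k` are conjugate, and folding the two-sided
  -- series leaves twice a real part. The term of index `0` is counted twice in the folded sum.
  have hneg : ∀ k : ℕ, d (-k) = conj (d k) := by
    intro k
    have hint : ∫ t in (0 : ℝ)..(2 * π), (H t : ℂ) * Complex.exp (-(Complex.I * ((-k : ℤ) : ℂ) * t))
        = conj (∫ t in (0 : ℝ)..(2 * π), (H t : ℂ) *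
          Complex.exp (-(Complex.I * ((k : ℤ) : ℂ) * t))) := by
      rw [intervalIntegral.integral_of_le two_pi_pos.le, intervalIntegral.integral_of_le two_pi_pos.le,
        ← integral_conj]
      congr 1
      funext t
      simp [← Complex.exp_conj]
    simp only [hd, map_mul, hint]
    simp [← Complex.exp_conj, Complex.conj_ofNat]
  have h3 := hs.nat_add_neg
  have h4 : ∀ k : ℕ, (d k + d (-k)).re = 2 * (d k).re := fun k => by
    rw [hneg]; simp; ring
  have h5 := (Complex.reCLM.hasSum h3)
  have h6 : HasSum (fun k : ℕ => 2 * (d k).re) ((H θ : ℂ) + d 0).re := by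
    refine h5.congr_fun ?_ |> fun h => h
    intro k; exact (h4 k).symm
  have hsc : Summable fun k : ℕ => d k := by
    have := (summable_coeff hH hper c hc)
    refine Summable.of_norm (this.congr fun k => ?_)
    rw [hpos, norm_mul, norm_pow, norm_ei, one_pow, mul_one]
  have h7 : ((H θ : ℂ) + d 0).re = 2 * (∑' k : ℕ, d k).re := by
    rw [← h6.tsum_eq, tsum_mul_left, Complex.re_tsum hsc]
  have h8 : ∑' k : ℕ, d k = d (0 : ℕ) + ∑' k : ℕ, d ((k + 1 : ℕ) : ℤ) := hsc.tsum_eq_zero_add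
  have h9 : ∑' k : ℕ, c (k + 1) * ei θ ^ (k + 1) = ∑' k : ℕ, d ((k + 1 : ℕ) : ℤ) := by
    simp only [hpos]
  have h10 : d (0 : ℕ) = c 0 := by rw [hpos]; simp
  rw [h9]
  rw [h8, h10] at h7
  have h11 : d 0 = c 0 := h10
  rw [h11] at h7
  simp only [Complex.add_re, Complex.ofReal_re, Complex.mul_re, Complex.re_ofNat,
    Complex.im_ofNat, zero_mul, sub_zero] at h7 ⊢
  linarith

end Fourier


/-! ### Circles in the projective line -/

/-- The squared Hermitian norm on `ℂ²`. -/
def nsq (v : ℂ × ℂ) : ℝ := ‖v.1‖ ^ 2 + ‖v.2‖ ^ 2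

/-- The Hermitian product on `ℂ²`, conjugate-linear in the first argument. -/
def hdot (u v : ℂ × ℂ) : ℂ := conj u.1 * v.1 + conj u.2 * v.2

/-- A vector of `ℂ²` orthogonal to `v`, of the same norm. -/
def perp (v : ℂ × ℂ) : ℂ × ℂ := (conj v.2, -conj v.1)

theorem ofReal_norm_sq (z : ℂ) : ((‖z‖ : ℂ)) ^ 2 = z * conj z := (Complex.mul_conj' z).symm

theorem ofReal_nsq (v : ℂ × ℂ) : (nsq v : ℂ) = v.1 * conj v.1 + v.2 * conj v.2 := by
  simp only [nsq]; push_cast; rw [ofReal_norm_sq, ofReal_norm_sq]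

theorem nsq_nonneg (v : ℂ × ℂ) : 0 ≤ nsq v := by unfold nsq; positivity

theorem nsq_eq_zero {v : ℂ × ℂ} : nsq v = 0 ↔ v = 0 :=
  ⟨fun h => by_contra fun hv => normSq_add_ne_zero hv h, fun h => by simp [h, nsq]⟩

theorem nsq_pos {v : ℂ × ℂ} (hv : v ≠ 0) : 0 < nsq v :=
  lt_of_le_of_ne (nsq_nonneg v) fun h => hv (nsq_eq_zero.1 h.symm)

theorem nsq_smul (c : ℂ) (v : ℂ × ℂ) : nsq (c • v) = ‖c‖ ^ 2 * nsq v := by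
  simp only [nsq, Prod.smul_fst, Prod.smul_snd, smul_eq_mul, norm_mul]; ring

theorem contDiff_nsq : ContDiff ℝ ∞ nsq := by
  unfold nsq
  exact (contDiff_fst.norm_sq ℝ).add (contDiff_snd.norm_sq ℝ)

theorem contDiff_conj : ContDiff ℝ ∞ (fun z : ℂ => conj z) := Complex.conjCLE.contDiff

theorem contDiff_hdot : ContDiff ℝ ∞ fun p : (ℂ × ℂ) × (ℂ × ℂ) => hdot p.1 p.2 := by
  unfold hdot
  exact ((contDiff_conj.comp (contDiff_fst.comp contDiff_fst)).mul
    (contDiff_fst.comp contDiff_snd)).add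
    ((contDiff_conj.comp (contDiff_snd.comp contDiff_fst)).mul (contDiff_snd.comp contDiff_snd))

/-- The vector `q A + m w A'` with `A' = perp A`. -/
def circVec (A : ℂ × ℂ) (q m : ℝ) (w : ℂ) : ℂ × ℂ := (q : ℂ) • A + (m * w : ℂ) • perp A

/-- The vector `q conj w A + m A'` with `A' = perp A`; it represents the point which is inverse to
that of `circVec A q m w` with respect to the circle of all `circVec A q m ζ`, `|ζ| = 1`. -/
def reflVec (A : ℂ × ℂ) (q m : ℝ) (w : ℂ) : ℂ × ℂ := (q * conj w : ℂ) • A + (m : ℂ) • perp A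

section

variable (A : ℂ × ℂ) (q m : ℝ) (w : ℂ)

theorem nsq_circVec : nsq (circVec A q m w) = nsq A * (q ^ 2 + m ^ 2 * ‖w‖ ^ 2) := by
  apply Complex.ofReal_injective
  rw [ofReal_nsq]; push_cast; rw [ofReal_nsq, ofReal_norm_sq]
  simp [circVec, perp]; ring

theorem nsq_reflVec : nsq (reflVec A q m w) = nsq A * (q ^ 2 * ‖w‖ ^ 2 + m ^ 2) := by
  apply Complex.ofReal_injective
  rw [ofReal_nsq]; push_cast; rw [ofReal_nsq, ofReal_norm_sq]
  simp [reflVec, perp]; ring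

theorem hdot_reflVec_circVec :
    hdot (reflVec A q m w) (circVec A q m w) = (q ^ 2 + m ^ 2) * w * nsq A := by
  rw [ofReal_nsq]
  simp [reflVec, circVec, hdot, perp]; ring

/-- For `|w| < 1` the points `T + ζ V` with `T = circVec A q m w`, `V = reflVec A q m w` run through
the circle of `A`, reparametrized by the disk automorphism that takes `0` to `w`. In this way the
circle is encoded by the pair `(T, V)`. -/
theorem circVec_add_smul_reflVec {ζ : ℂ} (h : 1 + conj w * ζ ≠ 0) :
    circVec A q m w + ζ • reflVec A q m w =
      (1 + conj w * ζ) • circVec A q m ((ζ + w) / (1 + conj w * ζ)) := by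
  have : circVec A q m ((ζ + w) / (1 + conj w * ζ))
      = (1 + conj w * ζ)⁻¹ • (circVec A q m w + ζ • reflVec A q m w) := by
    have hD := inv_mul_cancel₀ h
    apply Prod.ext <;> simp only [circVec, reflVec, Prod.fst_add, Prod.snd_add, Prod.smul_fst,
      Prod.smul_snd, smul_eq_mul, div_eq_mul_inv]
    · linear_combination -(q * A.1) * hD
    · linear_combination -(q * A.2) * hD
  rw [this, smul_inv_smul₀ h]

theorem reflVec_eq_smul (hw : ‖w‖ = 1) : reflVec A q m w = conj w • circVec A q m w := by
  have h : conj w * w = 1 := by rw [Complex.conj_mul', hw]; simp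
  apply Prod.ext <;> simp only [circVec, reflVec, Prod.fst_add, Prod.snd_add, Prod.smul_fst,
    Prod.smul_snd, smul_eq_mul]
  · linear_combination -(m * (perp A).1) * h
  · linear_combination -(m * (perp A).2) * h

variable {A q m w}

theorem circVec_ne_zero (hA : A ≠ 0) (hqm : q ^ 2 + m ^ 2 = 1) (hw : ‖w‖ = 1) :
    circVec A q m w ≠ 0 := by
  intro h
  have := nsq_eq_zero.2 h
  rw [nsq_circVec, hw] at this
  simp [hqm, (nsq_pos hA).ne'] at this

end

theorem norm_mobius {ζ w : ℂ} (hζ : ‖ζ‖ = 1) (hw : ‖w‖ < 1) :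
    ‖(ζ + w) / (1 + conj w * ζ)‖ = 1 := by
  have h := one_add_conj_mul_ne_zero hw hζ
  rw [norm_div, div_eq_one_iff_eq (norm_ne_zero_iff.2 h)]
  have h2 : ζ + w = ζ * conj (1 + conj w * ζ) := by
    have : ζ * conj ζ = 1 := by rw [Complex.mul_conj', hζ]; simp
    simp only [map_add, map_one, map_mul, Complex.conj_conj]
    linear_combination -w * this
  rw [h2, norm_mul, hζ, one_mul, Complex.norm_conj]

/-! ### The Schwarz integral of a pair of vectors -/

/-- A pair `(T, V)` such that the circle of all `T + ζ V`, `|ζ| = 1`, misses the origin. -/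
def GoodPair (p : (ℂ × ℂ) × (ℂ × ℂ)) : Prop := ∀ θ : ℝ, p.1 + ei θ • p.2 ≠ 0

/-- The integrand of the Schwarz integral. -/
def schwarzIntegrand (h : S2 → ℝ) (p : (ℂ × ℂ) × (ℂ × ℂ)) (θ : ℝ) : ℂ :=
  (liftS h (p.1 + ei θ • p.2) : ℂ) *
    (1 + 2 * Complex.I * (((conj (ei θ) * hdot p.2 p.1).im / nsq (p.1 + ei θ • p.2) : ℝ) : ℂ))

/-- The Schwarz integral of `h` over the circle of all `T + ζ V`, normalized at the point `T`. -/
def schwarz (h : S2 → ℝ) (p : (ℂ × ℂ) × (ℂ × ℂ)) : ℂ :=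
  (2 * Real.pi : ℂ)⁻¹ * ∫ θ in (0 : ℝ)..(2 * Real.pi), schwarzIntegrand h p θ

/-- The mean value of `h` over the circle of all `T + ζ V`, `|ζ| = 1`. -/
def meanS (h : S2 → ℝ) (p : (ℂ × ℂ) × (ℂ × ℂ)) : ℝ :=
  (2 * Real.pi)⁻¹ * ∫ θ in (0 : ℝ)..(2 * Real.pi), liftS h (p.1 + ei θ • p.2)

/-- A common factor cancels because the integrand is homogeneous of degree zero, and a relative
phase is a shift of `θ`. This invariance allows a rescaling of `T` to be traded for one of `V` when
`twist` is inverted. -/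
theorem schwarz_smul (h : S2 → ℝ) (p : (ℂ × ℂ) × (ℂ × ℂ)) {u v : ℂ} (huv : ‖u‖ = ‖v‖)
    (hu : u ≠ 0) : schwarz h (u • p.1, v • p.2) = schwarz h p := by
  have hvu : ‖v / u‖ = 1 := by rw [norm_div, ← huv, div_self (norm_ne_zero_iff.2 hu)]
  obtain ⟨α, hα⟩ := exists_ei_eq hvu
  have hei : ∀ θ, ei (θ + α) = ei θ * (v / u) := fun θ => by
    rw [← hα]; simp [ei, mul_add, Complex.exp_add]
  have hint : ∀ θ, schwarzIntegrand h (u • p.1, v • p.2) θ = schwarzIntegrand h p (θ + α) := by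
    intro θ
    have h1 : u • p.1 + ei θ • v • p.2 = u • (p.1 + ei (θ + α) • p.2) := by
      rw [hei, smul_add, smul_smul, smul_smul]
      congr 2
      field_simp
    have h2 : conj (ei θ) * hdot (v • p.2) (u • p.1) =
        ((‖u‖ ^ 2 : ℝ) : ℂ) * (conj (ei (θ + α)) * hdot p.2 p.1) := by
      rw [hei]
      push_cast
      rw [ofReal_norm_sq]
      have hcu : conj u ≠ 0 := by simpa using hu
      simp only [hdot, Prod.smul_fst, Prod.smul_snd, smul_eq_mul, map_mul, map_div₀]
      field_simp
    have h3 : ‖u‖ ^ 2 ≠ 0 := pow_ne_zero 2 (norm_ne_zero_iff.2 hu)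
    simp only [schwarzIntegrand]
    rw [h1, h2, liftS_smul h hu, nsq_smul, Complex.im_ofReal_mul, mul_div_mul_left _ _ h3]
  have hper : Function.Periodic (schwarzIntegrand h p) (2 * Real.pi) := fun θ => by
    simp only [schwarzIntegrand, ei_add_two_pi]
  simp only [schwarz, hint]
  rw [intervalIntegral.integral_comp_add_right, zero_add, add_comm (2 * Real.pi) α,
    hper.intervalIntegral_add_eq α 0, zero_add]

theorem isOpen_goodPair : IsOpen {p | GoodPair p} := by
  have h : {p | GoodPair p} = {p : (ℂ × ℂ) × (ℂ × ℂ) |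
      ∀ z ∈ Metric.sphere (0 : ℂ) 1, p.1 + z • p.2 ≠ 0} := by
    ext p
    constructor
    · intro hp z hz
      obtain ⟨θ, rfl⟩ := exists_ei_eq (mem_sphere_zero_iff_norm.1 hz)
      exact hp θ
    · intro hp θ
      exact hp _ (by simp [norm_ei])
  rw [h, isOpen_iff_mem_nhds]
  intro p hp
  have := (isCompact_sphere (0 : ℂ) 1).eventually_forall_of_forall_eventually (x₀ := p)
    (P := fun p z => p.1 + z • p.2 ≠ 0) fun z hz => by
      have hc : Continuous fun x : ((ℂ × ℂ) × (ℂ × ℂ)) × ℂ => x.1.1 + x.2 • x.1.2 := by fun_prop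
      exact hc.continuousAt.eventually_ne (hp z hz)
  exact this

theorem contDiffOn_schwarzIntegrand {h : S2 → ℝ} (hh : ContMDiff (𝓡 2) 𝓘(ℝ, ℝ) ∞ h) :
    ContDiffOn ℝ ∞ (fun x : ((ℂ × ℂ) × (ℂ × ℂ)) × ℝ => schwarzIntegrand h x.1 x.2)
      ({p | GoodPair p} ×ˢ Set.univ) := by
  rintro ⟨p, θ⟩ ⟨hp, -⟩
  apply ContDiffAt.contDiffWithinAt
  have hv : ContDiff ℝ ∞ fun x : ((ℂ × ℂ) × (ℂ × ℂ)) × ℝ => x.1.1 + ei x.2 • x.1.2 :=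
    (contDiff_fst.comp contDiff_fst).add
      ((contDiff_ei.comp contDiff_snd).smul (contDiff_snd.comp contDiff_fst))
  have h1 : ContDiffAt ℝ ∞ (fun x : ((ℂ × ℂ) × (ℂ × ℂ)) × ℝ =>
      (liftS h (x.1.1 + ei x.2 • x.1.2) : ℂ)) (p, θ) :=
    Complex.ofRealCLM.contDiff.contDiffAt.comp _
      (ContDiffAt.comp (g := liftS h) _ (contDiffAt_liftS hh (hp θ)) hv.contDiffAt)
  have h2 : ContDiff ℝ ∞ fun x : ((ℂ × ℂ) × (ℂ × ℂ)) × ℝ =>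
      (conj (ei x.2) * hdot x.1.2 x.1.1).im := by
    have := contDiff_hdot.comp ((contDiff_snd.comp contDiff_fst).prodMk
      (contDiff_fst.comp contDiff_fst) : ContDiff ℝ ∞
        fun x : ((ℂ × ℂ) × (ℂ × ℂ)) × ℝ => (x.1.2, x.1.1))
    exact Complex.imCLM.contDiff.comp (((contDiff_conj.comp contDiff_ei).comp contDiff_snd).mul this)
  have h3 : ContDiffAt ℝ ∞ (fun x : ((ℂ × ℂ) × (ℂ × ℂ)) × ℝ =>
      (conj (ei x.2) * hdot x.1.2 x.1.1).im / nsq (x.1.1 + ei x.2 • x.1.2)) (p, θ) :=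
    h2.contDiffAt.div (contDiff_nsq.comp hv).contDiffAt (nsq_pos (hp θ)).ne'
  exact h1.mul (contDiffAt_const.add (contDiffAt_const.mul
    (Complex.ofRealCLM.contDiff.contDiffAt.comp _ h3)))

theorem contDiffOn_schwarz {h : S2 → ℝ} (hh : ContMDiff (𝓡 2) 𝓘(ℝ, ℝ) ∞ h) :
    ContDiffOn ℝ ∞ (schwarz h) {p | GoodPair p} := by
  have h1 : ContDiffOn ℝ ∞ (fun p : (ℂ × ℂ) × (ℂ × ℂ) => ∫ θ in (0 : ℝ)..(2 * Real.pi),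
      schwarzIntegrand h p θ) {p | GoodPair p} :=
    contDiffOn_intervalIntegral_param
      (f := fun x : ((ℂ × ℂ) × (ℂ × ℂ)) × ℝ => schwarzIntegrand h x.1 x.2) isOpen_goodPair
      (contDiffOn_schwarzIntegrand hh)
  unfold schwarz
  exact (contDiff_const.contDiffOn (s := {p | GoodPair p})).mul h1

/-- Parametrized from the point `T`, the kernel has real part `1`, so the real part of the integral
is a plain average. -/
theorem re_schwarz {h : S2 → ℝ} (hh : ContMDiff (𝓡 2) 𝓘(ℝ, ℝ) ∞ h) {p : (ℂ × ℂ) × (ℂ × ℂ)}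
    (hp : GoodPair p) : (schwarz h p).re = meanS h p := by
  have hp' : Continuous fun θ : ℝ => (p, θ) := Continuous.prodMk_right p
  have hm : ∀ θ : ℝ, (p, θ) ∈ {p | GoodPair p} ×ˢ (Set.univ : Set ℝ) :=
    fun θ => Set.mk_mem_prod hp (Set.mem_univ θ)
  have hco := (contDiffOn_schwarzIntegrand hh).continuousOn
  have hc := hco.comp_continuous hp' hm
  have h1 := Complex.reCLM.intervalIntegral_comp_comm
    (μ := MeasureTheory.volume) (hc.intervalIntegrable 0 (2 * Real.pi))
  simp only [Complex.reCLM_apply, Function.comp] at h1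
  have h2 : ((2 * Real.pi : ℂ)⁻¹) = (((2 * Real.pi)⁻¹ : ℝ) : ℂ) := by push_cast; rfl
  rw [schwarz, h2, Complex.re_ofReal_mul, ← h1, meanS]
  congr 1
  refine intervalIntegral.integral_congr fun θ _ => ?_
  simp [schwarzIntegrand]

/-! ### The disks in terms of pairs of vectors -/

/-- The spinor `(a, b)` of a point of the sphere. -/
def spinV (y : S2) : ℂ × ℂ := (spinA y, spinB y)

/-- The vector `(z₀, z₁)` of a point of the disk, up to a factor. -/
def topV (ξ : S2 × S2) (w : ℂ) : ℂ × ℂ := circVec (spinV ξ.2) (radQ ξ.1) (radM ξ.1) w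

/-- The vector `(conj z₃, conj z₂)` of a point of the disk. -/
def botV (ξ : S2 × S2) (w : ℂ) : ℂ × ℂ := reflVec (spinV ξ.2) (radQ ξ.1) (radM ξ.1) w

theorem topV_eq (ξ : S2 × S2) (w : ℂ) : topV ξ w = (top0 ξ w, top1 ξ w) := by
  apply Prod.ext <;> simp [topV, circVec, spinV, perp, top0, top1] <;> ring

theorem botV_eq (ξ : S2 × S2) (w : ℂ) : botV ξ w = (conj (bot1 ξ w), conj (bot0 ξ w)) := by
  apply Prod.ext <;> simp [botV, reflVec, spinV, perp, bot0, bot1] <;> ring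

theorem spinV_ne_zero (y : S2) : spinV y ≠ 0 := by
  unfold spinV spinA spinB
  intro h
  have h1 := congrArg Prod.fst h
  have h2 := congrArg Prod.snd h
  split_ifs at h1 h2 <;> simp_all

theorem sphere_sum_sq (x : S2) : x.1 0 ^ 2 + x.1 1 ^ 2 + x.1 2 ^ 2 = 1 := by
  have h := mem_sphere_zero_iff_norm.1 x.2
  have h2 := EuclideanSpace.norm_sq_eq x.1
  rw [h] at h2
  simp [Fin.sum_univ_three] at h2
  linarith

theorem radQ_sq (x : S2) : radQ x ^ 2 = (1 + x.1 2) / 2 := by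
  have := sphere_sum_sq x
  exact Real.sq_sqrt (by nlinarith [sq_nonneg (x.1 0), sq_nonneg (x.1 1)])

theorem radM_sq (x : S2) : radM x ^ 2 = (1 - x.1 2) / 2 := by
  have := sphere_sum_sq x
  exact Real.sq_sqrt (by nlinarith [sq_nonneg (x.1 0), sq_nonneg (x.1 1)])

theorem radQ_nonneg (x : S2) : 0 ≤ radQ x := Real.sqrt_nonneg _

theorem radM_nonneg (x : S2) : 0 ≤ radM x := Real.sqrt_nonneg _

theorem radQ_sq_add_radM_sq (x : S2) : radQ x ^ 2 + radM x ^ 2 = 1 := by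
  rw [radQ_sq, radM_sq]; ring

theorem norm_phase (x : S2) : ‖phase x‖ = 1 := by
  unfold phase
  split_ifs with h
  · simp
  · rw [norm_div, Complex.norm_real, norm_norm, div_self (norm_ne_zero_iff.2 h)]

theorem goodPair_disk (ξ : S2 × S2) {w : ℂ} (hw : ‖w‖ < 1) : GoodPair (topV ξ w, botV ξ w) := by
  intro θ
  have hne := one_add_conj_mul_ne_zero hw (norm_ei θ)
  simp only [topV, botV]
  rw [circVec_add_smul_reflVec _ _ _ _ hne]
  exact smul_ne_zero hne (circVec_ne_zero (spinV_ne_zero _) (radQ_sq_add_radM_sq _)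
    (norm_mobius (norm_ei θ) hw))

theorem topV_ne_zero (ξ : S2 × S2) {w : ℂ} (hw : ‖w‖ = 1) : topV ξ w ≠ 0 :=
  circVec_ne_zero (spinV_ne_zero _) (radQ_sq_add_radM_sq _) hw

theorem boundaryH_eq (h : S2 → ℝ) (ξ : S2 × S2) (θ : ℝ) :
    boundaryH h ξ θ = liftS h (topV ξ (ei θ)) := by
  rw [topV_eq]; rfl

theorem contDiff_topV_ei (ξ : S2 × S2) : ContDiff ℝ ∞ fun θ => topV ξ (ei θ) := by
  unfold topV circVec
  exact contDiff_const.add ((contDiff_const.mul contDiff_ei).smul contDiff_const)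

theorem contDiff_boundaryH {h : S2 → ℝ} (hh : ContMDiff (𝓡 2) 𝓘(ℝ, ℝ) ∞ h) (ξ : S2 × S2) :
    ContDiff ℝ ∞ (boundaryH h ξ) := by
  rw [show boundaryH h ξ = _ from funext (boundaryH_eq h ξ), contDiff_iff_contDiffAt]
  intro θ
  exact ContDiffAt.comp (g := liftS h) θ (contDiffAt_liftS hh (topV_ne_zero ξ (norm_ei θ)))
    (contDiff_topV_ei ξ).contDiffAt

theorem boundaryH_periodic (h : S2 → ℝ) (ξ : S2 × S2) :
    Function.Periodic (boundaryH h ξ) (2 * Real.pi) := fun θ => by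
  rw [boundaryH_eq, boundaryH_eq, ei_add_two_pi]

/-- The automorphism taking `0` to `w` multiplies the measure by the Poisson factor. Poisson factor
times Schwarz kernel becomes `1 + 2 i Im (conj ζ w) / |1 + conj w ζ|²`. Both `w` and the denominator
can be read off the pair: `hdot V T = w ‖A‖²` and `‖T + ζ V‖² = |1 + conj w ζ|² ‖A‖²`. So `E` no
longer refers to `ξ` and `w` separately. -/
theorem factorE_eq_exp_schwarz {h : S2 → ℝ} (hh : ContMDiff (𝓡 2) 𝓘(ℝ, ℝ) ∞ h) (ξ : S2 × S2)
    {w : ℂ} (hw : ‖w‖ < 1) :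
    factorE h ξ w = Complex.exp (schwarz h (topV ξ w, botV ξ w)) := by
  have hHc := (contDiff_boundaryH hh ξ).continuous
  rw [factorE, schwarz_integral hHc hw (coeffH h ξ) fun k => rfl]
  congr 1
  have hne : ∀ φ, ei φ - w ≠ 0 := fun φ h0 => by
    rw [← sub_eq_zero.1 h0, norm_ei] at hw
    exact lt_irrefl _ hw
  have hcv := integral_circle_mobius (F := ℂ)
    (fun v => (liftS h (topV ξ v) : ℂ) * ((v + w) / (v - w))) (by
      simp only [← boundaryH_eq]
      exact (Complex.continuous_ofReal.comp hHc).mul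
        ((continuous_ei.add continuous_const).div (continuous_ei.sub continuous_const) hne)) hw
  simp only [boundaryH_eq]
  rw [schwarz, ← hcv]
  congr 1
  refine intervalIntegral.integral_congr fun θ _ => ?_
  have hζ := norm_ei θ
  have hζ' := ei_mul_conj θ
  have h0 := one_add_conj_mul_ne_zero hw hζ
  have hqm := radQ_sq_add_radM_sq ξ.1
  have hA := (nsq_pos (spinV_ne_zero ξ.2)).ne'
  have hlift : liftS h (topV ξ w + ei θ • botV ξ w)
      = liftS h (topV ξ ((ei θ + w) / (1 + conj w * ei θ))) := by
    simp only [topV, botV]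
    rw [circVec_add_smul_reflVec _ _ _ _ h0, liftS_smul h h0]
  have hn : nsq (topV ξ w + ei θ • botV ξ w) = ‖1 + conj w * ei θ‖ ^ 2 * nsq (spinV ξ.2) := by
    simp only [topV, botV]
    rw [circVec_add_smul_reflVec _ _ _ _ h0, nsq_smul, nsq_circVec, norm_mobius hζ hw]
    simp [hqm]
  have hd : hdot (botV ξ w) (topV ξ w) = w * nsq (spinV ξ.2) := by
    simp only [topV, botV]
    rw [hdot_reflVec_circVec, show ((radQ ξ.1 : ℂ) ^ 2 + (radM ξ.1 : ℂ) ^ 2) = 1 by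
      exact_mod_cast hqm, one_mul]
  simp only [schwarzIntegrand]
  rw [hlift, hn, hd, Complex.real_smul, ← mul_assoc (conj (ei θ)), Complex.im_mul_ofReal,
    mul_div_mul_right _ _ hA, mul_left_comm]
  congr 1
  have hN : ((‖1 + conj w * ei θ‖ ^ 2 : ℝ) : ℂ) = (1 + conj w * ei θ) * (1 + w * conj (ei θ)) := by
    push_cast; rw [ofReal_norm_sq]; simp
  have hN0 : (1 + conj w * ei θ) * (1 + w * conj (ei θ)) ≠ 0 := by
    rw [← hN]
    exact_mod_cast pow_ne_zero 2 (norm_ne_zero_iff.2 h0)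
  have hw2 : ((‖w‖ ^ 2 : ℝ) : ℂ) = w * conj w := by push_cast; rw [ofReal_norm_sq]
  have him : (2 * Complex.I * ((conj (ei θ) * w).im : ℂ)) = conj (ei θ) * w - ei θ * conj w := by
    have := Complex.sub_conj (conj (ei θ) * w)
    simp only [map_mul, Complex.conj_conj] at this
    rw [this]; push_cast; ring
  have hwlt : (1 - w * conj w) ≠ 0 := by
    rw [← hw2]
    have : 1 - ‖w‖ ^ 2 ≠ 0 := by nlinarith [norm_nonneg w]
    exact_mod_cast this
  have hfrac : ((ei θ + w) / (1 + conj w * ei θ) + w) / ((ei θ + w) / (1 + conj w * ei θ) - w)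
      = (ei θ + w + w * (1 + conj w * ei θ)) / (ei θ * (1 - w * conj w)) := by
    have : (ei θ + w) / (1 + conj w * ei θ) - w
        = (ei θ * (1 - w * conj w)) / (1 + conj w * ei θ) := by
      rw [div_sub' h0]; ring
    rw [this, div_add' _ _ _ h0, div_div_div_cancel_right₀ h0]
  have hrhs : 1 + 2 * Complex.I * (((conj (ei θ) * w).im : ℂ) /
      ((‖1 + conj w * ei θ‖ ^ 2 : ℝ) : ℂ)) = ((1 + conj w * ei θ) * (1 + w * conj (ei θ)) +
        (conj (ei θ) * w - ei θ * conj w)) / ((1 + conj w * ei θ) * (1 + w * conj (ei θ))) := by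
    rw [hN, ← him, add_div, div_self hN0, mul_div_assoc]
  have he := ei_ne_zero θ
  rw [Complex.ofReal_div, Complex.ofReal_div, hrhs, hN, Complex.ofReal_sub, hw2,
    Complex.ofReal_one, hfrac, div_mul_div_comm, div_eq_div_iff
      (mul_ne_zero hN0 (mul_ne_zero he hwlt)) hN0]
  linear_combination (-2 * w - w * conj w * ei θ) * ((1 + conj w * ei θ) *
    (1 + w * conj (ei θ))) * (1 - w * conj w) * hζ'


/-! ### Homogeneous coordinates -/

/-- The pair `(z₀, z₁)`. -/
def topOf (z : Fin 4 → ℂ) : ℂ × ℂ := (z 0, z 1)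

/-- The pair `(conj z₃, conj z₂)`. -/
def botOf (z : Fin 4 → ℂ) : ℂ × ℂ := (conj (z 3), conj (z 2))

/-- The vector with given `topOf` and `botOf`. -/
def vecOf (p : (ℂ × ℂ) × (ℂ × ℂ)) : Fin 4 → ℂ := ![p.1.1, p.1.2, conj p.2.2, conj p.2.1]

theorem topOf_vecOf (p : (ℂ × ℂ) × (ℂ × ℂ)) : topOf (vecOf p) = p.1 := by simp [topOf, vecOf]

theorem botOf_vecOf (p : (ℂ × ℂ) × (ℂ × ℂ)) : botOf (vecOf p) = p.2 := by simp [botOf, vecOf]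

theorem vecOf_topOf_botOf (z : Fin 4 → ℂ) : vecOf (topOf z, botOf z) = z := by
  funext i; fin_cases i <;> simp [topOf, botOf, vecOf]

theorem topOf_smul (c : ℂ) (z : Fin 4 → ℂ) : topOf (c • z) = c • topOf z := by
  simp [topOf]

theorem botOf_smul (c : ℂ) (z : Fin 4 → ℂ) : botOf (c • z) = conj c • botOf z := by
  simp [botOf]

theorem ext_topOf_botOf {z z' : Fin 4 → ℂ} (h1 : topOf z = topOf z') (h2 : botOf z = botOf z') :
    z = z' := by
  rw [← vecOf_topOf_botOf z, ← vecOf_topOf_botOf z', h1, h2]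

theorem topOf_botOf_eq_zero {z : Fin 4 → ℂ} : z = 0 ↔ topOf z = 0 ∧ botOf z = 0 := by
  constructor
  · rintro rfl; simp [topOf, botOf]
  · rintro ⟨h1, h2⟩
    exact ext_topOf_botOf (by simpa [topOf] using h1) (by simpa [botOf] using h2)

theorem contDiff_topOf : ContDiff ℝ ∞ topOf :=
  (contDiff_apply ℝ ℂ 0).prodMk (contDiff_apply ℝ ℂ 1)

theorem contDiff_botOf : ContDiff ℝ ∞ botOf :=
  (contDiff_conj.comp (contDiff_apply ℝ ℂ 3)).prodMk (contDiff_conj.comp (contDiff_apply ℝ ℂ 2))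

theorem contDiff_vecOf : ContDiff ℝ ∞ vecOf := by
  rw [contDiff_pi]
  intro i
  fin_cases i
  · exact contDiff_fst.comp contDiff_fst
  · exact contDiff_snd.comp contDiff_fst
  · exact contDiff_conj.comp (contDiff_snd.comp contDiff_snd)
  · exact contDiff_conj.comp (contDiff_fst.comp contDiff_snd)

theorem mk_eq_mk_iff_exists {z z' : Fin 4 → ℂ} (hz : z ≠ 0) (hz' : z' ≠ 0) :
    (Projectivization.mk ℂ z hz : CP3) = Projectivization.mk ℂ z' hz' ↔
      ∃ c : ℂ, c ≠ 0 ∧ z = c • z' := by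
  rw [Projectivization.mk_eq_mk_iff']
  constructor
  · rintro ⟨c, rfl⟩
    exact ⟨c, fun h => hz (by simp [h]), rfl⟩
  · rintro ⟨c, -, h⟩
    exact ⟨c, h.symm⟩

theorem mk_mem_twistorZ {z : Fin 4 → ℂ} (hz : z ≠ 0) :
    (Projectivization.mk ℂ z hz : CP3) ∈ twistorZ ↔ topOf z ≠ 0 ∧ botOf z ≠ 0 := by
  obtain ⟨c, hc, h⟩ := rep_mk z hz
  simp [twistorZ, lineLplus, lineLminus, h, hc, topOf, botOf, Prod.ext_iff]
  tauto

theorem exists_sq_div (u : ℂ) (hu : ‖u‖ = 1) : ∃ d : ℂ, ‖d‖ = 1 ∧ d * d = u := by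
  obtain ⟨d, hd⟩ := IsAlgClosed.exists_pow_nat_eq u (n := 2) two_pos
  refine ⟨d, ?_, by rw [← sq, hd]⟩
  have := congrArg norm hd
  rw [norm_pow, hu] at this
  exact (pow_eq_one_iff_of_nonneg (norm_nonneg _) two_ne_zero).1 this

theorem conj_mul_self_of_norm_eq_one {d : ℂ} (hd : ‖d‖ = 1) : conj d * d = 1 := by
  rw [Complex.conj_mul', hd]; simp

/-- Rescaling a vector by `d` multiplies the ratio of `botOf` to `topOf` by `conj d / d`, so only
the modulus of the ratio is meaningful for an arbitrary representative. Conversely a square root of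
the phase of the ratio rescales the vector to one with positive ratio. -/
theorem mk_mem_realP (h : S2 → ℝ) {z : Fin 4 → ℂ} (hz : z ≠ 0) :
    (Projectivization.mk ℂ z hz : CP3) ∈ realP h ↔ topOf z ≠ 0 ∧
      ∃ c : ℂ, botOf z = c • topOf z ∧ ‖c‖ = Real.exp (-liftS h (topOf z)) := by
  constructor
  · rintro ⟨hZ, z', hz', heq, h3, h2⟩
    have hZ' := (mk_mem_twistorZ hz).1 hZ
    obtain ⟨c, hc, rfl⟩ := (mk_eq_mk_iff_exists hz' hz).1 heq
    have hcc : conj c ≠ 0 := by simpa using hc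
    refine ⟨hZ'.1, c / conj c * Real.exp (-liftS h (topOf z)), ?_, ?_⟩
    · have hl : liftS h (topOf z) = h (spherePoint ((c • z) 0) ((c • z) 1)) := by
        rw [← liftS_smul h hc, ← topOf_smul]; rfl
      rw [← hl] at h2 h3
      have h3' := congrArg conj h3
      have h2' := congrArg conj h2
      simp only [map_mul, Complex.conj_conj, Complex.conj_ofReal, Pi.smul_apply, smul_eq_mul] at h3' h2'
      have e3 : conj (z 3) = (conj c)⁻¹ * (c * z 0 * Real.exp (-liftS h (topOf z))) := by
        rw [← h3', inv_mul_cancel_left₀ hcc]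
      have e2 : conj (z 2) = (conj c)⁻¹ * (c * z 1 * Real.exp (-liftS h (topOf z))) := by
        rw [← h2', inv_mul_cancel_left₀ hcc]
      apply Prod.ext
      · change conj (z 3) = _ * z 0
        rw [e3, div_eq_mul_inv]; ring
      · change conj (z 2) = _ * z 1
        rw [e2, div_eq_mul_inv]; ring
    · rw [norm_mul, norm_div, Complex.norm_conj, div_self (norm_ne_zero_iff.2 hc), one_mul,
        Complex.norm_real, Real.norm_eq_abs, Real.abs_exp]
  · rintro ⟨ht, c, hb, hc⟩
    have hc0 : c ≠ 0 := norm_ne_zero_iff.1 (by rw [hc]; exact (Real.exp_pos _).ne')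
    obtain ⟨d, hd, hdd⟩ := exists_sq_div (c / ‖c‖) (by
      rw [norm_div, Complex.norm_real, norm_norm, div_self (norm_ne_zero_iff.2 hc0)])
    have hd0 : d ≠ 0 := norm_ne_zero_iff.1 (by rw [hd]; exact one_ne_zero)
    refine ⟨(mk_mem_twistorZ hz).2 ⟨ht, by rw [hb]; exact smul_ne_zero hc0 ht⟩, d • z,
      smul_ne_zero hd0 hz, (mk_eq_mk_iff_exists _ _).2 ⟨d, hd0, rfl⟩, ?_⟩
    have hl : liftS h (topOf z) = h (spherePoint ((d • z) 0) ((d • z) 1)) := by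
      rw [← liftS_smul h hd0, ← topOf_smul]; rfl
    rw [← hl, ← hc]
    have hcn : (‖c‖ : ℂ) ≠ 0 := by exact_mod_cast norm_ne_zero_iff.2 hc0
    have hdc : c = d * d * ‖c‖ := by rw [hdd, div_mul_cancel₀ _ hcn]
    have hd1 := conj_mul_self_of_norm_eq_one hd
    have key : conj d * c = d * ‖c‖ := by
      rw [hdc]
      simp only [norm_mul, hd, one_mul, Complex.norm_real, norm_norm]
      linear_combination d * ‖c‖ * hd1
    have h3 : conj (z 3) = c * z 0 := congrArg Prod.fst hb
    have h2 : conj (z 2) = c * z 1 := congrArg Prod.snd hb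
    constructor
    · apply (starRingEnd ℂ).injective
      simp only [Pi.smul_apply, smul_eq_mul, map_mul, Complex.conj_conj, Complex.conj_ofReal, h3]
      linear_combination z 0 * key
    · apply (starRingEnd ℂ).injective
      simp only [Pi.smul_apply, smul_eq_mul, map_mul, Complex.conj_conj, Complex.conj_ofReal, h2]
      linear_combination z 1 * key

theorem continuousOn_mk {X : Type*} [TopologicalSpace X] {f : X → Fin 4 → ℂ} {s : Set X}
    (hf : ContinuousOn f s) (h0 : ∀ x, f x ≠ 0) :
    ContinuousOn (fun x => (Projectivization.mk ℂ (f x) (h0 x) : CP3)) s := by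
  rw [continuousOn_iff_continuous_domRestrict] at hf ⊢
  exact isQuotientMap_mk'.continuous.comp (hf.subtype_mk fun x => h0 x)

/-! ### The disks -/

section Disk

variable (h : S2 → ℝ) (ξ : S2 × S2) (w : ℂ)

theorem factorE_ne_zero : factorE h ξ w ≠ 0 := Complex.exp_ne_zero _

theorem topOf_diskVec :
    topOf (diskVec h ξ w) = (-Complex.I * phase ξ.1 * factorE h ξ w) • topV ξ w := by
  rw [topV_eq]; simp [topOf, diskVec]

theorem botOf_diskVec : botOf (diskVec h ξ w) = botV ξ w := by
  rw [botV_eq]; simp [botOf, diskVec]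

theorem disk_factor_ne_zero : -Complex.I * phase ξ.1 * factorE h ξ w ≠ 0 :=
  mul_ne_zero (mul_ne_zero (by simp) (phase_ne_zero _)) (factorE_ne_zero _ _ _)

variable {h}

theorem continuousOn_exponent (hh : ContMDiff (𝓡 2) 𝓘(ℝ, ℝ) ∞ h) :
    ContinuousOn (fun w => coeffH h ξ 0 + 2 * ∑' k : ℕ, coeffH h ξ (k + 1) * w ^ (k + 1))
      (Metric.closedBall 0 1) := by
  have hs := summable_coeff (contDiff_boundaryH hh ξ) (boundaryH_periodic h ξ) (coeffH h ξ)
    fun k => rfl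
  have h1 : ContinuousOn (fun w => ∑' k : ℕ, coeffH h ξ (k + 1) * w ^ (k + 1))
      (Metric.closedBall 0 1) := by
    refine continuousOn_tsum (fun k => by fun_prop) ((summable_nat_add_iff 1).2 hs) fun k w hw => ?_
    rw [norm_mul, norm_pow]
    exact mul_le_of_le_one_right (norm_nonneg _)
      (pow_le_one₀ (norm_nonneg _) (mem_closedBall_zero_iff.1 hw))
  exact continuousOn_const.add (continuousOn_const.mul h1)

theorem continuousOn_factorE (hh : ContMDiff (𝓡 2) 𝓘(ℝ, ℝ) ∞ h) :
    ContinuousOn (factorE h ξ) (Metric.closedBall 0 1) :=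
  (continuousOn_exponent ξ hh).cexp

theorem differentiableOn_factorE (hh : ContMDiff (𝓡 2) 𝓘(ℝ, ℝ) ∞ h) :
    DifferentiableOn ℂ (factorE h ξ) (Metric.ball 0 1) := by
  have hs := summable_coeff (contDiff_boundaryH hh ξ) (boundaryH_periodic h ξ) (coeffH h ξ)
    fun k => rfl
  have h1 : DifferentiableOn ℂ (fun w => ∑' k : ℕ, coeffH h ξ (k + 1) * w ^ (k + 1))
      (Metric.ball 0 1) := by
    refine Complex.differentiableOn_tsum_of_summable_norm ((summable_nat_add_iff 1).2 hs)
      (fun k => by fun_prop) Metric.isOpen_ball fun k w hw => ?_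
    rw [norm_mul, norm_pow]
    exact mul_le_of_le_one_right (norm_nonneg _)
      (pow_le_one₀ (norm_nonneg _) (mem_ball_zero_iff.1 hw).le)
  exact ((differentiableOn_const _).add ((differentiableOn_const _).mul h1)).cexp

theorem continuousOn_diskVec (hh : ContMDiff (𝓡 2) 𝓘(ℝ, ℝ) ∞ h) :
    ContinuousOn (diskVec h ξ) (Metric.closedBall 0 1) := by
  have hE := continuousOn_factorE ξ hh
  rw [continuousOn_pi]
  intro i
  fin_cases i
  · change ContinuousOn (fun w => -Complex.I * phase ξ.1 * factorE h ξ w * top0 ξ w) _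
    unfold top0; fun_prop
  · change ContinuousOn (fun w => -Complex.I * phase ξ.1 * factorE h ξ w * top1 ξ w) _
    unfold top1; fun_prop
  · change ContinuousOn (fun w => bot0 ξ w) _
    unfold bot0; fun_prop
  · change ContinuousOn (fun w => bot1 ξ w) _
    unfold bot1; fun_prop

theorem differentiableOn_diskVec (hh : ContMDiff (𝓡 2) 𝓘(ℝ, ℝ) ∞ h) :
    DifferentiableOn ℂ (diskVec h ξ) (Metric.ball 0 1) := by
  have hE := differentiableOn_factorE ξ hh
  rw [differentiableOn_pi]
  intro i
  fin_cases i
  · change DifferentiableOn ℂ (fun w => -Complex.I * phase ξ.1 * factorE h ξ w * top0 ξ w) _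
    unfold top0; fun_prop
  · change DifferentiableOn ℂ (fun w => -Complex.I * phase ξ.1 * factorE h ξ w * top1 ξ w) _
    unfold top1; fun_prop
  · change DifferentiableOn ℂ (fun w => bot0 ξ w) _
    unfold bot0; fun_prop
  · change DifferentiableOn ℂ (fun w => bot1 ξ w) _
    unfold bot1; fun_prop

theorem norm_factorE_boundary (hh : ContMDiff (𝓡 2) 𝓘(ℝ, ℝ) ∞ h) (hw : ‖w‖ = 1) :
    ‖factorE h ξ w‖ = Real.exp (liftS h (topV ξ w)) := by
  obtain ⟨θ, rfl⟩ := exists_ei_eq hw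
  rw [factorE, Complex.norm_exp, re_coeff_sum (contDiff_boundaryH hh ξ) (boundaryH_periodic h ξ)
    (coeffH h ξ) (fun k => rfl), boundaryH_eq]

theorem diskMap_mem_realP (hh : ContMDiff (𝓡 2) 𝓘(ℝ, ℝ) ∞ h) (hw : ‖w‖ = 1) :
    diskMap h ξ w ∈ realP h := by
  have hf := disk_factor_ne_zero h ξ w
  rw [diskMap, mk_mem_realP, topOf_diskVec, botOf_diskVec, liftS_smul h hf]
  refine ⟨smul_ne_zero hf (topV_ne_zero ξ hw),
    conj w / (-Complex.I * phase ξ.1 * factorE h ξ w), ?_, ?_⟩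
  · rw [smul_smul, div_mul_cancel₀ _ hf]
    exact reflVec_eq_smul _ _ _ _ hw
  · rw [norm_div, Complex.norm_conj, hw, norm_mul, norm_mul, norm_neg, Complex.norm_I, norm_phase,
      norm_factorE_boundary ξ w hh hw, Real.exp_neg]
    simp

/-- On `P_h` one has `V = c T`, so the circle shrinks to the point of `T` and the mean is `h(T)`.
Then `|c E| = 1`, and some `ζ` on the unit circle makes `E⁻¹ T + ζ V` vanish, against goodness. -/
theorem not_mem_realP_of_goodPair {z : Fin 4 → ℂ} (hz : z ≠ 0) {E : ℂ}
    (hE : ‖E‖ = Real.exp (meanS h (E⁻¹ • topOf z, botOf z)))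
    (hg : GoodPair (E⁻¹ • topOf z, botOf z)) : (Projectivization.mk ℂ z hz : CP3) ∉ realP h := by
  rw [mk_mem_realP]
  rintro ⟨ht, c, hb, hc⟩
  have hE0 : E ≠ 0 := norm_ne_zero_iff.1 (by rw [hE]; exact (Real.exp_pos _).ne')
  have hmean : meanS h (E⁻¹ • topOf z, botOf z) = liftS h (topOf z) := by
    have : ∀ θ : ℝ, liftS h (E⁻¹ • topOf z + ei θ • botOf z) = liftS h (topOf z) := by
      intro θ
      have h1 := hg θ
      simp only [hb, smul_smul, ← add_smul] at h1 ⊢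
      exact liftS_smul h (fun h0 => h1 (by rw [h0, zero_smul])) _
    simp only [meanS, this]
    rw [intervalIntegral.integral_const, sub_zero, smul_eq_mul, ← mul_assoc,
      inv_mul_cancel₀ (by positivity), one_mul]
  rw [hmean] at hE
  have hn : ‖-(c * E)⁻¹‖ = 1 := by
    rw [norm_neg, norm_inv, norm_mul, hE, hc, ← Real.exp_add]; simp
  obtain ⟨θ, hθ⟩ := exists_ei_eq hn
  apply hg θ
  have hc0 : c ≠ 0 := norm_ne_zero_iff.1 (by rw [hc]; exact (Real.exp_pos _).ne')
  simp only [hb, smul_smul, ← add_smul, hθ]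
  rw [mul_inv, show E⁻¹ + -(c⁻¹ * E⁻¹) * c = 0 by field_simp; ring, zero_smul]

theorem diskMap_not_mem_realP (hh : ContMDiff (𝓡 2) 𝓘(ℝ, ℝ) ∞ h) (hw : ‖w‖ < 1) :
    diskMap h ξ w ∉ realP h := by
  have hE0 := factorE_ne_zero h ξ w
  have hu : ‖-Complex.I * phase ξ.1‖ = ‖(1 : ℂ)‖ := by simp [norm_phase]
  have hu0 : -Complex.I * phase ξ.1 ≠ 0 := mul_ne_zero (by simp) (phase_ne_zero _)
  have e1 : (factorE h ξ w)⁻¹ • topOf (diskVec h ξ w) = (-Complex.I * phase ξ.1) • topV ξ w := by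
    rw [topOf_diskVec, smul_smul]; congr 1; field_simp
  have hg := goodPair_disk ξ hw
  have hg' : GoodPair ((-Complex.I * phase ξ.1) • topV ξ w, botV ξ w) := by
    intro θ h0
    obtain ⟨α, hα⟩ := exists_ei_eq (w := ei θ * (-Complex.I * phase ξ.1)⁻¹)
      (by rw [norm_mul, norm_inv, hu, norm_ei]; simp)
    apply hg α
    have : topV ξ w + ei α • botV ξ w = (-Complex.I * phase ξ.1)⁻¹ •
        ((-Complex.I * phase ξ.1) • topV ξ w + ei θ • botV ξ w) := by
      rw [smul_add, inv_smul_smul₀ hu0, smul_smul, hα, mul_comm (ei θ)]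
    simp only [this]
    simp only at h0
    rw [h0, smul_zero]
  refine not_mem_realP_of_goodPair (E := factorE h ξ w) _ ?_ ?_
  · rw [e1, botOf_diskVec, ← re_schwarz hh hg', factorE_eq_exp_schwarz hh ξ hw, Complex.norm_exp]
    have := schwarz_smul h (topV ξ w, botV ξ w) hu hu0
    rw [one_smul] at this
    rw [this]
  · rw [e1, botOf_diskVec]; exact hg'

/-! ### Orthogonal coordinates on `ℂ²` and injectivity of the disks -/

theorem hdot_perp (v : ℂ × ℂ) : hdot v (perp v) = 0 := by simp [hdot, perp]; ring

theorem hdot_perp_left (v : ℂ × ℂ) : hdot (perp v) v = 0 := by simp [hdot, perp]; ring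

theorem hdot_self (v : ℂ × ℂ) : hdot v v = nsq v := by
  rw [ofReal_nsq]; simp [hdot]; ring

theorem nsq_perp (v : ℂ × ℂ) : nsq (perp v) = nsq v := by simp [nsq, perp]; ring

theorem hdot_add (u v v' : ℂ × ℂ) : hdot u (v + v') = hdot u v + hdot u v' := by
  simp [hdot]; ring

theorem hdot_smul (u v : ℂ × ℂ) (c : ℂ) : hdot u (c • v) = c * hdot u v := by
  simp [hdot]; ring

theorem eq_of_perp_coords {A : ℂ × ℂ} (hA : A ≠ 0) {s t s' t' : ℂ}
    (h : s • A + t • perp A = s' • A + t' • perp A) : s = s' ∧ t = t' := by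
  have hn : (nsq A : ℂ) ≠ 0 := by exact_mod_cast (nsq_pos hA).ne'
  have h1 := congrArg (hdot A) h
  have h2 := congrArg (hdot (perp A)) h
  simp only [hdot_add, hdot_smul, hdot_perp, hdot_self, hdot_perp_left, nsq_perp, mul_zero,
    add_zero, zero_add] at h1 h2
  exact ⟨mul_right_cancel₀ hn h1, mul_right_cancel₀ hn h2⟩

/-- Needed for the fixed spheres, where the boundary circle degenerates to a point. -/
theorem factorE_eq_of_const {ξ : S2 × S2} {C : ℝ} (hC : ∀ θ, boundaryH h ξ θ = C) :
    factorE h ξ w = Complex.exp (C : ℂ) := by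
  have hk : ∀ k : ℕ, coeffH h ξ (k + 1) = 0 := by
    intro k
    have hd : ∀ t : ℝ, HasDerivAt (fun _ : ℝ => (C : ℂ)) 0 t := fun t => hasDerivAt_const t _
    have := integral_mul_exp_eq_of_hasDerivAt hd continuous_const rfl
      (k := (k + 1 : ℕ)) (by positivity)
    simp only [coeffH, hC]
    simp only [Int.cast_natCast] at this
    rw [this]; simp
  have h0 : coeffH h ξ 0 = C := by
    simp only [coeffH, hC]
    simp
    have : (Real.pi : ℂ) ≠ 0 := by exact_mod_cast Real.pi_ne_zero
    field_simp
  simp [factorE, hk, h0]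

/-- In the basis `A, perp A` the top vector is `f (q, m w)` and the bottom vector is `(q conj w,
m)`, with `f` a multiple of `E`. If `m ≠ 0`, the second bottom coordinate gives `c = 1`, the first
top coordinate gives equality of the factors when `q ≠ 0`, and then the second determines `w`. If
`q` or `m` vanishes, `E` is constant; for `m = 0` the point `w` is read off the bottom vector. -/
theorem diskMap_injOn : Set.InjOn (diskMap h ξ) (Metric.closedBall 0 1) := by
  intro w _ w' _ heq
  obtain ⟨c, hc, hz⟩ := (mk_eq_mk_iff_exists _ _).1 heq
  have ht := congrArg topOf hz
  have hb := congrArg botOf hz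
  rw [topOf_smul, topOf_diskVec, topOf_diskVec, topV, topV, circVec, circVec] at ht
  rw [botOf_smul, botOf_diskVec, botOf_diskVec, botV, botV, reflVec, reflVec] at hb
  simp only [smul_add, smul_smul] at ht hb
  obtain ⟨ht1, ht2⟩ := eq_of_perp_coords (spinV_ne_zero _) ht
  obtain ⟨hb1, hb2⟩ := eq_of_perp_coords (spinV_ne_zero _) hb
  have hqm := radQ_sq_add_radM_sq ξ.1
  have hf := disk_factor_ne_zero h ξ w
  have hf' := disk_factor_ne_zero h ξ w'
  have hE : radM ξ.1 = 0 ∨ radQ ξ.1 = 0 → factorE h ξ w = factorE h ξ w' := by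
    intro h0
    obtain ⟨C, hC⟩ : ∃ C, ∀ θ, boundaryH h ξ θ = C := by
      rcases h0 with h0 | h0
      · refine ⟨liftS h ((radQ ξ.1 : ℂ) • spinV ξ.2), fun θ => ?_⟩
        rw [boundaryH_eq, topV, circVec, h0]; simp
      · refine ⟨liftS h ((radM ξ.1 : ℂ) • perp (spinV ξ.2)), fun θ => ?_⟩
        rw [boundaryH_eq, topV, circVec, h0, mul_comm (radM ξ.1 : ℂ), mul_smul, Complex.ofReal_zero,
          zero_smul, zero_add, liftS_smul h (ei_ne_zero θ)]
    rw [factorE_eq_of_const w hC, factorE_eq_of_const w' hC]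
  by_cases hm : radM ξ.1 = 0
  · have hq : (radQ ξ.1 : ℂ) ≠ 0 := by
      intro h0
      have h0' : radQ ξ.1 = 0 := by exact_mod_cast h0
      simp [hm, h0'] at hqm
    rw [hE (Or.inl hm)] at ht1
    have hc1 : c = 1 := by
      exact mul_right_cancel₀ (mul_ne_zero hf' hq) (by rw [one_mul, ← ht1])
    rw [hc1, map_one, one_mul] at hb1
    exact (starRingEnd ℂ).injective (mul_left_cancel₀ hq hb1)
  · have hm' : (radM ξ.1 : ℂ) ≠ 0 := by exact_mod_cast hm
    have hc1 : c = 1 := by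
      have := mul_right_cancel₀ hm' (by rw [one_mul, ← hb2] : (1 : ℂ) * radM ξ.1 = conj c * radM ξ.1)
      exact (starRingEnd ℂ).injective (by rw [← this, map_one])
    rw [hc1, one_mul] at ht1 ht2
    have hEE : factorE h ξ w = factorE h ξ w' := by
      by_cases hq : radQ ξ.1 = 0
      · exact hE (Or.inr hq)
      · have hq' : (radQ ξ.1 : ℂ) ≠ 0 := by exact_mod_cast hq
        have := mul_right_cancel₀ hq' ht1
        exact mul_left_cancel₀ (mul_ne_zero (by simp) (phase_ne_zero ξ.1)) this
    rw [hEE] at ht2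
    exact mul_left_cancel₀ hm' (mul_left_cancel₀ hf' ht2)

/-! ### Holomorphy of the disks -/

theorem mdifferentiableAt_mk {f : ℂ → Fin 4 → ℂ} (h0 : ∀ x, f x ≠ 0) {x : ℂ}
    (hf : DifferentiableAt ℂ f x) : MDifferentiableAt 𝓘(ℂ, ℂ) 𝓘(ℂ, Fin 3 → ℂ)
      (fun y => (Projectivization.mk ℂ (f y) (h0 y) : CP3)) x := by
  have hc : ContinuousAt (fun y => (Projectivization.mk ℂ (f y) (h0 y) : CP3)) x :=
    isQuotientMap_mk'.continuous.continuousAt.comp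
      (f := fun y => (⟨f y, h0 y⟩ : {v : Fin 4 → ℂ // v ≠ 0}))
      (Topology.IsInducing.subtypeVal.continuousAt_iff.2 hf.continuousAt)
  rw [mdifferentiableAt_iff]
  refine ⟨hc, ?_⟩
  set p : CP3 := Projectivization.mk ℂ (f x) (h0 x) with hp
  obtain ⟨i, hi, hch⟩ : ∃ i, p.rep i ≠ 0 ∧ chartAt (Fin 3 → ℂ) p = affineChart i :=
    ⟨_, (exists_rep_ne_zero p).choose_spec, rfl⟩
  have hfi : f x i ≠ 0 := by
    obtain ⟨c, hc, hr⟩ := rep_mk (f x) (h0 x)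
    rw [hp, hr] at hi
    exact right_ne_zero_of_mul hi
  have : writtenInExtChartAt 𝓘(ℂ, ℂ) 𝓘(ℂ, Fin 3 → ℂ) x
      (fun y => (Projectivization.mk ℂ (f y) (h0 y) : CP3))
      = fun y j => f y (i.succAbove j) / f y i := by
    funext y
    simp only [writtenInExtChartAt, extChartAt, mfld_simps, Function.comp, ← hp, hch]
    exact affineCoord_mk i (f y) (h0 y)
  rw [this]
  refine DifferentiableAt.differentiableWithinAt ?_
  rw [differentiableAt_pi]
  intro j
  have hf' := differentiableAt_pi.1 hf
  exact (hf' _).div (hf' i) hfi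

theorem isHolomorphicDisk (hh : ContMDiff (𝓡 2) 𝓘(ℝ, ℝ) ∞ h) :
    IsHolomorphicDisk (realP h) (diskMap h ξ) where
  continuousOn := continuousOn_mk (continuousOn_diskVec ξ hh) _
  injOn := diskMap_injOn ξ
  holomorphic _ hw := (mdifferentiableAt_mk (diskVec_ne_zero h ξ)
    ((differentiableOn_diskVec ξ hh).differentiableAt
      (Metric.isOpen_ball.mem_nhds hw))).mdifferentiableWithinAt
  boundary w hw := diskMap_mem_realP ξ w hh (mem_sphere_zero_iff_norm.1 hw)

/-! ### Position of the disks relative to the lines `L₊` and `L₋` -/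

theorem sphere_eq_of_coord_two {x : S2} {c : ℝ} (hc : c ^ 2 = 1) (h : x.1 2 = c) :
    (x : E3) = !₂[0, 0, c] := by
  have := sphere_sum_sq x
  have h0 : x.1 0 = 0 := by
    rw [h] at this
    nlinarith [sq_nonneg (x.1 0), sq_nonneg (x.1 1)]
  have h1 : x.1 1 = 0 := by
    rw [h] at this
    nlinarith [sq_nonneg (x.1 0), sq_nonneg (x.1 1)]
  refine PiLp.ext fun i => ?_
  fin_cases i <;> simp [h0, h1, h]

theorem mem_Splus_iff : ξ ∈ Splus ↔ radM ξ.1 = 0 := by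
  rw [← pow_eq_zero_iff two_ne_zero, radM_sq]
  constructor
  · intro h
    have : ξ.1.1 2 = 1 := by rw [show (ξ.1 : E3) = _ from h]; simp
    rw [this]; norm_num
  · intro h
    exact sphere_eq_of_coord_two (by norm_num) (by linarith)

theorem mem_Sminus_iff : ξ ∈ Sminus ↔ radQ ξ.1 = 0 := by
  rw [← pow_eq_zero_iff two_ne_zero, radQ_sq]
  constructor
  · intro h
    have : ξ.1.1 2 = -1 := by rw [show (ξ.1 : E3) = _ from h]; simp
    rw [this]; norm_num
  · intro h
    exact sphere_eq_of_coord_two (by norm_num) (by linarith)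

/-- The centre `w = 0` has the pair `(q A, m perp A)` up to a factor in the top vector, so it lies
on `L₊` for `m = 0` and on `L₋` for `q = 0`. If both are positive, the norm formulas keep both
vectors away from zero for every `w`. -/
theorem not_mem_fixed_iff_disk_subset (h : S2 → ℝ) :
    ξ ∉ Splus ∪ Sminus ↔ disk h ξ ⊆ twistorZ := by
  rw [Set.mem_union, mem_Splus_iff, mem_Sminus_iff, not_or]
  have hA := nsq_pos (spinV_ne_zero ξ.2)
  constructor
  · rintro ⟨hm, hq⟩ _ ⟨w, -, rfl⟩
    rw [diskMap, mk_mem_twistorZ, topOf_diskVec, botOf_diskVec]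
    have hm2 : 0 < radM ξ.1 ^ 2 := by positivity
    have hq2 : 0 < radQ ξ.1 ^ 2 := by positivity
    constructor
    · refine smul_ne_zero (disk_factor_ne_zero _ _ _) fun h0 => ?_
      have := nsq_eq_zero.2 h0
      rw [topV, nsq_circVec] at this
      have h2 : 0 < radQ ξ.1 ^ 2 + radM ξ.1 ^ 2 * ‖w‖ ^ 2 := by positivity
      exact (mul_pos hA h2).ne' this
    · intro h0
      have := nsq_eq_zero.2 h0
      rw [botV, nsq_reflVec] at this
      have h2 : 0 < radQ ξ.1 ^ 2 * ‖w‖ ^ 2 + radM ξ.1 ^ 2 := by positivity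
      exact (mul_pos hA h2).ne' this
  · intro hD
    have h0 := hD ⟨0, by simp, rfl⟩
    rw [diskMap, mk_mem_twistorZ, topOf_diskVec, botOf_diskVec] at h0
    constructor
    · intro hm; exact h0.2 (by simp [botV, reflVec, hm])
    · intro hq; exact h0.1 (by simp [topV, circVec, hq])

end Disk


/-! ### The parametrization of good pairs by the undeformed disks -/

/-- The point `y` is recovered from its spinor; this is how `y` enters the invariants that separate
the disks. The case `y₀ = -1` is `lam = ∞`, with spinor `(0, 1)`. -/
theorem spinV_coords (y : S2) :
    ‖spinA y‖ ^ 2 - ‖spinB y‖ ^ 2 = nsq (spinV y) * y.1 0 ∧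
      2 * (conj (spinA y) * spinB y) = nsq (spinV y) * ((y.1 1 : ℂ) + Complex.I * y.1 2) := by
  have hs := sphere_sum_sq y
  by_cases h : 1 + y.1 0 = 0
  · have h0 : y.1 0 = -1 := by linarith
    rw [h0] at hs
    have h1 : y.1 1 = 0 := by nlinarith [sq_nonneg (y.1 1), sq_nonneg (y.1 2)]
    have h2 : y.1 2 = 0 := by nlinarith [sq_nonneg (y.1 1), sq_nonneg (y.1 2)]
    simp [spinV, spinA, spinB, nsq, h0, h1, h2]
  · have hb : ‖spinB y‖ ^ 2 = (1 - y.1 0) / (1 + y.1 0) := by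
      rw [spinB, if_neg h, norm_div, div_pow]
      have e1 : ‖(y.1 1 : ℂ) + Complex.I * y.1 2‖ ^ 2 = y.1 1 ^ 2 + y.1 2 ^ 2 := by
        rw [Complex.sq_norm, Complex.normSq_apply]; simp; ring
      have e2 : ‖(1 : ℂ) + y.1 0‖ ^ 2 = (1 + y.1 0) ^ 2 := by
        rw [show (1 : ℂ) + y.1 0 = ((1 + y.1 0 : ℝ) : ℂ) by push_cast; rfl, Complex.norm_real,
          Real.norm_eq_abs, sq_abs]
      rw [e1, e2]
      field_simp
      linarith
    have hn : nsq (spinV y) = 2 / (1 + y.1 0) := by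
      simp only [nsq, spinV, hb]
      simp only [spinA, if_neg h]
      field_simp
      norm_num
    constructor
    · rw [hn, hb, spinA, if_neg h]
      field_simp
      norm_num
      ring
    · have hc : (1 : ℂ) + y.1 0 ≠ 0 := by
        rw [show (1 : ℂ) + y.1 0 = ((1 + y.1 0 : ℝ) : ℂ) by push_cast; rfl]
        exact Complex.ofReal_ne_zero.2 h
      rw [hn, spinA, spinB, if_neg h, if_neg h]
      push_cast
      simp
      field_simp

theorem exists_spinV_eq_smul {u : ℂ × ℂ} (hu : u ≠ 0) :
    ∃ (y : S2) (d : ℂ), d ≠ 0 ∧ u = d • spinV y := by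
  have hN := normSq_add_ne_zero hu
  refine ⟨spherePoint u.1 u.2, ?_⟩
  have h0 : 1 + (spherePoint u.1 u.2).1 0 = 2 * ‖u.1‖ ^ 2 / (‖u.1‖ ^ 2 + ‖u.2‖ ^ 2) := by
    rw [spherePoint, dif_neg hN]; simp; field_simp; ring
  by_cases ha : u.1 = 0
  · have hb : u.2 ≠ 0 := fun hb => hu (Prod.ext ha hb)
    refine ⟨u.2, hb, ?_⟩
    have : 1 + (spherePoint u.1 u.2).1 0 = 0 := by rw [h0, ha]; simp
    apply Prod.ext <;> simp only [spinV, spinA, spinB, if_pos this] <;> simp [ha]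
  · refine ⟨u.1, ha, ?_⟩
    have hna : ‖u.1‖ ≠ 0 := norm_ne_zero_iff.2 ha
    have h1 : 1 + (spherePoint u.1 u.2).1 0 ≠ 0 := by
      rw [h0]; positivity
    apply Prod.ext <;> simp only [spinV, spinA, spinB, if_neg h1]
    · simp
    · have h2 : (1 : ℂ) + ((spherePoint u.1 u.2).1 0 : ℂ)
          = 2 * (u.1 * conj u.1) / ((‖u.1‖ ^ 2 + ‖u.2‖ ^ 2 : ℝ) : ℂ) := by
        rw [← ofReal_norm_sq, show (1 : ℂ) + ((spherePoint u.1 u.2).1 0 : ℂ)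
          = ((1 + (spherePoint u.1 u.2).1 0 : ℝ) : ℂ) by push_cast; rfl, h0]
        push_cast; rfl
      have h3 : ((spherePoint u.1 u.2).1 1 : ℂ) + Complex.I * ((spherePoint u.1 u.2).1 2 : ℂ)
          = 2 * (conj u.1 * u.2) / ((‖u.1‖ ^ 2 + ‖u.2‖ ^ 2 : ℝ) : ℂ) := by
        rw [spherePoint, dif_neg hN]
        simp only [Matrix.cons_val_one, Matrix.cons_val, Matrix.cons_val_zero]
        rw [Complex.ofReal_div, Complex.ofReal_div, Complex.ofReal_mul, Complex.ofReal_mul,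
          Complex.ofReal_ofNat, ← mul_div_assoc, ← add_div]
        congr 1
        nth_rewrite 3 [← Complex.re_add_im (conj u.1 * u.2)]
        ring
      have hc : conj u.1 ≠ 0 := by simpa using ha
      have hN' : ((‖u.1‖ ^ 2 + ‖u.2‖ ^ 2 : ℝ) : ℂ) ≠ 0 := by exact_mod_cast hN
      rw [h2, h3]
      simp only [Prod.smul_snd, smul_eq_mul]
      field_simp

theorem perp_smul (c : ℂ) (v : ℂ × ℂ) : perp (c • v) = conj c • perp v := by
  apply Prod.ext <;> simp [perp]

theorem nsq_smul_eq (A v : ℂ × ℂ) :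
    (nsq A : ℂ) • v = hdot A v • A + hdot (perp A) v • perp A := by
  rw [ofReal_nsq]
  apply Prod.ext <;> simp [hdot, perp] <;> ring

/-- In dimension two the orthogonal complement of `T ≠ 0` is spanned by `perp T`. If `T = 0`, the
spinor is taken from `perp V` instead. -/
theorem exists_orthogonal_eq_smul {T V : ℂ × ℂ} (hTV : hdot V T = 0) (h0 : ¬(T = 0 ∧ V = 0)) :
    ∃ (y : S2) (t v : ℂ), T = t • spinV y ∧ V = v • perp (spinV y) := by
  have key : ∀ {u v : ℂ × ℂ}, u ≠ 0 → hdot u v = 0 → ∃ c : ℂ, v = c • perp u := by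
    intro u v hu h
    have hn : (nsq u : ℂ) ≠ 0 := by exact_mod_cast (nsq_pos hu).ne'
    refine ⟨(nsq u : ℂ)⁻¹ * hdot (perp u) v, ?_⟩
    rw [mul_smul, eq_inv_smul_iff₀ hn, nsq_smul_eq, h, zero_smul, zero_add]
  have hsymm : hdot T V = 0 := by
    have := congrArg conj hTV
    simp [hdot] at this ⊢
    linear_combination this
  by_cases hT : T = 0
  · have hV : V ≠ 0 := fun h => h0 ⟨hT, h⟩
    have hpV : perp V ≠ 0 := fun h => hV (nsq_eq_zero.1 (by rw [← nsq_perp, h]; simp [nsq]))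
    obtain ⟨y, d, hd, hy⟩ := exists_spinV_eq_smul hpV
    refine ⟨y, 0, -conj d, by simp [hT], ?_⟩
    rw [neg_smul, ← perp_smul, ← hy]
    apply Prod.ext <;> simp [perp]
  · obtain ⟨y, d, hd, hy⟩ := exists_spinV_eq_smul hT
    obtain ⟨c, hc⟩ := key hT hsymm
    refine ⟨y, d, c * conj d, hy, ?_⟩
    rw [mul_smul, ← perp_smul, ← hy, hc]

/-- The point is `(2 q m σ, q² - m²)`. The condition on `σ` matches the convention that `phase` is
`1` at the poles. -/
theorem exists_base_point {q m : ℝ} (hq : 0 ≤ q) (hm : 0 ≤ m) (hqm : q ^ 2 + m ^ 2 = 1) {σ : ℂ}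
    (hσ : ‖σ‖ = 1) (h1 : q * m = 0 → σ = 1) :
    ∃ x : S2, radQ x = q ∧ radM x = m ∧ phase x = σ := by
  have hσ2 : σ.re ^ 2 + σ.im ^ 2 = 1 := by
    have := Complex.sq_norm σ
    rw [hσ, Complex.normSq_apply] at this
    linarith
  let x : S2 := ⟨!₂[2 * q * m * σ.re, 2 * q * m * σ.im, q ^ 2 - m ^ 2], by
    rw [mem_sphere_zero_iff_norm, EuclideanSpace.norm_eq, Real.sqrt_eq_one]
    simp only [Fin.sum_univ_three, Real.norm_eq_abs, sq_abs, Matrix.cons_val_zero,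
      Matrix.cons_val_one, Matrix.cons_val]
    have : (q ^ 2 + m ^ 2) ^ 2 = 1 := by rw [hqm]; norm_num
    linear_combination this + (2 * q * m) ^ 2 * hσ2⟩
  have h2 : x.1 2 = q ^ 2 - m ^ 2 := rfl
  refine ⟨x, ?_, ?_, ?_⟩
  · rw [radQ, h2, show (1 + (q ^ 2 - m ^ 2)) / 2 = q ^ 2 by linarith, Real.sqrt_sq hq]
  · rw [radM, h2, show (1 - (q ^ 2 - m ^ 2)) / 2 = m ^ 2 by linarith, Real.sqrt_sq hm]
  · have h3 : (x.1 0 : ℂ) + Complex.I * (x.1 1 : ℂ) = ((2 * q * m : ℝ) : ℂ) * σ := by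
      have e0 : x.1 0 = 2 * q * m * σ.re := rfl
      have e1 : x.1 1 = 2 * q * m * σ.im := rfl
      rw [e0, e1]; push_cast
      linear_combination (2 * q * m : ℂ) * Complex.re_add_im σ
    have hσ0 : σ ≠ 0 := norm_ne_zero_iff.1 (by rw [hσ]; exact one_ne_zero)
    by_cases hz : q * m = 0
    · rw [phase, if_pos, h1 hz]
      rw [h3, show 2 * q * m = 2 * (q * m) by ring, hz]; simp
    · have hp : 0 < 2 * q * m := by
        have : 0 < q * m := lt_of_le_of_ne (mul_nonneg hq hm) (Ne.symm hz)
        linarith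
      have hp' : ((2 * q * m : ℝ) : ℂ) ≠ 0 := by exact_mod_cast hp.ne'
      rw [phase, if_neg, h3, norm_mul, hσ, mul_one, Complex.norm_real, Real.norm_of_nonneg hp.le,
        mul_div_cancel_left₀ _ hp']
      rw [h3]; exact mul_ne_zero hp' hσ0

theorem nsq_add_smul (p : (ℂ × ℂ) × (ℂ × ℂ)) (θ : ℝ) :
    nsq (p.1 + ei θ • p.2) = nsq p.1 + nsq p.2 + 2 * (conj (ei θ) * hdot p.2 p.1).re := by
  have h := ei_mul_conj θ
  apply Complex.ofReal_injective
  push_cast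
  rw [ofReal_nsq, ofReal_nsq, ofReal_nsq, Complex.re_eq_add_conj]
  simp only [hdot, Prod.fst_add, Prod.snd_add, Prod.smul_fst, Prod.smul_snd, smul_eq_mul, map_add,
    map_mul, Complex.conj_conj]
  linear_combination (p.2.1 * conj p.2.1 + p.2.2 * conj p.2.2) * h

/-- Positivity of `‖T + ζ V‖²` at the `ζ` for which the mixed term is most negative. The strict
inequality makes the discriminant in `exists_disk_of_goodPair` positive. -/
theorem GoodPair.two_mul_norm_hdot_lt {p : (ℂ × ℂ) × (ℂ × ℂ)} (hp : GoodPair p) :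
    2 * ‖hdot p.2 p.1‖ < nsq p.1 + nsq p.2 := by
  set s := hdot p.2 p.1 with hs
  obtain ⟨θ, hθ⟩ : ∃ θ : ℝ, conj (ei θ) * s = -(‖s‖ : ℂ) := by
    by_cases h0 : s = 0
    · exact ⟨0, by simp [h0]⟩
    · have hn : (‖s‖ : ℂ) ≠ 0 := by exact_mod_cast norm_ne_zero_iff.2 h0
      obtain ⟨θ, hθ⟩ := exists_ei_eq (w := -s / ‖s‖) (by
        rw [norm_div, norm_neg, Complex.norm_real, norm_norm, div_self (norm_ne_zero_iff.2 h0)])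
      refine ⟨θ, ?_⟩
      rw [hθ]
      simp only [map_div₀, map_neg, Complex.conj_ofReal]
      rw [div_mul_eq_mul_div, neg_mul, Complex.conj_mul', neg_div, sq, mul_div_assoc, div_self hn,
        mul_one]
  have := nsq_pos (hp θ)
  rw [nsq_add_smul, ← hs, hθ] at this
  simp at this
  linarith

/-- A disk automorphism in `ζ` replaces `(T, V)` by multiples of `T₀ = T - μ V` and `V₀ = V - conj μ
T`, which parametrize the same circle. These are orthogonal exactly when `conj s μ² - S μ + s = 0`,
with `s = hdot V T` and `S = ‖T‖² + ‖V‖²`. An orthogonal pair is a rescaled `(q A, m perp A)`, the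
centre of a disk, and `μ` is then the parameter `w` up to phases. -/
theorem exists_disk_of_goodPair {p : (ℂ × ℂ) × (ℂ × ℂ)} (hp : GoodPair p) :
    ∃ (ξ : S2 × S2) (w c : ℂ), ‖w‖ < 1 ∧ c ≠ 0 ∧
      c • p.1 = (-Complex.I * phase ξ.1) • topV ξ w ∧ conj c • p.2 = botV ξ w := by
  obtain ⟨T, V⟩ := p
  have hlt := hp.two_mul_norm_hdot_lt
  simp only at hlt ⊢
  set s := hdot V T with hs
  set S := nsq T + nsq V with hS
  have hD : 0 < S ^ 2 - 4 * ‖s‖ ^ 2 := by nlinarith [norm_nonneg s]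
  -- The root of modulus less than `1` is `μ = 2 s / r`; in this form it makes sense for `s = 0`
  -- too.
  set r := S + √(S ^ 2 - 4 * ‖s‖ ^ 2) with hr
  have hSpos : 0 < S := by linarith [norm_nonneg s]
  have hsq := Real.sqrt_nonneg (S ^ 2 - 4 * ‖s‖ ^ 2)
  have hrS : S ≤ r := by linarith
  have hr0 : 0 < r := by linarith
  have hr2 : r ^ 2 - 2 * S * r + 4 * ‖s‖ ^ 2 = 0 := by
    have := Real.sq_sqrt hD.le
    rw [hr]; linear_combination this
  have hrc : (r : ℂ) ≠ 0 := by exact_mod_cast hr0.ne'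
  set μ : ℂ := 2 * s / r with hμ
  have hμ1 : ‖μ‖ < 1 := by
    rw [hμ, norm_div, norm_mul, Complex.norm_real, Real.norm_of_nonneg hr0.le, div_lt_one hr0]
    simp; linarith
  have hμeq : conj s * μ ^ 2 - S * μ + s = 0 := by
    have h2 : (r : ℂ) ^ 2 - 2 * S * r + 4 * (s * conj s) = 0 := by
      rw [← ofReal_norm_sq]; exact_mod_cast hr2
    rw [hμ]
    field_simp
    linear_combination s * h2
  clear_value μ
  set T0 := T - μ • V with hT0
  set V0 := V - conj μ • T with hV0
  have hk : (1 - μ * conj μ : ℂ) ≠ 0 := by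
    rw [← ofReal_norm_sq]
    have : 1 - ‖μ‖ ^ 2 ≠ 0 := by nlinarith [norm_nonneg μ]
    exact_mod_cast this
  have eT : (1 - μ * conj μ) • T = T0 + μ • V0 := by
    rw [hT0, hV0]; module
  have eV : (1 - μ * conj μ) • V = V0 + conj μ • T0 := by
    rw [hT0, hV0]; module
  have horth : hdot V0 T0 = 0 := by
    have hexp : hdot V0 T0 = conj s * μ ^ 2 - S * μ + s := by
      rw [hT0, hV0, hs, hS]
      push_cast
      rw [ofReal_nsq, ofReal_nsq]
      simp [hdot]; ring
    rw [hexp, hμeq]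
  have hne : ¬(T0 = 0 ∧ V0 = 0) := by
    rintro ⟨h1, h2⟩
    rw [h1, h2, smul_zero, add_zero] at eT eV
    have hT := (smul_eq_zero.1 eT).resolve_left hk
    have hV := (smul_eq_zero.1 eV).resolve_left hk
    exact hp 0 (by simp [hT, hV])
  obtain ⟨y, t, v, ht, hv⟩ := exists_orthogonal_eq_smul horth hne
  have htv : 0 < ‖t‖ ^ 2 + ‖v‖ ^ 2 := by
    by_contra hcon
    have h1 : ‖t‖ ^ 2 = 0 := by nlinarith [sq_nonneg ‖t‖, sq_nonneg ‖v‖]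
    have h2 : ‖v‖ ^ 2 = 0 := by nlinarith [sq_nonneg ‖t‖, sq_nonneg ‖v‖]
    have h1' : t = 0 := by simpa using h1
    have h2' : v = 0 := by simpa using h2
    exact hne ⟨by rw [ht, h1', zero_smul], by rw [hv, h2', zero_smul]⟩
  set R := √(‖t‖ ^ 2 + ‖v‖ ^ 2) with hR
  have hR0 : 0 < R := Real.sqrt_pos.2 htv
  have hR2 : R ^ 2 = ‖t‖ ^ 2 + ‖v‖ ^ 2 := Real.sq_sqrt htv.le
  have hRc : (R : ℂ) ≠ 0 := by exact_mod_cast hR0.ne'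
  -- The scalar `c` makes `conj c v` real and nonnegative with the two moduli normalized; the
  -- remaining phase of `c t` is `σ`. When `t` or `v` vanishes the phase is free or can be absorbed
  -- in `c`, and `σ = 1` is chosen as required at the poles.
  obtain ⟨c, σ, hc0, hσ, hσ1, hct, hcv⟩ : ∃ c σ : ℂ, c ≠ 0 ∧ ‖σ‖ = 1 ∧
      (‖t‖ / R * (‖v‖ / R) = 0 → σ = 1) ∧ c * t = -Complex.I * σ * (‖t‖ / R : ℝ) ∧
      conj c * v = (‖v‖ / R : ℝ) := by
    by_cases hv0 : v = 0
    · have ht0 : t ≠ 0 := by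
        rintro rfl
        simp [hv0] at htv
      have htn : (‖t‖ : ℂ) ≠ 0 := by exact_mod_cast norm_ne_zero_iff.2 ht0
      refine ⟨-Complex.I * (‖t‖ / R : ℝ) / t, 1, ?_, by simp, fun _ => rfl, ?_, by simp [hv0]⟩
      · push_cast
        exact div_ne_zero (mul_ne_zero (by simp) (div_ne_zero htn hRc)) ht0
      · field_simp
    · have hvn : (‖v‖ : ℂ) ≠ 0 := by exact_mod_cast norm_ne_zero_iff.2 hv0
      have hcv0 : conj v ≠ 0 := by simpa using hv0
      set c : ℂ := (‖v‖ / R : ℝ) / conj v with hc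
      have hc0 : c ≠ 0 := by
        rw [hc]; push_cast
        exact div_ne_zero (div_ne_zero hvn hRc) hcv0
      have hcn : ‖c‖ = 1 / R := by
        rw [hc, norm_div, Complex.norm_conj, Complex.norm_real, Real.norm_of_nonneg (by positivity)]
        have := norm_ne_zero_iff.2 hv0
        field_simp
      have hcv : conj c * v = (‖v‖ / R : ℝ) := by
        rw [hc]; simp only [map_div₀, Complex.conj_ofReal, Complex.conj_conj]
        rw [div_mul_cancel₀ _ hv0]
      by_cases ht0 : t = 0
      · exact ⟨c, 1, hc0, by simp, fun _ => rfl, by simp [ht0], hcv⟩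
      · have htn : ‖t‖ ≠ 0 := norm_ne_zero_iff.2 ht0
        have hq : ((‖t‖ / R : ℝ) : ℂ) ≠ 0 := by
          have : ‖t‖ / R ≠ 0 := by positivity
          exact_mod_cast this
        refine ⟨c, Complex.I * (c * t) / (‖t‖ / R : ℝ), hc0, ?_, fun h0 => ?_, ?_, hcv⟩
        · rw [norm_div, norm_mul, norm_mul, hcn, Complex.norm_I, Complex.norm_real,
            Real.norm_of_nonneg (by positivity)]
          field_simp
        · exfalso
          have : ‖t‖ / R * (‖v‖ / R) ≠ 0 := by
            have := norm_ne_zero_iff.2 hv0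
            positivity
          exact this h0
        · rw [mul_assoc, div_mul_cancel₀ _ hq]
          linear_combination (c * t) * Complex.I_sq
  obtain ⟨x, hxq, hxm, hxσ⟩ := exists_base_point (q := ‖t‖ / R) (m := ‖v‖ / R) (by positivity)
    (by positivity) (by rw [div_pow, div_pow, ← add_div, ← hR2, div_self (by positivity)]) hσ hσ1
  have hcc : conj c ≠ 0 := by simpa using hc0
  have hσc := conj_mul_self_of_norm_eq_one hσ
  refine ⟨(x, y), Complex.I * conj σ * μ * (c / conj c), c * (1 - μ * conj μ), ?_,
    mul_ne_zero hc0 hk, ?_, ?_⟩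
  · rw [norm_mul, norm_mul, norm_mul, norm_div, Complex.norm_conj, Complex.norm_conj, hσ,
      div_self (norm_ne_zero_iff.2 hc0)]
    simpa using hμ1
  · rw [mul_smul, eT, ht, hv, topV, circVec, hxq, hxm, hxσ]
    simp only [smul_add, smul_smul]
    congr 2
    have hI := Complex.I_sq
    have h3 := div_mul_cancel₀ c hcc
    rw [← hcv]
    linear_combination (conj σ * σ * μ * v * (c / conj c * conj c)) * hI -
      μ * v * (c / conj c * conj c) * hσc - μ * v * h3
  · have hk' : conj (1 - μ * conj μ) = 1 - μ * conj μ := by simp; ring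
    rw [map_mul, hk', mul_smul, eV, ht, hv, botV, reflVec, hxq, hxm]
    simp only [smul_add, smul_smul]
    rw [hcv, add_comm]
    congr 2
    have h2 : ((‖t‖ / R : ℝ) : ℂ) * (-Complex.I * σ) = c * t := by rw [hct]; ring
    simp only [map_mul, map_div₀, Complex.conj_conj, Complex.conj_I]
    field_simp
    linear_combination (-conj μ) * h2

theorem coords_eq_radQ_mul_radM_mul_phase (x : S2) :
    (x.1 0 : ℂ) + Complex.I * (x.1 1 : ℂ) = 2 * radQ x * radM x * phase x := by
  have hs := sphere_sum_sq x
  have hn : ‖(x.1 0 : ℂ) + Complex.I * (x.1 1 : ℂ)‖ = 2 * radQ x * radM x := by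
    rw [← sq_eq_sq₀ (norm_nonneg _) (by have := radQ_nonneg x; have := radM_nonneg x; positivity),
      mul_pow, mul_pow, radQ_sq, radM_sq, Complex.sq_norm, Complex.normSq_apply]
    simp
    nlinarith
  by_cases h : (x.1 0 : ℂ) + Complex.I * (x.1 1 : ℂ) = 0
  · rw [h, norm_zero] at hn
    rw [h]
    have : (2 * radQ x * radM x : ℂ) = 0 := by exact_mod_cast hn.symm
    rw [this, zero_mul]
  · rw [phase, if_neg h, ← mul_div_assoc, hn, eq_div_iff (by rw [← hn]; simpa using h)]
    push_cast; ring

/-! ### Quadratic invariants that recover a disk from a pair -/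

section Invariants

variable (p : (ℂ × ℂ) × (ℂ × ℂ)) (A : ℂ × ℂ) {q m : ℝ} (w : ℂ)

/-- The off-diagonal entry of the Hermitian matrix `T T* - V V*`. -/
def invC : ℂ := conj p.1.1 * p.1.2 - conj p.2.1 * p.2.2

/-- The difference of the diagonal entries of `T T* - V V*`. -/
def invR : ℂ := p.1.1 * conj p.1.1 - p.1.2 * conj p.1.2 - p.2.1 * conj p.2.1 + p.2.2 * conj p.2.2

/-- The trace of `T T* - V V*`. -/
def invT : ℂ := p.1.1 * conj p.1.1 + p.1.2 * conj p.1.2 - p.2.1 * conj p.2.1 - p.2.2 * conj p.2.2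

/-- The determinant of the pair `(T, V)`. -/
def invD : ℂ := p.1.1 * p.2.2 - p.1.2 * p.2.1

variable {A}

/-- The Hermitian matrix `T T* - V V*` ignores the phases of `u` and `v`, the determinant keeps
them. For `v = conj u` all four quantities are multiplied by the same positive number. -/
theorem inv_smul (u v : ℂ) (huv : conj u * u = conj v * v) :
    invC (u • p.1, v • p.2) = (conj u * u) * invC p ∧
    invR (u • p.1, v • p.2) = (conj u * u) * invR p ∧
    invT (u • p.1, v • p.2) = (conj u * u) * invT p ∧
    invD (u • p.1, v • p.2) = (u * v) * invD p := by
  simp only [invC, invR, invT, invD, Prod.smul_fst, Prod.smul_snd, smul_eq_mul, map_mul]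
  refine ⟨?_, ?_, ?_, ?_⟩
  · linear_combination conj p.2.1 * p.2.2 * huv
  · linear_combination (p.2.1 * conj p.2.1 - p.2.2 * conj p.2.2) * huv
  · linear_combination (p.2.1 * conj p.2.1 + p.2.2 * conj p.2.2) * huv
  · ring

theorem inv_circVec (hqm : (q : ℂ) ^ 2 + (m : ℂ) ^ 2 = 1) :
    invC (circVec A q m w, reflVec A q m w) = (1 - w * conj w) * (conj A.1 * A.2) ∧
    invR (circVec A q m w, reflVec A q m w) =
      (1 - w * conj w) * (A.1 * conj A.1 - A.2 * conj A.2) ∧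
    invT (circVec A q m w, reflVec A q m w) =
      (1 - w * conj w) * nsq A * ((q : ℂ) ^ 2 - (m : ℂ) ^ 2) ∧
    invD (circVec A q m w, reflVec A q m w) = -((1 - w * conj w) * nsq A * (q * m)) := by
  rw [ofReal_nsq]
  simp only [invC, invR, invT, invD, circVec, reflVec, perp, Prod.smul_fst, Prod.smul_snd,
    Prod.fst_add, Prod.snd_add, smul_eq_mul, map_mul, map_add, map_neg, Complex.conj_ofReal,
    Complex.conj_conj]
  refine ⟨?_, ?_, ?_, ?_⟩
  · linear_combination (1 - w * conj w) * (conj A.1 * A.2) * hqm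
  · linear_combination (1 - w * conj w) * (A.1 * conj A.1 - A.2 * conj A.2) * hqm
  · ring
  · ring

end Invariants

/-- The undeformed disks do not meet each other. -/
theorem eq_of_smul_disk_eq {ξ ξ' : S2 × S2} {w w' c : ℂ} (hw : ‖w‖ < 1) (hw' : ‖w'‖ < 1)
    (h1 : (-Complex.I * phase ξ.1) • topV ξ w = c • (-Complex.I * phase ξ'.1) • topV ξ' w')
    (h2 : botV ξ w = conj c • botV ξ' w') : ξ = ξ' := by
  let ρ : S2 × S2 → ℂ → ℝ := fun ξ w => (1 - ‖w‖ ^ 2) * nsq (spinV ξ.2)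
  let P : S2 × S2 → ℂ → (ℂ × ℂ) × (ℂ × ℂ) := fun ξ w =>
    ((-Complex.I * phase ξ.1) • topV ξ w, botV ξ w)
  have hρ : ∀ ξ w, ‖w‖ < 1 → 0 < ρ ξ w := fun ξ w hw =>
    mul_pos (by nlinarith [norm_nonneg w]) (nsq_pos (spinV_ne_zero _))
  have hρc : ∀ ξ w, (ρ ξ w : ℂ) = (1 - w * conj w) * nsq (spinV ξ.2) := fun ξ w => by
    simp only [ρ]; push_cast; rw [ofReal_norm_sq]
  -- Up to the common positive factor `ρ = (1 - |w|²) ‖A‖²`, the traceless part of `T T* - V V*`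
  -- gives `y`, its trace gives `x₂`, and the determinant gives `x₀ + i x₁`.
  have hinv : ∀ ξ w, 2 * invC (P ξ w) = ρ ξ w * ((ξ.2.1 1 : ℂ) + Complex.I * ξ.2.1 2) ∧
      invR (P ξ w) = ρ ξ w * ξ.2.1 0 ∧ invT (P ξ w) = ρ ξ w * ξ.1.1 2 ∧
      -2 * Complex.I * invD (P ξ w) = ρ ξ w * ((ξ.1.1 0 : ℂ) + Complex.I * ξ.1.1 1) := by
    intro ξ w
    have hu : conj (-Complex.I * phase ξ.1) * (-Complex.I * phase ξ.1) = 1 :=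
      conj_mul_self_of_norm_eq_one (by simp [norm_phase])
    have hqm : (radQ ξ.1 : ℂ) ^ 2 + (radM ξ.1 : ℂ) ^ 2 = 1 := by
      exact_mod_cast radQ_sq_add_radM_sq ξ.1
    obtain ⟨s1, s2, s3, s4⟩ := inv_smul (topV ξ w, botV ξ w) (-Complex.I * phase ξ.1) 1
      (by rw [hu]; simp)
    obtain ⟨c1, c2, c3, c4⟩ := inv_circVec (A := spinV ξ.2) w hqm
    obtain ⟨e1, e2⟩ := spinV_coords ξ.2
    have e1' : (spinA ξ.2 * conj (spinA ξ.2) - spinB ξ.2 * conj (spinB ξ.2) : ℂ)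
        = nsq (spinV ξ.2) * ξ.2.1 0 := by
      rw [← ofReal_norm_sq, ← ofReal_norm_sq]; exact_mod_cast e1
    have e3 : (ξ.1.1 2 : ℂ) = (radQ ξ.1 : ℂ) ^ 2 - (radM ξ.1 : ℂ) ^ 2 := by
      have : ξ.1.1 2 = radQ ξ.1 ^ 2 - radM ξ.1 ^ 2 := by rw [radQ_sq, radM_sq]; ring
      exact_mod_cast this
    have e4 := coords_eq_radQ_mul_radM_mul_phase ξ.1
    rw [hu, one_mul, one_smul] at s1 s2 s3
    rw [one_smul] at s4
    simp only [P]
    refine ⟨?_, ?_, ?_, ?_⟩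
    · rw [s1]
      erw [c1]
      rw [hρc, mul_assoc, ← e2]; simp only [spinV]; ring
    · rw [s2]
      erw [c2]
      rw [hρc, mul_assoc, ← e1']; rfl
    · rw [s3]
      erw [c3]
      rw [hρc, e3]
    · rw [s4]
      erw [c4]
      rw [hρc, e4]
      linear_combination (-2 * phase ξ.1 * ((1 - w * conj w) * nsq (spinV ξ.2) *
        (radQ ξ.1 * radM ξ.1))) * Complex.I_sq
  have hP : P ξ w = (c • (P ξ' w').1, conj c • (P ξ' w').2) := Prod.ext h1 h2
  obtain ⟨s1, s2, s3, s4⟩ := inv_smul (P ξ' w') c (conj c) (by simp; ring)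
  rw [← hP] at s1 s2 s3 s4
  obtain ⟨i1, i2, i3, i4⟩ := hinv ξ w
  obtain ⟨j1, j2, j3, j4⟩ := hinv ξ' w'
  set k : ℝ := ‖c‖ ^ 2 with hk
  have hkc : (k : ℂ) = conj c * c := by rw [hk]; push_cast; rw [ofReal_norm_sq]; ring
  have r1 : (ρ ξ w : ℂ) * ((ξ.2.1 1 : ℂ) + Complex.I * ξ.2.1 2)
      = k * ρ ξ' w' * ((ξ'.2.1 1 : ℂ) + Complex.I * ξ'.2.1 2) := by
    rw [mul_assoc, ← i1, ← j1, s1, hkc]; ring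
  have r2 : (ρ ξ w : ℂ) * ξ.2.1 0 = k * ρ ξ' w' * ξ'.2.1 0 := by
    rw [mul_assoc, ← i2, ← j2, s2, hkc]
  have r3 : (ρ ξ w : ℂ) * ξ.1.1 2 = k * ρ ξ' w' * ξ'.1.1 2 := by
    rw [mul_assoc, ← i3, ← j3, s3, hkc]
  have r4 : (ρ ξ w : ℂ) * ((ξ.1.1 0 : ℂ) + Complex.I * ξ.1.1 1)
      = k * ρ ξ' w' * ((ξ'.1.1 0 : ℂ) + Complex.I * ξ'.1.1 1) := by
    rw [mul_assoc, ← i4, ← j4, s4, hkc]; ring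
  have hsplit : ∀ {r r' x y x' y' : ℝ}, (r : ℂ) * ((x : ℂ) + Complex.I * y)
      = k * r' * ((x' : ℂ) + Complex.I * y') → r * x = k * r' * x' ∧ r * y = k * r' * y' := by
    intro r r' x y x' y' h
    have hre := congrArg Complex.re h
    have him := congrArg Complex.im h
    simp at hre him
    exact ⟨by linarith, by linarith⟩
  obtain ⟨y1, y2⟩ := hsplit r1
  obtain ⟨x0, x1⟩ := hsplit r4
  have y0 : ρ ξ w * ξ.2.1 0 = k * ρ ξ' w' * ξ'.2.1 0 := by exact_mod_cast r2
  have x2 : ρ ξ w * ξ.1.1 2 = k * ρ ξ' w' * ξ'.1.1 2 := by exact_mod_cast r3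
  have hpos := hρ ξ w hw
  have hpos' := hρ ξ' w' hw'
  -- Both second components are unit vectors, so the positive factors of proportionality agree.
  have hρeq : ρ ξ w = k * ρ ξ' w' := by
    rw [← sq_eq_sq₀ hpos.le (by positivity)]
    have e := sphere_sum_sq ξ.2
    have e' := sphere_sum_sq ξ'.2
    have e0 := congrArg (· ^ 2) y0
    have e1 := congrArg (· ^ 2) y1
    have e2 := congrArg (· ^ 2) y2
    simp only [mul_pow] at e0 e1 e2
    rw [mul_pow]
    linear_combination e0 + e1 + e2 - ρ ξ w ^ 2 * e + k ^ 2 * ρ ξ' w' ^ 2 * e'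
  rw [← hρeq] at x0 x1 x2 y0 y1 y2
  have hcancel : ∀ {x y : ℝ}, ρ ξ w * x = ρ ξ w * y → x = y :=
    fun h => mul_left_cancel₀ hpos.ne' h
  refine Prod.ext (Subtype.ext (PiLp.ext fun i => ?_)) (Subtype.ext (PiLp.ext fun i => ?_))
  · fin_cases i
    exacts [hcancel x0, hcancel x1, hcancel x2]
  · fin_cases i
    exacts [hcancel y0, hcancel y1, hcancel y2]


/-! ### The variation of the mean value with the radius -/

/-- The derivative of `τ ↦ meanS h (T, exp τ • V)` at `0`. -/
def fluxS (h : S2 → ℝ) (p : (ℂ × ℂ) × (ℂ × ℂ)) : ℝ :=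
  (2 * Real.pi)⁻¹ * ∫ θ in (0 : ℝ)..(2 * Real.pi),
    fderiv ℝ (liftS h) (p.1 + ei θ • p.2) (ei θ • p.2)

theorem hasFDerivAt_liftS {h : S2 → ℝ} (hh : ContMDiff (𝓡 2) 𝓘(ℝ, ℝ) ∞ h) {v : ℂ × ℂ}
    (hv : v ≠ 0) : HasFDerivAt (liftS h) (fderiv ℝ (liftS h) v) v :=
  ((contDiffAt_liftS hh hv).differentiableAt (by simp)).hasFDerivAt

/-- Homogeneity of degree zero under complex scalars: the derivative annihilates the complex line of
`v`. -/
theorem fderiv_liftS_self {h : S2 → ℝ} (hh : ContMDiff (𝓡 2) 𝓘(ℝ, ℝ) ∞ h) {v : ℂ × ℂ}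
    (hv : v ≠ 0) (c : ℂ) : fderiv ℝ (liftS h) v (c • v) = 0 := by
  have h1 : HasDerivAt (fun s : ℝ => v + (s : ℂ) • c • v) (c • v) 0 := by
    have := ((Complex.ofRealCLM.hasDerivAt (x := 0)).smul_const (c • v)).const_add v
    exact this.congr_deriv (by simp)
  have h2 : HasDerivAt (fun s : ℝ => liftS h (v + (s : ℂ) • c • v))
      (fderiv ℝ (liftS h) v (c • v)) 0 :=
    HasFDerivAt.comp_hasDerivAt (l := liftS h) (0 : ℝ) (by simpa using hasFDerivAt_liftS hh hv) h1
  have h3 : ∀ᶠ s : ℝ in nhds 0, liftS h (v + (s : ℂ) • c • v) = liftS h v := by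
    have hc : Continuous fun s : ℝ => (1 + s * c : ℂ) := by fun_prop
    filter_upwards [hc.continuousAt.eventually_ne (y := 0) (x := 0) (by simp)] with s hs
    rw [← liftS_smul h hs v, add_smul, one_smul, smul_smul]
  exact h2.unique ((hasDerivAt_const (0 : ℝ) (liftS h v)).congr_of_eventuallyEq h3)

theorem fderiv_liftS_smul {h : S2 → ℝ} (hh : ContMDiff (𝓡 2) 𝓘(ℝ, ℝ) ∞ h) {v : ℂ × ℂ}
    (hv : v ≠ 0) {c : ℂ} (hc : c ≠ 0) (y : ℂ × ℂ) :
    fderiv ℝ (liftS h) (c • v) (c • y) = fderiv ℝ (liftS h) v y := by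
  have h1 : HasFDerivAt (fun x : ℂ × ℂ => c • x) (c • ContinuousLinearMap.id ℝ (ℂ × ℂ)) v :=
    (hasFDerivAt_id v).const_smul c
  have h2 := HasFDerivAt.comp (g := liftS h) v (hasFDerivAt_liftS hh (smul_ne_zero hc hv)) h1
  have h3 : liftS h ∘ (fun x => c • x) = liftS h := funext fun x => liftS_smul h hc x
  rw [h3] at h2
  rw [(hasFDerivAt_liftS hh hv).unique h2]
  simp

theorem GoodPair.smul {p : (ℂ × ℂ) × (ℂ × ℂ)} (hp : GoodPair p) {u v : ℂ} (huv : ‖u‖ = ‖v‖)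
    (hu : u ≠ 0) : GoodPair (u • p.1, v • p.2) := by
  intro θ h0
  obtain ⟨α, hα⟩ := exists_ei_eq (w := ei θ * (v / u))
    (by rw [norm_mul, norm_div, huv, norm_ei, div_self (by rw [← huv]; simpa using hu), one_mul])
  apply hp α
  have : u • (p.1 + ei α • p.2) = 0 := by
    rw [← h0, hα, smul_add, smul_smul, smul_smul]
    congr 2; field_simp
  exact (smul_eq_zero.1 this).resolve_left hu

theorem meanS_smul {h : S2 → ℝ} (hh : ContMDiff (𝓡 2) 𝓘(ℝ, ℝ) ∞ h) {p : (ℂ × ℂ) × (ℂ × ℂ)}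
    (hp : GoodPair p) {u v : ℂ} (huv : ‖u‖ = ‖v‖) (hu : u ≠ 0) :
    meanS h (u • p.1, v • p.2) = meanS h p := by
  rw [← re_schwarz hh hp, ← re_schwarz hh (hp.smul huv hu), schwarz_smul h p huv hu]

theorem contDiffOn_meanS {h : S2 → ℝ} (hh : ContMDiff (𝓡 2) 𝓘(ℝ, ℝ) ∞ h) :
    ContDiffOn ℝ ∞ (meanS h) {p | GoodPair p} :=
  (Complex.reCLM.contDiff.comp_contDiffOn (contDiffOn_schwarz hh)).congr
    fun _ hp => (re_schwarz hh hp).symm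

theorem hasDerivAt_exp_smul (V : ℂ × ℂ) (τ : ℝ) :
    HasDerivAt (fun τ : ℝ => (Real.exp τ : ℂ) • V) ((Real.exp τ : ℂ) • V) τ :=
  (Real.hasDerivAt_exp τ).ofReal_comp.smul_const V

theorem hasDerivAt_meanS {h : S2 → ℝ} (hh : ContMDiff (𝓡 2) 𝓘(ℝ, ℝ) ∞ h) (T V : ℂ × ℂ) (τ : ℝ)
    (hp : GoodPair (T, (Real.exp τ : ℂ) • V)) :
    HasDerivAt (fun τ : ℝ => meanS h (T, (Real.exp τ : ℂ) • V))
      (fluxS h (T, (Real.exp τ : ℂ) • V)) τ := by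
  have hpath : Continuous fun τ : ℝ => (T, (Real.exp τ : ℂ) • V) := by fun_prop
  have hU : IsOpen {τ : ℝ | GoodPair (T, (Real.exp τ : ℂ) • V)} := isOpen_goodPair.preimage hpath
  have hγ : ContDiff ℝ ∞ fun x : ℝ × ℝ => T + ei x.2 • (Real.exp x.1 : ℂ) • V :=
    contDiff_const.add ((contDiff_ei.comp contDiff_snd).smul
      ((Complex.ofRealCLM.contDiff.comp (Real.contDiff_exp.comp contDiff_fst)).smul contDiff_const))
  have hf : ContDiffOn ℝ 1 (fun x : ℝ × ℝ => liftS h (T + ei x.2 • (Real.exp x.1 : ℂ) • V))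
      ({τ : ℝ | GoodPair (T, (Real.exp τ : ℂ) • V)} ×ˢ Set.univ) := by
    rintro ⟨τ, θ⟩ ⟨hτ, -⟩
    have h0 : ContDiffAt ℝ ∞ (liftS h) (T + ei θ • (Real.exp τ : ℂ) • V) :=
      contDiffAt_liftS hh (hτ θ)
    exact ((ContDiffAt.comp (g := liftS h) (τ, θ) h0 hγ.contDiffAt).of_le
      (by exact_mod_cast le_top)).contDiffWithinAt
  have key := (hasFDerivAt_intervalIntegral_param (a := 0) (b := 2 * Real.pi) hU hf hp).hasDerivAt
  have hm := key.const_mul ((2 * Real.pi)⁻¹)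
  refine HasDerivAt.congr_deriv hm ?_
  rw [fluxS]
  congr 1
  have hO := hU.prod (isOpen_univ (X := ℝ))
  have hint : IntervalIntegrable (fun t : ℝ => (fderiv ℝ (fun x : ℝ × ℝ =>
      liftS h (T + ei x.2 • (Real.exp x.1 : ℂ) • V)) (τ, t)).comp
        (ContinuousLinearMap.inl ℝ ℝ ℝ)) MeasureTheory.volume 0 (2 * Real.pi) := by
    apply Continuous.intervalIntegrable
    have h1 := (hf.continuousOn_fderiv_of_isOpen hO le_rfl).comp_continuous
      (Continuous.prodMk_right τ) (fun t => Set.mk_mem_prod hp (Set.mem_univ t))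
    exact h1.clm_comp continuous_const
  rw [ContinuousLinearMap.intervalIntegral_apply hint]
  refine intervalIntegral.integral_congr fun θ _ => ?_
  have h1 : HasDerivAt (fun τ : ℝ => T + ei θ • (Real.exp τ : ℂ) • V)
      (ei θ • (Real.exp τ : ℂ) • V) τ := ((hasDerivAt_exp_smul V τ).const_smul (ei θ)).const_add T
  have h2 : HasDerivAt (fun τ : ℝ => liftS h (T + ei θ • (Real.exp τ : ℂ) • V))
      (fderiv ℝ (liftS h) (T + ei θ • (Real.exp τ : ℂ) • V) (ei θ • (Real.exp τ : ℂ) • V)) τ :=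
    HasFDerivAt.comp_hasDerivAt (l := liftS h) τ (hasFDerivAt_liftS hh (hp θ)) h1
  have h3 : HasFDerivAt (fun x : ℝ × ℝ => liftS h (T + ei x.2 • (Real.exp x.1 : ℂ) • V))
      (fderiv ℝ (fun x : ℝ × ℝ => liftS h (T + ei x.2 • (Real.exp x.1 : ℂ) • V)) (τ, θ)) (τ, θ) :=
    ((hf.contDiffAt (hO.mem_nhds (Set.mk_mem_prod hp (Set.mem_univ θ)))).differentiableAt
      (by simp)).hasFDerivAt
  have h4 : HasDerivAt (fun τ : ℝ => (τ, θ)) ((1 : ℝ), (0 : ℝ)) τ :=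
    (hasDerivAt_id τ).prodMk (hasDerivAt_const τ θ)
  have h5 := h3.comp_hasDerivAt τ h4
  exact h5.unique h2

/-- Conformal invariance of the flux. At `T + ζ V`, a multiple of the point `circVec A q m z` of the
circle, the vector `ζ V` splits into a part along the point, which the derivative kills, and a real
multiple of `m z perp A`. That multiple is `(1 - |w|²) / |1 + conj w ζ|²`, the Jacobian of `ζ ↦ z`,
so the change of variables yields the flux of the centred pair. -/
theorem fluxS_circVec {h : S2 → ℝ} (hh : ContMDiff (𝓡 2) 𝓘(ℝ, ℝ) ∞ h) {A : ℂ × ℂ} (hA : A ≠ 0)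
    {q m : ℝ} (hqm : q ^ 2 + m ^ 2 = 1) {w : ℂ} (hw : ‖w‖ < 1) :
    fluxS h (circVec A q m w, reflVec A q m w) = fluxS h ((q : ℂ) • A, (m : ℂ) • perp A) := by
  have hX : ∀ z : ℂ, ‖z‖ = 1 → circVec A q m z ≠ 0 := fun z hz => circVec_ne_zero hA hqm hz
  have hcont : Continuous fun φ => fderiv ℝ (liftS h) (circVec A q m (ei φ))
      ((m * ei φ) • perp A) := by
    have hg : Continuous fun φ => circVec A q m (ei φ) := by
      unfold circVec; have := continuous_ei; fun_prop
    have h1 : Continuous fun φ => fderiv ℝ (liftS h) (circVec A q m (ei φ)) := by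
      rw [continuous_iff_continuousAt]
      intro φ
      exact ContinuousAt.comp (f := fun φ => circVec A q m (ei φ)) (g := fderiv ℝ (liftS h))
        ((contDiffAt_liftS hh (hX _ (norm_ei φ))).continuousAt_fderiv (by simp)) hg.continuousAt
    exact h1.clm_apply (by have := continuous_ei; fun_prop)
  have key := integral_circle_mobius (F := ℝ)
    (fun z => fderiv ℝ (liftS h) (circVec A q m z) ((m * z) • perp A)) hcont hw
  unfold fluxS
  congr 1
  have hr : ∀ φ : ℝ, fderiv ℝ (liftS h) (circVec A q m (ei φ)) ((m * ei φ) • perp A) =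
      fderiv ℝ (liftS h) ((q : ℂ) • A + ei φ • (m : ℂ) • perp A) (ei φ • (m : ℂ) • perp A) := by
    intro φ
    rw [circVec, smul_smul, mul_comm (ei φ)]
  simp only [hr] at key
  rw [← key]
  refine intervalIntegral.integral_congr fun θ _ => ?_
  have hζ := norm_ei θ
  have hN := one_add_conj_mul_ne_zero hw hζ
  simp only
  rw [circVec_add_smul_reflVec A q m w hN]
  set ζ := ei θ
  set z := (ζ + w) / (1 + conj w * ζ) with hz
  have hz1 : ‖z‖ = 1 := norm_mobius hζ hw
  have hdec : ζ • reflVec A q m w = (1 + conj w * ζ) • ((ζ * conj w / (1 + conj w * ζ)) •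
      circVec A q m z + (((1 - ‖w‖ ^ 2) / ‖1 + conj w * ζ‖ ^ 2 : ℝ) : ℂ) • (m * z) • perp A) := by
    have hζc : ζ * conj ζ = 1 := by rw [Complex.mul_conj', hζ]; simp
    have hN' : 1 + w * conj ζ ≠ 0 := by
      intro h0; apply hN; have := congrArg conj h0; simpa using this
    have e1 : (((1 - ‖w‖ ^ 2) / ‖1 + conj w * ζ‖ ^ 2 : ℝ) : ℂ)
        = (1 - w * conj w) / ((1 + conj w * ζ) * (1 + w * conj ζ)) := by
      push_cast
      rw [ofReal_norm_sq, ofReal_norm_sq]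
      simp
    have e2 : ζ + w = ζ * (1 + w * conj ζ) := by linear_combination -w * hζc
    have e3 : (1 + conj w * ζ) * ((1 - w * conj w) / ((1 + conj w * ζ) * (1 + w * conj ζ)) *
        (m * z)) = m * ζ - ζ * conj w * (m * z) := by
      have : 1 - conj w * z = (1 - w * conj w) / (1 + conj w * ζ) := by
        rw [hz, eq_div_iff hN, sub_mul, mul_assoc, div_mul_cancel₀ _ hN]; ring
      have e4 : m * ζ - ζ * conj w * (m * z) = m * ζ * (1 - conj w * z) := by ring
      rw [e4, this, hz, e2]
      field_simp
    rw [e1, smul_add, smul_smul, smul_smul _ _ ((m * z) • perp A), smul_smul _ _ (perp A), mul_div_cancel₀ _ hN]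
    have e5 : (1 + conj w * ζ) * ((1 - w * conj w) / ((1 + conj w * ζ) * (1 + w * conj ζ))) *
        (m * z) = m * ζ - ζ * conj w * (m * z) := by rw [mul_assoc, e3]
    rw [e5, circVec, reflVec, smul_add, smul_add, sub_smul, smul_smul, smul_smul, smul_smul,
      smul_smul]
    rw [show ζ * (q * conj w) = ζ * conj w * q by ring, show ζ * m = m * ζ by ring]
    abel
  rw [hdec, fderiv_liftS_smul hh (hX z hz1) hN, map_add, fderiv_liftS_self hh (hX z hz1), zero_add]
  rw [show ∀ (r : ℝ) (v : ℂ × ℂ), (r : ℂ) • v = r • v from fun r v => rfl, map_smul]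

theorem fluxS_smul {h : S2 → ℝ} (hh : ContMDiff (𝓡 2) 𝓘(ℝ, ℝ) ∞ h) {p : (ℂ × ℂ) × (ℂ × ℂ)}
    (hp : GoodPair p) {u v : ℂ} (huv : ‖u‖ = ‖v‖) (hu : u ≠ 0) :
    fluxS h (u • p.1, v • p.2) = fluxS h p := by
  have e : ∀ V : ℂ × ℂ, (Real.exp 0 : ℂ) • V = V := fun V => by simp
  have h1 := hasDerivAt_meanS hh p.1 p.2 0 (by rw [e]; exact hp)
  have h2 := hasDerivAt_meanS hh (u • p.1) (v • p.2) 0 (by rw [e]; exact hp.smul huv hu)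
  rw [e] at h1 h2
  refine h2.unique (h1.congr_of_eventuallyEq ?_)
  have hc : Continuous fun τ : ℝ => (p.1, (Real.exp τ : ℂ) • p.2) := by fun_prop
  have := (isOpen_goodPair.preimage hc).mem_nhds (x := 0) (by
    change GoodPair (p.1, (Real.exp 0 : ℂ) • p.2)
    rw [e]; exact hp)
  filter_upwards [this] with τ hτ
  rw [smul_comm (Real.exp τ : ℂ) v, meanS_smul hh hτ huv hu]

/-! ### Comparison of the flux with the circle transform -/

/-- The frame is the rotation attached to `A` by the covering `SU(2) → SO(3)`, with axis `e 2` the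
point of `A`. Under stereographic projection from this axis the circle at height `tanh t` has radius
`e^{-t}`. -/
theorem exists_smallCircle_eq {A : ℂ × ℂ} (hA : nsq A = 1) :
    ∃ e : OrthonormalBasis (Fin 3) ℝ E3, ∀ t φ : ℝ, smallCircle e t φ =
      spherePoint (A + ei φ • (Real.exp (-t) : ℂ) • perp A).1
        (A + ei φ • (Real.exp (-t) : ℂ) • perp A).2 := by
  obtain ⟨⟨x, y⟩, ⟨z, w⟩⟩ := A
  have hN : x ^ 2 + y ^ 2 + z ^ 2 + w ^ 2 = 1 := by
    simp only [nsq, Complex.sq_norm, Complex.normSq_apply] at hA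
    linarith
  let v : Fin 3 → E3 := ![
    !₂[2 * (x * z - y * w), z ^ 2 - w ^ 2 - x ^ 2 + y ^ 2, 2 * (z * w + x * y)],
    !₂[2 * (x * w + y * z), 2 * (z * w - x * y), y ^ 2 + w ^ 2 - x ^ 2 - z ^ 2],
    !₂[x ^ 2 + y ^ 2 - z ^ 2 - w ^ 2, 2 * (x * z + y * w), 2 * (x * w - y * z)]]
  have hv : Orthonormal ℝ v := by
    rw [orthonormal_iff_ite]
    intro i j
    rw [PiLp.inner_apply, Fin.sum_univ_three]
    fin_cases i <;> fin_cases j <;> simp [v, sq_abs, mul_pow] <;>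
      first
        | ring1
        | linear_combination (x ^ 2 + y ^ 2 + z ^ 2 + w ^ 2 + 1) * hN
  obtain ⟨e, he⟩ := Orthonormal.exists_orthonormalBasis_extension_of_card_eq
    (ι := Fin 3) (𝕜 := ℝ) (E := E3) (by simp) (v := v) (s := Set.univ)
    (hv.comp _ Subtype.val_injective)
  refine ⟨e, fun t φ => Subtype.ext ?_⟩
  have hc : Real.cosh t ≠ 0 := (Real.cosh_pos t).ne'
  set κ := Real.exp (-t) with hκ
  have hκ0 : 0 < κ := Real.exp_pos _
  have ht : Real.exp t = κ⁻¹ := by rw [hκ, Real.exp_neg, inv_inv]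
  have hcosh : Real.cosh t = (1 + κ ^ 2) / (2 * κ) := by
    rw [Real.cosh_eq, ht, ← hκ]; field_simp
  have htanh : Real.tanh t = (1 - κ ^ 2) / (1 + κ ^ 2) := by
    rw [Real.tanh_eq_sinh_div_cosh, Real.sinh_eq, hcosh, ht, ← hκ]; field_simp
  have hei : ei φ = ⟨Real.cos φ, Real.sin φ⟩ := by
    rw [ei, mul_comm, Complex.exp_mul_I]
    apply Complex.ext <;> simp [← Complex.ofReal_cos, ← Complex.ofReal_sin]
  have hcs := Real.sin_sq_add_cos_sq φ
  set c := Real.cos φ with hcφ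
  set s := Real.sin φ with hsφ
  set X := ((⟨x, y⟩, ⟨z, w⟩) : ℂ × ℂ) + ei φ • (κ : ℂ) • perp (⟨x, y⟩, ⟨z, w⟩) with hX
  have hX1 : X.1 = ⟨x + κ * (c * z + s * w), y + κ * (s * z - c * w)⟩ := by
    rw [hX, hei]; apply Complex.ext <;> simp [perp] <;> ring
  have hX2 : X.2 = ⟨z - κ * (c * x + s * y), w - κ * (s * x - c * y)⟩ := by
    rw [hX, hei]; apply Complex.ext <;> simp [perp] <;> ring
  have hn : ‖X.1‖ ^ 2 + ‖X.2‖ ^ 2 = 1 + κ ^ 2 := by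
    simp only [Complex.sq_norm, Complex.normSq_apply, hX1, hX2]
    linear_combination (1 + κ ^ 2) * hN + κ ^ 2 * (x ^ 2 + y ^ 2 + z ^ 2 + w ^ 2) * hcs
  have hκ1 : 1 + κ ^ 2 ≠ 0 := by positivity
  have hn0 : ¬ (‖X.1‖ ^ 2 + ‖X.2‖ ^ 2 = 0) := by rw [hn]; exact hκ1
  simp only [smallCircle, spherePoint, dif_neg hn0, he _ (Set.mem_univ _), v]
  rw [hn, htanh, hcosh, ← hcφ, ← hsφ]
  clear_value κ c s
  ext i
  fin_cases i
  · simp [Complex.sq_norm, Complex.normSq_apply, hX1, hX2]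
    field_simp
    linear_combination κ ^ 2 * (x ^ 2 + y ^ 2 - z ^ 2 - w ^ 2) * hcs
  · simp [hX1, hX2]
    field_simp
    linear_combination κ ^ 2 * (x * z + y * w) * hcs
  · simp [hX1, hX2]
    field_simp
    linear_combination κ ^ 2 * (x * w - y * z) * hcs

theorem perp_ne_zero {A : ℂ × ℂ} (hA : A ≠ 0) : perp A ≠ 0 := fun h => by
  have := nsq_perp A
  rw [h] at this
  exact hA (nsq_eq_zero.1 (by rw [← this]; simp [nsq]))

theorem goodPair_orthogonal {A : ℂ × ℂ} (hA : A ≠ 0) {q m : ℝ} (hqm : q ^ 2 + m ^ 2 ≠ 0) :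
    GoodPair ((q : ℂ) • A, (m : ℂ) • perp A) := by
  intro θ h0
  have h1 : (q : ℂ) • A + ei θ • (m : ℂ) • perp A = (0 : ℂ) • A + (0 : ℂ) • perp A := by
    rw [zero_smul, zero_smul, add_zero]; exact h0
  rw [smul_smul] at h1
  obtain ⟨h2, h3⟩ := eq_of_perp_coords hA h1
  have h4 : m = 0 := by simpa [ei_ne_zero] using h3
  have h5 : q = 0 := by simpa using h2
  simp [h4, h5] at hqm

theorem circleMean_eq_meanS (h : S2 → ℝ) {A : ℂ × ℂ} (hA : nsq A = 1) :
    ∃ e : OrthonormalBasis (Fin 3) ℝ E3, ∀ t : ℝ,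
      circleMean h e t = meanS h (A, (Real.exp (-t) : ℂ) • perp A) := by
  obtain ⟨e, he⟩ := exists_smallCircle_eq hA
  refine ⟨e, fun t => ?_⟩
  simp only [circleMean, he]
  rfl

/-- Every good pair lies on an undeformed disk, and by invariance its flux is that of the centre of
the disk. There the circles are concentric small circles and the flux is `-∂ₜ` of the circle mean,
so admissibility applies. For `q = 0` or `m = 0` the circle is a point and the flux vanishes. -/
theorem abs_fluxS_lt_one {h : S2 → ℝ} (hh : IsAdmissible h) {p : (ℂ × ℂ) × (ℂ × ℂ)}
    (hp : GoodPair p) : |fluxS h p| < 1 := by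
  have hs := hh.smooth
  obtain ⟨ξ, w, c, hw, hc, h1, h2⟩ := exists_disk_of_goodPair hp
  have hph : ‖-Complex.I * phase ξ.1‖ = ‖(1 : ℂ)‖ := by simp [norm_phase]
  have hph0 : -Complex.I * phase ξ.1 ≠ 0 := mul_ne_zero (by simp) (phase_ne_zero _)
  have e1 : fluxS h p = fluxS h (topV ξ w, botV ξ w) := by
    rw [← fluxS_smul hs hp (u := c) (v := conj c) (by simp) hc, h1, h2]
    have := fluxS_smul hs (goodPair_disk ξ hw) hph hph0
    rwa [one_smul] at this
  have hA := spinV_ne_zero ξ.2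
  have hqm := radQ_sq_add_radM_sq ξ.1
  have e2 : fluxS h p = fluxS h ((radQ ξ.1 : ℂ) • spinV ξ.2, (radM ξ.1 : ℂ) • perp (spinV ξ.2)) :=
    e1.trans (fluxS_circVec hs hA hqm hw)
  rw [e2]
  clear e1 e2 h1 h2
  have hg := goodPair_orthogonal hA (q := radQ ξ.1) (m := radM ξ.1) (by rw [hqm]; exact one_ne_zero)
  rcases (radQ_nonneg ξ.1).eq_or_lt with hq | hq
  · have hm : radM ξ.1 ≠ 0 := by
      intro hm; rw [hm, ← hq] at hqm; norm_num at hqm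
    have : fluxS h ((radQ ξ.1 : ℂ) • spinV ξ.2, (radM ξ.1 : ℂ) • perp (spinV ξ.2)) = 0 := by
      rw [fluxS, ← hq]
      have : ∀ θ : ℝ, fderiv ℝ (liftS h) (((0 : ℝ) : ℂ) • spinV ξ.2 +
          ei θ • (radM ξ.1 : ℂ) • perp (spinV ξ.2)) (ei θ • (radM ξ.1 : ℂ) • perp (spinV ξ.2)) = 0 := by
        intro θ
        rw [Complex.ofReal_zero, zero_smul, zero_add]
        have := fderiv_liftS_self hs (v := ei θ • (radM ξ.1 : ℂ) • perp (spinV ξ.2))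
          (smul_ne_zero (ei_ne_zero θ) (smul_ne_zero (by exact_mod_cast hm) (perp_ne_zero hA))) 1
        rwa [one_smul] at this
      simp only [this, intervalIntegral.integral_zero, mul_zero]
    rw [this, abs_zero]; exact one_pos
  rcases (radM_nonneg ξ.1).eq_or_lt with hm | hm
  · simp [fluxS, ← hm]
  -- the case of a proper circle
  set N := √(nsq (spinV ξ.2)) with hN
  have hN0 : 0 < N := Real.sqrt_pos.2 (nsq_pos hA)
  obtain ⟨e, he⟩ := circleMean_eq_meanS h (A := ((N⁻¹ : ℝ) : ℂ) • spinV ξ.2) (by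
    rw [nsq_smul, Complex.norm_real, Real.norm_eq_abs, sq_abs, inv_pow, hN,
      Real.sq_sqrt (nsq_nonneg _), inv_mul_cancel₀ (nsq_pos hA).ne'])
  -- Chosen so that `e^{-t} = m / q` is the stereographic radius of the circle.
  set t := -Real.log (radM ξ.1 / radQ ξ.1) with ht
  have hexp : Real.exp (-t) = radM ξ.1 / radQ ξ.1 := by
    rw [ht, neg_neg, Real.exp_log (div_pos hm hq)]
  have hNq : (N⁻¹ : ℝ) / radQ ξ.1 ≠ 0 := (div_pos (inv_pos.2 hN0) hq).ne'
  have hsc : ((((N⁻¹ : ℝ) : ℂ) • spinV ξ.2), (Real.exp (-t) : ℂ) • perp (((N⁻¹ : ℝ) : ℂ) • spinV ξ.2))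
      = ((((N⁻¹ : ℝ) / radQ ξ.1 : ℝ) : ℂ) • (radQ ξ.1 : ℂ) • spinV ξ.2,
        (((N⁻¹ : ℝ) / radQ ξ.1 : ℝ) : ℂ) • (radM ξ.1 : ℂ) • perp (spinV ξ.2)) := by
    have hq' : (radQ ξ.1 : ℂ) ≠ 0 := by exact_mod_cast hq.ne'
    rw [hexp, perp_smul, Complex.conj_ofReal, smul_smul, smul_smul, smul_smul]
    congr 2
    · push_cast; field_simp
    · push_cast; field_simp
  have hd := hh.deriv_lt e t
  have hder := hasDerivAt_meanS hs ((((N⁻¹ : ℝ) : ℂ)) • spinV ξ.2)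
    (perp (((N⁻¹ : ℝ) : ℂ) • spinV ξ.2)) (-t) (by
      rw [hsc]; exact hg.smul rfl (by exact_mod_cast hNq))
  have hder2 := hder.scomp t (hasDerivAt_neg t)
  have hfun : circleMean h e = (fun τ : ℝ => meanS h ((((N⁻¹ : ℝ) : ℂ)) • spinV ξ.2,
      (Real.exp τ : ℂ) • perp (((N⁻¹ : ℝ) : ℂ) • spinV ξ.2))) ∘ fun t => -t := funext he
  rw [hfun, hder2.deriv, hsc, fluxS_smul hs hg rfl (by exact_mod_cast hNq)] at hd
  simpa using hd


/-! ### The radius equation -/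

/-- The logarithmic radius `τ` solves the radius equation of the pair `(T, V)`. -/
def RadiusEq (h : S2 → ℝ) (p : (ℂ × ℂ) × (ℂ × ℂ)) (τ : ℝ) : Prop :=
  GoodPair (p.1, (Real.exp τ : ℂ) • p.2) ∧ meanS h (p.1, (Real.exp τ : ℂ) • p.2) = τ

theorem meanS_of_const {h : S2 → ℝ} {p : (ℂ × ℂ) × (ℂ × ℂ)} {X : ℂ × ℂ} (hp : GoodPair p)
    (hX : ∀ θ : ℝ, ∃ c : ℂ, p.1 + ei θ • p.2 = c • X) : meanS h p = liftS h X := by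
  have : ∀ θ : ℝ, liftS h (p.1 + ei θ • p.2) = liftS h X := by
    intro θ
    obtain ⟨c, hc⟩ := hX θ
    rw [hc]
    refine liftS_smul h (fun h0 => hp θ ?_) X
    rw [hc, h0, zero_smul]
  simp only [meanS, this]
  rw [intervalIntegral.integral_const, sub_zero, smul_eq_mul, ← mul_assoc,
    inv_mul_cancel₀ (by positivity), one_mul]

theorem exp_smul_ne_zero (τ : ℝ) {V : ℂ × ℂ} (hV : V ≠ 0) : (Real.exp τ : ℂ) • V ≠ 0 :=
  smul_ne_zero (by exact_mod_cast (Real.exp_pos τ).ne') hV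

/-- Pairs `(T, V)` which do not represent a point of the real submanifold. -/
def NotReal (h : S2 → ℝ) (p : (ℂ × ℂ) × (ℂ × ℂ)) : Prop :=
  p ≠ 0 ∧ ¬ (p.1 ≠ 0 ∧ ∃ c : ℂ, p.2 = c • p.1 ∧ ‖c‖ = Real.exp (-liftS h p.1))

theorem goodPair_of_independent {T V : ℂ × ℂ} (hV : ¬ ∃ c : ℂ, V = c • T) (τ : ℝ) :
    GoodPair (T, (Real.exp τ : ℂ) • V) := by
  intro θ h0
  have hu : ei θ * (Real.exp τ : ℂ) ≠ 0 :=
    mul_ne_zero (ei_ne_zero θ) (by exact_mod_cast (Real.exp_pos τ).ne')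
  apply hV
  refine ⟨-(ei θ * (Real.exp τ : ℂ))⁻¹, ?_⟩
  simp only [smul_smul] at h0
  rw [neg_smul, eq_neg_of_add_eq_zero_left h0, smul_neg, neg_neg, inv_smul_smul₀ hu]

theorem strictMono_sub_meanS {h : S2 → ℝ} (hh : IsAdmissible h) {T V : ℂ × ℂ}
    (hV : ¬ ∃ c : ℂ, V = c • T) :
    StrictMono fun τ : ℝ => τ - meanS h (T, (Real.exp τ : ℂ) • V) := by
  refine strictMono_of_deriv_pos fun τ => ?_
  have hg := goodPair_of_independent hV τ
  have hd : HasDerivAt (fun τ : ℝ => τ - meanS h (T, (Real.exp τ : ℂ) • V)) _ τ :=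
    (hasDerivAt_id τ).sub (hasDerivAt_meanS hh.smooth T V τ hg)
  rw [hd.deriv]
  have := abs_lt.1 (abs_fluxS_lt_one hh hg)
  linarith

theorem abs_meanS_le {h : S2 → ℝ} {C : ℝ} (hC : ∀ v, |liftS h v| ≤ C)
    (p : (ℂ × ℂ) × (ℂ × ℂ)) : |meanS h p| ≤ C := by
  have h1 := intervalIntegral.norm_integral_le_of_norm_le_const (a := 0) (b := 2 * Real.pi)
    (f := fun θ => liftS h (p.1 + ei θ • p.2)) (C := C) fun θ _ => hC _
  rw [Real.norm_eq_abs, sub_zero, abs_of_pos Real.two_pi_pos] at h1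
  rw [meanS, abs_mul, abs_of_pos (inv_pos.2 Real.two_pi_pos)]
  calc (2 * Real.pi)⁻¹ * _ ≤ (2 * Real.pi)⁻¹ * (C * (2 * Real.pi)) := by gcongr
    _ = C := by field_simp

/-- For independent `T, V` the mean is bounded by `C`, so `τ - M` changes sign on `[-C, C]`. If `T =
0` or `V = c T`, the circle is a single point and `τ` must be the value of `h` there. The scaled
pair then fails to be good only if `|c| e^τ = 1`, which is membership in `P_h`. -/
theorem exists_radiusEq {h : S2 → ℝ} (hh : IsAdmissible h) {p : (ℂ × ℂ) × (ℂ × ℂ)}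
    (hp : NotReal h p) : ∃ τ, RadiusEq h p τ := by
  obtain ⟨T, V⟩ := p
  obtain ⟨h0, hP⟩ := hp
  by_cases hT : T = 0
  · subst hT
    have hV : V ≠ 0 := fun hV => h0 (by simp [hV])
    have hg : ∀ τ : ℝ, GoodPair ((0 : ℂ × ℂ), (Real.exp τ : ℂ) • V) := fun τ θ => by
      rw [zero_add]; exact smul_ne_zero (ei_ne_zero θ) (exp_smul_ne_zero τ hV)
    exact ⟨liftS h V, hg _, meanS_of_const (hg _) fun θ => ⟨_, by rw [zero_add, smul_smul]⟩⟩
  by_cases hV : ∃ c : ℂ, V = c • T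
  · obtain ⟨c, rfl⟩ := hV
    have hg : GoodPair (T, (Real.exp (liftS h T) : ℂ) • c • T) := by
      intro θ h1
      have h2 : (1 + ei θ * (Real.exp (liftS h T) * c)) • T = 0 := by
        rw [add_smul, one_smul, ← h1, smul_smul, smul_smul]
      have h3 := (smul_eq_zero.1 h2).resolve_right hT
      refine hP ⟨hT, c, rfl, ?_⟩
      have h4 : ‖ei θ * (Real.exp (liftS h T) * c)‖ = 1 := by
        rw [eq_neg_of_add_eq_zero_right h3]; simp
      rw [norm_mul, norm_ei, one_mul, norm_mul, Complex.norm_real, Real.norm_eq_abs,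
        Real.abs_exp] at h4
      rw [Real.exp_neg, eq_inv_of_mul_eq_one_right h4]
    refine ⟨liftS h T, hg, meanS_of_const hg fun θ => ⟨1 + ei θ * (Real.exp (liftS h T) * c), ?_⟩⟩
    rw [add_smul, one_smul, smul_smul, smul_smul]
  · obtain ⟨C, hC⟩ := exists_bound_liftS hh.smooth.continuous
    have hcont : Continuous fun τ : ℝ => τ - meanS h (T, (Real.exp τ : ℂ) • V) :=
      continuous_iff_continuousAt.2 fun τ => ((hasDerivAt_id τ).sub
        (hasDerivAt_meanS hh.smooth T V τ (goodPair_of_independent hV τ))).continuousAt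
    have hC0 : 0 ≤ C := (abs_nonneg _).trans (hC 0)
    have := intermediate_value_Icc (a := -C) (b := C) (by linarith) hcont.continuousOn
    obtain ⟨τ, -, hτ⟩ := this (show (0 : ℝ) ∈ Set.Icc _ _ from by
      constructor
      · have := abs_le.1 (abs_meanS_le hC (T, (Real.exp (-C) : ℂ) • V))
        linarith
      · have := abs_le.1 (abs_meanS_le hC (T, (Real.exp C : ℂ) • V))
        linarith)
    exact ⟨τ, goodPair_of_independent hV τ, by simp only at hτ ⊢; linarith⟩

theorem RadiusEq.unique {h : S2 → ℝ} (hh : IsAdmissible h) {p : (ℂ × ℂ) × (ℂ × ℂ)} {τ τ' : ℝ}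
    (h1 : RadiusEq h p τ) (h2 : RadiusEq h p τ') : τ = τ' := by
  obtain ⟨T, V⟩ := p
  by_cases hT : T = 0
  · subst hT
    have key : ∀ τ, RadiusEq h (0, V) τ → τ = liftS h V := fun τ hτ => by
      rw [← hτ.2]
      exact meanS_of_const hτ.1 fun θ => ⟨_, by rw [zero_add, smul_smul]⟩
    rw [key τ h1, key τ' h2]
  by_cases hV : ∃ c : ℂ, V = c • T
  · obtain ⟨c, rfl⟩ := hV
    have key : ∀ τ, RadiusEq h (T, c • T) τ → τ = liftS h T := fun τ hτ => by
      rw [← hτ.2]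
      refine meanS_of_const hτ.1 fun θ => ⟨1 + ei θ * (Real.exp τ * c), ?_⟩
      rw [add_smul, one_smul, smul_smul, smul_smul]
    rw [key τ h1, key τ' h2]
  · refine (strictMono_sub_meanS hh hV).injective ?_
    exact (sub_eq_zero.2 h1.2.symm).trans (sub_eq_zero.2 h2.2.symm).symm

open Classical in
/-- The solution of the radius equation. -/
def tauS (h : S2 → ℝ) (p : (ℂ × ℂ) × (ℂ × ℂ)) : ℝ :=
  -- The value `0` plays no role: `tauS` is only used where the equation has a solution.
  if hp : ∃ τ, RadiusEq h p τ then hp.choose else 0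

theorem radiusEq_tauS {h : S2 → ℝ} {p : (ℂ × ℂ) × (ℂ × ℂ)} (hp : ∃ τ, RadiusEq h p τ) :
    RadiusEq h p (tauS h p) := by
  rw [tauS, dif_pos hp]; exact hp.choose_spec

theorem RadiusEq.tauS_eq {h : S2 → ℝ} (hh : IsAdmissible h) {p : (ℂ × ℂ) × (ℂ × ℂ)} {τ : ℝ}
    (hp : RadiusEq h p τ) : tauS h p = τ := (radiusEq_tauS ⟨τ, hp⟩).unique hh hp

/-- Implicit function theorem for `τ - M(T, e^τ V)`, whose derivative in `τ` is `1 - flux > 0`.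
Global uniqueness identifies the local implicit function with `tauS`. Degenerate pairs need no
separate treatment here. -/
theorem contDiffAt_tauS {h : S2 → ℝ} (hh : IsAdmissible h) {p : (ℂ × ℂ) × (ℂ × ℂ)} {τ : ℝ}
    (hp : RadiusEq h p τ) :
    ContDiffAt ℝ ∞ (tauS h) p ∧ ∀ᶠ q in nhds p, ∃ τ, RadiusEq h q τ := by
  have hpath : ContDiff ℝ ∞ fun x : ((ℂ × ℂ) × (ℂ × ℂ)) × ℝ =>
      (x.1.1, (Real.exp x.2 : ℂ) • x.1.2) :=
    (contDiff_fst.comp contDiff_fst).prodMk ((Complex.ofRealCLM.contDiff.comp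
      (Real.contDiff_exp.comp contDiff_snd)).smul (contDiff_snd.comp contDiff_fst))
  have hm : ContDiffAt ℝ ∞ (meanS h) (p.1, (Real.exp τ : ℂ) • p.2) :=
    (contDiffOn_meanS hh.smooth).contDiffAt (isOpen_goodPair.mem_nhds hp.1)
  let f : ((ℂ × ℂ) × (ℂ × ℂ)) × ℝ → ℝ := fun x =>
    x.2 - meanS h (x.1.1, (Real.exp x.2 : ℂ) • x.1.2)
  have hf : ContDiffAt ℝ ∞ f (p, τ) :=
    contDiffAt_snd.sub (ContDiffAt.comp (g := meanS h) (p, τ) hm hpath.contDiffAt)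
  have hd : (fderiv ℝ f (p, τ)) (0, 1) = 1 - fluxS h (p.1, (Real.exp τ : ℂ) • p.2) := by
    have h1 := (hf.differentiableAt (by simp)).hasFDerivAt.comp_hasDerivAt τ
      ((hasDerivAt_const τ p).prodMk (hasDerivAt_id τ))
    exact h1.unique ((hasDerivAt_id τ).sub (hasDerivAt_meanS hh.smooth p.1 p.2 τ hp.1))
  have hd0 : (fderiv ℝ f (p, τ)) (0, 1) ≠ 0 := by
    rw [hd]
    have := abs_lt.1 (abs_fluxS_lt_one hh hp.1)
    linarith
  have hinv : (fderiv ℝ f (p, τ) ∘L .inr ℝ ((ℂ × ℂ) × (ℂ × ℂ)) ℝ).IsInvertible := by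
    refine ⟨ContinuousLinearEquiv.unitsEquivAut ℝ (Units.mk0 _ hd0), ?_⟩
    ext
    simp
  have hne : (∞ : WithTop ℕ∞) ≠ 0 := by simp
  have h0 : f (p, τ) = 0 := by simp only [f]; rw [hp.2, sub_self]
  have e1 := hf.eventually_apply_implicitFunction hne hinv
  have e2 := hf.contDiffAt_implicitFunction hne hinv
  have hgood : ∀ᶠ q in nhds p, GoodPair (q.1, (Real.exp (hf.implicitFunction hne hinv q) : ℂ) • q.2) := by
    have hc : ContinuousAt (fun q => (q, hf.implicitFunction hne hinv q)) p :=
      continuousAt_id.prodMk e2.continuousAt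
    have hc2 := ContinuousAt.comp (g := fun x : ((ℂ × ℂ) × (ℂ × ℂ)) × ℝ =>
      (x.1.1, (Real.exp x.2 : ℂ) • x.1.2)) hpath.continuous.continuousAt hc
    refine hc2 (isOpen_goodPair.mem_nhds ?_)
    have := hf.implicitFunction_apply_self hne hinv
    simp only [Function.comp] at this ⊢
    rw [this]
    exact hp.1
  have e3 : ∀ᶠ q in nhds p, RadiusEq h q (hf.implicitFunction hne hinv q) := by
    filter_upwards [e1, hgood] with q hq1 hq2
    refine ⟨hq2, ?_⟩
    rw [h0] at hq1
    simp only [f] at hq1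
    linarith
  refine ⟨e2.congr_of_eventuallyEq ?_, e3.mono fun q hq => ⟨_, hq⟩⟩
  filter_upwards [e3] with q hq
  exact hq.tauS_eq hh

/-! ### The twist map -/

/-- The pairs for which the radius equation can be solved. -/
def solvable (h : S2 → ℝ) : Set ((ℂ × ℂ) × (ℂ × ℂ)) := {p | ∃ τ, RadiusEq h p τ}

theorem isOpen_solvable {h : S2 → ℝ} (hh : IsAdmissible h) : IsOpen (solvable h) :=
  isOpen_iff_mem_nhds.2 fun _ ⟨_, hτ⟩ => (contDiffAt_tauS hh hτ).2

/-- The map `(T, V) ↦ (exp S • T, V)`, `S` the Schwarz integral, which sends the disks for `h = 0` to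
those for `h`. -/
def twist (h : S2 → ℝ) (p : (ℂ × ℂ) × (ℂ × ℂ)) : (ℂ × ℂ) × (ℂ × ℂ) :=
  (Complex.exp (schwarz h p) • p.1, p.2)

/-- The inverse of `twist`. -/
def untwist (h : S2 → ℝ) (p : (ℂ × ℂ) × (ℂ × ℂ)) : (ℂ × ℂ) × (ℂ × ℂ) :=
  (Complex.exp (-schwarz h (p.1, (Real.exp (tauS h p) : ℂ) • p.2)) • p.1, p.2)

section

variable {h : S2 → ℝ} (hh : IsAdmissible h) {p : (ℂ × ℂ) × (ℂ × ℂ)}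

include hh

theorem norm_exp_schwarz (hp : GoodPair p) :
    ‖Complex.exp (schwarz h p)‖ = Real.exp (meanS h p) := by
  rw [Complex.norm_exp, re_schwarz hh.smooth hp]

omit hh in
theorem twist_eq_smul :
    ((twist h p).1, (Real.exp (meanS h p) : ℂ) • (twist h p).2) =
      (Complex.exp (schwarz h p) • p.1, (Real.exp (meanS h p) : ℂ) • p.2) := rfl

theorem norm_exp_schwarz' (hp : GoodPair p) :
    ‖Complex.exp (schwarz h p)‖ = ‖(Real.exp (meanS h p) : ℂ)‖ := by
  rw [norm_exp_schwarz hh hp, Complex.norm_real, Real.norm_eq_abs, Real.abs_exp]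

/-- The origin of the radius equation: `|exp S| = e^M`, so `(exp S T, e^M V)` arises from `(T, V)`
by factors of equal modulus and has the same mean `M`. Thus `M` solves the equation of the twisted
pair. -/
theorem radiusEq_twist (hp : GoodPair p) : RadiusEq h (twist h p) (meanS h p) := by
  refine ⟨?_, ?_⟩
  · rw [twist_eq_smul]
    exact hp.smul (norm_exp_schwarz' hh hp) (Complex.exp_ne_zero _)
  · rw [twist_eq_smul]
    exact meanS_smul hh.smooth hp (norm_exp_schwarz' hh hp) (Complex.exp_ne_zero _)

theorem untwist_twist (hp : GoodPair p) : untwist h (twist h p) = p := by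
  rw [untwist, (radiusEq_twist hh hp).tauS_eq hh, twist_eq_smul,
    schwarz_smul h p (norm_exp_schwarz' hh hp) (Complex.exp_ne_zero _)]
  apply Prod.ext
  · simp only [twist]
    rw [smul_smul, ← Complex.exp_add, neg_add_cancel, Complex.exp_zero, one_smul]
  · rfl

omit hh in
theorem untwist_eq_smul :
    untwist h p = (Complex.exp (-schwarz h (p.1, (Real.exp (tauS h p) : ℂ) • p.2)) • p.1,
      (Real.exp (-tauS h p) : ℂ) • (Real.exp (tauS h p) : ℂ) • p.2) := by
  rw [untwist, smul_smul, ← Complex.ofReal_mul, ← Real.exp_add, neg_add_cancel, Real.exp_zero,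
    Complex.ofReal_one, one_smul]

theorem norm_untwist_factor (hp : p ∈ solvable h) :
    ‖Complex.exp (-schwarz h (p.1, (Real.exp (tauS h p) : ℂ) • p.2))‖ =
      ‖(Real.exp (-tauS h p) : ℂ)‖ := by
  have hτ := radiusEq_tauS hp
  rw [Complex.norm_exp, Complex.neg_re, re_schwarz hh.smooth hτ.1, hτ.2, Complex.norm_real,
    Real.norm_eq_abs, Real.abs_exp]

theorem goodPair_untwist (hp : p ∈ solvable h) : GoodPair (untwist h p) := by
  rw [untwist_eq_smul]
  exact (radiusEq_tauS hp).1.smul (norm_untwist_factor hh hp) (Complex.exp_ne_zero _)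

/-- By `untwist_eq_smul` the untwisted pair is `(T, e^τ V)` with both entries multiplied by factors
of modulus `e^{-τ}`, so `schwarz` takes the same value on both and the exponentials cancel. -/
theorem twist_untwist (hp : p ∈ solvable h) : twist h (untwist h p) = p := by
  have h1 : schwarz h (untwist h p) = schwarz h (p.1, (Real.exp (tauS h p) : ℂ) • p.2) := by
    rw [untwist_eq_smul]
    exact schwarz_smul h (p.1, (Real.exp (tauS h p) : ℂ) • p.2) (norm_untwist_factor hh hp)
      (Complex.exp_ne_zero _)
  rw [twist, h1]
  apply Prod.ext
  · simp only [untwist]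
    rw [smul_smul, ← Complex.exp_add, add_neg_cancel, Complex.exp_zero, one_smul]
  · rfl

theorem twist_mem_solvable (hp : GoodPair p) : twist h p ∈ solvable h :=
  ⟨_, radiusEq_twist hh hp⟩

omit hh in
theorem twist_smul {u v : ℂ} (huv : ‖u‖ = ‖v‖) (hu : u ≠ 0) :
    twist h (u • p.1, v • p.2) = (u • (twist h p).1, v • (twist h p).2) := by
  rw [twist, schwarz_smul h p huv hu, twist, smul_comm]

theorem solvable_smul (hp : p ∈ solvable h) {u v : ℂ} (huv : ‖u‖ = ‖v‖) (hu : u ≠ 0) :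
    (u • p.1, v • p.2) ∈ solvable h := by
  rw [← twist_untwist hh hp, ← twist_smul huv hu]
  exact twist_mem_solvable hh ((goodPair_untwist hh hp).smul huv hu)

theorem untwist_smul (hp : p ∈ solvable h) {u v : ℂ} (huv : ‖u‖ = ‖v‖) (hu : u ≠ 0) :
    untwist h (u • p.1, v • p.2) = (u • (untwist h p).1, v • (untwist h p).2) := by
  conv_lhs => rw [← twist_untwist hh hp]
  rw [← twist_smul huv hu, untwist_twist hh ((goodPair_untwist hh hp).smul huv hu)]

theorem contDiffOn_twist : ContDiffOn ℝ ∞ (twist h) {p | GoodPair p} :=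
  ((contDiffOn_schwarz hh.smooth).cexp.smul contDiff_fst.contDiffOn).prodMk
    contDiff_snd.contDiffOn

theorem contDiffOn_untwist : ContDiffOn ℝ ∞ (untwist h) (solvable h) := by
  intro p hp
  apply ContDiffAt.contDiffWithinAt
  have hτ := radiusEq_tauS hp
  have h1 := (contDiffAt_tauS hh hτ).1
  have h2 : ContDiffAt ℝ ∞ (fun p : (ℂ × ℂ) × (ℂ × ℂ) =>
      (p.1, (Real.exp (tauS h p) : ℂ) • p.2)) p :=
    contDiffAt_fst.prodMk ((Complex.ofRealCLM.contDiff.contDiffAt.comp p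
      (Real.contDiff_exp.contDiffAt.comp p h1)).smul contDiffAt_snd)
  have h3 : ContDiffAt ℝ ∞ (schwarz h) (p.1, (Real.exp (tauS h p) : ℂ) • p.2) :=
    (contDiffOn_schwarz hh.smooth).contDiffAt (isOpen_goodPair.mem_nhds hτ.1)
  have h4 := ContDiffAt.comp (g := schwarz h) p h3 h2
  exact (h4.neg.cexp.smul contDiffAt_fst).prodMk contDiffAt_snd

theorem mk_notMem_realP_iff {z : Fin 4 → ℂ} (hz : z ≠ 0) :
    (Projectivization.mk ℂ z hz : CP3) ∉ realP h ↔ (topOf z, botOf z) ∈ solvable h := by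
  constructor
  · intro hP
    refine exists_radiusEq hh ⟨fun h0 => hz (topOf_botOf_eq_zero.2 ?_), fun h1 =>
      hP ((mk_mem_realP h hz).2 h1)⟩
    exact ⟨congrArg Prod.fst h0, congrArg Prod.snd h0⟩
  · rintro ⟨τ, hg, hτ⟩
    have e : ((Real.exp τ : ℂ)⁻¹ • topOf z, botOf z) = ((Real.exp τ : ℂ)⁻¹ • topOf z,
        (Real.exp τ : ℂ)⁻¹ • (Real.exp τ : ℂ) • botOf z) := by
      rw [inv_smul_smul₀ (by exact_mod_cast (Real.exp_pos τ).ne')]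
    have h0 : (Real.exp τ : ℂ)⁻¹ ≠ 0 := inv_ne_zero (by exact_mod_cast (Real.exp_pos τ).ne')
    refine not_mem_realP_of_goodPair hz (E := (Real.exp τ : ℂ)) ?_ ?_
    · rw [e, meanS_smul hh.smooth hg rfl h0, hτ, Complex.norm_real, Real.norm_eq_abs, Real.abs_exp]
    · rw [e]; exact hg.smul rfl h0

/-! ### The disks cover the complement of the real submanifold and are disjoint -/

theorem diskVec_eq_twist (ξ : S2 × S2) {w : ℂ} (hw : ‖w‖ < 1) :
    (topOf (diskVec h ξ w), botOf (diskVec h ξ w)) =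
      twist h ((-Complex.I * phase ξ.1) • topV ξ w, botV ξ w) := by
  have hph : ‖-Complex.I * phase ξ.1‖ = ‖(1 : ℂ)‖ := by simp [norm_phase]
  have hph0 : -Complex.I * phase ξ.1 ≠ 0 := mul_ne_zero (by simp) (phase_ne_zero _)
  have := schwarz_smul h (topV ξ w, botV ξ w) hph hph0
  rw [one_smul] at this
  rw [topOf_diskVec, botOf_diskVec, twist, this, factorE_eq_exp_schwarz hh.smooth ξ hw, smul_smul,
    mul_comm]

end

theorem goodPair_disk' (ξ : S2 × S2) {w : ℂ} (hw : ‖w‖ < 1) :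
    GoodPair ((-Complex.I * phase ξ.1) • topV ξ w, botV ξ w) := by
  have := (goodPair_disk ξ hw).smul (u := -Complex.I * phase ξ.1) (v := 1) (by simp [norm_phase])
    (mul_ne_zero (by simp) (phase_ne_zero _))
  rwa [one_smul] at this

/-- As `twist` commutes with the action of scalars, membership in a disk for `h` becomes membership
of the untwisted pair in the disk for `h = 0`. -/
theorem mk_mem_diskInterior_iff {h : S2 → ℝ} (hh : IsAdmissible h) {z : Fin 4 → ℂ} (hz : z ≠ 0)
    (hs : (topOf z, botOf z) ∈ solvable h) (ξ : S2 × S2) :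
    (Projectivization.mk ℂ z hz : CP3) ∈ diskInterior h ξ ↔ ∃ w c : ℂ, ‖w‖ < 1 ∧ c ≠ 0 ∧
      (untwist h (topOf z, botOf z)).1 = c • (-Complex.I * phase ξ.1) • topV ξ w ∧
      (untwist h (topOf z, botOf z)).2 = conj c • botV ξ w := by
  constructor
  · rintro ⟨w, hw, heq⟩
    rw [mem_ball_zero_iff] at hw
    obtain ⟨c, hc, he⟩ := (mk_eq_mk_iff_exists hz _).1 heq.symm
    refine ⟨w, c, hw, hc, ?_⟩
    have h1 : (topOf z, botOf z) = twist h (c • (-Complex.I * phase ξ.1) • topV ξ w,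
        conj c • botV ξ w) := by
      rw [twist_smul (p := ((-Complex.I * phase ξ.1) • topV ξ w, botV ξ w)) (by simp) hc,
        ← diskVec_eq_twist hh ξ hw, he, topOf_smul, botOf_smul]
    have h2 := (goodPair_disk' ξ hw).smul (u := c) (v := conj c) (by simp) hc
    rw [h1, untwist_twist hh h2]
    exact ⟨rfl, rfl⟩
  · rintro ⟨w, c, hw, hc, h1, h2⟩
    refine ⟨w, mem_ball_zero_iff.2 hw, ((mk_eq_mk_iff_exists hz _).2 ⟨c, hc, ?_⟩).symm⟩
    have h3 : (topOf z, botOf z) = (topOf (c • diskVec h ξ w), botOf (c • diskVec h ξ w)) := by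
      rw [← twist_untwist hh hs, show untwist h (topOf z, botOf z) =
        (c • (-Complex.I * phase ξ.1) • topV ξ w, conj c • botV ξ w) from Prod.ext h1 h2,
        twist_smul (p := ((-Complex.I * phase ξ.1) • topV ξ w, botV ξ w)) (by simp) hc,
        ← diskVec_eq_twist hh ξ hw, topOf_smul, botOf_smul]
    exact ext_topOf_botOf (congrArg Prod.fst h3) (congrArg Prod.snd h3)

theorem iUnion_diskInterior {h : S2 → ℝ} (hh : IsAdmissible h) :
    ⋃ ξ, diskInterior h ξ = (realP h)ᶜ := by
  ext p
  induction p using Projectivization.ind with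
  | h z hz =>
  rw [Set.mem_iUnion, Set.mem_compl_iff, mk_notMem_realP_iff hh hz]
  constructor
  · rintro ⟨ξ, w, hw, heq⟩
    rw [← mk_notMem_realP_iff hh hz, ← heq]
    exact diskMap_not_mem_realP ξ w hh.smooth (mem_ball_zero_iff.1 hw)
  · intro hs
    obtain ⟨ξ, w, c, hw, hc, h1, h2⟩ := exists_disk_of_goodPair (goodPair_untwist hh hs)
    refine ⟨ξ, (mk_mem_diskInterior_iff hh hz hs ξ).2 ⟨w, c⁻¹, hw, inv_ne_zero hc, ?_, ?_⟩⟩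
    · rw [← h1, inv_smul_smul₀ hc]
    · rw [← h2, map_inv₀, inv_smul_smul₀ (by simpa using hc)]

theorem disjoint_diskInterior {h : S2 → ℝ} (hh : IsAdmissible h) :
    Pairwise fun ξ ξ' => Disjoint (diskInterior h ξ) (diskInterior h ξ') := by
  intro ξ ξ' hne
  rw [Set.disjoint_left]
  intro p hp hp'
  apply hne
  induction p using Projectivization.ind with
  | h z hz =>
  have hs : (topOf z, botOf z) ∈ solvable h := by
    rw [← mk_notMem_realP_iff hh hz, ← Set.mem_compl_iff, ← iUnion_diskInterior hh]
    exact Set.mem_iUnion.2 ⟨ξ, hp⟩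
  obtain ⟨w, c, hw, hc, h1, h2⟩ := (mk_mem_diskInterior_iff hh hz hs ξ).1 hp
  obtain ⟨w', c', hw', hc', h1', h2'⟩ := (mk_mem_diskInterior_iff hh hz hs ξ').1 hp'
  have hcc : conj c ≠ 0 := by simpa using hc
  refine eq_of_smul_disk_eq (c := c⁻¹ * c') hw hw' ?_ ?_
  · rw [mul_smul c⁻¹ c', ← h1', h1, inv_smul_smul₀ hc]
  · rw [map_mul, map_inv₀, mul_smul, ← h2', h2, inv_smul_smul₀ hcc]

theorem isConnected_diskInterior {h : S2 → ℝ} (hh : IsAdmissible h) (ξ : S2 × S2) :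
    IsConnected (diskInterior h ξ) := by
  refine ((convex_ball (0 : ℂ) 1).isConnected ⟨0, by simp⟩).image _ ?_
  exact (isHolomorphicDisk ξ hh.smooth).continuousOn.mono Metric.ball_subset_closedBall


/-! ### Charts of projective space given by homogeneous functions -/

theorem contDiff_insertNth (i : Fin 4) :
    ContDiff ℝ ∞ fun w : Fin 3 → ℂ => (i.insertNth (1 : ℂ) w : Fin 4 → ℂ) := by
  rw [contDiff_pi]
  intro l
  refine Fin.succAboveCases i ?_ (fun m => ?_) l
  · simpa using contDiff_const
  · simpa using contDiff_apply ℝ ℂ m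

/-- A map of degree zero on an open cone, together with a smooth section, descends to a chart of the
quotient. The transition maps to an affine chart are computed on vectors, through `g` in one
direction and through the slice `z_i = 1` in the other. This suits coordinates that are built from
`untwist` and hence live on vectors. -/
theorem exists_chart_of_homogeneous {f : (Fin 4 → ℂ) → Fin 3 → ℂ} {g : (Fin 3 → ℂ) → Fin 4 → ℂ}
    {O : Set (Fin 4 → ℂ)} {B : Set (Fin 3 → ℂ)} (hO : IsOpen O) (hB : IsOpen B)
    (hsm : ∀ v ∈ O, ∀ c : ℂ, c ≠ 0 → c • v ∈ O ∧ f (c • v) = f v)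
    (hf : ContDiffOn ℝ ∞ f O) (hg : ContDiffOn ℝ ∞ g B) (hg0 : ∀ m, g m ≠ 0)
    (hfB : ∀ v ∈ O, f v ∈ B) (hgO : ∀ m ∈ B, g m ∈ O) (hfg : ∀ m ∈ B, f (g m) = m)
    (hgf : ∀ v ∈ O, ∃ c : ℂ, c ≠ 0 ∧ v = c • g (f v)) :
    ∃ φ ∈ IsManifold.maximalAtlas 𝓘(ℝ, Fin 3 → ℂ) ∞ CP3, φ.target = B ∧
      ∀ (v : Fin 4 → ℂ) (hv : v ≠ 0), ((Projectivization.mk ℂ v hv : CP3) ∈ φ.source ↔ v ∈ O) ∧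
        (v ∈ O → φ (Projectivization.mk ℂ v hv) = f v) := by
  have hmem : ∀ {v : Fin 4 → ℂ} {c : ℂ}, c ≠ 0 → (c • v ∈ O ↔ v ∈ O) := fun {v c} hc =>
    ⟨fun h => by simpa [smul_smul, inv_mul_cancel₀ hc] using (hsm _ h c⁻¹ (inv_ne_zero hc)).1,
      fun h => (hsm v h c hc).1⟩
  have hrep : ∀ (v : Fin 4 → ℂ) (hv : v ≠ 0),
      (((Projectivization.mk ℂ v hv : CP3).rep ∈ O) ↔ v ∈ O) ∧
        (v ∈ O → f (Projectivization.mk ℂ v hv : CP3).rep = f v) := fun v hv => by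
    obtain ⟨c, hc, h⟩ := rep_mk v hv
    rw [h]
    exact ⟨hmem hc, fun hvO => (hsm v hvO c hc).2⟩
  have hpre : (Projectivization.mk' ℂ : {v : Fin 4 → ℂ // v ≠ 0} → CP3) ⁻¹' {p | p.rep ∈ O} =
      {v | v.1 ∈ O} := by
    ext v
    exact (hrep v.1 v.2).1
  have hopen : IsOpen {p : CP3 | p.rep ∈ O} := by
    rw [← isQuotientMap_mk'.isOpen_preimage, hpre]
    exact hO.preimage continuous_subtype_val
  let φ : OpenPartialHomeomorph CP3 (Fin 3 → ℂ) :=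
    { toFun := fun p => f p.rep
      invFun := fun m => Projectivization.mk ℂ (g m) (hg0 m)
      source := {p | p.rep ∈ O}
      target := B
      map_source' := fun p hp => hfB _ hp
      map_target' := fun m hm => (hrep _ _).1.2 (hgO m hm)
      left_inv' := fun p hp => by
        obtain ⟨c, hc, h⟩ := hgf _ hp
        conv_rhs => rw [← p.mk_rep]
        exact ((mk_eq_mk_iff_exists _ _).2 ⟨c, hc, h⟩).symm
      right_inv' := fun m hm => ((hrep _ _).2 (hgO m hm)).trans (hfg m hm)
      open_source := hopen
      open_target := hB
      continuousOn_toFun := by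
        rw [isQuotientMap_mk'.continuousOn_isOpen_iff hopen, hpre]
        refine (hf.continuousOn.comp continuous_subtype_val.continuousOn fun v hv => hv).congr ?_
        intro v hv
        exact (hrep v.1 v.2).2 hv
      continuousOn_invFun := continuousOn_mk hg.continuousOn hg0 }
  refine ⟨φ, ?_, rfl, fun v hv => hrep v hv⟩
  rw [IsManifold.mem_maximalAtlas_iff, mem_maximalAtlas_iff]
  rintro _ ⟨i, rfl⟩
  have k1 : ContDiffOn ℝ ∞ (fun m => affineCoord i (Projectivization.mk ℂ (g m) (hg0 m)))
      (φ.symm ≫ₕ affineChart i).source := by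
    have h1 : ∀ m ∈ (φ.symm ≫ₕ affineChart i).source, m ∈ B ∧ g m i ≠ 0 := by
      intro m hm
      have hm' : m ∈ B ∧ (Projectivization.mk ℂ (g m) (hg0 m) : CP3).rep i ≠ 0 := hm
      obtain ⟨c, hc, h⟩ := rep_mk (g m) (hg0 m)
      rw [h] at hm'
      exact ⟨hm'.1, right_ne_zero_of_mul hm'.2⟩
    have hgi : ∀ k, ContDiffOn ℝ ∞ (fun m => g m k) (φ.symm ≫ₕ affineChart i).source :=
      fun k => (contDiffOn_pi.1 hg k).mono fun m hm => (h1 m hm).1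
    simp only [affineCoord_mk, contDiffOn_pi, div_eq_mul_inv]
    exact fun j => (hgi _).mul ((hgi i).inv fun m hm => (h1 m hm).2)
  have k2 : ContDiffOn ℝ ∞ (fun w : Fin 3 → ℂ => f (Projectivization.mk ℂ
      (i.insertNth (1 : ℂ) w : Fin 4 → ℂ) (insertNth_ne_zero i w) : CP3).rep)
      ((affineChart i).symm ≫ₕ φ).source := by
    have h1 : ∀ w ∈ ((affineChart i).symm ≫ₕ φ).source,
        (i.insertNth (1 : ℂ) w : Fin 4 → ℂ) ∈ O := fun w hw => (hrep _ _).1.1 hw.2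
    exact (hf.comp (contDiff_insertNth i).contDiffOn h1).congr fun w hw => (hrep _ _).2 (h1 w hw)
  change ContDiffOn ℝ ∞ (affineChart i ∘ φ.symm) _ at k1
  change ContDiffOn ℝ ∞ (φ ∘ (affineChart i).symm) _ at k2
  constructor
  · refine mem_groupoid_of_pregroupoid.2 ⟨?_, ?_⟩
    · simpa [contDiffPregroupoid] using k1
    · simpa [contDiffPregroupoid, OpenPartialHomeomorph.trans_symm_eq_symm_trans_symm] using k2
  · refine mem_groupoid_of_pregroupoid.2 ⟨?_, ?_⟩
    · simpa [contDiffPregroupoid] using k2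
    · simpa [contDiffPregroupoid, OpenPartialHomeomorph.trans_symm_eq_symm_trans_symm] using k1

/-! ### Real coordinates -/

/-- Linear coordinates in which the real submanifold for `h = 0` consists of the real points. -/
def realCoord (p : (ℂ × ℂ) × (ℂ × ℂ)) : Fin 4 → ℂ :=
  ![p.1.1 + conj p.2.1, Complex.I * (p.1.1 - conj p.2.1), p.1.2 + conj p.2.2,
    Complex.I * (p.1.2 - conj p.2.2)]

/-- The inverse of `realCoord`. -/
def pairOfReal (R : Fin 4 → ℂ) : (ℂ × ℂ) × (ℂ × ℂ) :=
  (((R 0 - Complex.I * R 1) / 2, (R 2 - Complex.I * R 3) / 2),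
    (conj ((R 0 + Complex.I * R 1) / 2), conj ((R 2 + Complex.I * R 3) / 2)))

theorem pairOfReal_realCoord (p : (ℂ × ℂ) × (ℂ × ℂ)) : pairOfReal (realCoord p) = p := by
  have hI := Complex.I_mul_I
  refine Prod.ext (Prod.ext ?_ ?_) (Prod.ext ?_ ?_)
  · simp [pairOfReal, realCoord]; linear_combination -(p.1.1 - conj p.2.1) / 2 * hI
  · simp [pairOfReal, realCoord]; linear_combination -(p.1.2 - conj p.2.2) / 2 * hI
  · apply (starRingEnd ℂ).injective
    simp [pairOfReal, realCoord]; linear_combination (p.1.1 - conj p.2.1) / 2 * hI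
  · apply (starRingEnd ℂ).injective
    simp [pairOfReal, realCoord]; linear_combination (p.1.2 - conj p.2.2) / 2 * hI

theorem realCoord_pairOfReal (R : Fin 4 → ℂ) : realCoord (pairOfReal R) = R := by
  have hI := Complex.I_mul_I
  funext k
  fin_cases k
  · simp [pairOfReal, realCoord]; ring
  · simp [pairOfReal, realCoord]; linear_combination -R 1 * hI
  · simp [pairOfReal, realCoord]; ring
  · simp [pairOfReal, realCoord]; linear_combination -R 3 * hI

theorem realCoord_smul (c : ℂ) (p : (ℂ × ℂ) × (ℂ × ℂ)) :
    realCoord (c • p.1, conj c • p.2) = c • realCoord p := by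
  funext k
  fin_cases k <;> simp [realCoord] <;> ring

theorem contDiff_realCoord : ContDiff ℝ ∞ realCoord := by
  have h1 : ContDiff ℝ ∞ fun p : (ℂ × ℂ) × (ℂ × ℂ) => p.1.1 := contDiff_fst.comp contDiff_fst
  have h2 : ContDiff ℝ ∞ fun p : (ℂ × ℂ) × (ℂ × ℂ) => p.1.2 := contDiff_snd.comp contDiff_fst
  have h3 : ContDiff ℝ ∞ fun p : (ℂ × ℂ) × (ℂ × ℂ) => conj p.2.1 :=
    contDiff_conj.comp (contDiff_fst.comp contDiff_snd)
  have h4 : ContDiff ℝ ∞ fun p : (ℂ × ℂ) × (ℂ × ℂ) => conj p.2.2 :=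
    contDiff_conj.comp (contDiff_snd.comp contDiff_snd)
  rw [contDiff_pi]
  intro k
  fin_cases k
  · exact h1.add h3
  · exact contDiff_const.mul (h1.sub h3)
  · exact h2.add h4
  · exact contDiff_const.mul (h2.sub h4)

theorem contDiff_pairOfReal : ContDiff ℝ ∞ pairOfReal := by
  have h := fun k => contDiff_apply ℝ ℂ (ι := Fin 4) (n := ∞) k
  refine ContDiff.prodMk (ContDiff.prodMk ?_ ?_) (ContDiff.prodMk ?_ ?_)
  · exact ((h 0).sub (contDiff_const.mul (h 1))).div_const 2
  · exact ((h 2).sub (contDiff_const.mul (h 3))).div_const 2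
  · exact contDiff_conj.comp (((h 0).add (contDiff_const.mul (h 1))).div_const 2)
  · exact contDiff_conj.comp (((h 2).add (contDiff_const.mul (h 3))).div_const 2)

/-- The Plücker coordinates of the real plane spanned by the real and imaginary part of `R`. -/
def plu (R : Fin 4 → ℂ) (k l : Fin 4) : ℝ := (R k * conj (R l)).im

theorem plu_smul (c : ℂ) (R : Fin 4 → ℂ) (k l : Fin 4) :
    plu (c • R) k l = ‖c‖ ^ 2 * plu R k l := by
  simp only [plu, Pi.smul_apply, smul_eq_mul, map_mul]
  rw [mul_mul_mul_comm, ← ofReal_norm_sq, ← Complex.ofReal_pow, Complex.im_ofReal_mul]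

theorem plu_swap (R : Fin 4 → ℂ) (k l : Fin 4) : plu R k l = -plu R l k := by
  simp only [plu, Complex.mul_im, Complex.conj_re, Complex.conj_im]; ring

/-- The map `z ↦ c z + d conj z` of the real plane `ℂ` has determinant `|c|² - |d|²`. -/
theorem plu_add_conj (X : Fin 4 → ℂ) (c d : ℂ) (k l : Fin 4) :
    plu (fun k => c * X k + d * conj (X k)) k l = (‖c‖ ^ 2 - ‖d‖ ^ 2) * plu X k l := by
  simp only [plu, Complex.sq_norm, Complex.normSq_apply, Complex.mul_im, Complex.mul_re,
    Complex.add_re, Complex.add_im, Complex.conj_re, Complex.conj_im]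
  ring

theorem contDiff_plu (k l : Fin 4) : ContDiff ℝ ∞ fun R => plu R k l :=
  Complex.imCLM.contDiff.comp ((contDiff_apply ℝ ℂ k).mul
    (contDiff_conj.comp (contDiff_apply ℝ ℂ l)))

/-- Cramer's rule in the real plane `ℂ`: if `plu R 1 0 ≠ 0`, every `R k` is a real combination of `R
1` and `R 0`, with ratios of Plücker coordinates as coefficients. These coefficients for `k = 2, 3`
are the transverse foliation coordinates. -/
theorem plu_relation (R : Fin 4 → ℂ) (k : Fin 4) :
    (plu R 1 0 : ℂ) * R k = plu R k 0 * R 1 - plu R k 1 * R 0 := by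
  apply Complex.ext <;> simp [plu] <;> ring

/-- If `T + ζ V = 0`, then `conj R = -conj ζ R`, so `R` is a unimodular multiple of a real vector
and all Plücker coordinates vanish. -/
theorem goodPair_of_plu {p : (ℂ × ℂ) × (ℂ × ℂ)} {k l : Fin 4} (hkl : plu (realCoord p) k l ≠ 0) :
    GoodPair p := by
  intro θ h0
  apply hkl
  have h1 : p.1.1 = -(ei θ * p.2.1) := eq_neg_of_add_eq_zero_left (congrArg Prod.fst h0)
  have h2 : p.1.2 = -(ei θ * p.2.2) := eq_neg_of_add_eq_zero_left (congrArg Prod.snd h0)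
  have he := ei_mul_conj θ
  have key : ∀ k, conj (realCoord p k) = -conj (ei θ) * realCoord p k := by
    intro k
    fin_cases k
    · simp [realCoord, h1]; linear_combination -p.2.1 * he
    · simp [realCoord, h1]; linear_combination Complex.I * p.2.1 * he
    · simp [realCoord, h2]; linear_combination -p.2.2 * he
    · simp [realCoord, h2]; linear_combination Complex.I * p.2.2 * he
  have h3 : plu (realCoord p) k l = plu (realCoord p) l k := by
    simp only [plu, key]; congr 1; ring
  have := plu_swap (realCoord p) k l
  linarith

/-- If all coordinates vanish, `R` is a complex multiple of a real vector, and the phase of that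
multiple gives a `ζ` with `T + ζ V = 0`. Otherwise antisymmetry allows the sign to be chosen. -/
theorem GoodPair.exists_plu_pos {p : (ℂ × ℂ) × (ℂ × ℂ)} (hp : GoodPair p) :
    ∃ k l, k ≠ l ∧ 0 < plu (realCoord p) k l := by
  by_contra! hcon
  have hz : ∀ k l, plu (realCoord p) k l = 0 := by
    intro k l
    by_cases hkl : k = l
    · subst hkl
      have := plu_swap (realCoord p) k k
      linarith
    · have h1 := hcon k l hkl
      have h2 := hcon l k (Ne.symm hkl)
      have h3 := plu_swap (realCoord p) k l
      linarith
  have hR : ∃ l, realCoord p l ≠ 0 := by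
    by_contra! h0
    have h1 : realCoord p = realCoord 0 := by
      rw [show realCoord p = 0 from funext h0]
      funext k; fin_cases k <;> simp [realCoord]
    have h2 : p = 0 := by rw [← pairOfReal_realCoord p, h1, pairOfReal_realCoord]
    exact hp 0 (by simp [h2])
  obtain ⟨l, hl⟩ := hR
  set r := realCoord p l with hr
  have hrc : conj r ≠ 0 := by simpa using hl
  have hreal : ∀ k, realCoord p k * conj r = r * conj (realCoord p k) := by
    intro k
    have h1 : (realCoord p k * conj r).im = 0 := hz k l
    have h2 := Complex.conj_eq_iff_im.2 h1
    rw [← h2]; simp [mul_comm]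
  obtain ⟨θ, hθ⟩ := exists_ei_eq (w := -(r / conj r)) (by
    rw [norm_neg, norm_div, Complex.norm_conj, div_self (norm_ne_zero_iff.2 hl)])
  apply hp θ
  have e : ∀ x y : ℂ, x * conj r = r * y → x + -(r / conj r) * y = 0 := fun x y hxy => by
    field_simp
    linear_combination hxy
  have hI := Complex.I_mul_I
  have h0 := hreal 0
  have h1 := hreal 1
  have h2 := hreal 2
  have h3 := hreal 3
  simp only [realCoord, Matrix.cons_val_zero, Matrix.cons_val_one, Matrix.cons_val, map_add,
    map_sub, map_mul, Complex.conj_conj, Complex.conj_I] at h0 h1 h2 h3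
  rw [hθ]
  refine Prod.ext (e _ _ ?_) (e _ _ ?_)
  · linear_combination (1 / 2) * h0 - (Complex.I / 2) * h1 + (1 / 2) * (p.1.1 * conj r -
      conj p.2.1 * conj r + r * (conj p.1.1 - p.2.1)) * hI
  · linear_combination (1 / 2) * h2 - (Complex.I / 2) * h3 + (1 / 2) * (p.1.2 * conj r -
      conj p.2.2 * conj r + r * (conj p.1.2 - p.2.2)) * hI

/-! ### The foliation coordinates -/

/-- Coordinates on the region `plu R 1 0 > 0`, constant along the leaves except for the first. -/
def foliCoord (R : Fin 4 → ℂ) : Fin 3 → ℂ :=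
  ![R 1 / R 0, ⟨-plu R 2 1 / plu R 1 0, plu R 2 0 / plu R 1 0⟩,
    ⟨-plu R 3 1 / plu R 1 0, plu R 3 0 / plu R 1 0⟩]

/-- The inverse of `foliCoord`. -/
def foliVec (m : Fin 3 → ℂ) : Fin 4 → ℂ :=
  ![1, m 0, (m 1).im * m 0 + (m 1).re, (m 2).im * m 0 + (m 2).re]

theorem ne_zero_of_plu {R : Fin 4 → ℂ} (hR : 0 < plu R 1 0) : R 0 ≠ 0 := fun h => by
  simp [plu, h] at hR

theorem smul_foliVec_foliCoord {R : Fin 4 → ℂ} (hR : 0 < plu R 1 0) :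
    R 0 • foliVec (foliCoord R) = R := by
  have h0 := ne_zero_of_plu hR
  have hp : (plu R 1 0 : ℂ) ≠ 0 := by exact_mod_cast hR.ne'
  have h2 := plu_relation R 2
  have h3 := plu_relation R 3
  funext k
  fin_cases k
  · simp [foliVec]
  · simp [foliVec, foliCoord, mul_div_cancel₀ _ h0]
  · simp [foliVec, foliCoord]
    field_simp
    linear_combination -h2
  · simp [foliVec, foliCoord]
    field_simp
    linear_combination -h3

theorem plu_foliVec (m : Fin 3 → ℂ) : plu (foliVec m) 1 0 = (m 0).im := by
  simp [plu, foliVec]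

theorem foliCoord_foliVec {m : Fin 3 → ℂ} (hm : 0 < (m 0).im) : foliCoord (foliVec m) = m := by
  have h10 := plu_foliVec m
  have h20 : plu (foliVec m) 2 0 = (m 1).im * (m 0).im := by simp [plu, foliVec]
  have h30 : plu (foliVec m) 3 0 = (m 2).im * (m 0).im := by simp [plu, foliVec]
  have h21 : plu (foliVec m) 2 1 = -(m 1).re * (m 0).im := by simp [plu, foliVec]; ring
  have h31 : plu (foliVec m) 3 1 = -(m 2).re * (m 0).im := by simp [plu, foliVec]; ring
  funext k
  fin_cases k
  · simp [foliCoord, foliVec]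
  · apply Complex.ext <;> simp [foliCoord, h10, h20, h21, hm.ne']
  · apply Complex.ext <;> simp [foliCoord, h10, h30, h31, hm.ne']

theorem foliCoord_smul {c : ℂ} (hc : c ≠ 0) (R : Fin 4 → ℂ) :
    foliCoord (c • R) = foliCoord R := by
  have hn : ‖c‖ ^ 2 ≠ 0 := pow_ne_zero 2 (norm_ne_zero_iff.2 hc)
  simp only [foliCoord, plu_smul, ← mul_neg, mul_div_mul_left _ _ hn]
  simp [mul_div_mul_left _ _ hc]

theorem im_foliCoord {R : Fin 4 → ℂ} (hR : 0 < plu R 1 0) : 0 < (foliCoord R 0).im := by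
  rw [← plu_foliVec]
  rw [← smul_foliVec_foliCoord hR, plu_smul] at hR
  exact pos_of_mul_pos_right hR (by positivity)

theorem contDiffOn_foliCoord : ContDiffOn ℝ ∞ foliCoord {R | 0 < plu R 1 0} := by
  have hd : ∀ k l, ContDiffOn ℝ ∞ (fun R => plu R k l / plu R 1 0) {R | 0 < plu R 1 0} :=
    fun k l => (contDiff_plu k l).contDiffOn.div (contDiff_plu 1 0).contDiffOn fun R hR => hR.ne'
  have hc : ∀ a b : (Fin 4 → ℂ) → ℝ, ContDiffOn ℝ ∞ a {R | 0 < plu R 1 0} →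
      ContDiffOn ℝ ∞ b {R | 0 < plu R 1 0} →
      ContDiffOn ℝ ∞ (fun R => (⟨a R, b R⟩ : ℂ)) {R | 0 < plu R 1 0} := fun a b ha hb => by
    have := (Complex.ofRealCLM.contDiff.comp_contDiffOn ha).add
      ((Complex.ofRealCLM.contDiff.comp_contDiffOn hb).mul (contDiffOn_const (c := Complex.I)))
    refine this.congr fun R _ => ?_
    apply Complex.ext <;> simp
  rw [contDiffOn_pi]
  intro k
  fin_cases k
  · change ContDiffOn ℝ ∞ (fun R : Fin 4 → ℂ => R 1 / R 0) _
    simp only [div_eq_mul_inv]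
    exact (contDiff_apply ℝ ℂ 1).contDiffOn.mul ((contDiff_apply ℝ ℂ 0).contDiffOn.inv
      fun R hR => ne_zero_of_plu hR)
  · exact hc _ _ (by simpa only [neg_div] using (hd 2 1).neg) (hd 2 0)
  · exact hc _ _ (by simpa only [neg_div] using (hd 3 1).neg) (hd 3 0)

theorem contDiff_foliVec : ContDiff ℝ ∞ foliVec := by
  have h := fun k => contDiff_apply ℝ ℂ (ι := Fin 3) (n := ∞) k
  have hk : ∀ k, ContDiff ℝ ∞ fun m : Fin 3 → ℂ => ((m k).im : ℂ) * m 0 + ((m k).re : ℂ) :=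
    fun k => ((Complex.ofRealCLM.contDiff.comp (Complex.imCLM.contDiff.comp (h k))).mul (h 0)).add
      (Complex.ofRealCLM.contDiff.comp (Complex.reCLM.contDiff.comp (h k)))
  rw [contDiff_pi]
  intro k
  fin_cases k
  · exact contDiff_const
  · exact h 0
  · exact hk 1
  · exact hk 2

/-- The half of the complexification of a real plane which contains `X`. -/
def InHalf (X R : Fin 4 → ℂ) : Prop :=
  ∃ c u : ℂ, c ≠ 0 ∧ ‖u‖ < 1 ∧ R = c • fun k => X k + u * conj (X k)

theorem InHalf.exists_plu {X R : Fin 4 → ℂ} (h : InHalf X R) :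
    ∃ r : ℝ, 0 < r ∧ ∀ k l, plu R k l = r * plu X k l := by
  obtain ⟨c, u, hc, hu, rfl⟩ := h
  refine ⟨‖c‖ ^ 2 * (1 - ‖u‖ ^ 2), ?_, fun k l => ?_⟩
  · have := norm_pos_iff.2 hc
    have : 0 < 1 - ‖u‖ ^ 2 := by nlinarith [norm_nonneg u]
    positivity
  · have := plu_add_conj X 1 u k l
    simp only [one_mul, norm_one, one_pow] at this
    rw [plu_smul, this, mul_assoc]

/-- The transverse coordinates are ratios of Plücker coordinates, which on one half change only by a
common positive factor. -/
theorem InHalf.foliCoord_eq {X R R' : Fin 4 → ℂ} (h : InHalf X R) (h' : InHalf X R') :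
    foliCoord R 1 = foliCoord R' 1 ∧ foliCoord R 2 = foliCoord R' 2 := by
  obtain ⟨r, hr, e⟩ := h.exists_plu
  obtain ⟨r', hr', e'⟩ := h'.exists_plu
  simp [foliCoord, e, e', ← mul_neg, mul_div_mul_left _ _ hr.ne', mul_div_mul_left _ _ hr'.ne']

/-- Equal transverse coordinates mean that `R'` satisfies the same real linear relations as `X`, so
`R' = c X + d conj X`. Then `plu R' 1 0 = (|c|² - |d|²) plu X 1 0`, and positivity of both sides
places `R'` in the half `|d| < |c|`. -/
theorem InHalf.of_foliCoord_eq {X R R' : Fin 4 → ℂ} (h : InHalf X R) (hR : 0 < plu R 1 0)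
    (hR' : 0 < plu R' 1 0) (h1 : foliCoord R 1 = foliCoord R' 1)
    (h2 : foliCoord R 2 = foliCoord R' 2) : InHalf X R' := by
  obtain ⟨r, hr, e⟩ := h.exists_plu
  have hX : 0 < plu X 1 0 := by
    rw [e] at hR; exact pos_of_mul_pos_right hR hr.le
  have hXR : ∀ k l, plu X k l / plu X 1 0 = plu R k l / plu R 1 0 := fun k l => by
    rw [e, e, mul_div_mul_left _ _ hr.ne']
  have hk : ∀ k, ∃ s t : ℝ, X k = s * X 1 + t * X 0 ∧ R' k = s * R' 1 + t * R' 0 := by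
    have hgen : ∀ {Y : Fin 4 → ℂ}, 0 < plu Y 1 0 → ∀ k, Y k = ((plu Y k 0 / plu Y 1 0 : ℝ) : ℂ) * Y 1
        + ((-plu Y k 1 / plu Y 1 0 : ℝ) : ℂ) * Y 0 := by
      intro Y hY k
      have hp : (plu Y 1 0 : ℂ) ≠ 0 := by exact_mod_cast hY.ne'
      have := plu_relation Y k
      push_cast
      field_simp
      linear_combination this
    have hrat : ∀ k, plu R k 0 / plu R 1 0 = plu R' k 0 / plu R' 1 0 →
        -plu R k 1 / plu R 1 0 = -plu R' k 1 / plu R' 1 0 →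
        ∃ s t : ℝ, X k = s * X 1 + t * X 0 ∧ R' k = s * R' 1 + t * R' 0 := by
      intro k e1 e2
      refine ⟨_, _, hgen hX k, ?_⟩
      rw [neg_div, hXR, hXR, ← neg_div, e1, e2]
      exact hgen hR' k
    intro k
    fin_cases k
    · exact ⟨0, 1, by simp, by simp⟩
    · exact ⟨1, 0, by simp, by simp⟩
    · exact hrat 2 (congrArg Complex.im h1) (congrArg Complex.re h1)
    · exact hrat 3 (congrArg Complex.im h2) (congrArg Complex.re h2)
  set D := X 1 * conj (X 0) - X 0 * conj (X 1) with hD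
  have hD0 : D ≠ 0 := by
    have h3 : D = 2 * plu X 1 0 * Complex.I := by
      have := Complex.sub_conj (X 1 * conj (X 0))
      simp only [map_mul, Complex.conj_conj] at this
      rw [hD, mul_comm (X 0), this, plu]
      push_cast; ring
    rw [h3]
    have : (plu X 1 0 : ℂ) ≠ 0 := by exact_mod_cast hX.ne'
    simp [this]
  -- Cramer's rule for `c X + d conj X = R'` in the coordinates `0` and `1`; the determinant `D` is
  -- `2 i plu X 1 0`.
  set c := (R' 1 * conj (X 0) - R' 0 * conj (X 1)) / D with hc
  set d := (X 1 * R' 0 - X 0 * R' 1) / D with hd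
  have hc' : c * D = R' 1 * conj (X 0) - R' 0 * conj (X 1) := div_mul_cancel₀ _ hD0
  have hd' : d * D = X 1 * R' 0 - X 0 * R' 1 := div_mul_cancel₀ _ hD0
  have e0 : R' 0 = c * X 0 + d * conj (X 0) := by
    apply mul_right_cancel₀ hD0
    rw [add_mul, mul_right_comm, hc', mul_right_comm, hd', hD]; ring
  have e1 : R' 1 = c * X 1 + d * conj (X 1) := by
    apply mul_right_cancel₀ hD0
    rw [add_mul, mul_right_comm, hc', mul_right_comm, hd', hD]; ring
  clear_value c d D
  have hall : R' = fun k => c * X k + d * conj (X k) := by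
    funext k
    obtain ⟨s, t, hs, ht⟩ := hk k
    rw [ht, hs, e0, e1]
    simp only [map_add, map_mul, Complex.conj_ofReal]
    ring
  have hlt : ‖d‖ < ‖c‖ := by
    rw [hall, plu_add_conj] at hR'
    have := pos_of_mul_pos_left hR' hX.le
    exact lt_of_pow_lt_pow_left₀ 2 (norm_nonneg _) (by linarith)
  have hc0 : c ≠ 0 := norm_pos_iff.1 ((norm_nonneg _).trans_lt hlt)
  refine ⟨c, d / c, hc0, ?_, ?_⟩
  · rw [norm_div, div_lt_one (norm_pos_iff.2 hc0)]; exact hlt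
  · rw [hall]
    funext k
    simp only [Pi.smul_apply, smul_eq_mul]
    field_simp

/-- In real coordinates, moving `w` adds a multiple of the conjugate of the central vector. So the
undeformed open disk is one half of the complexification of a real plane, with disk coordinate `u =
-i e^{is} w`. -/
theorem realCoord_disk (ξ : S2 × S2) (w : ℂ) :
    realCoord ((-Complex.I * phase ξ.1) • topV ξ w, botV ξ w) = fun k =>
      realCoord ((-Complex.I * phase ξ.1) • topV ξ 0, botV ξ 0) k + (-Complex.I * phase ξ.1) * w *
        conj (realCoord ((-Complex.I * phase ξ.1) • topV ξ 0, botV ξ 0) k) := by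
  have hρ : ‖-Complex.I * phase ξ.1‖ = 1 := by simp [norm_phase]
  have hρ' : conj (-Complex.I * phase ξ.1) * (-Complex.I * phase ξ.1) = 1 :=
    conj_mul_self_of_norm_eq_one hρ
  generalize -Complex.I * phase ξ.1 = ρ at *
  funext k
  fin_cases k
  · simp [realCoord, topV, botV, circVec, reflVec, perp]
    linear_combination (-(w * radQ ξ.1 * conj (spinV ξ.2).1)) * hρ'
  · simp [realCoord, topV, botV, circVec, reflVec, perp]
    linear_combination (Complex.I * (w * radQ ξ.1 * conj (spinV ξ.2).1)) * hρ'
  · simp [realCoord, topV, botV, circVec, reflVec, perp]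
    linear_combination (-(w * radQ ξ.1 * conj (spinV ξ.2).2)) * hρ'
  · simp [realCoord, topV, botV, circVec, reflVec, perp]
    linear_combination (Complex.I * (w * radQ ξ.1 * conj (spinV ξ.2).2)) * hρ'

/-! ### The foliation -/

/-- Real coordinates of the untwisted point, permuted. -/
def untwistReal (h : S2 → ℝ) (σ : Equiv.Perm (Fin 4)) (v : Fin 4 → ℂ) : Fin 4 → ℂ :=
  realCoord (untwist h (topOf v, botOf v)) ∘ σ

theorem mk_mem_diskInterior_iff_inHalf {h : S2 → ℝ} (hh : IsAdmissible h) {z : Fin 4 → ℂ}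
    (hz : z ≠ 0) (hs : (topOf z, botOf z) ∈ solvable h) (σ : Equiv.Perm (Fin 4)) (ξ : S2 × S2) :
    (Projectivization.mk ℂ z hz : CP3) ∈ diskInterior h ξ ↔
      InHalf (realCoord ((-Complex.I * phase ξ.1) • topV ξ 0, botV ξ 0) ∘ σ)
        (untwistReal h σ z) := by
  have hρ : ‖-Complex.I * phase ξ.1‖ = 1 := by simp [norm_phase]
  have hρ0 : -Complex.I * phase ξ.1 ≠ 0 := norm_ne_zero_iff.1 (by rw [hρ]; exact one_ne_zero)
  rw [mk_mem_diskInterior_iff hh hz hs]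
  constructor
  · rintro ⟨w, c, hw, hc, h1, h2⟩
    refine ⟨c, (-Complex.I * phase ξ.1) * w, hc, by rwa [norm_mul, hρ, one_mul], ?_⟩
    rw [untwistReal, show untwist h (topOf z, botOf z) =
      (c • (-Complex.I * phase ξ.1) • topV ξ w, conj c • botV ξ w) from Prod.ext h1 h2,
      realCoord_smul c ((-Complex.I * phase ξ.1) • topV ξ w, botV ξ w), realCoord_disk]
    rfl
  · rintro ⟨c, u, hc, hu, he⟩
    refine ⟨(-Complex.I * phase ξ.1)⁻¹ * u, c, by rwa [norm_mul, norm_inv, hρ, inv_one, one_mul],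
      hc, ?_⟩
    have h1 : untwist h (topOf z, botOf z) = (c • (-Complex.I * phase ξ.1) •
        topV ξ ((-Complex.I * phase ξ.1)⁻¹ * u), conj c • botV ξ ((-Complex.I * phase ξ.1)⁻¹ * u)) := by
      rw [← pairOfReal_realCoord (untwist h (topOf z, botOf z)), ← pairOfReal_realCoord (c • _, _)]
      congr 1
      rw [realCoord_smul c ((-Complex.I * phase ξ.1) • topV ξ ((-Complex.I * phase ξ.1)⁻¹ * u),
        botV ξ ((-Complex.I * phase ξ.1)⁻¹ * u)), realCoord_disk, mul_inv_cancel_left₀ hρ0]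
      funext k
      have := congrFun he (σ.symm k)
      simpa [untwistReal] using this
    exact ⟨congrArg Prod.fst h1, congrArg Prod.snd h1⟩

/-- The region on which the foliation coordinates are defined. -/
def foliDomain (h : S2 → ℝ) (σ : Equiv.Perm (Fin 4)) : Set (Fin 4 → ℂ) :=
  {v | (topOf v, botOf v) ∈ solvable h ∧ 0 < plu (untwistReal h σ v) 1 0}

/-- The inverse of the foliation coordinates. -/
def foliInv (h : S2 → ℝ) (σ : Equiv.Perm (Fin 4)) (m : Fin 3 → ℂ) : Fin 4 → ℂ :=
  vecOf (twist h (pairOfReal (foliVec m ∘ σ.symm)))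

section

variable {h : S2 → ℝ} (hh : IsAdmissible h) (σ : Equiv.Perm (Fin 4))

theorem foliInv_ne_zero (m : Fin 3 → ℂ) : foliInv h σ m ≠ 0 := by
  intro h0
  obtain ⟨h1, h2⟩ := topOf_botOf_eq_zero.1 h0
  rw [foliInv, topOf_vecOf] at h1
  rw [foliInv, botOf_vecOf] at h2
  have h3 : pairOfReal (foliVec m ∘ σ.symm) = 0 :=
    Prod.ext ((smul_eq_zero.1 h1).resolve_left (Complex.exp_ne_zero _)) h2
  have h4 := realCoord_pairOfReal (foliVec m ∘ σ.symm)
  rw [h3] at h4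
  have h5 := congrFun h4 (σ 0)
  have h6 : realCoord 0 = 0 := by funext k; fin_cases k <;> simp [realCoord]
  rw [h6] at h5
  simp [foliVec] at h5

include hh

theorem contDiffOn_untwistReal :
    ContDiffOn ℝ ∞ (untwistReal h σ) {v | (topOf v, botOf v) ∈ solvable h} := by
  have h1 : ContDiffOn ℝ ∞ (fun v => realCoord (untwist h (topOf v, botOf v)))
      {v | (topOf v, botOf v) ∈ solvable h} :=
    contDiff_realCoord.comp_contDiffOn ((contDiffOn_untwist hh).comp
      (contDiff_topOf.prodMk contDiff_botOf).contDiffOn fun v hv => hv)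
  exact contDiffOn_pi.2 fun k => contDiffOn_pi.1 h1 (σ k)

theorem isOpen_solvable_vec : IsOpen {v : Fin 4 → ℂ | (topOf v, botOf v) ∈ solvable h} :=
  (isOpen_solvable hh).preimage (contDiff_topOf.prodMk contDiff_botOf).continuous

theorem isOpen_foliDomain : IsOpen (foliDomain h σ) :=
  ((contDiff_plu 1 0).comp_contDiffOn (contDiffOn_untwistReal hh σ)).continuousOn.isOpen_inter_preimage
    (isOpen_solvable_vec hh) isOpen_Ioi

theorem untwistReal_smul {v : Fin 4 → ℂ} (hv : (topOf v, botOf v) ∈ solvable h) {c : ℂ}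
    (hc : c ≠ 0) : (topOf (c • v), botOf (c • v)) ∈ solvable h ∧
      untwistReal h σ (c • v) = c • untwistReal h σ v := by
  have hn : ‖c‖ = ‖conj c‖ := by simp
  rw [topOf_smul, botOf_smul]
  refine ⟨solvable_smul hh hv hn hc, ?_⟩
  rw [untwistReal, topOf_smul, botOf_smul, untwist_smul hh hv hn hc, realCoord_smul]
  rfl

theorem untwistReal_foliInv {m : Fin 3 → ℂ} (hm : 0 < (m 0).im) :
    (topOf (foliInv h σ m), botOf (foliInv h σ m)) ∈ solvable h ∧
      untwistReal h σ (foliInv h σ m) = foliVec m := by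
  have hg : GoodPair (pairOfReal (foliVec m ∘ σ.symm)) := by
    refine goodPair_of_plu (k := σ 1) (l := σ 0) ?_
    rw [realCoord_pairOfReal]
    have := plu_foliVec m
    simp only [plu, Function.comp, Equiv.symm_apply_apply] at this ⊢
    rw [this]; exact hm.ne'
  have e : (topOf (foliInv h σ m), botOf (foliInv h σ m)) =
      twist h (pairOfReal (foliVec m ∘ σ.symm)) := by
    rw [foliInv, topOf_vecOf, botOf_vecOf]
  refine ⟨by rw [e]; exact twist_mem_solvable hh hg, ?_⟩
  rw [untwistReal, e, untwist_twist hh hg, realCoord_pairOfReal]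
  funext k; simp

theorem contDiffOn_foliInv : ContDiffOn ℝ ∞ (foliInv h σ) {m | 0 < (m 0).im} := by
  have h1 : ContDiff ℝ ∞ fun m => pairOfReal (foliVec m ∘ σ.symm) :=
    contDiff_pairOfReal.comp (contDiff_pi.2 fun k => contDiff_pi.1 contDiff_foliVec (σ.symm k))
  refine contDiff_vecOf.comp_contDiffOn ((contDiffOn_twist hh).comp h1.contDiffOn fun m hm => ?_)
  refine goodPair_of_plu (k := σ 1) (l := σ 0) ?_
  rw [realCoord_pairOfReal]
  have := plu_foliVec m
  simp only [plu, Function.comp, Equiv.symm_apply_apply] at this ⊢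
  rw [this]; exact (ne_of_gt hm)

theorem exists_smul_foliInv {v : Fin 4 → ℂ} (hv : v ∈ foliDomain h σ) :
    ∃ c : ℂ, c ≠ 0 ∧ v = c • foliInv h σ (foliCoord (untwistReal h σ v)) := by
  set R := untwistReal h σ v with hR
  have hp : 0 < plu R 1 0 := hv.2
  refine ⟨R 0, ne_zero_of_plu hp, ?_⟩
  have h1 : realCoord (untwist h (topOf v, botOf v)) = R 0 • (foliVec (foliCoord R) ∘ σ.symm) := by
    funext k
    have := congrFun (smul_foliVec_foliCoord hp) (σ.symm k)
    simp only [Pi.smul_apply, Function.comp] at this ⊢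
    rw [this, hR]; simp [untwistReal]
  have h2 : untwist h (topOf v, botOf v) = (R 0 • (pairOfReal (foliVec (foliCoord R) ∘ σ.symm)).1,
      conj (R 0) • (pairOfReal (foliVec (foliCoord R) ∘ σ.symm)).2) := by
    rw [← pairOfReal_realCoord (untwist h _), h1, ← pairOfReal_realCoord (R 0 • _, _),
      realCoord_smul, realCoord_pairOfReal]
  have h3 := twist_untwist hh hv.1
  rw [h2, twist_smul (by simp) (ne_zero_of_plu hp)] at h3
  refine ext_topOf_botOf ?_ ?_
  · rw [topOf_smul, foliInv, topOf_vecOf]; exact (congrArg Prod.fst h3).symm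
  · rw [botOf_smul, foliInv, botOf_vecOf]; exact (congrArg Prod.snd h3).symm

omit hh in
theorem exists_perm_apply : ∀ k l : Fin 4, k ≠ l → ∃ σ : Equiv.Perm (Fin 4), σ 1 = k ∧ σ 0 = l := by
  decide

theorem exists_foliated_chart {p : CP3} (hp : p ∈ (realP h)ᶜ) :
    ∃ φ ∈ IsManifold.maximalAtlas 𝓘(ℝ, Fin 3 → ℂ) ∞ CP3, p ∈ φ.source ∧ φ.source ⊆ (realP h)ᶜ ∧
      (∃ c r, φ.target = Metric.ball c r) ∧
      ∀ ξ, ∀ x ∈ diskInterior h ξ ∩ φ.source,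
        connectedComponentIn (diskInterior h ξ ∩ φ.source) x =
          {x' ∈ φ.source | φ x' 1 = φ x 1 ∧ φ x' 2 = φ x 2} := by
  induction p using Projectivization.ind with
  | h z hz =>
  have hs := (mk_notMem_realP_iff hh hz).1 hp
  -- The coordinates require `plu R 1 0 > 0`. Some Plücker coordinate of the untwisted point is
  -- positive, and a permutation moves it to this place.
  obtain ⟨k, l, hkl, hpos⟩ := (goodPair_untwist hh hs).exists_plu_pos
  obtain ⟨σ, rfl, rfl⟩ := exists_perm_apply k l hkl
  have hzO : z ∈ foliDomain h σ := ⟨hs, hpos⟩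
  let f : (Fin 4 → ℂ) → Fin 3 → ℂ := fun v => foliCoord (untwistReal h σ v)
  have hf : ContDiffOn ℝ ∞ f (foliDomain h σ) :=
    contDiffOn_foliCoord.comp ((contDiffOn_untwistReal hh σ).mono fun v hv => hv.1)
      fun v hv => hv.2
  have hHo : IsOpen {m : Fin 3 → ℂ | 0 < (m 0).im} :=
    isOpen_lt continuous_const (Complex.continuous_im.comp (continuous_apply 0))
  obtain ⟨r, hr, hball⟩ := Metric.isOpen_iff.1 hHo (f z) (im_foliCoord hzO.2)
  have hO : IsOpen (foliDomain h σ ∩ f ⁻¹' Metric.ball (f z) r) :=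
    hf.continuousOn.isOpen_inter_preimage (isOpen_foliDomain hh σ) Metric.isOpen_ball
  have hinv : ∀ m ∈ Metric.ball (f z) r, foliInv h σ m ∈ foliDomain h σ ∧ f (foliInv h σ m) = m := by
    intro m hm
    obtain ⟨h1, h2⟩ := untwistReal_foliInv hh σ (hball hm)
    refine ⟨⟨h1, ?_⟩, ?_⟩
    · rw [h2, plu_foliVec]; exact hball hm
    · simp only [f, h2, foliCoord_foliVec (hball hm)]
  obtain ⟨φ, hφ, htarget, hsrc⟩ := exists_chart_of_homogeneous (f := f) (g := foliInv h σ) hO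
    (Metric.isOpen_ball (x := f z) (ε := r)) (fun v hv c hc => by
      obtain ⟨h1, h2⟩ := untwistReal_smul hh σ hv.1.1 hc
      have h3 : f (c • v) = f v := by simp only [f, h2, foliCoord_smul hc]
      refine ⟨⟨⟨h1, ?_⟩, ?_⟩, h3⟩
      · rw [h2, plu_smul]
        have := norm_pos_iff.2 hc
        have := hv.1.2
        positivity
      · rw [Set.mem_preimage, h3]; exact hv.2)
    (hf.mono Set.inter_subset_left) ((contDiffOn_foliInv hh σ).mono hball) (foliInv_ne_zero σ)
    (fun v hv => hv.2) (fun m hm => ⟨(hinv m hm).1, by rw [Set.mem_preimage, (hinv m hm).2]; exact hm⟩)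
    (fun m hm => (hinv m hm).2) (fun v hv => exists_smul_foliInv hh σ hv.1)
  refine ⟨φ, hφ, (hsrc z hz).1.2 ⟨hzO, Metric.mem_ball_self hr⟩, ?_, ⟨f z, r, htarget⟩, ?_⟩
  · intro p hp
    induction p using Projectivization.ind with
    | h v hv =>
    exact (mk_notMem_realP_iff hh hv).2 ((hsrc v hv).1.1 hp).1.1
  · intro ξ x hx
    -- The whole trace of a leaf is a single slice: halves with equal transverse coordinates
    -- coincide. It remains to see that the slice is connected, being the image of a ball cut by an
    -- affine subspace.
    have hset : diskInterior h ξ ∩ φ.source =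
        {x' ∈ φ.source | φ x' 1 = φ x 1 ∧ φ x' 2 = φ x 2} := by
      induction x using Projectivization.ind with
      | h v hv =>
      obtain ⟨hxl, hxs⟩ := hx
      have hvO := (hsrc v hv).1.1 hxs
      have hfv := (hsrc v hv).2 hvO
      have hl := (mk_mem_diskInterior_iff_inHalf hh hv hvO.1.1 σ ξ).1 hxl
      ext p
      induction p using Projectivization.ind with
      | h v' hv' =>
      rw [Set.mem_inter_iff, Set.mem_sep_iff, and_comm]
      refine and_congr_right fun hps => ?_
      have hvO' := (hsrc v' hv').1.1 hps
      rw [(hsrc v' hv').2 hvO', hfv, mk_mem_diskInterior_iff_inHalf hh hv' hvO'.1.1 σ ξ]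
      exact ⟨fun hl' => hl'.foliCoord_eq hl, fun he =>
        hl.of_foliCoord_eq hvO.1.2 hvO'.1.2 he.1.symm he.2.symm⟩
    have himg : {x' ∈ φ.source | φ x' 1 = φ x 1 ∧ φ x' 2 = φ x 2} =
        φ.symm '' (Metric.ball (f z) r ∩ {m | m 1 = φ x 1 ∧ m 2 = φ x 2}) := by
      ext p
      constructor
      · rintro ⟨hp, he⟩
        exact ⟨φ p, ⟨by rw [← htarget]; exact φ.map_source hp, he⟩, φ.left_inv hp⟩
      · rintro ⟨m, ⟨hm, he⟩, rfl⟩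
        rw [← htarget] at hm
        refine ⟨φ.map_target hm, ?_⟩
        rw [φ.right_inv hm]; exact he
    have hconv : Convex ℝ {m : Fin 3 → ℂ | m 1 = φ x 1 ∧ m 2 = φ x 2} := by
      rintro m ⟨h1, h2⟩ m' ⟨h1', h2'⟩ a b - - hab
      have hab' : (a : ℂ) + b = 1 := by exact_mod_cast hab
      constructor
      · simp only [Pi.add_apply, Pi.smul_apply, h1, h1', Complex.real_smul, ← add_mul, hab', one_mul]
      · simp only [Pi.add_apply, Pi.smul_apply, h2, h2', Complex.real_smul, ← add_mul, hab', one_mul]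
    have hpre : IsPreconnected (diskInterior h ξ ∩ φ.source) := by
      rw [hset, himg]
      refine ((convex_ball (f z) r).inter hconv).isPreconnected.image _ ?_
      exact φ.continuousOn_symm.mono (by rw [htarget]; exact Set.inter_subset_left)
    rw [hpre.connectedComponentIn hx, hset]

theorem isFoliation_diskInterior : IsFoliation (realP h)ᶜ (diskInterior h) where
  connected := isConnected_diskInterior hh
  disjoint := disjoint_diskInterior hh
  cover := iUnion_diskInterior hh
  foliated_chart := fun _ hp => exists_foliated_chart hh hp

end


/-! ### Singular chains -/

section Chains

open CategoryTheory Limits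

/-- Singular simplices. -/
abbrev Simp (n : ℕ) (X : Type) [TopologicalSpace X] : Type :=
  C(stdSimplex ℝ (Fin (n + 1)), X)

/-- Singular chains with integer coefficients. -/
abbrev Chn (n : ℕ) (X : Type) [TopologicalSpace X] : Type := Simp n X →₀ ℤ

/-- The inclusion of a face of the standard simplex. -/
def faceMap {n : ℕ} (i : Fin (n + 2)) : C(stdSimplex ℝ (Fin (n + 1)), stdSimplex ℝ (Fin (n + 2))) :=
  ⟨stdSimplex.map i.succAbove, stdSimplex.continuous_map _⟩

variable {X Y : Type} [TopologicalSpace X] [TopologicalSpace Y]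

/-- The boundary of a singular chain. -/
def bd {n : ℕ} : Chn (n + 1) X →ₗ[ℤ] Chn n X :=
  Finsupp.lift (Chn n X) ℤ (Simp (n + 1) X)
    fun σ => ∑ i : Fin (n + 2), Finsupp.single (σ.comp (faceMap i)) ((-1 : ℤ) ^ i.val)

theorem bd_single {n : ℕ} (σ : Simp (n + 1) X) :
    bd (Finsupp.single σ 1) =
      ∑ i : Fin (n + 2), Finsupp.single (σ.comp (faceMap i)) ((-1 : ℤ) ^ i.val) := by
  simp [bd]

/-- The image of a chain under a continuous map. -/
def push (f : C(X, Y)) {n : ℕ} : Chn n X →ₗ[ℤ] Chn n Y :=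
  Finsupp.lmapDomain ℤ ℤ fun σ => f.comp σ

theorem push_single (f : C(X, Y)) {n : ℕ} (σ : Simp n X) (a : ℤ) :
    push f (Finsupp.single σ a) = Finsupp.single (f.comp σ) a := by
  simp [push]

theorem chn_hom_ext {n : ℕ} {M : Type*} [AddCommGroup M] [Module ℤ M] {f g : Chn n X →ₗ[ℤ] M}
    (h : ∀ σ, f (Finsupp.single σ 1) = g (Finsupp.single σ 1)) : f = g := by
  ext σ
  exact h σ

theorem chn_hom_ext' {n : ℕ} {M : Type*} [AddCommGroup M] {f g : Chn n X →+ M}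
    (h : ∀ σ, f (Finsupp.single σ 1) = g (Finsupp.single σ 1)) : f = g := by
  ext σ
  exact h σ

theorem push_comp {Z : Type} [TopologicalSpace Z] (g : C(Y, Z)) (f : C(X, Y)) {n : ℕ}
    (c : Chn n X) : push (g.comp f) c = push g (push f c) := by
  have : push (g.comp f) (n := n) = (push g).comp (push f) :=
    chn_hom_ext fun σ => by simp [push_single, ContinuousMap.comp_assoc]
  exact congrArg (· c) this

theorem push_id {n : ℕ} (c : Chn n X) : push (ContinuousMap.id X) c = c := by
  have : push (ContinuousMap.id X) (n := n) = LinearMap.id :=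
    chn_hom_ext fun σ => by simp [push_single]
  exact congrArg (· c) this

theorem bd_push (f : C(X, Y)) {n : ℕ} (c : Chn (n + 1) X) :
    bd (push f c) = push f (bd c) := by
  have : bd.comp (push f (n := n + 1)) = (push f).comp bd :=
    chn_hom_ext fun σ => by simp [push_single, bd_single, ContinuousMap.comp_assoc]
  exact congrArg (· c) this

/-- The inclusion of the summand of a singular simplex into the singular chain complex. -/
def simpHom {n : ℕ} (σ : Simp n X) :
    ModuleCat.of ℤ ℤ ⟶ (singularChains.obj (TopCat.of X)).X n :=
  SSet.ιChainComplex (R := ModuleCat.of ℤ ℤ) (TopCat.toSSet.obj (TopCat.of X))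
    (((TopCat.of X).toSSetObjEquiv (.op (.mk n))).symm σ)

theorem simpHom_d {n : ℕ} (σ : Simp (n + 1) X) :
    simpHom σ ≫ (singularChains.obj (TopCat.of X)).d (n + 1) n =
      ∑ i : Fin (n + 2), (-1 : ℤ) ^ i.val • simpHom (σ.comp (faceMap i)) :=
  SSet.ιChainComplex_d (R := ModuleCat.of ℤ ℤ) (TopCat.toSSet.obj (TopCat.of X)) _

theorem simpHom_map (f : C(X, Y)) {n : ℕ} (σ : Simp n X) :
    simpHom σ ≫ (singularChains.map (TopCat.ofHom f)).f n = simpHom (f.comp σ) :=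
  SSet.ι_chainComplexMap_f _ _ (TopCat.toSSet.map (TopCat.ofHom f)) (ModuleCat.of ℤ ℤ) _

theorem simpHom_hom_ext {n : ℕ} {T : ModuleCat.{0} ℤ}
    {f g : (singularChains.obj (TopCat.of X)).X n ⟶ T}
    (h : ∀ σ : Simp n X, simpHom σ ≫ f = simpHom σ ≫ g) : f = g :=
  SSet.chainComplex_hom_ext fun x => by
    have := h ((TopCat.of X).toSSetObjEquiv (.op (.mk n)) x)
    rwa [simpHom, Equiv.symm_apply_apply] at this

theorem exists_simpHom_desc {n : ℕ} {T : ModuleCat.{0} ℤ} (t : Simp n X → T) :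
    ∃ f : (singularChains.obj (TopCat.of X)).X n ⟶ T,
      ∀ σ, simpHom σ ≫ f = ModuleCat.ofHom (LinearMap.toSpanSingleton ℤ T (t σ)) := by
  let S := TopCat.toSSet.obj (TopCat.of X)
  refine ⟨(S.isColimitChainComplexXCofan (ModuleCat.of ℤ ℤ) n).desc
      (Cofan.mk T fun x => ModuleCat.ofHom
        (LinearMap.toSpanSingleton ℤ T (t ((TopCat.of X).toSSetObjEquiv (.op (.mk n)) x)))),
    fun σ => ?_⟩
  refine ((S.isColimitChainComplexXCofan (ModuleCat.of ℤ ℤ) n).fac _ ⟨_⟩).trans ?_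
  simp

/-- The comparison of singular chains with the singular chain complex of Mathlib. -/
def chnHom (n : ℕ) (X : Type) [TopologicalSpace X] :
    Chn n X →+ (singularChains.obj (TopCat.of X)).X n :=
  Finsupp.liftAddHom fun σ : Simp n X => (simpHom σ).hom.toAddMonoidHom

theorem chnHom_single {n : ℕ} (σ : Simp n X) (a : ℤ) :
    chnHom n X (Finsupp.single σ a) = (simpHom σ).hom a :=
  Finsupp.liftAddHom_apply_single _ σ a

/-- In each degree the singular complex is a coproduct of copies of `ℤ` indexed by the simplices;
its universal property provides the inverse. Chains may then be handled as finitely supported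
functions. -/
theorem chnHom_bijective (n : ℕ) (X : Type) [TopologicalSpace X] :
    Function.Bijective (chnHom n X) := by
  obtain ⟨inv, hinv⟩ := exists_simpHom_desc (X := X) (n := n) (T := ModuleCat.of ℤ (Chn n X))
    fun σ => Finsupp.single σ (1 : ℤ)
  have hinv' : ∀ σ : Simp n X, inv.hom ((simpHom σ).hom (1 : ℤ)) = Finsupp.single σ (1 : ℤ) := by
    intro σ
    have := congrArg (fun f => f.hom (1 : ℤ)) (hinv σ)
    refine this.trans ?_
    exact LinearMap.toSpanSingleton_apply_one ..
  have h1 : inv.hom.toAddMonoidHom.comp (chnHom n X) = AddMonoidHom.id _ := by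
    refine chn_hom_ext' fun σ => ?_
    rw [AddMonoidHom.comp_apply, chnHom_single]
    exact hinv' σ
  let lin : ModuleCat.of ℤ (Chn n X) ⟶ (singularChains.obj (TopCat.of X)).X n := ModuleCat.ofHom
    { toFun := chnHom n X
      map_add' := map_add _
      map_smul' := fun a x => map_intCast_smul (chnHom n X) ℤ ℤ a x }
  have h2 : inv ≫ lin = 𝟙 _ := by
    refine simpHom_hom_ext fun σ => ?_
    ext
    simp only [ModuleCat.hom_comp, LinearMap.comp_apply]
    erw [hinv' σ]
    exact chnHom_single σ 1
  refine Function.bijective_iff_has_inverse.2 ⟨inv.hom, fun c => ?_, fun c => ?_⟩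
  · exact congrArg (· c) h1
  · exact congrArg (fun f => f.hom c) h2

theorem chnHom_bd {n : ℕ} (c : Chn (n + 1) X) :
    chnHom n X (bd c) = ((singularChains.obj (TopCat.of X)).d (n + 1) n).hom (chnHom (n + 1) X c) := by
  have : (chnHom n X).comp bd.toAddMonoidHom =
      ((singularChains.obj (TopCat.of X)).d (n + 1) n).hom.toAddMonoidHom.comp
        (chnHom (n + 1) X) := by
    refine chn_hom_ext' fun σ => ?_
    rw [AddMonoidHom.comp_apply, AddMonoidHom.comp_apply, LinearMap.toAddMonoidHom_coe, bd_single,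
      chnHom_single]
    have := congrArg (fun f => f.hom (1 : ℤ)) (simpHom_d σ)
    refine Eq.trans ?_ this.symm
    simp only [map_sum, chnHom_single, ModuleCat.hom_sum, LinearMap.sum_apply]
    refine Finset.sum_congr rfl fun i _ => ?_
    refine Eq.trans ?_ (map_zsmul (simpHom (σ.comp (faceMap i))).hom ((-1 : ℤ) ^ i.val) 1)
    simp
  exact congrArg (· c) this

theorem chnHom_push (f : C(X, Y)) {n : ℕ} (c : Chn n X) :
    chnHom n Y (push f c) = ((singularChains.map (TopCat.ofHom f)).f n).hom (chnHom n X c) := by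
  have : (chnHom n Y).comp (push f).toAddMonoidHom =
      ((singularChains.map (TopCat.ofHom f)).f n).hom.toAddMonoidHom.comp (chnHom n X) := by
    refine chn_hom_ext' fun σ => ?_
    rw [AddMonoidHom.comp_apply, AddMonoidHom.comp_apply, LinearMap.toAddMonoidHom_coe, push_single,
      chnHom_single, chnHom_single]
    exact (congrArg (fun g => g.hom (1 : ℤ)) (simpHom_map f σ)).symm
  exact congrArg (· c) this

theorem bd_bd {n : ℕ} (c : Chn (n + 2) X) : bd (bd c) = 0 := by
  apply (chnHom_bijective n X).1
  rw [chnHom_bd, chnHom_bd, map_zero, ← LinearMap.comp_apply, ← ModuleCat.hom_comp,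
    HomologicalComplex.d_comp_d]
  rfl

theorem exists_bd_eq_of_exactAt {n : ℕ}
    (hX : (singularChains.obj (TopCat.of X)).ExactAt (n + 1)) {c : Chn (n + 1) X}
    (hc : bd c = 0) : ∃ e : Chn (n + 2) X, bd e = c := by
  rw [HomologicalComplex.exactAt_iff' _ (n + 2) (n + 1) n (by simp) (by simp),
    ShortComplex.moduleCat_exact_iff] at hX
  obtain ⟨e, he⟩ := hX (chnHom (n + 1) X c) (by
    have := chnHom_bd c
    rw [hc, map_zero] at this
    exact this.symm)
  obtain ⟨e, rfl⟩ := (chnHom_bijective (n + 2) X).2 e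
  refine ⟨e, (chnHom_bijective (n + 1) X).1 ?_⟩
  rw [chnHom_bd]
  exact he

theorem exists_bd_eq_push_sub_push {f g : C(X, Y)} (H : f.Homotopic g) {n : ℕ}
    {c : Chn (n + 1) X} (hc : bd c = 0) :
    ∃ e : Chn (n + 2) Y, bd e = push f c - push g c := by
  obtain ⟨H⟩ := H
  let K := TopCat.Homotopy.singularChainComplexFunctorObjMap
    (f := TopCat.ofHom f) (g := TopCat.ofHom g) H (ModuleCat.of ℤ ℤ)
  have hK := congrArg (fun f => f.hom (chnHom (n + 1) X c)) (K.comm (n + 1))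
  rw [Homotopy.dNext_succ_chainComplex, Homotopy.prevD_chainComplex] at hK
  obtain ⟨e, he⟩ := (chnHom_bijective (n + 2) Y).2
    ((K.hom (n + 1) (n + 2)).hom (chnHom (n + 1) X c))
  refine ⟨e, (chnHom_bijective (n + 1) Y).1 ?_⟩
  rw [chnHom_bd, he, map_sub, chnHom_push, chnHom_push]
  have h0 := chnHom_bd c
  rw [hc, map_zero] at h0
  rw [eq_sub_iff_add_eq]
  refine Eq.trans ?_ hK.symm
  simp only [ModuleCat.hom_add, LinearMap.add_apply, ModuleCat.hom_comp, LinearMap.comp_apply]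
  erw [← h0]
  rw [map_zero, zero_add]

/-- Cycles of positive degree in a contractible space are boundaries. -/
theorem exists_bd_eq_of_contractibleSpace [ContractibleSpace X] {n : ℕ} {c : Chn (n + 1) X}
    (hc : bd c = 0) : ∃ e : Chn (n + 2) X, bd e = c := by
  obtain ⟨y, hy⟩ := id_nullhomotopic X
  obtain ⟨e, he⟩ := exists_bd_eq_push_sub_push hy hc
  let a : C(X, Unit) := ContinuousMap.const X ()
  let b : C(Unit, X) := ContinuousMap.const Unit y
  have hab : ContinuousMap.const X y = b.comp a := rfl
  obtain ⟨e', he'⟩ := exists_bd_eq_of_exactAt (X := Unit) (n := n)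
    (AlgebraicTopology.singularChainComplexFunctor_exactAt_of_totallyDisconnectedSpace _ _ _ _
      n.succ_ne_zero) (c := push a c) (by rw [bd_push, hc, map_zero])
  refine ⟨e + push b e', ?_⟩
  rw [map_add, he, bd_push, he', ← push_comp, ← hab, push_id]
  abel

end Chains


/-! ### Relative homology classes in terms of chains -/

section RelativeHomology

open CategoryTheory Limits

/-- The inclusion of a subset. -/
def subIncl {X : Type} [TopologicalSpace X] (A : Set X) : C(A, X) := ⟨Subtype.val, by fun_prop⟩

/-- The projection to the relative chain complex. -/
def relProj (X : TopPair.{0}) : singularChains.obj X.fst ⟶ relChains X :=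
  cokernel.π (singularChains.map X.map)

theorem relProj_map {X Y : TopPair.{0}} (f : X ⟶ Y) :
    relProj X ≫ relChainsMap f = singularChains.map (TopPair.Hom.fst f) ≫ relProj Y :=
  cokernel.π_desc _ _ _

theorem map_relProj (X : TopPair.{0}) : singularChains.map X.map ≫ relProj X = 0 :=
  cokernel.condition _

theorem relProj_surjective (X : TopPair.{0}) (n : ℕ) :
    Function.Surjective ((relProj X).f n).hom := by
  have : Epi (relProj X) := inferInstanceAs (Epi (cokernel.π _))
  have : Epi ((relProj X).f n) :=
    inferInstanceAs (Epi ((HomologicalComplex.eval (ModuleCat.{0} ℤ) _ n).map (relProj X)))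
  exact (ModuleCat.epi_iff_surjective _).1 this

theorem exists_of_relProj_eq_zero (X : TopPair.{0}) (n : ℕ)
    {c : (singularChains.obj X.fst).X n} (hc : ((relProj X).f n).hom c = 0) :
    ∃ a, ((singularChains.map X.map).f n).hom a = c := by
  let S := ShortComplex.mk _ _ (map_relProj X)
  have hS : S.Exact := S.exact_of_g_is_cokernel (cokernelIsCokernel _)
  have := hS.map (HomologicalComplex.eval (ModuleCat.{0} ℤ) (ComplexShape.down ℕ) n)
  exact (ShortComplex.moduleCat_exact_iff _).1 this c hc

theorem exists_homologyπ_eq (K : ChainComplex (ModuleCat.{0} ℤ) ℕ) {n : ℕ} (y : K.homology n) :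
    ∃ z : K.cycles n, (K.homologyπ n).hom z = y :=
  (ModuleCat.epi_iff_surjective _).1 inferInstance y

theorem exists_cycles_of_d_eq_zero (K : ChainComplex (ModuleCat.{0} ℤ) ℕ) {n : ℕ} {x : K.X (n + 1)}
    (hx : (K.d (n + 1) n).hom x = 0) : ∃ z : K.cycles (n + 1), (K.iCycles (n + 1)).hom z = x := by
  let k : ModuleCat.of ℤ ℤ ⟶ K.X (n + 1) := ModuleCat.ofHom (LinearMap.toSpanSingleton ℤ _ x)
  have hk : k ≫ K.d (n + 1) n = 0 := by
    ext
    simpa [k] using hx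
  refine ⟨(K.liftCycles k n (by simp) hk).hom 1, ?_⟩
  have := congrArg (fun f => f.hom (1 : ℤ)) (K.liftCycles_i k n (by simp) hk)
  refine this.trans ?_
  exact LinearMap.toSpanSingleton_apply_one ..

theorem d_iCycles_eq_zero (K : ChainComplex (ModuleCat.{0} ℤ) ℕ) {m n : ℕ} (z : K.cycles m) :
    (K.d m n).hom ((K.iCycles m).hom z) = 0 :=
  congrArg (fun f => f.hom z) (K.iCycles_d m n)

theorem homologyπ_eq_of_iCycles_eq_add (K : ChainComplex (ModuleCat.{0} ℤ) ℕ) {n : ℕ}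
    {z z' : K.cycles n} {e : K.X (n + 1)}
    (h : (K.iCycles n).hom z = (K.iCycles n).hom z' + (K.d (n + 1) n).hom e) :
    (K.homologyπ n).hom z = (K.homologyπ n).hom z' := by
  have h1 : z = z' + (K.toCycles (n + 1) n).hom e := by
    apply (ModuleCat.mono_iff_injective (K.iCycles n)).1 inferInstance
    change (K.iCycles n).hom z = (K.iCycles n).hom _
    rw [map_add, h]
    congr 1
    exact (congrArg (fun f => f.hom e) (K.toCycles_i (n + 1) n)).symm
  rw [h1, map_add]
  have := congrArg (fun f => f.hom e) (K.toCycles_comp_homologyπ (n + 1) n)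
  have h2 : (K.homologyπ n).hom ((K.toCycles (n + 1) n).hom e) = 0 := this
  rw [h2, add_zero]

/-- On representatives, the hypothesis says that each relative cycle of `Y` is homologous to the
image of one of `X`. The chain `p` of the subspace dies in the quotient complex, and `b` witnesses
that `k` is a relative cycle. -/
theorem relHomologyMap_surjective {X Y : TopPair.{0}} (f : X ⟶ Y) (n : ℕ)
    (H : ∀ (c : (singularChains.obj Y.fst).X (n + 1)) (a : (singularChains.obj Y.snd).X n),
      ((singularChains.map Y.map).f n).hom a = ((singularChains.obj Y.fst).d (n + 1) n).hom c →
      ∃ (k : (singularChains.obj X.fst).X (n + 1)) (b : (singularChains.obj X.snd).X n)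
        (p : (singularChains.obj Y.snd).X (n + 1)) (e : (singularChains.obj Y.fst).X (n + 2)),
        ((singularChains.map X.map).f n).hom b =
          ((singularChains.obj X.fst).d (n + 1) n).hom k ∧
        c = ((singularChains.map (TopPair.Hom.fst f)).f (n + 1)).hom k +
          ((singularChains.map Y.map).f (n + 1)).hom p +
          ((singularChains.obj Y.fst).d (n + 2) (n + 1)).hom e) :
    Function.Surjective (relHomologyMap (n + 1) f).hom := by
  intro y
  obtain ⟨z, rfl⟩ := exists_homologyπ_eq _ y
  obtain ⟨c, hc⟩ := relProj_surjective Y (n + 1) (((relChains Y).iCycles (n + 1)).hom z)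
  have hπd : ∀ (Z : TopPair.{0}) (m : ℕ) (x : (singularChains.obj Z.fst).X (m + 1)),
      ((relProj Z).f m).hom (((singularChains.obj Z.fst).d (m + 1) m).hom x) =
      ((relChains Z).d (m + 1) m).hom (((relProj Z).f (m + 1)).hom x) := fun Z m x =>
    (congrArg (fun g => g.hom x) ((relProj Z).comm (m + 1) m)).symm
  have hπi : ∀ (Z : TopPair.{0}) (m : ℕ) (x : (singularChains.obj Z.snd).X m),
      ((relProj Z).f m).hom (((singularChains.map Z.map).f m).hom x) = 0 := fun Z m x =>
    congrArg (fun g => (g.f m).hom x) (map_relProj Z)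
  have hdc : ((relProj Y).f n).hom (((singularChains.obj Y.fst).d (n + 1) n).hom c) = 0 := by
    rw [hπd, hc, d_iCycles_eq_zero]
  obtain ⟨a, ha⟩ := exists_of_relProj_eq_zero Y n hdc
  obtain ⟨k, b, p, e, hb, hce⟩ := H c a ha
  have hk : ((relChains X).d (n + 1) n).hom (((relProj X).f (n + 1)).hom k) = 0 := by
    rw [← hπd, ← hb, hπi]
  obtain ⟨w, hw⟩ := exists_cycles_of_d_eq_zero _ hk
  refine ⟨((relChains X).homologyπ (n + 1)).hom w, ?_⟩
  have h1 : (relHomologyMap (n + 1) f).hom (((relChains X).homologyπ (n + 1)).hom w) =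
      ((relChains Y).homologyπ (n + 1)).hom
        ((HomologicalComplex.cyclesMap (relChainsMap f) (n + 1)).hom w) :=
    congrArg (fun g => g.hom w)
      (HomologicalComplex.homologyπ_naturality (relChainsMap f) (n + 1))
  rw [h1]
  symm
  refine homologyπ_eq_of_iCycles_eq_add _ (e := ((relProj Y).f (n + 2)).hom e) ?_
  have h2 : ((relChains Y).iCycles (n + 1)).hom
      ((HomologicalComplex.cyclesMap (relChainsMap f) (n + 1)).hom w) =
      ((relChainsMap f).f (n + 1)).hom (((relChains X).iCycles (n + 1)).hom w) :=
    congrArg (fun g => g.hom w) (HomologicalComplex.cyclesMap_i (relChainsMap f) (n + 1))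
  have h3 : ((relChainsMap f).f (n + 1)).hom (((relProj X).f (n + 1)).hom k) =
      ((relProj Y).f (n + 1)).hom
        (((singularChains.map (TopPair.Hom.fst f)).f (n + 1)).hom k) :=
    congrArg (fun g => (g.f (n + 1)).hom k) (relProj_map f)
  rw [h2, hw, h3, ← hc, hce, map_add, map_add, hπi, add_zero, hπd]

/-- The inclusion of the unit circle into the closed unit disk. -/
abbrev circleIncl : C({w : Metric.closedBall (0 : ℂ) 1 | ‖(w : ℂ)‖ = 1},
    Metric.closedBall (0 : ℂ) 1) := subIncl _

/-- A surjective linear map sends a generator to a generator, so neither relative homology group has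
to be computed. -/
theorem representsGenerator_of_chains {P : Set CP3} {f : ℂ → CP3} (hf : IsHolomorphicDisk P f)
    (H : ∀ (c : Chn 2 CP3) (a : Chn 1 P), push (subIncl P) a = bd c →
      ∃ (k : Chn 2 (Metric.closedBall (0 : ℂ) 1))
        (b : Chn 1 {w : Metric.closedBall (0 : ℂ) 1 | ‖(w : ℂ)‖ = 1})
        (p : Chn 2 P) (e : Chn 3 CP3),
        push circleIncl b = bd k ∧
        c = push ⟨fun w : Metric.closedBall (0 : ℂ) 1 => f w, hf.continuousOn.domRestrict⟩ k
          + push (subIncl P) p + bd e) : hf.RepresentsGenerator := by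
  have hsurj : Function.Surjective (relHomologyMap 2 hf.pairMap).hom := by
    refine relHomologyMap_surjective hf.pairMap 1 fun c a hca => ?_
    obtain ⟨c, rfl⟩ := (chnHom_bijective 2 CP3).2 c
    obtain ⟨a, rfl⟩ := (chnHom_bijective 1 P).2 a
    have h1 : push (subIncl P) a = bd c := by
      apply (chnHom_bijective 1 CP3).1
      rw [chnHom_push, chnHom_bd]
      exact hca
    obtain ⟨k, b, p, e, hb, hc⟩ := H c a h1
    refine ⟨chnHom 2 _ k, chnHom 1 _ b, chnHom 2 _ p, chnHom 3 _ e, ?_, ?_⟩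
    · refine (chnHom_push circleIncl b).symm.trans ?_
      rw [hb]
      exact chnHom_bd k
    · rw [hc, map_add, map_add, chnHom_push, chnHom_push, chnHom_bd]
      rfl
  intro c hc
  have := congrArg (Submodule.map (relHomologyMap 2 hf.pairMap).hom) hc
  rw [Submodule.map_span, Set.image_singleton, Submodule.map_top,
    LinearMap.range_eq_top.2 hsurj] at this
  exact this

end RelativeHomology


/-! ### Prisms -/

section Prisms

variable {X Y : Type} [TopologicalSpace X] [TopologicalSpace Y]

/-- The inclusion of `X` as a slice of the cylinder `X × unitInterval`. -/
def slice (t : unitInterval) : C(X, X × unitInterval) := ⟨fun x => (x, t), by fun_prop⟩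

/-- The map of cylinders induced by a map. -/
def cyl (f : C(X, Y)) : C(X × unitInterval, Y × unitInterval) := f.prodMap (ContinuousMap.id unitInterval)

theorem cyl_comp {Z : Type} [TopologicalSpace Z] (g : C(Y, Z)) (f : C(X, Y)) :
    cyl (g.comp f) = (cyl g).comp (cyl f) := rfl

theorem cyl_comp_slice (f : C(X, Y)) (t : unitInterval) : (cyl f).comp (slice t) = (slice t).comp f := rfl

/-- The natural operator on chains defined by a chain in the cylinder over the standard simplex. -/
def prismOp {n : ℕ} (p : Chn (n + 1) (stdSimplex ℝ (Fin (n + 1)) × unitInterval)) :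
    Chn n X →ₗ[ℤ] Chn (n + 1) (X × unitInterval) :=
  Finsupp.lift _ ℤ (Simp n X) fun σ => push (cyl σ) p

theorem prismOp_single {n : ℕ} (p : Chn (n + 1) (stdSimplex ℝ (Fin (n + 1)) × unitInterval)) (σ : Simp n X)
    (a : ℤ) : prismOp p (Finsupp.single σ a) = a • push (cyl σ) p := by
  simp [prismOp]

theorem prismOp_push {n : ℕ} (p : Chn (n + 1) (stdSimplex ℝ (Fin (n + 1)) × unitInterval)) (f : C(X, Y))
    (c : Chn n X) : prismOp p (push f c) = push (cyl f) (prismOp p c) := by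
  have : (prismOp p).comp (push f) = (push (cyl f)).comp (prismOp (X := X) p) :=
    chn_hom_ext fun σ => by simp [push_single, prismOp_single, cyl_comp, push_comp]
  exact congrArg (· c) this

/-- The tautological chain of the standard simplex. -/
def idChn (n : ℕ) : Chn n (stdSimplex ℝ (Fin (n + 1))) :=
  Finsupp.single (ContinuousMap.id _) 1

theorem push_idChn {n : ℕ} (σ : Simp n X) : push σ (idChn n) = Finsupp.single σ 1 := by
  simp [idChn, push_single]

/-- By naturality the prism identity for the tautological simplex implies it for all chains. -/
theorem bd_prismOp {n : ℕ} {p : Chn (n + 1) (stdSimplex ℝ (Fin (n + 1)) × unitInterval)}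
    {p' : Chn (n + 2) (stdSimplex ℝ (Fin (n + 2)) × unitInterval)}
    (h : bd p' = push (slice 1) (idChn (n + 1)) - push (slice 0) (idChn (n + 1))
      - prismOp p (bd (idChn (n + 1)))) (c : Chn (n + 1) X) :
    bd (prismOp p' c) = push (slice 1) c - push (slice 0) c - prismOp p (bd c) := by
  have : bd.comp (prismOp p') =
      push (slice (X := X) 1) - push (slice 0) - (prismOp p).comp bd := by
    refine chn_hom_ext fun σ => ?_
    simp only [LinearMap.comp_apply, LinearMap.sub_apply, prismOp_single, one_smul, bd_push, h,
      map_sub, ← push_comp, cyl_comp_slice]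
    rw [push_comp, push_comp, push_idChn, ← prismOp_push, ← bd_push, push_idChn]
  exact congrArg (· c) this

instance (n : ℕ) : ContractibleSpace (stdSimplex ℝ (Fin (n + 1))) :=
  (convex_stdSimplex ℝ _).contractibleSpace ⟨_, single_mem_stdSimplex ℝ 0⟩

instance : ContractibleSpace unitInterval := (convex_Icc (0 : ℝ) 1).contractibleSpace ⟨0, by simp⟩

/-- Acyclic models: the prescribed boundary is a cycle by the identity one degree lower, and it
bounds because a simplex times an interval is contractible. -/
theorem exists_prism_succ {n : ℕ} {p : Chn (n + 1) (stdSimplex ℝ (Fin (n + 1)) × unitInterval)}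
    (hp : ∀ (X : Type) [TopologicalSpace X] (c : Chn (n + 1) X),
      bd (prismOp p (bd c)) = push (slice 1) (bd c) - push (slice 0) (bd c)) :
    ∃ p' : Chn (n + 2) (stdSimplex ℝ (Fin (n + 2)) × unitInterval),
      bd p' = push (slice 1) (idChn (n + 1)) - push (slice 0) (idChn (n + 1))
        - prismOp p (bd (idChn (n + 1))) := by
  refine exists_bd_eq_of_contractibleSpace ?_
  rw [map_sub, map_sub, bd_push, bd_push, hp, sub_self]

theorem exists_prism_zero :
    ∃ p : Chn 1 (stdSimplex ℝ (Fin 1) × unitInterval), ∀ (X : Type) [TopologicalSpace X] (c : Chn 0 X),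
      bd (prismOp p c) = push (slice 1) c - push (slice 0) c := by
  -- The prism over a point is the vertical edge.
  let τ : Simp 1 (stdSimplex ℝ (Fin 1) × unitInterval) :=
    ⟨fun x => (default, stdSimplexHomeomorphUnitInterval x), by fun_prop⟩
  refine ⟨Finsupp.single τ 1, fun X _ c => ?_⟩
  have : bd.comp (prismOp (Finsupp.single τ 1)) = push (slice (X := X) 1) - push (slice 0) := by
    refine chn_hom_ext fun σ => ?_
    have key : ∀ (i : Fin 2) (t : unitInterval), stdSimplexHomeomorphUnitInterval
        (stdSimplex.map i.succAbove default) = t →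
        ((cyl σ).comp τ).comp (faceMap i) = (slice t).comp σ := by
      rintro i t rfl
      ext x : 1
      obtain rfl := Subsingleton.elim x default
      exact Prod.ext rfl rfl
    have hd : (default : stdSimplex ℝ (Fin 1)) = stdSimplex.vertex 0 := Subsingleton.elim _ _
    have h0 := key 0 1 (by
      rw [hd, stdSimplex.map_vertex]
      exact stdSimplexHomeomorphUnitInterval_one)
    have h1 := key 1 0 (by
      rw [hd, stdSimplex.map_vertex]
      exact stdSimplexHomeomorphUnitInterval_zero)
    rw [LinearMap.comp_apply, prismOp_single, one_smul, push_single, bd_single,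
      Fin.sum_univ_two, h0, h1, LinearMap.sub_apply, push_single, push_single]
    simp
    abel
  exact congrArg (· c) this

theorem exists_prism (n : ℕ) : ∃ (p : Chn (n + 1) (stdSimplex ℝ (Fin (n + 1)) × unitInterval))
    (p' : Chn (n + 2) (stdSimplex ℝ (Fin (n + 2)) × unitInterval)),
      bd p' = push (slice 1) (idChn (n + 1)) - push (slice 0) (idChn (n + 1))
        - prismOp p (bd (idChn (n + 1))) := by
  suffices H : ∃ p : Chn (n + 1) (stdSimplex ℝ (Fin (n + 1)) × unitInterval),
      ∀ (X : Type) [TopologicalSpace X] (c : Chn (n + 1) X),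
      bd (prismOp p (bd c)) = push (slice 1) (bd c) - push (slice 0) (bd c) by
    obtain ⟨p, hp⟩ := H
    exact ⟨p, exists_prism_succ hp⟩
  induction n with
  | zero =>
    obtain ⟨p, hp⟩ := exists_prism_zero
    exact ⟨p, fun X _ c => hp X _⟩
  | succ n ih =>
    obtain ⟨p, hp⟩ := ih
    obtain ⟨p', hp'⟩ := exists_prism_succ hp
    exact ⟨p', fun X _ c => by rw [bd_prismOp hp', bd_bd, map_zero, sub_zero]⟩

/-- A family of homotopies of the simplices of a cycle which is compatible with faces yields
a homologous cycle. -/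
theorem exists_bd_eq_of_natural_homotopy {n : ℕ} {c : Chn (n + 1) X} (hc : bd c = 0)
    (G : Simp (n + 1) X → C(stdSimplex ℝ (Fin (n + 2)) × unitInterval, Y))
    (G' : Simp n X → C(stdSimplex ℝ (Fin (n + 1)) × unitInterval, Y))
    (hG : ∀ σ ∈ c.support, ∀ i, (G σ).comp (cyl (faceMap i)) = G' (σ.comp (faceMap i))) :
    ∃ e : Chn (n + 2) Y, bd e = c.mapDomain (fun σ => (G σ).comp (slice 1))
      - c.mapDomain (fun σ => (G σ).comp (slice 0)) := by
  obtain ⟨p, p', h⟩ := exists_prism n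
  let T : Chn n X →ₗ[ℤ] Chn (n + 1) Y := Finsupp.lift _ ℤ _ fun σ => push (G' σ) p
  have hT : ∀ σ (a : ℤ), T (Finsupp.single σ a) = a • push (G' σ) p := fun σ a => by simp [T]
  refine ⟨c.sum fun σ a => a • push (G σ) p', ?_⟩
  have h1 : ∀ σ ∈ c.support, bd (push (G σ) p') =
      Finsupp.single ((G σ).comp (slice 1)) 1 - Finsupp.single ((G σ).comp (slice 0)) 1
        - T (bd (Finsupp.single σ 1)) := by
    intro σ hσ
    rw [bd_push, h, map_sub, map_sub, ← push_comp, ← push_comp, push_idChn, push_idChn]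
    congr 1
    rw [bd_single, idChn, bd_single]
    simp only [map_sum, prismOp_single, hT, map_smul, ← push_comp]
    refine Finset.sum_congr rfl fun i _ => ?_
    rw [← hG σ hσ i]
    rfl
  -- Compatibility with faces makes the sides of the prisms depend only on `bd c`, which vanishes.
  have h2 : c.sum (fun σ a => a • T (bd (Finsupp.single σ 1))) = 0 := by
    have h3 : T (bd (c.sum Finsupp.single)) = 0 := by rw [Finsupp.sum_single, hc, map_zero]
    rw [← h3, Finsupp.sum, Finsupp.sum, map_sum, map_sum]
    refine Finset.sum_congr rfl fun σ _ => ?_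
    rw [← map_smul, ← map_smul, Finsupp.smul_single_one]
  rw [Finsupp.mapDomain, Finsupp.mapDomain, Finsupp.sum, map_sum, Finsupp.sum, Finsupp.sum,
    ← sub_zero (_ - _), ← h2, Finsupp.sum, ← Finset.sum_sub_distrib, ← Finset.sum_sub_distrib]
  refine Finset.sum_congr rfl fun σ hσ => ?_
  rw [map_smul, h1 σ hσ, smul_sub, smul_sub, Finsupp.smul_single_one, Finsupp.smul_single_one]

end Prisms


/-! ### Bernstein polynomials on simplices -/

section Bernstein

theorem sum_prod_pi {ι κ : Type*} [Fintype ι] [DecidableEq ι] [Fintype κ] (f : ι → κ → ℝ) :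
    ∑ g : ι → κ, ∏ j, f j (g j) = ∏ j, ∑ l, f j l := by
  rw [Finset.prod_univ_sum, Fintype.piFinset_univ]

/-- The second moment of a sum of independent centered variables. -/
theorem sum_prod_mul_sq_sum {κ : Type*} [Fintype κ] {N : ℕ} {x φ : κ → ℝ} (hx : ∑ l, x l = 1)
    (hφ : ∑ l, x l * φ l = 0) :
    ∑ g : Fin N → κ, (∏ j, x (g j)) * (∑ j, φ (g j)) ^ 2 = N * ∑ l, x l * φ l ^ 2 := by
  have h1 : ∀ i j : Fin N, ∑ g : Fin N → κ, (∏ k, x (g k)) * (φ (g i) * φ (g j)) =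
      if i = j then ∑ l, x l * φ l ^ 2 else 0 := by
    intro i j
    have h2 : ∀ g : Fin N → κ, (∏ k, x (g k)) * (φ (g i) * φ (g j)) =
        ∏ k, x (g k) * ((if k = i then φ (g k) else 1) * (if k = j then φ (g k) else 1)) := by
      intro g
      rw [Finset.prod_mul_distrib, Finset.prod_mul_distrib]
      simp
    simp_rw [h2]
    rw [sum_prod_pi (fun k l => x l * ((if k = i then φ l else 1) * (if k = j then φ l else 1)))]
    split_ifs with hij
    · subst hij
      rw [← Finset.mul_prod_erase _ _ (Finset.mem_univ i), Finset.prod_eq_one, mul_one]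
      · simp [sq]
      · intro k hk
        simp [Finset.ne_of_mem_erase hk, hx]
    · refine Finset.prod_eq_zero (Finset.mem_univ i) ?_
      simp [hij, hφ]
  calc ∑ g : Fin N → κ, (∏ j, x (g j)) * (∑ j, φ (g j)) ^ 2
      = ∑ g : Fin N → κ, ∑ i, ∑ j, (∏ k, x (g k)) * (φ (g i) * φ (g j)) := by
        refine Finset.sum_congr rfl fun g _ => ?_
        rw [sq, Finset.sum_mul_sum]
        simp_rw [Finset.mul_sum]
    _ = ∑ i : Fin N, ∑ j : Fin N, ∑ g : Fin N → κ, (∏ k, x (g k)) * (φ (g i) * φ (g j)) := by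
        rw [Finset.sum_comm]
        refine Finset.sum_congr rfl fun i _ => ?_
        rw [Finset.sum_comm]
    _ = N * ∑ l, x l * φ l ^ 2 := by simp [h1]

/-- The average of a family of vertices of the standard simplex. -/
def avgVertex {N n : ℕ} (g : Fin (N + 1) → Fin (n + 1)) : stdSimplex ℝ (Fin (n + 1)) :=
  ⟨fun k => (N + 1 : ℝ)⁻¹ * ∑ j, if g j = k then 1 else 0, by
    refine ⟨fun k => by positivity, ?_⟩
    rw [← Finset.mul_sum, Finset.sum_comm]
    simp
    field_simp⟩

theorem avgVertex_apply {N n : ℕ} (g : Fin (N + 1) → Fin (n + 1)) (k : Fin (n + 1)) :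
    (avgVertex g).1 k = (N + 1 : ℝ)⁻¹ * ∑ j, if g j = k then 1 else 0 := rfl

theorem stdSimplex_map_apply {m n : ℕ} (f : Fin m → Fin n) (x : stdSimplex ℝ (Fin m))
    (k : Fin n) : (stdSimplex.map f x).1 k = ∑ l, if f l = k then x.1 l else 0 := by
  rw [← Finset.sum_filter]
  exact FunOnFinite.linearMap_apply_apply ..

theorem map_avgVertex {N m n : ℕ} (f : Fin (m + 1) → Fin (n + 1)) (g : Fin (N + 1) → Fin (m + 1)) :
    stdSimplex.map f (avgVertex g) = avgVertex (f ∘ g) := by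
  ext k
  refine (stdSimplex_map_apply f _ k).trans ?_
  refine Eq.trans ?_ (avgVertex_apply _ k).symm
  simp_rw [avgVertex_apply]
  rw [← Finset.sum_filter, ← Finset.mul_sum, Finset.sum_comm]
  congr 1
  refine Finset.sum_congr rfl fun j _ => ?_
  simp [Finset.sum_ite_eq]

variable {W : Type} [NormedAddCommGroup W] [NormedSpace ℝ W]

/-- The Bernstein polynomial of a function on the standard simplex. -/
def bernsteinPoly (N : ℕ) {n : ℕ} (f : stdSimplex ℝ (Fin (n + 1)) → W) (x : Fin (n + 1) → ℝ) : W :=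
  ∑ g : Fin (N + 1) → Fin (n + 1), (∏ j, x (g j)) • f (avgVertex g)

theorem contDiff_bernsteinPoly (N : ℕ) {n : ℕ} (f : stdSimplex ℝ (Fin (n + 1)) → W) :
    ContDiff ℝ 1 (bernsteinPoly N f) := by
  unfold bernsteinPoly
  refine ContDiff.sum fun g _ => ContDiff.smul (contDiff_prod fun j _ => ?_) contDiff_const
  exact contDiff_apply ℝ ℝ (g j)

/-- On a face the other barycentric coordinates vanish, so only maps `g` into the face contribute.
Thus the approximation of a simplex restricts to that of its faces, as needed to approximate whole
cycles. -/
theorem bernsteinPoly_map (N : ℕ) {m n : ℕ} {e : Fin (m + 1) → Fin (n + 1)}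
    (he : Function.Injective e) (f : stdSimplex ℝ (Fin (n + 1)) → W)
    (x : stdSimplex ℝ (Fin (m + 1))) :
    bernsteinPoly N f (stdSimplex.map e x).1 =
      bernsteinPoly N (fun y => f (stdSimplex.map e y)) x.1 := by
  symm
  refine Fintype.sum_of_injective (fun g : Fin (N + 1) → Fin (m + 1) => e ∘ g)
    (fun g g' h => funext fun j => he (congrFun h j)) _ _ (fun g hg => ?_) (fun g => ?_)
  · obtain ⟨j, hj⟩ : ∃ j, g j ∉ Set.range e := by
      by_contra! h
      choose g' hg' using h
      exact hg ⟨g', funext hg'⟩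
    rw [Finset.prod_eq_zero (Finset.mem_univ j), zero_smul]
    rw [stdSimplex_map_apply]
    exact Finset.sum_eq_zero fun l _ => if_neg fun h => hj ⟨l, h⟩
  · simp only [map_avgVertex]
    congr 1
    refine Finset.prod_congr rfl fun j _ => ?_
    rw [stdSimplex_map_apply]
    simp [he.eq_iff]

/-- Read `x` as a probability distribution on the vertices: `avgVertex g` is the empirical
distribution of `N + 1` independent samples, and its variance is of order `1 / (N + 1)`. -/
theorem sum_prod_avgVertex_le (N : ℕ) {n : ℕ} (x : stdSimplex ℝ (Fin (n + 1))) (k : Fin (n + 1)) :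
    ∑ g : Fin (N + 1) → Fin (n + 1), (∏ j, x.1 (g j)) * ((avgVertex g).1 k - x.1 k) ^ 2
      ≤ (N + 1 : ℝ)⁻¹ := by
  have hx : ∑ l, x.1 l = 1 := x.2.2
  have hφ : ∑ l, x.1 l * ((if l = k then 1 else 0) - x.1 k) = 0 := by
    simp [mul_sub, ← Finset.sum_mul, hx]
  have h := sum_prod_mul_sq_sum (N := N + 1) hx hφ
  have h1 : ∀ g : Fin (N + 1) → Fin (n + 1), ((avgVertex g).1 k - x.1 k) ^ 2 =
      ((N + 1 : ℝ)⁻¹) ^ 2 * (∑ j, ((if g j = k then 1 else 0) - x.1 k)) ^ 2 := by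
    intro g
    rw [avgVertex_apply, ← mul_pow]
    congr 1
    rw [Finset.sum_sub_distrib, mul_sub]
    congr 1
    simp
    field_simp
  have h2 : ∑ l, x.1 l * ((if l = k then 1 else 0) - x.1 k) ^ 2 ≤ 1 := by
    rw [← hx]
    refine Finset.sum_le_sum fun l _ => ?_
    have h3 := mem_Icc_of_mem_stdSimplex x.2 l
    have h4 := mem_Icc_of_mem_stdSimplex x.2 k
    refine mul_le_of_le_one_right h3.1 ?_
    rw [sq_le_one_iff_abs_le_one, abs_le]
    split_ifs <;> constructor <;> linarith [h4.1, h4.2]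
  calc _ = ((N + 1 : ℝ)⁻¹) ^ 2 * ∑ g : Fin (N + 1) → Fin (n + 1), (∏ j, x.1 (g j)) *
        (∑ j, ((if g j = k then 1 else 0) - x.1 k)) ^ 2 := by
        rw [Finset.mul_sum]
        refine Finset.sum_congr rfl fun g _ => ?_
        rw [h1]
        ring
    _ ≤ ((N + 1 : ℝ)⁻¹) ^ 2 * ((N + 1 : ℕ) * 1) := by
        rw [h]
        gcongr
    _ = (N + 1 : ℝ)⁻¹ := by
        push_cast
        field_simp

/-- Bernstein polynomials converge uniformly on the standard simplex. -/
theorem eventually_bernsteinPoly_sub_lt {n : ℕ} (f : C(stdSimplex ℝ (Fin (n + 1)), W)) {ε : ℝ}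
    (hε : 0 < ε) : ∀ᶠ N in Filter.atTop, ∀ x : stdSimplex ℝ (Fin (n + 1)),
      ‖bernsteinPoly N f x.1 - f x‖ < ε := by
  have : CompactSpace (stdSimplex ℝ (Fin (n + 1))) :=
    isCompact_iff_compactSpace.1 (isCompact_stdSimplex (𝕜 := ℝ) (ι := Fin (n + 1)))
  obtain ⟨δ, hδ, hf⟩ := Metric.uniformContinuous_iff.1
    (CompactSpace.uniformContinuous_of_continuous f.continuous) (ε / 2) (half_pos hε)
  obtain ⟨M, hM⟩ := isCompact_univ.exists_bound_of_continuousOn f.continuous.continuousOn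
  have hM0 : 0 ≤ M := (norm_nonneg _).trans (hM (avgVertex (N := 0) fun _ => 0) (Set.mem_univ _))
  have hlim : Filter.Tendsto (fun N : ℕ => 2 * M / δ ^ 2 * (n + 1) * (N + 1 : ℝ)⁻¹) Filter.atTop
      (nhds (2 * M / δ ^ 2 * (n + 1) * 0)) := by
    refine Filter.Tendsto.const_mul _ ?_
    simpa using tendsto_one_div_add_atTop_nhds_zero_nat (𝕜 := ℝ)
  rw [mul_zero] at hlim
  filter_upwards [hlim.eventually_lt_const (half_pos hε)] with N hN x
  have hx : ∑ g : Fin (N + 1) → Fin (n + 1), ∏ j, x.1 (g j) = 1 := by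
    rw [sum_prod_pi fun _ l => x.1 l]
    simp [show ∑ l, x.1 l = 1 from x.2.2]
  have hpos : ∀ g : Fin (N + 1) → Fin (n + 1), 0 ≤ ∏ j, x.1 (g j) := fun g =>
    Finset.prod_nonneg fun j _ => x.2.1 _
  -- Chebyshev's argument: near `x` uniform continuity is used; otherwise some coordinate differs by
  -- at least `δ`, and the trivial bound `2 M` is absorbed by the quadratic term.
  have hpt : ∀ y : stdSimplex ℝ (Fin (n + 1)),
      ‖f y - f x‖ ≤ ε / 2 + 2 * M / δ ^ 2 * ∑ k, (y.1 k - x.1 k) ^ 2 := by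
    intro y
    have hs : 0 ≤ ∑ k, (y.1 k - x.1 k) ^ 2 := Finset.sum_nonneg fun k _ => sq_nonneg _
    by_cases hy : dist y x < δ
    · have := (hf hy).le
      rw [dist_eq_norm] at this
      have : 0 ≤ 2 * M / δ ^ 2 * ∑ k, (y.1 k - x.1 k) ^ 2 := by positivity
      linarith
    · have h1 : ∃ k, δ ≤ |y.1 k - x.1 k| := by
        by_contra! h
        exact hy ((dist_pi_lt_iff hδ).2 fun k => by simpa [Real.dist_eq] using h k)
      obtain ⟨k, hk⟩ := h1
      have h2 : δ ^ 2 ≤ ∑ k, (y.1 k - x.1 k) ^ 2 := by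
        refine le_trans ?_ (Finset.single_le_sum (f := fun k => (y.1 k - x.1 k) ^ 2)
          (fun k _ => sq_nonneg _) (Finset.mem_univ k))
        rw [← sq_abs (y.1 k - x.1 k)]
        gcongr
      have h3 : ‖f y - f x‖ ≤ 2 * M := by
        refine (norm_sub_le _ _).trans ?_
        linarith [hM y (Set.mem_univ _), hM x (Set.mem_univ _)]
      have h4 : 2 * M ≤ 2 * M / δ ^ 2 * ∑ k, (y.1 k - x.1 k) ^ 2 := by
        calc 2 * M = 2 * M / δ ^ 2 * δ ^ 2 := by field_simp
          _ ≤ _ := by gcongr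
      linarith
  have h1 : bernsteinPoly N f x.1 - f x =
      ∑ g : Fin (N + 1) → Fin (n + 1), (∏ j, x.1 (g j)) • (f (avgVertex g) - f x) := by
    simp_rw [smul_sub]
    rw [Finset.sum_sub_distrib, ← Finset.sum_smul, hx, one_smul]
    rfl
  calc ‖bernsteinPoly N f x.1 - f x‖
      ≤ ∑ g : Fin (N + 1) → Fin (n + 1), (∏ j, x.1 (g j)) *
        (ε / 2 + 2 * M / δ ^ 2 * ∑ k, ((avgVertex g).1 k - x.1 k) ^ 2) := by
        rw [h1]
        refine norm_sum_le_of_le _ fun g _ => ?_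
        rw [norm_smul, Real.norm_of_nonneg (hpos g)]
        exact mul_le_mul_of_nonneg_left (hpt _) (hpos g)
    _ = ε / 2 + 2 * M / δ ^ 2 * ∑ k, ∑ g : Fin (N + 1) → Fin (n + 1), (∏ j, x.1 (g j)) *
        ((avgVertex g).1 k - x.1 k) ^ 2 := by
        simp_rw [mul_add]
        rw [Finset.sum_add_distrib, ← Finset.sum_mul, hx, one_mul, Finset.sum_comm,
          Finset.mul_sum]
        congr 1
        refine Finset.sum_congr rfl fun g _ => ?_
        rw [← Finset.mul_sum]
        ring
    _ ≤ ε / 2 + 2 * M / δ ^ 2 * ∑ k : Fin (n + 1), (N + 1 : ℝ)⁻¹ := by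
        gcongr with k
        exact sum_prod_avgVertex_le N x k
    _ < ε := by
        rw [Finset.sum_const, Finset.card_univ, Fintype.card_fin, nsmul_eq_mul, ← mul_assoc]
        push_cast
        linarith

end Bernstein


/-! ### Acyclicity of punctured vector spaces -/

section PuncturedSpace

variable {X Y : Type} [TopologicalSpace X] [TopologicalSpace Y]

theorem push_injective {f : C(X, Y)} (hf : Function.Injective f) (n : ℕ) :
    Function.Injective (push f (n := n)) :=
  Finsupp.mapDomain_injective fun σ τ h => by
    ext x
    exact hf (DFunLike.congr_fun h x)

theorem exists_push_eq {f : C(X, Y)} {n : ℕ} {c : Chn n Y}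
    (h : ∀ σ ∈ c.support, ∃ τ : Simp n X, f.comp τ = σ) : ∃ c' : Chn n X, push f c' = c := by
  choose τ hτ using h
  refine ⟨∑ s ∈ c.support.attach, Finsupp.single (τ s.1 s.2) (c s.1), ?_⟩
  simp only [map_sum, push_single, hτ]
  rw [Finset.sum_attach c.support fun σ => Finsupp.single σ (c σ)]
  exact Finsupp.sum_single c

variable {W : Type} [NormedAddCommGroup W] [NormedSpace ℝ W]

/-- The complement of the ray spanned by `u`. -/
def rayCompl (u : W) : Set W := {y | ∀ s : ℝ, 0 ≤ s → y ≠ s • u}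

/-- The complement of a ray is star-shaped about the opposite vector. -/
theorem contractibleSpace_rayCompl {u : W} (hu : u ≠ 0) : ContractibleSpace (rayCompl u) := by
  have hmem : -u ∈ rayCompl u := fun s hs h => by
    have h1 : (s + 1) • u = 0 := by rw [add_smul, ← h, one_smul, neg_add_cancel]
    rcases smul_eq_zero.1 h1 with h2 | h2
    · linarith
    · exact hu h2
  have hstar : StarConvex ℝ (-u) (rayCompl u) := by
    intro y hy a b ha hb hab s hs h
    rcases hb.eq_or_lt with rfl | hb
    · obtain rfl : a = 1 := by linarith
      rw [one_smul, zero_smul, add_zero] at h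
      exact hmem s hs h
    · refine hy ((s + a) / b) (by positivity) ?_
      have h1 : b • y = (s + a) • u := by
        rw [add_smul, ← h, smul_neg]
        abel
      rw [div_eq_inv_mul, mul_smul, ← h1, smul_smul, inv_mul_cancel₀ hb.ne', one_smul]
  exact hstar.contractibleSpace ⟨_, hmem⟩

/-- The inclusion of the complement of a ray into the punctured space. -/
def rayComplIncl (u : W) : C(rayCompl u, {y : W // y ≠ 0}) :=
  ⟨fun y => ⟨y.1, fun h => y.2 0 le_rfl (by rw [h, zero_smul])⟩, by fun_prop⟩

/-- The cone over each polynomial simplex is a `C¹` image of a space of dimension `n + 2`, less than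
that of `W`. A countable union of such sets has Hausdorff dimension below `dim W` and so misses some
nonzero `u`, whose ray then avoids all the simplices. -/
theorem exists_forall_bernsteinPoly_mem_rayCompl [FiniteDimensional ℝ W] {n : ℕ} (N : ℕ)
    (hn : n + 2 < Module.finrank ℝ W) (S : Set (stdSimplex ℝ (Fin (n + 1)) → W))
    (hS : S.Countable) : ∃ u : W, u ≠ 0 ∧ ∀ f ∈ S, ∀ x : stdSimplex ℝ (Fin (n + 1)),
      bernsteinPoly N f x.1 ≠ 0 → bernsteinPoly N f x.1 ∈ rayCompl u := by
  have := hS.to_subtype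
  let R : S → (Fin (n + 1) → ℝ) × ℝ → W := fun f p => p.2 • bernsteinPoly N f.1 p.1
  have hR : ∀ f, dimH (Set.range (R f)) ≤ ((n + 2 : ℕ) : ENNReal) := by
    intro f
    have h1 : ContDiff ℝ 1 (R f) :=
      contDiff_snd.smul ((contDiff_bernsteinPoly N f.1).comp contDiff_fst)
    refine h1.dimH_range_le.trans ?_
    simp
    norm_cast
  have hdim : dimH (⋃ f, Set.range (R f)) < Module.finrank ℝ W := by
    rw [dimH_iUnion]
    refine (iSup_le hR).trans_lt ?_
    exact_mod_cast hn
  have hne : ({0}ᶜ : Set W).Nonempty := by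
    have : Nontrivial W := Module.nontrivial_of_finrank_pos (R := ℝ) (by omega)
    exact exists_ne 0
  obtain ⟨u, hu, hu'⟩ := (dense_compl_of_dimH_lt_finrank hdim).inter_open_nonempty _
    isOpen_compl_singleton hne
  refine ⟨u, hu, fun f hf x hx s hs h => ?_⟩
  rcases hs.eq_or_lt with rfl | hs
  · exact hx (by rw [h, zero_smul])
  · refine hu' (Set.mem_iUnion.2 ⟨⟨f, hf⟩, (x.1, s⁻¹), ?_⟩)
    simp only [R]
    rw [h, smul_smul, inv_mul_cancel₀ hs.ne', one_smul]

/-- The straight-line homotopy from a simplex to its Bernstein polynomial (or a constant, if that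
homotopy meets the origin). -/
def bernsteinHomotopy (N : ℕ) {n : ℕ} (σ : Simp n {y : W // y ≠ 0}) :
    C(stdSimplex ℝ (Fin (n + 1)) × unitInterval, {y : W // y ≠ 0}) :=
  open Classical in
  if h : ∀ p : stdSimplex ℝ (Fin (n + 1)) × unitInterval,
    (σ p.1).1 + p.2.1 • (bernsteinPoly N (fun y => (σ y).1) p.1.1 - (σ p.1).1) ≠ 0 then
  ⟨fun p => ⟨_, h p⟩, by
    have := (contDiff_bernsteinPoly N (fun y => (σ y).1)).continuous
    fun_prop⟩
  else ContinuousMap.const _ (σ (avgVertex (N := 0) fun _ => 0))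

theorem bernsteinHomotopy_apply {N : ℕ} {n : ℕ} {σ : Simp n {y : W // y ≠ 0}}
    (h : ∀ p : stdSimplex ℝ (Fin (n + 1)) × unitInterval,
    (σ p.1).1 + p.2.1 • (bernsteinPoly N (fun y => (σ y).1) p.1.1 - (σ p.1).1) ≠ 0)
    (p : stdSimplex ℝ (Fin (n + 1)) × unitInterval) : (bernsteinHomotopy N σ p).1 =
    (σ p.1).1 + p.2.1 • (bernsteinPoly N (fun y => (σ y).1) p.1.1 - (σ p.1).1) := by
  rw [bernsteinHomotopy, dif_pos h]
  rfl

theorem eventually_segment_ne_zero {n : ℕ} (σ : Simp n {y : W // y ≠ 0}) :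
    ∀ᶠ N in Filter.atTop, ∀ p : stdSimplex ℝ (Fin (n + 1)) × unitInterval,
    (σ p.1).1 + p.2.1 • (bernsteinPoly N (fun y => (σ y).1) p.1.1 - (σ p.1).1) ≠ 0 := by
  have : CompactSpace (stdSimplex ℝ (Fin (n + 1))) :=
    isCompact_iff_compactSpace.1 (isCompact_stdSimplex (𝕜 := ℝ) (ι := Fin (n + 1)))
  let f : C(stdSimplex ℝ (Fin (n + 1)), W) := ⟨fun x => (σ x).1, by fun_prop⟩
  obtain ⟨x₀, -, hx₀⟩ := isCompact_univ.exists_isMinOn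
    ⟨avgVertex (N := 0) fun _ => (0 : Fin (n + 1)), Set.mem_univ _⟩ f.continuous.norm.continuousOn
  have hε : 0 < ‖f x₀‖ := norm_pos_iff.2 (σ x₀).2
  filter_upwards [eventually_bernsteinPoly_sub_lt f hε] with N hN p h0
  have h1 := hN p.1
  have h2 : ‖f x₀‖ ≤ ‖f p.1‖ := hx₀ (Set.mem_univ _)
  have h3 : f p.1 = -(p.2.1 • (bernsteinPoly N f p.1.1 - f p.1)) := eq_neg_of_add_eq_zero_left h0
  have h4 : ‖f p.1‖ ≤ ‖bernsteinPoly N f p.1.1 - f p.1‖ := by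
    conv_lhs => rw [h3]
    rw [norm_neg, norm_smul, Real.norm_of_nonneg p.2.2.1]
    exact mul_le_of_le_one_left (norm_nonneg _) p.2.2.2
  linarith

/-- The punctured space is acyclic below the dimension of the sphere. -/
theorem exists_bd_eq_of_punctured [FiniteDimensional ℝ W] {n : ℕ}
    (hn : n + 3 < Module.finrank ℝ W) {c : Chn (n + 1) {y : W // y ≠ 0}} (hc : bd c = 0) :
    ∃ e, bd e = c := by
  -- One degree `N` for all simplices of the cycle, large enough that the straight segments to the
  -- approximations avoid the origin.
  obtain ⟨N, hN⟩ : ∃ N, ∀ σ ∈ c.support, ∀ p : stdSimplex ℝ (Fin (n + 2)) × unitInterval,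
      (σ p.1).1 + p.2.1 • (bernsteinPoly N (fun y => (σ y).1) p.1.1 - (σ p.1).1) ≠ 0 :=
    ((Filter.eventually_all_finset c.support).2 fun σ _ => eventually_segment_ne_zero σ).exists
  obtain ⟨e, he⟩ := exists_bd_eq_of_natural_homotopy hc (bernsteinHomotopy N) (bernsteinHomotopy N)
    (by
      intro σ hσ i
      have key : ∀ p : stdSimplex ℝ (Fin (n + 1)) × unitInterval,
          ((σ.comp (faceMap i)) p.1).1 + p.2.1 •
            (bernsteinPoly N (fun y => ((σ.comp (faceMap i)) y).1) p.1.1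
              - ((σ.comp (faceMap i)) p.1).1) =
          (σ (faceMap i p.1)).1 + p.2.1 • (bernsteinPoly N (fun y => (σ y).1) (faceMap i p.1).1
            - (σ (faceMap i p.1)).1) := fun p => by
        have := bernsteinPoly_map N (Fin.succAbove_right_injective (p := i))
          (fun y => (σ y).1) p.1
        have h2 : bernsteinPoly N (fun y => (σ y).1) (faceMap i p.1).1 =
          bernsteinPoly N (fun y => ((σ.comp (faceMap i)) y).1) p.1.1 := this
        rw [h2]
        rfl
      ext p
      rw [bernsteinHomotopy_apply fun p => by rw [key]; exact hN σ hσ (faceMap i p.1, p.2), key]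
      exact bernsteinHomotopy_apply (hN σ hσ) (faceMap i p.1, p.2))
  have h0 : c.mapDomain (fun σ => (bernsteinHomotopy N σ).comp (slice 0)) = c := by
    refine (Finsupp.mapDomain_congr fun σ hσ => ?_).trans Finsupp.mapDomain_id
    ext x
    refine (bernsteinHomotopy_apply (hN σ hσ) (x, 0)).trans ?_
    simp
  rw [h0] at he
  set c' := c.mapDomain (fun σ => (bernsteinHomotopy N σ).comp (slice 1)) with hc'
  have hbd : bd c' = 0 := by
    rw [← sub_eq_zero, ← hc, ← map_sub, hc, ← he, bd_bd]
  -- The approximated cycle lies in the complement of a ray, which is contractible, so it bounds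
  -- there.
  obtain ⟨u, hu, hray⟩ := exists_forall_bernsteinPoly_mem_rayCompl (W := W) (n := n + 1) N hn
    ((fun (σ : Simp (n + 1) {y : W // y ≠ 0}) y => (σ y).1) '' c.support)
    ((Finset.countable_toSet _).image _)
  have := contractibleSpace_rayCompl hu
  obtain ⟨d, hd⟩ := exists_push_eq (f := rayComplIncl u) (c := c') fun τ hτ => by
    classical
    obtain ⟨σ, hσ, rfl⟩ := Finset.mem_image.1 (Finsupp.mapDomain_support hτ)
    have h1 : ∀ x, (((bernsteinHomotopy N σ).comp (slice 1)) x).1 =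
        bernsteinPoly N (fun y => (σ y).1) x.1 := fun x =>
      (bernsteinHomotopy_apply (hN σ hσ) (x, 1)).trans (by simp)
    have h2 : ∀ x, (((bernsteinHomotopy N σ).comp (slice 1)) x).1 ∈ rayCompl u := fun x => by
      rw [h1]
      refine hray _ ⟨σ, hσ, rfl⟩ x ?_
      rw [← h1]
      exact (((bernsteinHomotopy N σ).comp (slice 1)) x).2
    exact ⟨⟨fun x => ⟨_, h2 x⟩, by fun_prop⟩, rfl⟩
  have hd0 : bd d = 0 := by
    refine push_injective (f := rayComplIncl u) (fun a b h => ?_) _ ?_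
    · exact Subtype.ext (congrArg (fun y : {y : W // y ≠ 0} => y.1) h)
    · rw [← bd_push, hd, hbd, map_zero]
  obtain ⟨e', rfl⟩ := exists_bd_eq_of_contractibleSpace hd0
  exact ⟨push (rayComplIncl u) e' - e, by rw [map_sub, bd_push, hd, he]; abel⟩

end PuncturedSpace


/-! ### Lifting simplices from projective space -/

section Lifts

/-- The complement of the origin in `ℂ⁴`. -/
abbrev PuncturedC4 : Type := {z : Fin 4 → ℂ // z ≠ 0}

/-- The projection to projective space. -/
def projC : C(PuncturedC4, CP3) := ⟨Projectivization.mk' ℂ, isQuotientMap_mk'.continuous⟩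

theorem projC_apply (z : PuncturedC4) : projC z = Projectivization.mk ℂ z.1 z.2 := rfl

/-- The Hermitian product on `ℂ⁴`. -/
def herm (z w : Fin 4 → ℂ) : ℂ := ∑ i, conj (z i) * w i

theorem herm_smul_right (c : ℂ) (z w : Fin 4 → ℂ) : herm z (c • w) = c * herm z w := by
  simp only [herm, Pi.smul_apply, smul_eq_mul, Finset.mul_sum]
  exact Finset.sum_congr rfl fun i _ => by ring

theorem herm_smul_left (c : ℂ) (z w : Fin 4 → ℂ) : herm (c • z) w = conj c * herm z w := by
  simp only [herm, Pi.smul_apply, smul_eq_mul, Finset.mul_sum, map_mul]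
  exact Finset.sum_congr rfl fun i _ => by ring

theorem herm_self_ne_zero {z : Fin 4 → ℂ} (hz : z ≠ 0) : herm z z ≠ 0 := by
  have h1 : herm z z = ((∑ i, Complex.normSq (z i) : ℝ) : ℂ) := by
    simp [herm, Complex.normSq_eq_conj_mul_self]
  rw [h1]
  obtain ⟨i, hi⟩ := Function.ne_iff.1 hz
  have h2 : 0 < ∑ i, Complex.normSq (z i) :=
    Finset.sum_pos' (fun i _ => Complex.normSq_nonneg _)
      ⟨i, Finset.mem_univ _, Complex.normSq_pos.2 hi⟩
  exact_mod_cast h2.ne'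

@[fun_prop]
theorem Continuous.herm {X : Type*} [TopologicalSpace X] {f g : X → Fin 4 → ℂ} (hf : Continuous f)
    (hg : Continuous g) : Continuous fun x => herm (f x) (g x) := by
  unfold _root_.herm
  fun_prop

/-- The orthogonal projector on the line of a point of projective space. -/
def projector (p : CP3) (i j : Fin 4) : ℂ := p.rep i * conj (p.rep j) / herm p.rep p.rep

theorem projector_mk {z : Fin 4 → ℂ} (hz : z ≠ 0) (i j : Fin 4) :
    projector (Projectivization.mk ℂ z hz) i j = z i * conj (z j) / herm z z := by
  obtain ⟨c, hc, h⟩ := rep_mk z hz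
  have hc' : conj c ≠ 0 := by simpa using hc
  have h0 := herm_self_ne_zero hz
  rw [projector, h, herm_smul_left, herm_smul_right]
  simp only [Pi.smul_apply, smul_eq_mul, map_mul]
  field_simp

theorem continuous_projector (i j : Fin 4) : Continuous fun p => projector p i j := by
  rw [isQuotientMap_mk'.continuous_iff]
  have : (fun p => projector p i j) ∘ (Projectivization.mk' ℂ : PuncturedC4 → CP3) =
      fun z => z.1 i * conj (z.1 j) / herm z.1 z.1 := funext fun z => projector_mk z.2 i j
  rw [this]
  have hv : ∀ k, Continuous fun z : PuncturedC4 => z.1 k := fun k =>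
    (continuous_apply k).comp continuous_subtype_val
  exact ((hv i).mul (Complex.continuous_conj.comp (hv j))).div
    (continuous_subtype_val.herm continuous_subtype_val) fun z => herm_self_ne_zero z.2

/-- The projection of a vector to the line of a point of projective space. -/
def projLine (p : CP3) (v : Fin 4 → ℂ) : Fin 4 → ℂ := fun i => ∑ j, projector p i j * v j

theorem projLine_mk {z : Fin 4 → ℂ} (hz : z ≠ 0) (v : Fin 4 → ℂ) :
    projLine (Projectivization.mk ℂ z hz) v = (herm z v / herm z z) • z := by
  funext i
  simp only [projLine, projector_mk hz, Pi.smul_apply, smul_eq_mul, herm, Finset.sum_div,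
    Finset.sum_mul]
  exact Finset.sum_congr rfl fun j _ => by ring

/-- The trace of the product of two projectors. -/
def overlap (p q : CP3) : ℂ := ∑ i, ∑ j, projector p i j * projector q j i

theorem continuous_overlap : Continuous fun x : CP3 × CP3 => overlap x.1 x.2 := by
  unfold overlap
  refine continuous_finsetSum _ fun i _ => continuous_finsetSum _ fun j _ => ?_
  exact ((continuous_projector i j).comp continuous_fst).mul
    ((continuous_projector j i).comp continuous_snd)

theorem overlap_mk {z w : Fin 4 → ℂ} (hz : z ≠ 0) (hw : w ≠ 0) :
    overlap (Projectivization.mk ℂ z hz) (Projectivization.mk ℂ w hw) =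
      herm z w * herm w z / (herm z z * herm w w) := by
  simp only [overlap, projector_mk]
  have : herm z w * herm w z = ∑ i, ∑ j, (z i * conj (z j)) * (w j * conj (w i)) := by
    rw [mul_comm, herm, herm, Finset.sum_mul_sum]
    refine Finset.sum_congr rfl fun i _ => Finset.sum_congr rfl fun j _ => by ring
  rw [this, Finset.sum_div]
  refine Finset.sum_congr rfl fun i _ => ?_
  rw [Finset.sum_div]
  refine Finset.sum_congr rfl fun j _ => by rw [div_mul_div_comm]

theorem overlap_self (p : CP3) : overlap p p = 1 := by
  induction p using Projectivization.ind with
  | h z hz =>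
    rw [overlap_mk]
    exact div_self (mul_ne_zero (herm_self_ne_zero hz) (herm_self_ne_zero hz))

theorem projLine_ne_zero {v : PuncturedC4} {q : CP3} (h : overlap (projC v) q ≠ 0) :
    projLine q v.1 ≠ 0 := by
  induction q using Projectivization.ind with
  | h z hz =>
    have h1 : overlap (Projectivization.mk ℂ v.1 v.2) (Projectivization.mk ℂ z hz) ≠ 0 := h
    rw [overlap_mk] at h1
    rw [projLine_mk]
    refine smul_ne_zero (div_ne_zero (fun h2 => h1 ?_) (herm_self_ne_zero hz)) hz
    rw [h2, mul_zero, zero_div]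

theorem projC_projLine {v : PuncturedC4} {q : CP3} (h : projLine q v.1 ≠ 0) :
    projC ⟨projLine q v.1, h⟩ = q := by
  induction q using Projectivization.ind with
  | h z hz =>
    have h1 := projLine_mk hz v.1
    have h2 : herm z v.1 / herm z z ≠ 0 := fun h0 => h (by rw [h1, h0, zero_smul])
    rw [projC_apply, mk_eq_mk_iff_exists h hz]
    refine ⟨herm z v.1 / herm z z, h2, ?_⟩
    rw [h1]

variable {K : Type} [PseudoMetricSpace K] [CompactSpace K]

/-- A homotopy that starts at a constant map lifts to the punctured vector space. -/
theorem exists_lift_of_homotopy {H : K × unitInterval → CP3} (hH : Continuous H) {p₀ : CP3}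
    (h0 : ∀ x, H (x, 0) = p₀) : ∃ v : C(K, PuncturedC4), ∀ x, projC (v x) = H (x, 1) := by
  -- The overlap of a line with itself is `1`, so by uniform continuity lines at nearby times are
  -- never orthogonal. The lift is carried along by orthogonal projection to the next line, in `N`
  -- short steps.
  have hF : Continuous fun y : K × unitInterval × unitInterval =>
      overlap (H (y.1, y.2.1)) (H (y.1, y.2.2)) :=
    continuous_overlap.comp (f := fun y : K × unitInterval × unitInterval =>
      (H (y.1, y.2.1), H (y.1, y.2.2)))
      ((hH.comp (continuous_fst.prodMk (continuous_fst.comp continuous_snd))).prodMk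
        (hH.comp (continuous_fst.prodMk (continuous_snd.comp continuous_snd))))
  obtain ⟨δ, hδ, hu⟩ := Metric.uniformContinuous_iff.1
    (CompactSpace.uniformContinuous_of_continuous hF) 1 one_pos
  clear hF
  obtain ⟨N, hN⟩ := exists_nat_gt δ⁻¹
  have hN0 : (0 : ℝ) < N := (inv_pos.2 hδ).trans hN
  have key : ∀ (x : K) (s t : unitInterval), |s.1 - t.1| < δ →
      overlap (H (x, s)) (H (x, t)) ≠ 0 := by
    intro x s t hst h
    have h1 : dist ((x, s, t) : K × unitInterval × unitInterval) (x, s, s) < δ := by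
      rw [Prod.dist_eq, Prod.dist_eq, dist_self, dist_self, max_eq_right dist_nonneg,
        max_eq_right dist_nonneg, dist_comm, Subtype.dist_eq,
        Real.dist_eq]
      exact hst
    have h2 := hu h1
    rw [h, overlap_self, dist_zero_left, norm_one] at h2
    exact lt_irrefl _ h2
  have hmem : ∀ k ≤ N, (k / N : ℝ) ∈ unitInterval := fun k hk =>
    ⟨by positivity, div_le_one_of_le₀ (by exact_mod_cast hk) hN0.le⟩
  have hrec : ∀ k (hk : k ≤ N), ∃ v : C(K, PuncturedC4),
      ∀ x, projC (v x) = H (x, ⟨k / N, hmem k hk⟩) := by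
    intro k
    induction k with
    | zero =>
      intro hk
      refine ⟨ContinuousMap.const K ⟨p₀.rep, p₀.rep_nonzero⟩, fun x => ?_⟩
      have : (⟨((0 : ℕ) : ℝ) / N, hmem 0 hk⟩ : unitInterval) = 0 := Subtype.ext (by simp)
      rw [this, h0]
      exact p₀.mk_rep
    | succ k ih =>
      intro hk
      obtain ⟨v, hv⟩ := ih (by omega)
      have h1 : ∀ x, projLine (H (x, ⟨(k + 1 : ℕ) / N, hmem _ hk⟩)) (v x).1 ≠ 0 := by
        intro x
        apply projLine_ne_zero
        rw [hv]
        apply key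
        have : (k / N : ℝ) - ((k + 1 : ℕ) / N : ℝ) = - (N : ℝ)⁻¹ := by
          push_cast
          field_simp
          ring
        simp only [this, abs_neg, abs_inv, Nat.abs_cast]
        exact inv_lt_of_inv_lt₀ hδ hN
      refine ⟨⟨fun x => ⟨_, h1 x⟩, ?_⟩, fun x => projC_projLine (h1 x)⟩
      refine Continuous.subtype_mk (continuous_pi fun i => ?_) _
      refine continuous_finsetSum _ fun j _ => Continuous.mul ?_
        ((continuous_apply j).comp (continuous_subtype_val.comp v.continuous))
      exact (continuous_projector i j).comp (hH.comp (by fun_prop))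
  obtain ⟨v, hv⟩ := hrec N le_rfl
  refine ⟨v, fun x => ?_⟩
  rw [hv]
  congr 2
  exact Subtype.ext (div_self hN0.ne')

instance {n : ℕ} : CompactSpace (stdSimplex ℝ (Fin n)) :=
  isCompact_iff_compactSpace.1 (isCompact_stdSimplex (𝕜 := ℝ) (ι := Fin n))

/-- A simplex contracts to a point, so any map from it is the end of a homotopy that starts at a
constant. -/
theorem exists_lift_simp {n : ℕ} (σ : Simp n CP3) : ∃ τ : Simp n PuncturedC4, projC.comp τ = σ := by
  obtain ⟨x₀, ⟨F⟩⟩ := id_nullhomotopic (stdSimplex ℝ (Fin (n + 1)))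
  obtain ⟨v, hv⟩ := exists_lift_of_homotopy
    (H := fun y : stdSimplex ℝ (Fin (n + 1)) × unitInterval => σ (F.symm (y.2, y.1)))
    (by fun_prop) (p₀ := σ x₀) (fun x => by simp)
  exact ⟨v, ContinuousMap.ext fun x => by simpa using hv x⟩

/-- Continuous logarithms along paths. -/
theorem exists_log_simp (c : Simp 1 ℂ) (hc : ∀ x, c x ≠ 0) :
    ∃ φ : Simp 1 ℂ, ∀ x, Complex.exp (φ x) = c x := by
  let γ : C(unitInterval, {z : ℂ // z ≠ 0}) :=
    ⟨fun s => ⟨c (stdSimplexHomeomorphUnitInterval.symm s), hc _⟩, by fun_prop⟩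
  obtain ⟨Γ, hΓ, -⟩ := Complex.isCoveringMap_exp.exists_path_lifts γ (Complex.log (γ 0).1)
    (Subtype.ext (Complex.exp_log (γ 0).2).symm)
  refine ⟨⟨fun x => Γ (stdSimplexHomeomorphUnitInterval x), by fun_prop⟩, fun x => ?_⟩
  have := congrArg Subtype.val (congrFun hΓ (stdSimplexHomeomorphUnitInterval x))
  refine this.trans ?_
  simp [γ]

end Lifts


/-! ### The cone over the real submanifold -/

section RealCone

/-- The action of `ℂ` on the punctured vector space through the exponential. -/
def expSmul (φ : ℂ) (z : PuncturedC4) : PuncturedC4 :=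
  ⟨Complex.exp φ • z.1, smul_ne_zero (Complex.exp_ne_zero _) z.2⟩

theorem continuous_expSmul {X : Type*} [TopologicalSpace X] {f : X → ℂ} {g : X → PuncturedC4}
    (hf : Continuous f) (hg : Continuous g) : Continuous fun x => expSmul (f x) (g x) :=
  Continuous.subtype_mk ((Complex.continuous_exp.comp hf).smul
    (continuous_subtype_val.comp hg)) _

theorem expSmul_zero (z : PuncturedC4) : expSmul 0 z = z := Subtype.ext (by simp [expSmul])

theorem expSmul_expSmul (a b : ℂ) (z : PuncturedC4) :
    expSmul a (expSmul b z) = expSmul (a + b) z :=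
  Subtype.ext (by simp [expSmul, Complex.exp_add, smul_smul])

theorem projC_expSmul (a : ℂ) (z : PuncturedC4) : projC (expSmul a z) = projC z := by
  rw [projC_apply, projC_apply, mk_eq_mk_iff_exists]
  exact ⟨_, Complex.exp_ne_zero _, rfl⟩

theorem exists_expSmul_eq {z z' : PuncturedC4} (h : projC z = projC z') :
    ∃ a, z = expSmul a z' := by
  obtain ⟨c, hc, h1⟩ := (mk_eq_mk_iff_exists _ _).1 h
  exact ⟨Complex.log c, Subtype.ext (by simpa [expSmul, Complex.exp_log hc] using h1)⟩

theorem expSmul_eq_iff {a b : ℂ} {z : PuncturedC4} :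
    expSmul a z = expSmul b z ↔ ∃ n : ℤ, a = b + n * (2 * Real.pi * Complex.I) := by
  rw [← Complex.exp_eq_exp_iff_exists_int, Subtype.ext_iff]
  exact (smul_left_injective ℂ z.2).eq_iff

/-- Two lifts of a path differ by a continuous logarithm. -/
theorem exists_expSmul_eq_path {e e' : Simp 1 PuncturedC4} (h : projC.comp e = projC.comp e') :
    ∃ φ : Simp 1 ℂ, ∀ x, e x = expSmul (φ x) (e' x) := by
  have h1 : ∀ x, ∃ c : ℂ, c ≠ 0 ∧ (e x).1 = c • (e' x).1 := fun x =>
    (mk_eq_mk_iff_exists _ _).1 (DFunLike.congr_fun h x)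
  have he : Continuous fun x => (e x).1 := continuous_subtype_val.comp e.continuous
  have he' : Continuous fun x => (e' x).1 := continuous_subtype_val.comp e'.continuous
  let r : Simp 1 ℂ := ⟨fun x => herm (e' x).1 (e x).1 / herm (e' x).1 (e' x).1,
    (he'.herm he).div (he'.herm he') fun x => herm_self_ne_zero (e' x).2⟩
  have hr : ∀ x (c : ℂ), (e x).1 = c • (e' x).1 → r x = c := fun x c hc => by
    change herm (e' x).1 (e x).1 / herm (e' x).1 (e' x).1 = c
    rw [hc, herm_smul_right, mul_div_cancel_right₀ _ (herm_self_ne_zero (e' x).2)]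
  obtain ⟨φ, hφ⟩ := exists_log_simp r fun x => by
    obtain ⟨c, hc, hx⟩ := h1 x
    rwa [hr x c hx]
  refine ⟨φ, fun x => Subtype.ext ?_⟩
  obtain ⟨c, hc, hx⟩ := h1 x
  change (e x).1 = Complex.exp (φ x) • (e' x).1
  rw [hφ, hr x c hx, hx]

variable (h : S2 → ℝ)

/-- The cone over the real submanifold, normalized so that the ratio of `botOf` and `topOf` is
positive. -/
def realCone : Set PuncturedC4 :=
  {z | topOf z.1 ≠ 0 ∧ botOf z.1 = ((Real.exp (-liftS h (topOf z.1)) : ℝ) : ℂ) • topOf z.1}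

variable {h}

theorem projC_mem_realP {z : PuncturedC4} (hz : z ∈ realCone h) : projC z ∈ realP h := by
  rw [projC_apply, mk_mem_realP]
  exact ⟨hz.1, _, hz.2, by rw [Complex.norm_real, Real.norm_of_nonneg (Real.exp_pos _).le]⟩

/-- The scalar `e^a` acts on `botOf` by its conjugate, so the normalized ratio survives only for
real `e^a`, that is, for `Im a` a multiple of `π`. The half turn is thus the basic vertical motion
of the cone. -/
theorem expSmul_mem_realCone_iff {z : PuncturedC4} (hz : z ∈ realCone h) (a : ℂ) :
    expSmul a z ∈ realCone h ↔ conj (Complex.exp a) = Complex.exp a := by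
  have hE : ((Real.exp (-liftS h (topOf z.1)) : ℝ) : ℂ) ≠ 0 := by
    exact_mod_cast (Real.exp_pos _).ne'
  simp only [realCone, Set.mem_ofPred_eq, expSmul, topOf_smul, botOf_smul,
    liftS_smul h (Complex.exp_ne_zero a), hz.2, smul_smul]
  rw [and_iff_right (smul_ne_zero (Complex.exp_ne_zero a) hz.1), mul_comm,
    (smul_left_injective ℂ hz.1).eq_iff, mul_right_inj' hE]

theorem expSmul_ofReal_mem_realCone {z : PuncturedC4} (hz : z ∈ realCone h) (a : ℝ) :
    expSmul a z ∈ realCone h := by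
  rw [expSmul_mem_realCone_iff hz, ← Complex.exp_conj, Complex.conj_ofReal]

theorem expSmul_pi_mem_realCone {z : PuncturedC4} (hz : z ∈ realCone h) :
    expSmul (Real.pi * Complex.I) z ∈ realCone h := by
  rw [expSmul_mem_realCone_iff hz, Complex.exp_pi_mul_I]
  simp

theorem exists_eq_of_expSmul_mem_realCone {z : PuncturedC4} (hz : z ∈ realCone h) {a : ℂ}
    (ha : expSmul a z ∈ realCone h) : ∃ n : ℤ, a = a.re + n * (Real.pi * Complex.I) := by
  rw [expSmul_mem_realCone_iff hz, ← Complex.exp_conj, Complex.exp_eq_exp_iff_exists_int] at ha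
  obtain ⟨n, hn⟩ := ha
  refine ⟨-n, ?_⟩
  have h1 := congrArg Complex.im hn
  simp at h1
  apply Complex.ext
  · simp
  · simp
    linarith

/-- Multiplication by `e^a` changes the ratio by `e^{-2 i Im a}`, so `a = l / 2` removes the phase
of `e^l`. -/
theorem expSmul_half_mem_realCone {z : PuncturedC4} {l : ℂ} (h0 : topOf z.1 ≠ 0)
    (h1 : botOf z.1 = Complex.exp l • topOf z.1) (h2 : l.re = -liftS h (topOf z.1)) :
    expSmul (l / 2) z ∈ realCone h := by
  refine ⟨?_, ?_⟩
  · rw [expSmul, topOf_smul]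
    exact smul_ne_zero (Complex.exp_ne_zero _) h0
  · have hc : conj (l / 2) = conj l / 2 := by rw [map_div₀, map_ofNat]
    rw [expSmul, topOf_smul, botOf_smul, h1, liftS_smul h (Complex.exp_ne_zero _), smul_smul,
      smul_smul, ← h2, ← Complex.exp_conj, hc, ← Complex.exp_add, Complex.ofReal_exp,
      ← Complex.exp_add]
    congr 2
    apply Complex.ext
    · simp; ring
    · simp; ring

theorem continuous_topOf : Continuous topOf := contDiff_topOf.continuous

theorem continuous_botOf : Continuous botOf := contDiff_botOf.continuous

theorem hdot_self_ne_zero {v : ℂ × ℂ} (hv : v ≠ 0) : hdot v v ≠ 0 := by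
  have h1 : hdot v v = ((‖v.1‖ ^ 2 + ‖v.2‖ ^ 2 : ℝ) : ℂ) := by
    simp [hdot, Complex.conj_mul']
  rw [h1]
  exact_mod_cast normSq_add_ne_zero hv

theorem hdot_smul_right (c : ℂ) (u v : ℂ × ℂ) : hdot u (c • v) = c * hdot u v := by
  simp only [hdot, Prod.smul_fst, Prod.smul_snd, smul_eq_mul]
  ring

/-- Paths in the real submanifold lift to the cone. -/
theorem exists_lift_realCone {σ : Simp 1 PuncturedC4} (hσ : ∀ x, projC (σ x) ∈ realP h) :
    ∃ τ : Simp 1 (realCone h), ∀ x, projC (τ x).1 = projC (σ x) := by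
  have h1 : ∀ x, topOf (σ x).1 ≠ 0 ∧ ∃ c : ℂ, botOf (σ x).1 = c • topOf (σ x).1 ∧
      ‖c‖ = Real.exp (-liftS h (topOf (σ x).1)) := fun x => by
    have := hσ x
    rwa [projC_apply, mk_mem_realP] at this
  have hc : Continuous fun x => (σ x).1 := continuous_subtype_val.comp σ.continuous
  have ht : Continuous fun x => topOf (σ x).1 := continuous_topOf.comp hc
  have hb : Continuous fun x => botOf (σ x).1 := continuous_botOf.comp hc
  let u : Simp 1 ℂ := ⟨fun x => hdot (topOf (σ x).1) (botOf (σ x).1) /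
      hdot (topOf (σ x).1) (topOf (σ x).1), by
    refine Continuous.div ?_ ?_ fun x => hdot_self_ne_zero (h1 x).1
    · exact ((Complex.continuous_conj.comp ht.fst).mul hb.fst).add
        ((Complex.continuous_conj.comp ht.snd).mul hb.snd)
    · exact ((Complex.continuous_conj.comp ht.fst).mul ht.fst).add
        ((Complex.continuous_conj.comp ht.snd).mul ht.snd)⟩
  have hu : ∀ x, botOf (σ x).1 = u x • topOf (σ x).1 ∧
      ‖u x‖ = Real.exp (-liftS h (topOf (σ x).1)) := fun x => by
    obtain ⟨h0, c, hx, hn⟩ := h1 x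
    have : u x = c := by
      change hdot (topOf (σ x).1) (botOf (σ x).1) / hdot (topOf (σ x).1) (topOf (σ x).1) = c
      rw [hx, hdot_smul_right, mul_div_cancel_right₀ _ (hdot_self_ne_zero h0)]
    rw [this]
    exact ⟨hx, hn⟩
  obtain ⟨l, hl⟩ := exists_log_simp u fun x h0 => by
    have := (hu x).2
    rw [h0, norm_zero] at this
    exact (Real.exp_pos _).ne this
  have hmem : ∀ x, expSmul (l x / 2) (σ x) ∈ realCone h := fun x => by
    refine expSmul_half_mem_realCone (h1 x).1 (by rw [hl]; exact (hu x).1) ?_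
    have := (hu x).2
    rw [← hl, Complex.norm_exp] at this
    exact Real.exp_injective this
  refine ⟨⟨fun x => ⟨_, hmem x⟩, Continuous.subtype_mk
    (continuous_expSmul (by fun_prop) σ.continuous) _⟩, fun x => projC_expSmul _ _⟩

variable (hh : ContMDiff (𝓡 2) 𝓘(ℝ, ℝ) ∞ h)

/-- The projection of the cone to the punctured plane. -/
def coneTop (h : S2 → ℝ) : C(realCone h, {v : ℂ × ℂ // v ≠ 0}) :=
  ⟨fun z => ⟨topOf z.1.1, z.2.1⟩, Continuous.subtype_mk
    (continuous_topOf.comp (continuous_subtype_val.comp continuous_subtype_val)) _⟩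

-- The cone is a graph over `ℂ² ∖ 0`, from which it inherits path connectedness and the vanishing of
-- `H₁`.
include hh in
theorem exists_coneTop_inverse : ∃ g : C({v : ℂ × ℂ // v ≠ 0}, realCone h),
    (coneTop h).comp g = ContinuousMap.id _ ∧ g.comp (coneTop h) = ContinuousMap.id _ := by
  let F : {v : ℂ × ℂ // v ≠ 0} → Fin 4 → ℂ := fun v =>
    vecOf (v.1, ((Real.exp (-liftS h v.1) : ℝ) : ℂ) • v.1)
  have hF : Continuous F := by
    have h1 : Continuous fun v : {v : ℂ × ℂ // v ≠ 0} => liftS h v.1 :=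
      continuous_iff_continuousAt.2 fun v =>
        (contDiffAt_liftS hh v.2).continuousAt.comp continuous_subtype_val.continuousAt
    have h2 : Continuous fun v : {v : ℂ × ℂ // v ≠ 0} =>
        ((Real.exp (-liftS h v.1) : ℝ) : ℂ) • v.1 :=
      (Complex.continuous_ofReal.comp (Real.continuous_exp.comp h1.neg)).smul continuous_subtype_val
    exact contDiff_vecOf.continuous.comp (continuous_subtype_val.prodMk h2)
  have htop : ∀ v, topOf (F v) = v.1 := fun v => topOf_vecOf _
  have hbot : ∀ v, botOf (F v) = ((Real.exp (-liftS h v.1) : ℝ) : ℂ) • v.1 :=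
    fun v => botOf_vecOf _
  have hne : ∀ v, F v ≠ 0 := fun v h0 => v.2 (by
    rw [← htop v]
    exact (topOf_botOf_eq_zero.1 h0).1)
  refine ⟨⟨fun v => ⟨⟨F v, hne v⟩, ?_⟩, ?_⟩, ?_, ?_⟩
  · exact ⟨by rw [htop]; exact v.2, by rw [htop, hbot]⟩
  · exact Continuous.subtype_mk (Continuous.subtype_mk hF _) _
  · exact ContinuousMap.ext fun v => Subtype.ext (htop v)
  · refine ContinuousMap.ext fun z => Subtype.ext (Subtype.ext (ext_topOf_botOf (htop _) ?_))
    exact (hbot _).trans z.2.2.symm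

include hh in
theorem exists_bd_eq_of_realCone {c : Chn 1 (realCone h)} (hc : bd c = 0) : ∃ e, bd e = c := by
  obtain ⟨g, -, hg⟩ := exists_coneTop_inverse hh
  obtain ⟨e, he⟩ := exists_bd_eq_of_punctured (n := 0) (W := ℂ × ℂ) (by
    rw [Module.finrank_prod, Complex.finrank_real_complex]
    norm_num) (c := push (coneTop h) c) (by rw [bd_push, hc, map_zero])
  exact ⟨push g e, by rw [bd_push, he, ← push_comp, hg, push_id]⟩

theorem exists_bd_eq_of_puncturedC4 {c : Chn 2 PuncturedC4} (hc : bd c = 0) : ∃ e, bd e = c :=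
  exists_bd_eq_of_punctured (n := 1) (W := Fin 4 → ℂ) (by
    rw [Module.finrank_pi_fintype, Finset.sum_const, Complex.finrank_real_complex]
    norm_num) hc

theorem exists_simp_of_joined {X : Type} [TopologicalSpace X] {x y : X} (hxy : Joined x y) :
    ∃ γ : Simp 1 X, γ (stdSimplex.vertex 0) = x ∧ γ (stdSimplex.vertex 1) = y := by
  obtain ⟨γ⟩ := hxy
  refine ⟨⟨fun s => γ (stdSimplexHomeomorphUnitInterval s), by fun_prop⟩, ?_, ?_⟩
  · refine (congrArg γ ?_).trans γ.source
    exact stdSimplexHomeomorphUnitInterval_zero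
  · refine (congrArg γ ?_).trans γ.target
    exact stdSimplexHomeomorphUnitInterval_one

theorem pathConnectedSpace_punctured {W : Type} [NormedAddCommGroup W] [NormedSpace ℝ W]
    (hW : 1 < Module.rank ℝ W) : PathConnectedSpace {v : W // v ≠ 0} :=
  isPathConnected_iff_pathConnectedSpace.1 (isPathConnected_compl_singleton_of_one_lt_rank hW 0)

include hh in
theorem exists_path_realCone (z z' : realCone h) :
    ∃ γ : Simp 1 (realCone h), γ (stdSimplex.vertex 0) = z ∧ γ (stdSimplex.vertex 1) = z' := by
  obtain ⟨g, -, hg⟩ := exists_coneTop_inverse hh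
  have := pathConnectedSpace_punctured (W := ℂ × ℂ) (by
    rw [← Module.finrank_eq_rank, Module.finrank_prod, Complex.finrank_real_complex]
    norm_num)
  obtain ⟨γ, h0, h1⟩ := exists_simp_of_joined
    (PathConnectedSpace.joined (coneTop h z) (coneTop h z'))
  refine ⟨g.comp γ, ?_, ?_⟩
  · exact (congrArg g h0).trans (DFunLike.congr_fun hg z)
  · exact (congrArg g h1).trans (DFunLike.congr_fun hg z')

theorem exists_path_puncturedC4 (z z' : PuncturedC4) :
    ∃ γ : Simp 1 PuncturedC4, γ (stdSimplex.vertex 0) = z ∧ γ (stdSimplex.vertex 1) = z' := by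
  have := pathConnectedSpace_punctured (W := Fin 4 → ℂ) (by
    rw [← Module.finrank_eq_rank, Module.finrank_pi_fintype, Finset.sum_const,
      Complex.finrank_real_complex]
    norm_num)
  exact exists_simp_of_joined (PathConnectedSpace.joined z z')

end RealCone


/-! ### Paths in the fibres -/

section VerticalPaths

variable {X Y B : Type} [TopologicalSpace X] [TopologicalSpace Y] [TopologicalSpace B]

/-- A constant simplex. -/
def constSimp (n : ℕ) (x : X) : Simp n X := ContinuousMap.const _ x

theorem comp_constSimp (f : C(X, Y)) (n : ℕ) (x : X) :
    f.comp (constSimp n x) = constSimp n (f x) := rfl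

theorem bd_single_one (σ : Simp 1 X) : bd (Finsupp.single σ 1) =
    Finsupp.single (constSimp 0 (σ (stdSimplex.vertex 1))) 1
      - Finsupp.single (constSimp 0 (σ (stdSimplex.vertex 0))) 1 := by
  have hd : (default : stdSimplex ℝ (Fin 1)) = stdSimplex.vertex 0 := Subsingleton.elim _ _
  have key : ∀ i : Fin 2, σ.comp (faceMap i) =
      constSimp 0 (σ (stdSimplex.vertex (i.succAbove 0))) := by
    intro i
    ext x
    obtain rfl := Subsingleton.elim x default
    rw [hd]
    exact congrArg σ (stdSimplex.map_vertex i.succAbove 0)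
  rw [bd_single, Fin.sum_univ_two, key, key]
  simp only [Fin.val_zero, pow_zero, Fin.val_one, pow_one, Finsupp.single_neg]
  rw [← sub_eq_add_neg]
  rfl

/-- Constant one-simplices bound constant two-simplices. This is why the constant two-chains are
included in `N`: they absorb the degenerate paths that appear when vertical paths are projected. -/
theorem bd_constSimp_two (x : X) :
    bd (Finsupp.single (constSimp 2 x) 1) = Finsupp.single (constSimp 1 x) 1 := by
  have key : ∀ i : Fin 3, (constSimp 2 x).comp (faceMap i) = constSimp 1 x := fun i => rfl
  rw [bd_single, Fin.sum_univ_three, key, key, key]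
  simp

/-- The chains spanned by the constant simplices. -/
def constChn (n : ℕ) (X : Type) [TopologicalSpace X] : Submodule ℤ (Chn n X) :=
  Submodule.span ℤ (Set.range fun x => Finsupp.single (constSimp n x) 1)

theorem single_constSimp_mem (n : ℕ) (x : X) : Finsupp.single (constSimp n x) 1 ∈ constChn n X :=
  Submodule.subset_span ⟨x, rfl⟩

theorem push_mem_constChn (f : C(X, Y)) {n : ℕ} {c : Chn n X} (hc : c ∈ constChn n X) :
    push f c ∈ constChn n Y := by
  have : constChn n X ≤ (constChn n Y).comap (push f) := by
    refine Submodule.span_le.2 ?_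
    rintro _ ⟨x, rfl⟩
    change push f _ ∈ constChn n Y
    rw [push_single, comp_constSimp]
    exact single_constSimp_mem n _
  exact this hc

variable (h : S2 → ℝ) (N : Submodule ℤ (Chn 2 CP3))

/-- The one-chains that are boundaries of chains projecting to `N`, up to chains in the cone over
the real submanifold. -/
def fibreBd : Submodule ℤ (Chn 1 PuncturedC4) :=
  (N.comap (push projC)).map bd ⊔ LinearMap.range (push (subIncl (realCone h)))

variable {h N}

theorem single_mem_fibreBd {σ : Simp 1 PuncturedC4} (hσ : ∀ x, σ x ∈ realCone h) :
    Finsupp.single σ 1 ∈ fibreBd h N := by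
  refine Submodule.mem_sup_right ⟨Finsupp.single ⟨fun x => ⟨σ x, hσ x⟩, by fun_prop⟩ 1, ?_⟩
  rw [push_single]
  rfl

theorem bd_mem_fibreBd {c : Chn 2 PuncturedC4} (hc : push projC c ∈ N) : bd c ∈ fibreBd h N :=
  Submodule.mem_sup_left ⟨c, hc, rfl⟩

/-- The cycle `ζ` bounds some `w` in the contractible `Y`. The projection of `w` factors through the
contractible `B`, where it differs from the constant chain `κ` by a boundary, so it lands in `N`. -/
theorem push_mem_fibreBd [ContractibleSpace Y] [ContractibleSpace B]
    (hbd : LinearMap.range (bd (X := CP3) (n := 2)) ≤ N) (hconst : constChn 2 CP3 ≤ N)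
    {Φ : C(Y, PuncturedC4)} {pr : C(Y, B)} {τ : C(B, CP3)} (hΦ : projC.comp Φ = τ.comp pr)
    {ζ : Chn 1 Y} (hζ : bd ζ = 0) {κ : Chn 2 B} (hκ : κ ∈ constChn 2 B)
    (hκζ : push pr ζ = bd κ) : push Φ ζ ∈ fibreBd h N := by
  obtain ⟨w, rfl⟩ := exists_bd_eq_of_contractibleSpace hζ
  rw [← bd_push]
  apply bd_mem_fibreBd
  rw [← push_comp, hΦ, push_comp]
  obtain ⟨e, he⟩ := exists_bd_eq_of_contractibleSpace (X := B) (c := push pr w - κ)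
    (by rw [map_sub, bd_push, hκζ, sub_self])
  rw [eq_add_of_sub_eq he.symm, map_add, ← bd_push]
  exact N.add_mem (hbd ⟨_, rfl⟩) (hconst (push_mem_constChn τ hκ))

/-- The path `s ↦ e^{sψ} z` in a fibre. -/
def vert (z : PuncturedC4) (ψ : ℂ) : Simp 1 PuncturedC4 :=
  ⟨fun x => expSmul ((x.1 1 : ℂ) * ψ) z, continuous_expSmul
    ((Complex.continuous_ofReal.comp
      ((continuous_apply 1).comp continuous_subtype_val)).mul continuous_const) continuous_const⟩

/-- An affine path in the complex plane. -/
def segSimp (a b : ℂ) : Simp 1 ℂ :=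
  ⟨fun x => (x.1 0 : ℂ) * a + (x.1 1 : ℂ) * b, by
    have := fun i => Complex.continuous_ofReal.comp
      ((continuous_apply i).comp (continuous_subtype_val (p := (· ∈ stdSimplex ℝ (Fin (1 + 1))))))
    exact ((this 0).mul continuous_const).add ((this 1).mul continuous_const)⟩

theorem vertex_apply (i j : Fin 2) :
    (stdSimplex.vertex i : stdSimplex ℝ (Fin 2)).1 j = if j = i then 1 else 0 := by
  change (Pi.single i (1 : ℝ) : Fin 2 → ℝ) j = _
  rw [Pi.single_apply]

theorem segSimp_vertex_zero (a b : ℂ) : segSimp a b (stdSimplex.vertex 0) = a := by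
  change (((stdSimplex.vertex 0 : stdSimplex ℝ (Fin 2)).1 0 : ℝ) : ℂ) * a +
    (((stdSimplex.vertex 0 : stdSimplex ℝ (Fin 2)).1 1 : ℝ) : ℂ) * b = a
  rw [vertex_apply, vertex_apply]
  simp

theorem segSimp_vertex_one (a b : ℂ) : segSimp a b (stdSimplex.vertex 1) = b := by
  change (((stdSimplex.vertex 1 : stdSimplex ℝ (Fin 2)).1 0 : ℝ) : ℂ) * a +
    (((stdSimplex.vertex 1 : stdSimplex ℝ (Fin 2)).1 1 : ℝ) : ℂ) * b = b
  rw [vertex_apply, vertex_apply]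
  simp

theorem vert_eq (z : PuncturedC4) (ψ : ℂ) {Φ : C(ℂ, PuncturedC4)} (hΦ : ∀ a, Φ a = expSmul a z) :
    vert z ψ = Φ.comp (segSimp 0 ψ) := by
  ext1 x
  change expSmul _ z = Φ _
  rw [hΦ]
  congr 1
  change _ = _ * (0 : ℂ) + _ * ψ
  ring

theorem vert_expSmul_eq (z : PuncturedC4) (a b : ℂ) {Φ : C(ℂ, PuncturedC4)}
    (hΦ : ∀ a, Φ a = expSmul a z) : vert (expSmul a z) b = Φ.comp (segSimp a (a + b)) := by
  ext1 x
  change expSmul _ (expSmul a z) = Φ _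
  rw [hΦ, expSmul_expSmul]
  congr 1
  change (x.1 1 : ℂ) * b + a = (x.1 0 : ℂ) * a + (x.1 1 : ℂ) * (a + b)
  have h1 : x.1 0 + x.1 1 = 1 := by simpa [Fin.sum_univ_two] using x.2.2
  have h2 : (x.1 0 : ℂ) + (x.1 1 : ℂ) = 1 := by exact_mod_cast h1
  linear_combination -a * h2

variable (h N)

/-- The class of the path `s ↦ e^{sψ} z`. -/
def vertClass (z : PuncturedC4) (ψ : ℂ) : Chn 1 PuncturedC4 ⧸ fibreBd h N :=
  (fibreBd h N).mkQ (Finsupp.single (vert z ψ) 1)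

variable {h N} (hbd : LinearMap.range (bd (X := CP3) (n := 2)) ≤ N) (hconst : constChn 2 CP3 ≤ N)

include hbd hconst

/-- The three paths bound in the parameter plane `ℂ`, and everything there projects to a single
point. -/
theorem vertClass_add (z : PuncturedC4) (a b : ℂ) :
    vertClass h N z (a + b) = vertClass h N z a + vertClass h N (expSmul a z) b := by
  let Φ : C(ℂ, PuncturedC4) :=
    ⟨fun a => expSmul a z, continuous_expSmul continuous_id continuous_const⟩
  have hΦ : ∀ a, Φ a = expSmul a z := fun a => rfl
  rw [eq_comm, ← sub_eq_zero, vertClass, vertClass, vertClass, ← map_add, ← map_sub,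
    vert_expSmul_eq z a b hΦ, vert_eq z a hΦ, vert_eq z (a + b) hΦ, ← push_single, ← push_single,
    ← push_single, ← map_add, ← map_sub]
  refine (Submodule.Quotient.mk_eq_zero _).2 ?_
  refine push_mem_fibreBd hbd hconst (B := Unit) (pr := ContinuousMap.const _ ())
    (τ := ContinuousMap.const _ (projC z)) ?_ ?_ (single_constSimp_mem 2 ()) ?_
  · ext1 x
    exact projC_expSmul _ _
  · rw [map_sub, map_add, bd_single_one, bd_single_one, bd_single_one]
    simp only [segSimp_vertex_one, segSimp_vertex_zero]
    abel
  · rw [bd_constSimp_two, map_sub, map_add, push_single, push_single, push_single]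
    exact add_sub_cancel_right _ _

/-- The map `(s, a) ↦ e^a e(s)` on `Δ¹ × ℂ` carries a closed contour to the two lifts and the two
vertical paths at the ends. Its projection runs along the path forth and back, so `push_mem_fibreBd`
applies. -/
theorem mkQ_expSmul (e e' : Simp 1 PuncturedC4) (φ : Simp 1 ℂ)
    (he : ∀ x, e' x = expSmul (φ x) (e x)) :
    (fibreBd h N).mkQ (Finsupp.single e' 1) = (fibreBd h N).mkQ (Finsupp.single e 1)
      + vertClass h N (e (stdSimplex.vertex 1)) (φ (stdSimplex.vertex 1))
      - vertClass h N (e (stdSimplex.vertex 0)) (φ (stdSimplex.vertex 0)) := by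
  let Φ : C(stdSimplex ℝ (Fin 2) × ℂ, PuncturedC4) :=
    ⟨fun p => expSmul p.2 (e p.1), continuous_expSmul continuous_snd
      (e.continuous.comp continuous_fst)⟩
  let lift : Simp 1 ℂ → Simp 1 (stdSimplex ℝ (Fin 2) × ℂ) := fun ψ => (ContinuousMap.id _).prodMk ψ
  let col : stdSimplex ℝ (Fin 2) → Simp 1 (stdSimplex ℝ (Fin 2) × ℂ) := fun s =>
    (ContinuousMap.const _ s).prodMk (segSimp 0 (φ s))
  have h1 : e' = Φ.comp (lift φ) := ContinuousMap.ext he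
  have h2 : e = Φ.comp (lift (ContinuousMap.const _ 0)) :=
    ContinuousMap.ext fun x => (expSmul_zero _).symm
  have h3 : ∀ s, vert (e s) (φ s) = Φ.comp (col s) := fun s =>
    vert_eq (e s) (φ s) (Φ := Φ.comp ⟨fun a => (s, a), by fun_prop⟩) fun a => rfl
  rw [← sub_eq_zero, vertClass, vertClass, h3, h3]
  conv_lhs => enter [2, 1, 1]; rw [h2]
  rw [h1, ← map_add, ← map_sub, ← map_sub, ← push_single, ← push_single, ← push_single,
    ← push_single, ← map_add, ← map_sub, ← map_sub]
  refine (Submodule.Quotient.mk_eq_zero _).2 ?_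
  refine push_mem_fibreBd hbd hconst (B := stdSimplex ℝ (Fin 2)) (pr := ContinuousMap.fst)
    (τ := projC.comp e) (κ := Finsupp.single (constSimp 2 (stdSimplex.vertex 0)) 1 -
      Finsupp.single (constSimp 2 (stdSimplex.vertex 1)) 1) ?_ ?_
    (Submodule.sub_mem _ (single_constSimp_mem 2 _) (single_constSimp_mem 2 _)) ?_
  · ext1 x
    exact projC_expSmul _ _
  · have hl : ∀ ψ s, lift ψ s = (s, ψ s) := fun ψ s => rfl
    have hc : ∀ s t, col s t = (s, segSimp 0 (φ s) t) := fun ψ s => rfl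
    simp only [map_sub, map_add, bd_single_one, hl, hc, segSimp_vertex_one, segSimp_vertex_zero,
      ContinuousMap.const_apply]
    abel
  · have hl : ∀ ψ, ContinuousMap.fst.comp (lift ψ) = ContinuousMap.id _ := fun ψ => rfl
    have hc : ∀ s, ContinuousMap.fst.comp (col s) = constSimp 1 s := fun s => rfl
    simp only [map_sub, map_add, push_single, bd_constSimp_two, hl, hc]
    abel

theorem vertClass_zero (z : PuncturedC4) : vertClass h N z 0 = 0 := by
  have := vertClass_add (h := h) hbd hconst z 0 0
  rwa [add_zero, expSmul_zero, left_eq_add] at this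

end VerticalPaths


/-! ### Relative cycles of the projective space -/

section Cycles

variable {h : S2 → ℝ} {N : Submodule ℤ (Chn 2 CP3)}
  (hh : ContMDiff (𝓡 2) 𝓘(ℝ, ℝ) ∞ h)
  (hbd : LinearMap.range (bd (X := CP3) (n := 2)) ≤ N) (hconst : constChn 2 CP3 ≤ N)
  (hloop : ∃ (g : Simp 1 PuncturedC4) (l : Simp 1 ℂ), Finsupp.single g 1 ∈ fibreBd h N ∧
    g (stdSimplex.vertex 0) = g (stdSimplex.vertex 1) ∧
    (∀ x, expSmul (l x / 2) (g x) ∈ realCone h) ∧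
    l (stdSimplex.vertex 0) = l (stdSimplex.vertex 1) + 2 * (Real.pi * Complex.I))

theorem mkQ_single_eq_zero {σ : Simp 1 PuncturedC4} (hσ : ∀ x, σ x ∈ realCone h) :
    (fibreBd h N).mkQ (Finsupp.single σ 1) = 0 :=
  (Submodule.Quotient.mk_eq_zero _).2 (single_mem_fibreBd hσ)

include hbd hconst

include hloop in
-- The loop `g` is zero in the quotient by assumption, and its rotation by `e^{l/2}` is zero because
-- it lies in the cone. Comparing the two leaves the vertical paths at the common endpoint; as `l /
-- 2` loses `π i` along the loop, their difference is one half turn.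
theorem exists_vertClass_pi_eq_zero :
    ∃ z ∈ realCone h, vertClass h N z (Real.pi * Complex.I) = 0 := by
  obtain ⟨g, l, hg, hg', hl, hl'⟩ := hloop
  let p : Simp 1 PuncturedC4 :=
    ⟨fun x => expSmul (l x / 2) (g x), continuous_expSmul (by fun_prop) g.continuous⟩
  let φ : Simp 1 ℂ := ⟨fun x => l x / 2, by fun_prop⟩
  have h1 := mkQ_expSmul (h := h) hbd hconst g p φ fun x => rfl
  have h2 : (fibreBd h N).mkQ (Finsupp.single g 1) = 0 := (Submodule.Quotient.mk_eq_zero _).2 hg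
  rw [mkQ_single_eq_zero hl, h2, zero_add, ← hg'] at h1
  have h3 : φ (stdSimplex.vertex 0) = φ (stdSimplex.vertex 1) + Real.pi * Complex.I := by
    change l _ / 2 = l _ / 2 + _
    rw [hl']
    ring
  rw [h3, vertClass_add hbd hconst, sub_add_cancel_left, eq_comm, neg_eq_zero, hg'] at h1
  exact ⟨_, hl (stdSimplex.vertex 1), h1⟩

include hh hloop in
-- The half turn is transported from `z₀` to `z` along a path in the cone: both the path and its
-- negative are zero in the quotient.
theorem vertClass_pi {z : PuncturedC4} (hz : z ∈ realCone h) :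
    vertClass h N z (Real.pi * Complex.I) = 0 := by
  obtain ⟨z₀, hz₀, h0⟩ := exists_vertClass_pi_eq_zero hbd hconst hloop
  obtain ⟨γ, hγ0, hγ1⟩ := exists_path_realCone hh ⟨z₀, hz₀⟩ ⟨z, hz⟩
  let e : Simp 1 PuncturedC4 := (subIncl _).comp γ
  let e' : Simp 1 PuncturedC4 := ⟨fun x => expSmul (Real.pi * Complex.I) (e x),
    continuous_expSmul continuous_const e.continuous⟩
  have h1 := mkQ_expSmul (h := h) hbd hconst e e' (ContinuousMap.const _ (Real.pi * Complex.I))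
    fun x => rfl
  have he0 : e (stdSimplex.vertex 0) = z₀ := congrArg Subtype.val hγ0
  have he1 : e (stdSimplex.vertex 1) = z := congrArg Subtype.val hγ1
  rw [mkQ_single_eq_zero fun x => expSmul_pi_mem_realCone (γ x).2,
    mkQ_single_eq_zero fun x => (γ x).2, zero_add, he0, he1, ContinuousMap.const_apply,
    ContinuousMap.const_apply, h0, sub_zero] at h1
  exact h1.symm

theorem vertClass_int_mul {z : PuncturedC4} {c : ℂ}
    (hc : ∀ n : ℤ, vertClass h N (expSmul (n * c) z) c = 0) (n : ℤ) :
    vertClass h N z (n * c) = 0 := by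
  induction n with
  | zero => simpa using vertClass_zero hbd hconst z
  | succ n ih =>
    have h1 : (((n : ℤ) + 1 : ℤ) : ℂ) * c = (n : ℤ) * c + c := by push_cast; ring
    rw [h1, vertClass_add hbd hconst, ih, hc, add_zero]
  | pred n ih =>
    have h1 : ((-(n : ℤ) : ℤ) : ℂ) * c = ((-(n : ℤ) - 1 : ℤ) : ℂ) * c + c := by push_cast; ring
    rw [h1, vertClass_add hbd hconst, hc, add_zero] at ih
    exact ih

include hh hloop in
theorem vertClass_eq_zero_of_mem {z : PuncturedC4} (hz : z ∈ realCone h) {a : ℂ}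
    (ha : expSmul a z ∈ realCone h) : vertClass h N z a = 0 := by
  obtain ⟨n, hn⟩ := exists_eq_of_expSmul_mem_realCone hz ha
  have hz' : expSmul a.re z ∈ realCone h := expSmul_ofReal_mem_realCone hz _
  have h1 : vertClass h N z a.re = 0 := by
    refine mkQ_single_eq_zero fun x => ?_
    change expSmul ((x.1 1 : ℂ) * (a.re : ℂ)) z ∈ _
    rw [← Complex.ofReal_mul]
    exact expSmul_ofReal_mem_realCone hz _
  rw [hn, vertClass_add hbd hconst, h1, zero_add]
  refine vertClass_int_mul hbd hconst (fun m => vertClass_pi hh hbd hconst hloop ?_) n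
  rw [expSmul_mem_realCone_iff hz', ← Complex.exp_conj, Complex.exp_eq_exp_iff_exists_int]
  refine ⟨-m, ?_⟩
  simp
  ring

include hh hloop in
-- Here `z` need not lie in the cone. A full turn maps a path in `ℂ⁴ ∖ 0` to itself, so its class is
-- the same at every point, and on the cone it is twice the half turn.
theorem vertClass_two_pi (z : PuncturedC4) :
    vertClass h N z (2 * Real.pi * Complex.I) = 0 := by
  obtain ⟨z₀, hz₀, h0⟩ := exists_vertClass_pi_eq_zero hbd hconst hloop
  obtain ⟨e, he0, he1⟩ := exists_path_puncturedC4 z₀ z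
  have h2 : vertClass h N z₀ (2 * Real.pi * Complex.I) = 0 := by
    rw [show (2 * Real.pi * Complex.I : ℂ) = Real.pi * Complex.I + Real.pi * Complex.I by ring,
      vertClass_add hbd hconst, h0, zero_add]
    exact vertClass_pi hh hbd hconst hloop (expSmul_pi_mem_realCone hz₀)
  have h1 := mkQ_expSmul (h := h) hbd hconst e e
    (ContinuousMap.const _ (2 * Real.pi * Complex.I)) fun x =>
      Subtype.ext (by simp [expSmul, Complex.exp_two_pi_mul_I])
  rw [he0, he1, ContinuousMap.const_apply, ContinuousMap.const_apply, h2, sub_zero,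
    left_eq_add] at h1
  exact h1

include hh hloop in
theorem vertClass_congr {z : PuncturedC4} {a b : ℂ} (hab : expSmul a z = expSmul b z) :
    vertClass h N z a = vertClass h N z b := by
  obtain ⟨n, rfl⟩ := expSmul_eq_iff.1 hab
  rw [vertClass_add hbd hconst, vertClass_int_mul hbd hconst
    (fun m => vertClass_two_pi hh hbd hconst hloop _), add_zero]

omit hbd hconst in
theorem exists_section_realCone (h : S2 → ℝ) : ∃ r : CP3 → PuncturedC4,
    (∀ p, projC (r p) = p) ∧ ∀ p ∈ realP h, r p ∈ realCone h := by
  classical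
  have h1 : ∀ p : CP3, ∃ z, projC z = p ∧ (p ∈ realP h → z ∈ realCone h) := by
    intro p
    obtain ⟨z, hz⟩ : ∃ z, projC z = p := ⟨⟨p.rep, p.rep_nonzero⟩, p.mk_rep⟩
    by_cases hp : p ∈ realP h
    · obtain ⟨τ, hτ⟩ := exists_lift_realCone (h := h) (σ := constSimp 1 z) fun x => by
        change projC z ∈ _
        rwa [hz]
      exact ⟨(τ (stdSimplex.vertex 0)).1, (hτ _).trans hz, fun _ => (τ _).2⟩
    · exact ⟨z, hz, fun h => absurd h hp⟩
  choose r hr hr' using h1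
  exact ⟨r, hr, hr'⟩

omit hbd hconst in
theorem exists_lift_paths (h : S2 → ℝ) : ∃ L : Simp 1 CP3 → Simp 1 PuncturedC4,
    (∀ τ, projC.comp (L τ) = τ) ∧ ∀ τ, (∀ x, τ x ∈ realP h) → ∀ x, L τ x ∈ realCone h := by
  classical
  have h1 : ∀ τ : Simp 1 CP3, ∃ e, projC.comp e = τ ∧
      ((∀ x, τ x ∈ realP h) → ∀ x, e x ∈ realCone h) := by
    intro τ
    obtain ⟨e, rfl⟩ := exists_lift_simp τ
    by_cases hp : ∀ x, projC.comp e x ∈ realP h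
    · obtain ⟨e', he'⟩ := exists_lift_realCone hp
      exact ⟨(subIncl _).comp e', ContinuousMap.ext he', fun _ x => (e' x).2⟩
    · exact ⟨e, rfl, fun h => absurd h hp⟩
  choose L hL hL' using h1
  exact ⟨L, hL, hL'⟩

include hh hloop in
/-- Cycles that project to the real submanifold are boundaries up to chains in the cone. -/
theorem mem_fibreBd_of_cycle {ζ : Chn 1 PuncturedC4} (hζ : bd ζ = 0) {a : Chn 1 (realP h)}
    (ha : push projC ζ = push (subIncl _) a) : ζ ∈ fibreBd h N := by
  obtain ⟨r, hr, hrP⟩ := exists_section_realCone (h := h)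
  obtain ⟨L, hL, hLP⟩ := exists_lift_paths (h := h)
  have hα : ∀ y : PuncturedC4, ∃ α, y = expSmul α (r (projC y)) := fun y =>
    exists_expSmul_eq (hr _).symm
  choose α hα using hα
  -- The vertical path from the chosen point of the fibre to `y`. It is well defined because full
  -- turns vanish, additive along the fibre, and zero on the cone because half turns vanish.
  let A : PuncturedC4 → Chn 1 PuncturedC4 ⧸ fibreBd h N := fun y =>
    vertClass h N (r (projC y)) (α y)
  have hA : ∀ y ψ, A (expSmul ψ y) = A y + vertClass h N y ψ := by
    intro y ψ
    have h1 : expSmul (α (expSmul ψ y)) (r (projC y)) = expSmul (α y + ψ) (r (projC y)) := by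
      conv_lhs => rw [← projC_expSmul ψ y]
      rw [← hα, add_comm, ← expSmul_expSmul, ← hα]
    simp only [A]
    rw [projC_expSmul, vertClass_congr hh hbd hconst hloop h1, vertClass_add hbd hconst, ← hα]
  have hAP : ∀ y ∈ realCone h, A y = 0 := fun y hy =>
    vertClass_eq_zero_of_mem hh hbd hconst hloop (hrP _ (projC_mem_realP hy)) (by rwa [← hα])
  -- Corrected by the vertical terms at its ends, the class of a lift depends only on the projected
  -- path, and it vanishes for paths in `P_h`, whose chosen lifts lie in the cone.
  let T : Simp 1 CP3 → Chn 1 PuncturedC4 ⧸ fibreBd h N := fun τ =>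
    (fibreBd h N).mkQ (Finsupp.single (L τ) 1)
      - A (L τ (stdSimplex.vertex 1)) + A (L τ (stdSimplex.vertex 0))
  have hT : ∀ e : Simp 1 PuncturedC4, (fibreBd h N).mkQ (Finsupp.single e 1) =
      T (projC.comp e) + A (e (stdSimplex.vertex 1)) - A (e (stdSimplex.vertex 0)) := by
    intro e
    obtain ⟨φ, hφ⟩ := exists_expSmul_eq_path (e := e) (e' := L (projC.comp e)) (hL _).symm
    rw [mkQ_expSmul hbd hconst _ e φ hφ, hφ, hφ, hA, hA]
    simp only [T]
    abel
  have hTP : ∀ τ : Simp 1 (realP h), T ((subIncl _).comp τ) = 0 := by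
    intro τ
    have h1 := hLP ((subIncl _).comp τ) fun x => (τ x).2
    simp only [T]
    rw [mkQ_single_eq_zero h1, hAP _ (h1 _), hAP _ (h1 _), sub_zero, add_zero]
  let Tl : Chn 1 CP3 →ₗ[ℤ] Chn 1 PuncturedC4 ⧸ fibreBd h N := Finsupp.lift _ ℤ _ T
  let Al : Chn 0 PuncturedC4 →ₗ[ℤ] Chn 1 PuncturedC4 ⧸ fibreBd h N :=
    Finsupp.lift _ ℤ _ fun σ => A (σ (stdSimplex.vertex 0))
  -- The quotient map splits into a part that sees only the projection and a part that sees only the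
  -- boundary. On `ζ` the first vanishes because the projection is a chain of `P_h`, the second
  -- because `ζ` is a cycle.
  have h1 : (fibreBd h N).mkQ = Tl.comp (push projC) + Al.comp bd := by
    refine chn_hom_ext fun e => ?_
    rw [hT, LinearMap.add_apply, LinearMap.comp_apply, LinearMap.comp_apply, push_single,
      bd_single_one, map_sub]
    simp [Tl, Al, constSimp]
    abel
  have h2 : Tl.comp (push (subIncl (realP h))) = 0 := by
    refine chn_hom_ext fun τ => ?_
    rw [LinearMap.comp_apply, push_single, LinearMap.zero_apply]
    simpa [Tl] using hTP τ
  refine (Submodule.Quotient.mk_eq_zero _).1 ?_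
  have h3 := congrArg (· ζ) h1
  refine h3.trans ?_
  rw [LinearMap.add_apply, LinearMap.comp_apply, LinearMap.comp_apply, hζ, ha, map_zero, add_zero]
  exact congrArg (· a) h2

include hh hloop in
/-- Relative cycles lie in every submodule of chains with the above properties that contains
the chains of the real submanifold. -/
theorem mem_of_bd_eq_push (hP : LinearMap.range (push (subIncl (realP h)) (n := 2)) ≤ N)
    {c : Chn 2 CP3} {a : Chn 1 (realP h)} (hc : push (subIncl _) a = bd c) : c ∈ N := by
  obtain ⟨c', rfl⟩ := exists_push_eq (f := projC) (c := c) fun σ _ => exists_lift_simp σ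
  have h1 : bd c' ∈ fibreBd h N :=
    mem_fibreBd_of_cycle hh hbd hconst hloop (bd_bd c') (a := a) (by rw [hc, bd_push])
  -- Write the boundary of the lift as `bd v + p`, with `v` projecting to `N` and `p` in the cone.
  -- Then `p` bounds in the cone because `H₁` vanishes there, and the closed remainder bounds
  -- because `H₂` of `ℂ⁴ ∖ 0` vanishes.
  obtain ⟨_, ⟨v, hv, rfl⟩, _, ⟨p, rfl⟩, hvp⟩ := Submodule.mem_sup.1 h1
  have hp : bd p = 0 := by
    apply push_injective (f := subIncl (realCone h)) Subtype.val_injective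
    rw [map_zero, ← bd_push, eq_sub_of_add_eq' hvp, map_sub, bd_bd, bd_bd, sub_zero]
  obtain ⟨p', rfl⟩ := exists_bd_eq_of_realCone hh hp
  obtain ⟨w, hw⟩ := exists_bd_eq_of_puncturedC4 (c := c' - v - push (subIncl _) p') (by
    rw [map_sub, map_sub, bd_push, ← hvp]
    abel)
  have h2 : c' = v + push (subIncl _) p' + bd w := by
    rw [hw]
    abel
  rw [h2, map_add, map_add, ← bd_push]
  refine N.add_mem (N.add_mem hv (hP ?_)) (hbd ⟨_, rfl⟩)
  refine ⟨push ⟨fun z : realCone h => ⟨projC z.1, projC_mem_realP z.2⟩, by fun_prop⟩ p', ?_⟩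
  rw [← push_comp, ← push_comp]
  rfl

end Cycles


/-! ### The class of a disk -/

section DiskClass

/-- A constant chain that agrees in its boundary with a chain of a subset belongs to the subset. -/
theorem mem_range_push_of_constChn {X : Type} [TopologicalSpace X] {P : Set X} {κ : Chn 2 X}
    (hκ : κ ∈ constChn 2 X) {a : Chn 1 P} (ha : bd κ = push (subIncl P) a) :
    ∃ p : Chn 2 P, push (subIncl P) p = κ := by
  -- Sending a path to the constant two-simplex at its initial point is a left inverse of the
  -- boundary on constant chains and commutes with the inclusion of `P`.
  let T : ∀ (Y : Type) [TopologicalSpace Y], Chn 1 Y →ₗ[ℤ] Chn 2 Y := fun Y _ =>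
    Finsupp.lmapDomain ℤ ℤ fun σ => constSimp 2 (σ (stdSimplex.vertex 0))
  have hT : ∀ (Y : Type) [TopologicalSpace Y] (σ : Simp 1 Y), T Y (Finsupp.single σ 1) =
      Finsupp.single (constSimp 2 (σ (stdSimplex.vertex 0))) 1 := fun Y _ σ => by simp [T]
  have h1 : T X (bd κ) = κ := by
    have : constChn 2 X ≤ LinearMap.eqLocus ((T X).comp bd) LinearMap.id := by
      refine Submodule.span_le.2 ?_
      rintro _ ⟨x, rfl⟩
      change T X (bd _) = _
      rw [bd_constSimp_two, hT]
      rfl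
    exact this hκ
  have h2 : (T X).comp (push (subIncl P)) = (push (subIncl P)).comp (T P) :=
    chn_hom_ext fun σ => by
      rw [LinearMap.comp_apply, LinearMap.comp_apply, push_single, hT, hT, push_single]
      rfl
  refine ⟨T P a, ?_⟩
  rw [← h1, ha]
  exact (congrArg (· a) h2).symm

variable {h : S2 → ℝ} (ξ : S2 × S2) (hh : ContMDiff (𝓡 2) 𝓘(ℝ, ℝ) ∞ h)

theorem botOf_diskVec_eq_smul {w : ℂ} (hw : ‖w‖ = 1) : botOf (diskVec h ξ w) =
    (conj w * (-Complex.I * phase ξ.1 * factorE h ξ w)⁻¹) • topOf (diskVec h ξ w) := by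
  rw [topOf_diskVec, botOf_diskVec, smul_smul, mul_assoc,
    inv_mul_cancel₀ (disk_factor_ne_zero h ξ w), mul_one]
  exact reflVec_eq_smul _ _ _ _ hw

/-- The disk as a map to the punctured vector space. -/
def diskLift : C(Metric.closedBall (0 : ℂ) 1, PuncturedC4) :=
  ⟨fun w => ⟨diskVec h ξ w, diskVec_ne_zero h ξ w⟩,
    Continuous.subtype_mk (continuousOn_diskVec ξ hh).domRestrict _⟩

/-- The boundary circle of the unit disk as a singular simplex. -/
def circleSimp : Simp 1 {w : Metric.closedBall (0 : ℂ) 1 | ‖(w : ℂ)‖ = 1} :=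
  ⟨fun x => ⟨⟨ei (2 * Real.pi * x.1 1), mem_closedBall_zero_iff.2 (norm_ei _).le⟩, norm_ei _⟩, by
    refine Continuous.subtype_mk (Continuous.subtype_mk ?_ _) _
    exact Complex.continuous_exp.comp (continuous_const.mul (Complex.continuous_ofReal.comp
      (continuous_const.mul ((continuous_apply 1).comp continuous_subtype_val))))⟩

theorem circleSimp_vertex (i : Fin 2) :
    ((circleSimp (stdSimplex.vertex i)).1 : ℂ) = 1 := by
  change ei (2 * Real.pi * (stdSimplex.vertex i : stdSimplex ℝ (Fin 2)).1 1) = 1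
  rw [vertex_apply]
  split_ifs
  · simp [ei, mul_comm Complex.I, Complex.exp_two_pi_mul_I]
  · simp [ei]

instance : ContractibleSpace (Metric.closedBall (0 : ℂ) 1) :=
  (convex_closedBall (0 : ℂ) 1).contractibleSpace ⟨0, by simp⟩

theorem bd_circleSimp : bd (Finsupp.single (circleIncl.comp circleSimp) 1) = 0 := by
  have key : ∀ i, (circleIncl.comp circleSimp) (stdSimplex.vertex i) = ⟨1, by simp⟩ := fun i =>
    Subtype.ext (circleSimp_vertex i)
  rw [bd_single_one, key, key, sub_self]

/-- Along the boundary circle the ratio of `botOf` to `topOf` is `conj w` over the factor `-i e^{is}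
E`. The exponent `F` of `E` is continuous on the whole disk, so only `conj w` winds, exactly once;
hence the logarithm `l` drops by `2 π i`. Winding number one is what makes the disk a generator and
not a multiple of one. -/
theorem exists_boundary_loop {N : Submodule ℤ (Chn 2 CP3)}
    (hN : ∀ (k : Chn 2 (Metric.closedBall (0 : ℂ) 1)) b, push circleIncl b = bd k →
      push (projC.comp (diskLift ξ hh)) k ∈ N) :
    ∃ (g : Simp 1 PuncturedC4) (l : Simp 1 ℂ), Finsupp.single g 1 ∈ fibreBd h N ∧
      g (stdSimplex.vertex 0) = g (stdSimplex.vertex 1) ∧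
      (∀ x, expSmul (l x / 2) (g x) ∈ realCone h) ∧
      l (stdSimplex.vertex 0) = l (stdSimplex.vertex 1) + 2 * (Real.pi * Complex.I) := by
  let F : C(Metric.closedBall (0 : ℂ) 1, ℂ) := ⟨_, (continuousOn_exponent ξ hh).domRestrict⟩
  have hF : ∀ w, factorE h ξ w.1 = Complex.exp (F w) := fun w => rfl
  let θ : Simp 1 ℂ := ⟨fun x => 2 * Real.pi * x.1 1, continuous_const.mul
    (Complex.continuous_ofReal.comp ((continuous_apply 1).comp continuous_subtype_val))⟩
  let c : Simp 1 (Metric.closedBall (0 : ℂ) 1) := circleIncl.comp circleSimp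
  have hc : ∀ x, (c x).1 = ei (2 * Real.pi * x.1 1) := fun x => rfl
  have hcv : ∀ i, c (stdSimplex.vertex i) = ⟨1, by simp⟩ := fun i =>
    Subtype.ext (circleSimp_vertex i)
  have hn : ∀ x, ‖(c x).1‖ = 1 := fun x => norm_ei _
  let l : Simp 1 ℂ := ⟨fun x => -(Complex.I * θ x) - Complex.log (-Complex.I * phase ξ.1) - F (c x),
    by fun_prop⟩
  have hl : ∀ x, l x = -(Complex.I * θ x) - Complex.log (-Complex.I * phase ξ.1) - F (c x) :=
    fun x => rfl
  have hexp : ∀ x, Complex.exp (l x) =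
      conj (c x).1 * (-Complex.I * phase ξ.1 * factorE h ξ (c x).1)⁻¹ := by
    intro x
    rw [hl, Complex.exp_sub, Complex.exp_sub, Complex.exp_log
      (mul_ne_zero (by simp) (phase_ne_zero _)), hF, hc, ei, ← Complex.exp_conj, div_div,
      div_eq_mul_inv]
    congr 2
    rw [map_mul, Complex.conj_I, Complex.conj_ofReal, neg_mul]
    simp [θ]
  refine ⟨(diskLift ξ hh).comp c, l, ?_, ?_, fun x => ?_, ?_⟩
  · obtain ⟨K, hK⟩ := exists_bd_eq_of_contractibleSpace bd_circleSimp
    rw [← push_single, ← hK, ← bd_push]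
    apply bd_mem_fibreBd
    rw [← push_comp]
    exact hN K (Finsupp.single circleSimp 1) (by rw [hK, push_single])
  · exact congrArg (diskLift ξ hh) ((hcv 0).trans (hcv 1).symm)
  · have hb : botOf (diskVec h ξ (c x).1) = Complex.exp (l x) • topOf (diskVec h ξ (c x).1) := by
      rw [hexp]
      exact botOf_diskVec_eq_smul ξ (hn x)
    have hr := (isHolomorphicDisk ξ hh).boundary (mem_sphere_zero_iff_norm.2 (hn x))
    rw [diskMap, mk_mem_realP] at hr
    obtain ⟨h0, u, hu, hu'⟩ := hr
    have hul : u = Complex.exp (l x) := smul_left_injective ℂ h0 (hu.symm.trans hb)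
    rw [hul, Complex.norm_exp] at hu'
    exact expSmul_half_mem_realCone h0 hb (Real.exp_injective hu')
  · have hθ : ∀ i : Fin 2, θ (stdSimplex.vertex i) =
        2 * Real.pi * ((if (1 : Fin 2) = i then (1 : ℝ) else 0 : ℝ) : ℂ) := fun i => by
      rw [← vertex_apply]
      rfl
    rw [hl, hl, hcv, hcv, hθ, hθ]
    simp
    ring

/-- The argument for relative cycles is applied to the `N` spanned by the chains of `P_h`, the
constant chains, the boundaries and the images of relative cycles of the disk. -/
theorem representsGenerator : (isHolomorphicDisk ξ hh).RepresentsGenerator := by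
  refine representsGenerator_of_chains _ fun c a hc => ?_
  let f := projC.comp (diskLift ξ hh)
  let Z : Submodule ℤ (Chn 2 (Metric.closedBall (0 : ℂ) 1)) :=
    (LinearMap.range (push circleIncl)).comap bd
  let N : Submodule ℤ (Chn 2 CP3) := LinearMap.range (push (subIncl (realP h))) ⊔
    constChn 2 CP3 ⊔ LinearMap.range bd ⊔ Z.map (push f)
  have hbd : LinearMap.range bd ≤ N := le_sup_right.trans le_sup_left
  have hconst : constChn 2 CP3 ≤ N := (le_sup_right.trans le_sup_left).trans le_sup_left
  have hP : LinearMap.range (push (subIncl (realP h))) ≤ N :=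
    (le_sup_left.trans le_sup_left).trans le_sup_left
  have hZ : Z.map (push f) ≤ N := le_sup_right
  have hcN : c ∈ N := mem_of_bd_eq_push hh hbd hconst
    (exists_boundary_loop ξ hh fun k b hb => hZ ⟨k, ⟨b, hb⟩, rfl⟩) hP hc
  obtain ⟨y, hy, _, ⟨k, ⟨b, hb⟩, rfl⟩, rfl⟩ := Submodule.mem_sup.1 hcN
  obtain ⟨x, hx, _, ⟨e, rfl⟩, rfl⟩ := Submodule.mem_sup.1 hy
  obtain ⟨_, ⟨p, rfl⟩, κ, hκ, rfl⟩ := Submodule.mem_sup.1 hx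
  let fb : C({w : Metric.closedBall (0 : ℂ) 1 | ‖(w : ℂ)‖ = 1}, realP h) :=
    ⟨fun w => ⟨f w.1, (isHolomorphicDisk ξ hh).boundary (mem_sphere_zero_iff_norm.2 w.2)⟩,
      by fun_prop⟩
  have hfb : push (subIncl (realP h)) (push fb b) = push f (bd k) := by
    rw [← hb, ← push_comp, ← push_comp f circleIncl]
    rfl
  -- The boundary of the constant part `κ` is a chain of `P_h`, because those of all the other terms
  -- are. So `κ` itself belongs to `P_h`.
  obtain ⟨p', hp'⟩ := mem_range_push_of_constChn hκ (a := a - bd p - push fb b) (by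
    rw [map_sub, map_sub, hc, hfb, map_add, map_add, map_add, bd_bd, bd_push f, bd_push]
    abel)
  refine ⟨k, b, p + p', e, hb, ?_⟩
  rw [map_add, hp']
  change _ = push f k + _ + _
  abel

end DiskClass

end

theorem mainTheorem7 (h : S2 → ℝ) (hh : IsAdmissible h) :
    (∀ ξ : S2 × S2, ξ ∉ Splus ∪ Sminus ↔ disk h ξ ⊆ twistorZ) ∧
    (∀ ξ : S2 × S2, ∃ hD : IsHolomorphicDisk (realP h) (diskMap h ξ), hD.RepresentsGenerator) ∧
    IsFoliation (realP h)ᶜ (diskInterior h) :=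
  ⟨fun ξ => not_mem_fixed_iff_disk_subset ξ h,
    fun ξ => ⟨isHolomorphicDisk ξ hh.smooth, representsGenerator ξ hh.smooth⟩,
    isFoliation_diskInterior hh⟩
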